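/- **Setting.** Let $d\in\{2,3\}$, let $\mathcal O\subset\mathbb R^d$ be a nonempty, open, bounded, convex, polygonal (polyhedral) domain, and let $T>0$. For $N\in\mathbb N$ put $\tau=T/N$ and $t^n=n\tau$, where only $N$ with $\tau<1$ are considered. *Mesh.* Let $(\mathcal T_h)_{h\in(0,1]}$ be a quasi-uniform family of conforming partitions of $\mathcal O$ into disjoint open simplices $K$ with $\overline{\mathcal O}=\bigcup_{K\in\mathcal T_h}\overline K$, i.e. $\operatorname{diam}K\le h$ and every $K\in\mathcal T_h$ contains a ball of radius $\rho h$ with $\rho>0$ independent of $h$ and $K$. Let $U_h$ be the space of continuous functions on $\overline{\mathcal O}$ that are affine on each simplex of $\mathcal T_h$, and $\mathcal I_h$ the nodal interpolation operator onto $U_h$ at the vertices of $\mathcal T_h$. *Potential.* Let $F\in C^2(\mathbb R)$ with $F\ge\gamma$ for some $\gamma>0$ and, for some $c>0$ and $C<\infty$ and all $\zeta\in\mathbb R$, $c(1+|\zeta|^4)\le F(\zeta)\le C(1+|\zeta|^4)$, $|F'(\zeta)|\le C(1+|\zeta|^3)$, $|F''(\zeta)|\le C(1+|\zeta|^2)$.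 Let moreover $F=F_1+F_2$ with $F_1\in C^2(\mathbb R)$, $F_1''$ globally Hölder continuous with exponent $\nu\in(0,1]$, and $F_2\in C^3(\mathbb R)$, $|F_2'''(\zeta)|\le C(1+|\zeta|^2)$. Put $E_h(\zeta_h)=\int_{\mathcal O}\mathcal I_h\{F(\zeta_h)\}\,dx$ for $\zeta_h\in U_h$. *Initial data.* Let $\phi_0\in H^1(\mathcal O)$ and let $\mathcal P_h:H^1(\mathcal O)\to U_h$, $h\in(0,1]$, be mappings with $\sup_h\|\mathcal P_h\phi_0\|_{H^1(\mathcal O)}<\infty$ and $\mathcal P_h\phi_0\to\phi_0$ in $L^2(\mathcal O)$ as $h\searrow0$. *Noise.* Let $\sigma:\mathbb R\to\mathbb R$ be bounded and Lipschitz continuous. Let $(\mathfrak g_k)_{k\in\mathbb Z}$ be an orthonormal basis of $L^2(\mathcal O)$ consisting of functions continuous on $\overline{\mathcal O}$, and $(\lambda_k)_{k\in\mathbb Z}$ real numbers with $\sum_k\lambda_k^2\|\mathfrak g_k\|_{W^{1,\infty}(\mathcal O)}^2<\infty$. Let $\mathbb Z_h\subset\mathbb Z$, $h\in(0,1]$,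 be finite sets that increase as $h$ decreases, with $\bigcup_h\mathbb Z_h=\mathbb Z$. Let $(\Omega,\mathcal A,(\mathcal F_t)_{t\ge0},\mathbb P)$ be a filtered probability space. For every $N$ as above let $\xi^{n,\tau}:\Omega\to L^2(\mathcal O)$, $n=1,\dots,N$, be such that $\xi^{n,\tau}$ is $\mathcal F_{t^n}$-measurable and independent of $\mathcal F_{t^m}$ for $0\le m\le n-1$, and, almost surely, $\xi^{n,\tau}=\sqrt\tau\sum_{k\in\mathbb Z}\lambda_k\mathfrak g_k\xi_k^{n,\tau}$ with mutually independent symmetric real random variables $\xi_k^{n,\tau}$ satisfying $\mathbb E[\xi_k^{n,\tau}]=0$, $\mathbb E[|\xi_k^{n,\tau}|^2]=1$ and $\mathbb E[|\xi_k^{n,\tau}|^q]\le C_q$ for all integers $q\ge2$, where $C_q$ does not depend on $\tau,k,n$. For $\zeta_h\in U_h$ and $f\in L^2(\mathcal O)$ put $\Phi_h(\zeta_h)f=\sum_{k\in\mathbb Z_h}\mathcal I_h\{\sigma(\zeta_h)(f,\mathfrak g_k)_{L^2(\mathcal O)}\mathfrak g_k\}$. *Scheme.* For all $h\in(0,1]$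 and $N$ let $(\phi_h^n,r_h^n)_{n=0,\dots,N}$ be $U_h\times\mathbb R$-valued random variables with $\phi_h^0=\mathcal P_h\phi_0$ and $r_h^0=\sqrt{E_h(\phi_h^0)}$ such that for every $\omega\in\Omega$ and $n=1,\dots,N$, with the abbreviations $E:=E_h(\phi_h^{n-1})$, $F':=F'(\phi_h^{n-1})$, $F'':=F''(\phi_h^{n-1})$, $\Theta:=\Phi_h(\phi_h^{n-1})\xi^{n,\tau}$ and $D:=\phi_h^n-\phi_h^{n-1}$, $$\int_{\mathcal O}\mathcal I_h\{D\psi\}\,dx+\tau\int_{\mathcal O}\nabla\phi_h^n\cdot\nabla\psi\,dx+\frac{\tau r_h^n}{\sqrt E}\int_{\mathcal O}\mathcal I_h\{F'\psi\}\,dx-\frac{\tau r_h^n}{4E^{3/2}}\int_{\mathcal O}\mathcal I_h\{F'\Theta\}\,dx\int_{\mathcal O}\mathcal I_h\{F'\psi\}\,dx+\frac{\tau r_h^n}{2\sqrt E}\int_{\mathcal O}\mathcal I_h\{F''\Theta\psi\}\,dx=\int_{\mathcal O}\mathcal I_h\{\Theta\psi\}\,dx$$ for all $\psi\in U_h$,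 and $$r_h^n-r_h^{n-1}=\frac1{2\sqrt E}\int_{\mathcal O}\mathcal I_h\{F'D\}\,dx-\frac1{8E^{3/2}}\int_{\mathcal O}\mathcal I_h\{F'\Theta\}\,dx\int_{\mathcal O}\mathcal I_h\{F'D\}\,dx+\frac1{4\sqrt E}\int_{\mathcal O}\mathcal I_h\{F''D\,\Theta\}\,dx .$$ **Lemma 6.4.** For every $p\in[1,\infty)$ there is a constant $C>0$, independent of $h$ and $\tau$, such that for all $h\in(0,1]$, all $N$ with $\tau=T/N<1$ and all $0<\delta<1/2$ the random variable $\max_{0\le m\le N}\big|r_h^m-\sqrt{E_h(\phi_h^m)}\big|^p$ is integrable and $$\mathbb E\Big[\max_{0\le m\le N}\Big|r_h^m-\sqrt{E_h(\phi_h^m)}\Big|^p\Big]\le C\,\tau^{\,p\min\{\nu/2,\;1/4-\delta/2\}} .$$ -/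

import Mathlib

open MeasureTheory ProbabilityTheory Set Filter Topology
open scoped NNReal ENNReal

noncomputable section

namespace SAV

/-- The Euclidean space `ℝ^d`. -/
abbrev Space (d : ℕ) : Type := EuclideanSpace ℝ (Fin d)

/-- The Hilbert space `L²(O)`. -/
abbrev L2 {d : ℕ} (O : Set (Space d)) : Type := Lp ℝ 2 (volume.restrict O)

/-- A nonempty, open, bounded, convex domain that is polygonal (polyhedral). -/
structure IsConvexPolyhedralDomain {d : ℕ} (O : Set (Space d)) : Prop where
  isOpen : IsOpen O
  nonempty : O.Nonempty
  bounded : Bornology.IsBounded O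
  convex : Convex ℝ O
  polyhedral : ∃ V : Finset (Space d), closure O = convexHull ℝ (V : Set (Space d))

/-! ### Sobolev spaces through weak gradients -/

/-- `G` is the weak gradient of `u` on the open set `O`. -/
structure HasWeakGradient {d : ℕ} (O : Set (Space d)) (u : Space d → ℝ)
    (G : Space d → Space d) : Prop where
  locInt : LocallyIntegrableOn u O
  locInt_grad : LocallyIntegrableOn G O
  integral_eq : ∀ ψ : Space d → ℝ, ContDiff ℝ ((⊤ : ℕ∞) : WithTop ℕ∞) ψ → HasCompactSupport ψ → tsupport ψ ⊆ O →
    ∫ x in O, u x • gradient ψ x = - ∫ x in O, ψ x • G x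

/-- `u ∈ H¹(O)`. -/
def MemH1 {d : ℕ} (O : Set (Space d)) (u : Space d → ℝ) : Prop :=
  MemLp u 2 (volume.restrict O) ∧
    ∃ G, HasWeakGradient O u G ∧ MemLp G 2 (volume.restrict O)

/-- The norm of `W^{1,∞}(O)`; it is `∞` if `u` is not in that space.  (Weak gradients are unique
almost everywhere, so the infimum runs over one value, or over none.) -/
def w1infNorm {d : ℕ} (O : Set (Space d)) (u : Space d → ℝ) : ℝ≥0∞ :=
  eLpNorm u ∞ (volume.restrict O) +
    ⨅ (G : Space d → Space d) (_ : HasWeakGradient O u G), eLpNorm G ∞ (volume.restrict O)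

/-! ### Triangulations and linear finite elements -/

/-- A conforming partition of `O` into nondegenerate simplices.  A cell is given by the finite set
of its vertices; the closed simplex is the convex hull and the open simplex its interior. By
`conforming`, two cells meet at most in a common face, so distinct open cells are disjoint. -/
structure Triangulation {d : ℕ} (O : Set (Space d)) where
  cells : Finset (Finset (Space d))
  card_cell : ∀ s ∈ cells, s.card = d + 1
  affineIndependent : ∀ s ∈ cells, AffineIndependent ℝ ((↑) : s → Space d)
  cover : closure O = ⋃ s ∈ cells, convexHull ℝ (s : Set (Space d))
  conforming : ∀ s ∈ cells, ∀ t ∈ cells,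
    convexHull ℝ (s : Set (Space d)) ∩ convexHull ℝ (t : Set (Space d)) ⊆
      convexHull ℝ ((s : Set (Space d)) ∩ (t : Set (Space d)))

namespace Triangulation

variable {d : ℕ} {O : Set (Space d)}

open Classical in
/-- The vertices of the triangulation. -/
def vertices (𝒯 : Triangulation O) : Finset (Space d) := 𝒯.cells.biUnion id

theorem mem_vertices (𝒯 : Triangulation O) {v : Space d} :
    v ∈ 𝒯.vertices ↔ ∃ s ∈ 𝒯.cells, v ∈ s := by
  simp [vertices]

/-- The finite element space `U_h`: continuous functions on `closure O` which are affine on every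
closed cell.  The values outside of `closure O` carry no meaning and are set to zero. -/
def femSpace (𝒯 : Triangulation O) : Submodule ℝ (Space d → ℝ) where
  carrier := {u | ContinuousOn u (closure O) ∧
    (∀ s ∈ 𝒯.cells, ∃ a : Space d →ᵃ[ℝ] ℝ, EqOn u a (convexHull ℝ (s : Set (Space d)))) ∧
    ∀ x ∉ closure O, u x = 0}
  add_mem' := by
    rintro u v ⟨hu, hu', hu''⟩ ⟨hv, hv', hv''⟩
    refine ⟨hu.add hv, fun s hs => ?_, fun x hx => by simp [hu'' x hx, hv'' x hx]⟩
    obtain ⟨a, ha⟩ := hu' s hs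
    obtain ⟨b, hb⟩ := hv' s hs
    exact ⟨a + b, fun x hx => by simp [ha hx, hb hx]⟩
  zero_mem' := ⟨continuousOn_const, fun s _ => ⟨0, fun x _ => by simp⟩, fun x _ => rfl⟩
  smul_mem' := by
    rintro c u ⟨hu, hu', hu''⟩
    refine ⟨hu.const_smul c, fun s hs => ?_, fun x hx => by simp [hu'' x hx]⟩
    obtain ⟨a, ha⟩ := hu' s hs
    exact ⟨c • a, fun x hx => by simp [ha hx]⟩

theorem eqOn_convexHull {a b : Space d →ᵃ[ℝ] ℝ} {S : Set (Space d)} (h : EqOn a b S) :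
    EqOn a b (convexHull ℝ S) := by
  have hc : Convex ℝ {x | a x = b x} := by
    intro x hx y hy s t _ _ hst
    simp only [mem_ofPred_eq] at *
    rw [Convex.combo_affine_apply hst, Convex.combo_affine_apply hst, hx, hy]
  exact fun x hx => convexHull_min (s := S) (fun y hy => h hy) hc hx

/-- On a single nondegenerate simplex, nodal values are attained by an affine function. -/
theorem exists_affine (𝒯 : Triangulation O) {s : Finset (Space d)} (hs : s ∈ 𝒯.cells)
    (a : Space d → ℝ) : ∃ f : Space d →ᵃ[ℝ] ℝ, ∀ v ∈ s, f v = a v := by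
  have htop : affineSpan ℝ (range ((↑) : s → Space d)) = ⊤ := by
    rw [(𝒯.affineIndependent s hs).affineSpan_eq_top_iff_card_eq_finrank_add_one]
    simp [𝒯.card_cell s hs]
  let B : AffineBasis s ℝ (Space d) := ⟨(↑), 𝒯.affineIndependent s hs, htop⟩
  refine ⟨∑ w : s, a w • B.coord w, fun v hv => ?_⟩
  have hB : ∀ w : s, B.coord w v = if w = ⟨v, hv⟩ then 1 else 0 := by
    intro w
    exact B.coord_apply w ⟨v, hv⟩
  have hsum : ∀ (t : Finset s),
      (∑ w ∈ t, a w • B.coord w : Space d →ᵃ[ℝ] ℝ) v = ∑ w ∈ t, a w * B.coord w v := by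
    intro t
    classical
    induction t using Finset.induction_on with
    | empty => simp
    | insert w t hw ih => simp [Finset.sum_insert hw, ih]
  rw [hsum]
  simp [hB]

/-- Arbitrary nodal values are attained by a finite element function. -/
theorem exists_femSpace (𝒯 : Triangulation O) (a : Space d → ℝ) :
    ∃ u ∈ 𝒯.femSpace, ∀ v ∈ 𝒯.vertices, u v = a v := by
  classical
  choose! f hf using fun s (hs : s ∈ 𝒯.cells) => 𝒯.exists_affine hs a
  have hcompat : ∀ s ∈ 𝒯.cells, ∀ t ∈ 𝒯.cells, ∀ x ∈ convexHull ℝ (s : Set (Space d)),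
      x ∈ convexHull ℝ (t : Set (Space d)) → f s x = f t x := by
    intro s hs t ht x hxs hxt
    exact eqOn_convexHull (S := (s : Set (Space d)) ∩ t)
      (fun y hy => (hf s hs y hy.1).trans (hf t ht y hy.2).symm)
      (𝒯.conforming s hs t ht ⟨hxs, hxt⟩)
  let u : Space d → ℝ := fun x =>
    if h : ∃ s ∈ 𝒯.cells, x ∈ convexHull ℝ (s : Set (Space d)) then f h.choose x else 0
  have hu : ∀ s ∈ 𝒯.cells, EqOn u (f s) (convexHull ℝ (s : Set (Space d))) := by
    intro s hs x hx
    have h : ∃ s ∈ 𝒯.cells, x ∈ convexHull ℝ (s : Set (Space d)) := ⟨s, hs, hx⟩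
    simp only [u, dif_pos h]
    exact hcompat _ h.choose_spec.1 s hs x h.choose_spec.2 hx
  refine ⟨u, ⟨?_, fun s hs => ⟨f s, hu s hs⟩, fun x hx => ?_⟩, fun v hv => ?_⟩
  · rw [𝒯.cover]
    have : LocallyFinite fun s : 𝒯.cells => convexHull ℝ ((s : Finset (Space d)) : Set (Space d)) :=
      locallyFinite_of_finite _
    rw [show (⋃ s ∈ 𝒯.cells, convexHull ℝ (s : Set (Space d))) =
        ⋃ s : 𝒯.cells, convexHull ℝ ((s : Finset (Space d)) : Set (Space d)) by
      ext; simp]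
    refine this.continuousOn_iUnion (fun s => ?_) (fun s => ?_)
    · exact (s.1.finite_toSet.isCompact_convexHull ℝ).isClosed
    · exact ((f s).continuous_of_finiteDimensional.continuousOn).congr (hu s s.2)
  · have h : ¬ ∃ s ∈ 𝒯.cells, x ∈ convexHull ℝ (s : Set (Space d)) := by
      rw [𝒯.cover] at hx
      simpa using hx
    simp only [u, dif_neg h]
  · obtain ⟨s, hs, hvs⟩ := 𝒯.mem_vertices.1 hv
    rw [hu s hs (subset_convexHull ℝ _ hvs), hf s hs v hvs]

/-- A finite element function is determined by its nodal values. -/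
theorem femSpace_ext (𝒯 : Triangulation O) {u w : Space d → ℝ} (hu : u ∈ 𝒯.femSpace)
    (hw : w ∈ 𝒯.femSpace) (h : ∀ v ∈ 𝒯.vertices, u v = w v) : u = w := by
  obtain ⟨-, hu', hu''⟩ := hu
  obtain ⟨-, hw', hw''⟩ := hw
  funext x
  by_cases hx : x ∈ closure O
  · rw [𝒯.cover] at hx
    simp only [mem_iUnion] at hx
    obtain ⟨s, hs, hxs⟩ := hx
    obtain ⟨a, ha⟩ := hu' s hs
    obtain ⟨b, hb⟩ := hw' s hs
    rw [ha hxs, hb hxs]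
    refine eqOn_convexHull (S := (s : Set (Space d))) (fun y hy => ?_) hxs
    rw [← ha (subset_convexHull ℝ _ hy), ← hb (subset_convexHull ℝ _ hy)]
    exact h y (𝒯.mem_vertices.2 ⟨s, hs, hy⟩)
  · rw [hu'' x hx, hw'' x hx]

open Classical in
/-- The nodal basis function `χ_v` of the vertex `v`: the element of `U_h` with value one in `v`
and zero in all other vertices. -/
def hat (𝒯 : Triangulation O) (v : Space d) : Space d → ℝ :=
  (𝒯.exists_femSpace (fun w => if w = v then 1 else 0)).choose

theorem hat_mem (𝒯 : Triangulation O) (v : Space d) : 𝒯.hat v ∈ 𝒯.femSpace := by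
  classical
  exact (𝒯.exists_femSpace (fun w => if w = v then 1 else 0)).choose_spec.1

open Classical in
theorem hat_apply (𝒯 : Triangulation O) (v : Space d) {w : Space d} (hw : w ∈ 𝒯.vertices) :
    𝒯.hat v w = if w = v then 1 else 0 :=
  (𝒯.exists_femSpace (fun w => if w = v then 1 else 0)).choose_spec.2 w hw

/-- The nodal interpolation operator `I_h`. -/
def interp (𝒯 : Triangulation O) (a : Space d → ℝ) : Space d → ℝ :=
  ∑ v ∈ 𝒯.vertices, a v • 𝒯.hat v

theorem interp_mem (𝒯 : Triangulation O) (a : Space d → ℝ) : 𝒯.interp a ∈ 𝒯.femSpace :=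
  Submodule.sum_mem _ fun v _ => Submodule.smul_mem _ _ (𝒯.hat_mem v)

theorem interp_apply (𝒯 : Triangulation O) (a : Space d → ℝ) {w : Space d}
    (hw : w ∈ 𝒯.vertices) : 𝒯.interp a w = a w := by
  simp [interp, Finset.sum_apply, 𝒯.hat_apply _ hw, hw]

end Triangulation

/-- Quasi-uniformity of the family `(𝒯 h)`, `h ∈ (0,1]`: the cells have diameter at most `h` and
contain balls of radius at least `ρ h`. -/
def QuasiUniform {d : ℕ} {O : Set (Space d)} (𝒯 : ℝ → Triangulation O) : Prop :=
  ∃ ρ > 0, ∀ h ∈ Ioc (0 : ℝ) 1, ∀ s ∈ (𝒯 h).cells,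
    Metric.diam (convexHull ℝ (s : Set (Space d))) ≤ h ∧
    ∃ c, Metric.ball c (ρ * h) ⊆ convexHull ℝ (s : Set (Space d))

/-- The `H¹(O)`-norm of a finite element function.  Such a function is affine on every cell, hence
its weak gradient is its classical gradient, which exists almost everywhere. -/
def femH1Norm {d : ℕ} (O : Set (Space d)) (u : Space d → ℝ) : ℝ :=
  √((∫ x in O, u x ^ 2) + ∫ x in O, ‖gradient u x‖ ^ 2)

/-! ### Assumptions on the data -/

/-- The assumptions on the double-well potential `F`, with Hölder exponent `ν`. -/
structure IsPotential (F : ℝ → ℝ) (ν : ℝ) : Prop where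
  contDiff : ContDiff ℝ 2 F
  lower : ∃ γ > 0, ∀ x, γ ≤ F x
  growth : ∃ c > 0, ∃ C, ∀ x,
    c * (1 + |x| ^ 4) ≤ F x ∧ F x ≤ C * (1 + |x| ^ 4) ∧
    |deriv F x| ≤ C * (1 + |x| ^ 3) ∧ |iteratedDeriv 2 F x| ≤ C * (1 + |x| ^ 2)
  exponent_pos : 0 < ν
  exponent_le : ν ≤ 1
  decomposition : ∃ F₁ F₂ : ℝ → ℝ, (∀ x, F x = F₁ x + F₂ x) ∧
    ContDiff ℝ 2 F₁ ∧
    (∃ K, ∀ x y, |iteratedDeriv 2 F₁ x - iteratedDeriv 2 F₁ y| ≤ K * |x - y| ^ ν) ∧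
    ContDiff ℝ 3 F₂ ∧ ∃ C, ∀ x, |iteratedDeriv 3 F₂ x| ≤ C * (1 + |x| ^ 2)

/-- The assumptions on the coefficient function: `σ` is bounded and Lipschitz continuous. -/
structure IsNoiseCoefficient (σ : ℝ → ℝ) : Prop where
  bounded : ∃ M, ∀ x, |σ x| ≤ M
  lipschitz : ∃ K, LipschitzWith K σ

/-- The assumptions on the initial datum `φ₀` and the mappings `proj h : H¹(O) → U_h`. -/
structure IsInitialApproximation {d : ℕ} {O : Set (Space d)} (𝒯 : ℝ → Triangulation O)
    (φ₀ : Space d → ℝ) (proj : ℝ → (Space d → ℝ) → (Space d → ℝ)) : Prop where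
  memH1 : MemH1 O φ₀
  mapsTo : ∀ h ∈ Ioc (0 : ℝ) 1, ∀ u, MemH1 O u → proj h u ∈ (𝒯 h).femSpace
  bounded : ∃ C, ∀ h ∈ Ioc (0 : ℝ) 1, femH1Norm O (proj h φ₀) ≤ C
  tendsto : Tendsto (fun h => eLpNorm (proj h φ₀ - φ₀) 2 (volume.restrict O)) (𝓝[>] 0) (𝓝 0)

/-- The spatial structure of the noise: `𝔤` is an orthonormal basis of `L²(O)` with continuous
representatives `g k`, and `∑ₖ λₖ² ‖gₖ‖²_{W^{1,∞}}` is finite. -/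
structure IsColored {d : ℕ} {O : Set (Space d)} (𝔤 : HilbertBasis ℤ ℝ (L2 O))
    (g : ℤ → Space d → ℝ) (lam : ℤ → ℝ) : Prop where
  representative : ∀ k, (𝔤 k : Space d → ℝ) =ᵐ[volume.restrict O] g k
  continuousOn : ∀ k, ContinuousOn (g k) (closure O)
  color : ∑' k, ENNReal.ofReal (lam k ^ 2) * w1infNorm O (g k) ^ 2 < ∞

/-- The finite index sets `Z h` increase to `ℤ` as `h` decreases to zero. -/
structure IsExhausting (Z : ℝ → Finset ℤ) : Prop where
  antitone : ∀ h₁ ∈ Ioc (0 : ℝ) 1, ∀ h₂ ∈ Ioc (0 : ℝ) 1, h₂ ≤ h₁ → Z h₁ ⊆ Z h₂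
  exhausts : ∀ k, ∃ h ∈ Ioc (0 : ℝ) 1, k ∈ Z h

/-- The node `t^n = n τ` of the time grid, where `τ = T / N`. -/
def gridTime (T : ℝ) (N n : ℕ) : ℝ≥0 := Real.toNNReal (n * (T / N))

/-- `ξ 1, …, ξ N` are discrete stochastic increments for the step size `τ = T / N`.  The
piecewise constant filtration of the time grid takes the value `𝓕_{t^n}` at `t^n`. -/
structure IsDiscreteIncrement {d : ℕ} {O : Set (Space d)} {Ω : Type*} {mΩ : MeasurableSpace Ω}
    (P : Measure Ω) (𝓕 : Filtration ℝ≥0 mΩ) (T : ℝ) (N : ℕ)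
    (𝔤 : HilbertBasis ℤ ℝ (L2 O)) (lam : ℤ → ℝ) (Cmom : ℕ → ℝ) (ξ : ℕ → Ω → L2 O) : Prop where
  /-- `ξ n` is measurable with respect to `𝓕_{t^n}` -/
  measurable : ∀ n, 1 ≤ n → n ≤ N → @Measurable Ω (L2 O) (𝓕 (gridTime T N n)) (borel (L2 O)) (ξ n)
  /-- `ξ n` is independent of `𝓕_{t^m}` for `m ≤ n - 1` -/
  indep : ∀ n, 1 ≤ n → n ≤ N → ∀ m < n,
    Indep (MeasurableSpace.comap (ξ n) (borel (L2 O))) (𝓕 (gridTime T N m)) P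
  /-- `ξ n = √τ ∑ₖ λₖ gₖ ξₖⁿ` with independent, symmetric, normalized `ξₖⁿ` with uniformly bounded
  moments; `X i k` is `ξₖⁿ` with `n = i + 1` -/
  expansion : ∃ X : Fin N → ℤ → Ω → ℝ,
    (∀ i k, Measurable (X i k)) ∧
    iIndepFun (fun q : Fin N × ℤ => X q.1 q.2) P ∧
    (∀ i k, P.map (X i k) = P.map (fun ω => - X i k ω)) ∧
    (∀ i k, ∫ ω, X i k ω ∂P = 0) ∧
    (∀ i k, ∫ ω, |X i k ω| ^ 2 ∂P = 1) ∧
    (∀ i k, ∀ q : ℕ, 2 ≤ q →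
      Integrable (fun ω => |X i k ω| ^ q) P ∧ ∫ ω, |X i k ω| ^ q ∂P ≤ Cmom q) ∧
    ∀ i : Fin N, ∀ᵐ ω ∂P,
      HasSum (fun k => (√(T / N) * lam k * X i k ω) • 𝔤 k) (ξ (i + 1) ω)

/-! ### The discrete scheme -/

section Scheme

variable {d : ℕ} {O : Set (Space d)}

/-- `∫_O I_h{a} dx` -/
def lumped (𝒯 : Triangulation O) (a : Space d → ℝ) : ℝ := ∫ x in O, 𝒯.interp a x

/-- `∫_O ∇u · ∇v dx` for finite element functions, whose weak gradients are their classical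
gradients. -/
def dirichletForm (O : Set (Space d)) (u v : Space d → ℝ) : ℝ :=
  ∫ x in O, inner ℝ (gradient u x) (gradient v x)

/-- The discrete nonlinear energy `E_h(ζ) = ∫_O I_h{F(ζ)} dx`. -/
def discEnergy (𝒯 : Triangulation O) (F : ℝ → ℝ) (ζ : Space d → ℝ) : ℝ :=
  lumped 𝒯 fun x => F (ζ x)

/-- The operator `Φ_h(ζ) f = ∑_{k ∈ Z_h} I_h{σ(ζ) (f, gₖ)_{L²} gₖ}`. -/
def discPhi (𝒯 : Triangulation O) (Z : Finset ℤ) (σ : ℝ → ℝ) (𝔤 : HilbertBasis ℤ ℝ (L2 O))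
    (g : ℤ → Space d → ℝ) (ζ : Space d → ℝ) (f : L2 O) : Space d → ℝ :=
  ∑ k ∈ Z, 𝒯.interp fun x => σ (ζ x) * inner ℝ f (𝔤 k) * g k x

/-- One step of the scheme, for one path: `(φ₁, r₁)` is computed from `(φ₀, r₀)`, where `dW` is the
function `Φ_h(φ₀) ξ`. -/
structure IsStep (𝒯 : Triangulation O) (F : ℝ → ℝ) (τ : ℝ) (dW φ₀ : Space d → ℝ) (r₀ : ℝ)
    (φ₁ : Space d → ℝ) (r₁ : ℝ) : Prop where
  phase : ∀ ψ ∈ 𝒯.femSpace,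
    lumped 𝒯 (fun x => (φ₁ x - φ₀ x) * ψ x)
      + τ * dirichletForm O φ₁ ψ
      + τ * (r₁ / √(discEnergy 𝒯 F φ₀)) * lumped 𝒯 (fun x => deriv F (φ₀ x) * ψ x)
      - 1 / 4 * τ * (r₁ / discEnergy 𝒯 F φ₀ ^ (3 / 2 : ℝ))
          * lumped 𝒯 (fun x => deriv F (φ₀ x) * dW x) * lumped 𝒯 (fun x => deriv F (φ₀ x) * ψ x)
      + 1 / 2 * τ * (r₁ / √(discEnergy 𝒯 F φ₀))
          * lumped 𝒯 (fun x => iteratedDeriv 2 F (φ₀ x) * dW x * ψ x)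
      = lumped 𝒯 (fun x => dW x * ψ x)
  auxiliary :
    r₁ - r₀ =
      1 / (2 * √(discEnergy 𝒯 F φ₀)) * lumped 𝒯 (fun x => deriv F (φ₀ x) * (φ₁ x - φ₀ x))
      - 1 / (8 * discEnergy 𝒯 F φ₀ ^ (3 / 2 : ℝ))
          * lumped 𝒯 (fun x => deriv F (φ₀ x) * dW x)
          * lumped 𝒯 (fun x => deriv F (φ₀ x) * (φ₁ x - φ₀ x))
      + 1 / (4 * √(discEnergy 𝒯 F φ₀))
          * lumped 𝒯 (fun x => iteratedDeriv 2 F (φ₀ x) * (φ₁ x - φ₀ x) * dW x)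

/-- `(φ n, r n)`, `n = 0, …, N`, are `U_h × ℝ`-valued random variables which solve the discrete
scheme pathwise, with step size `τ` and initial value `φinit ∈ U_h`. -/
structure IsDiscreteSolution {Ω : Type*} [MeasurableSpace Ω] (𝒯 : Triangulation O) (Z : Finset ℤ)
    (F σ : ℝ → ℝ) (𝔤 : HilbertBasis ℤ ℝ (L2 O)) (g : ℤ → Space d → ℝ) (τ : ℝ) (N : ℕ)
    (φinit : Space d → ℝ) (ξ : ℕ → Ω → L2 O)
    (φ : ℕ → Ω → Space d → ℝ) (r : ℕ → Ω → ℝ) : Prop where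
  mem : ∀ n ≤ N, ∀ ω, φ n ω ∈ 𝒯.femSpace
  measurable_phase : ∀ n ≤ N, Measurable (φ n)
  measurable_auxiliary : ∀ n ≤ N, Measurable (r n)
  init_phase : ∀ ω, φ 0 ω = φinit
  init_auxiliary : ∀ ω, r 0 ω = √(discEnergy 𝒯 F φinit)
  step : ∀ n, 1 ≤ n → n ≤ N → ∀ ω,
    IsStep 𝒯 F τ (discPhi 𝒯 Z σ 𝔤 g (φ (n - 1) ω) (ξ n ω)) (φ (n - 1) ω) (r (n - 1) ω)
      (φ n ω) (r n ω)

end Scheme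

end SAV

end

/-!
The auxiliary variable `r` is meant to follow the square root of the discrete energy. The scheme
advances it by a linearization of the square root which contains an Itô correction, so in one step the
two differ by a Taylor remainder only. The proof bounds this remainder by quantities that an energy
estimate controls, and sums over the time steps.

*Energy.* Testing the scheme with the increment `D` of the phase minus the noise `Θ` shows that
`energy`, a quadratic functional of the phase and of `r`, grows in one step by a term `noisePairing`
linear in the noise and by a multiple of `τ χ²` times itself. The same inequality
(`exists_energy_step`) controls a dissipation `s`, which contains the gradient of `D` and the lumped
integral of `(D - Θ)²` divided by `τ`. Here `χ` is the size of the noise divided by `√τ` (`noiseSize`):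
it bounds the sixth moment of `Θ` and the Dirichlet energy of `Θ` relative to that of the phase.

*Consistency.* The growth of the potential is handled by the embedding of the discrete `H¹` norm into
the lumped `L⁶` norm. Its constant must not depend on the triangulation (`exists_lumped_pow_six_le`);
it follows from a Gagliardo–Nirenberg inequality on the convex domain, applied to the fourth power of a
finite element function. In the Taylor expansion of the error of one step the terms of first and second
order cancel up to terms containing `D - Θ`, which is small because of the dissipation. What remains is
at most `ϱ W⁷ (s + τ χ²)` up to a constant, with `ϱ = τ^min(ν/2, 1/4)` and `W` a bound for the energies
before and after the step (`exists_consistency`). As the energy inequality also bounds the sum of `s`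
and `τ χ²` over all steps, the error is bounded along each path by `ϱ S⁸`, where `S` is the running
maximum of a majorant of the energy (`exists_path_bounds`).

*Moments.* Linear combinations of the independent coefficients of the noise satisfy an inequality of
Marcinkiewicz–Zygmund type (`exists_integral_sum_pow_le`). Together with the decay of `λₖ` it bounds all
moments of `χ` uniformly in the discretization parameters (`exists_integral_noiseSize_pow_le`); a finite
element gradient enters `χ` only through weights of bounded total mass, so no inverse estimate is used.
All moments of `S` are then bounded by a stochastic Gronwall argument
(`exists_integral_runningMax_pow_le`). For a process `Y` with running maximum `S` the functional
`(S - Y)² + Y²` is comparable with `S²`, and its increment is linear in the martingale increment of `Y`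
up to a term of order `τ`. So it suffices that this increment is orthogonal to the past
(`integral_mul_noisePairing_eq_zero`), which requires that the discrete solution is adapted: a step of
the scheme is a linear system with a positive definite matrix, and its solution is a measurable function
of the data (`measurable_of_isStep`).

The rate `min(ν/2, 1/4)` is larger than the one with `1/4 - δ/2`, and `τ < 1`.
-/

noncomputable section

namespace SAV

/-! ### Geometry of the cells and gradients of finite element functions -/

/-- The closed simplex with vertex set `s`. -/
abbrev cell {d : ℕ} (s : Finset (Space d)) : Set (Space d) := convexHull ℝ (s : Set (Space d))

theorem isCompact_cell {d : ℕ} (s : Finset (Space d)) : IsCompact (cell s) :=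
  s.finite_toSet.isCompact_convexHull ℝ

theorem measurableSet_cell {d : ℕ} (s : Finset (Space d)) : MeasurableSet (cell s) :=
  (isCompact_cell s).isClosed.measurableSet

theorem volume_frontier_cell {d : ℕ} (s : Finset (Space d)) :
    volume (frontier (cell s)) = 0 :=
  (convex_convexHull ℝ _).addHaar_frontier volume

theorem IsConvexPolyhedralDomain.closure_ae_eq {d : ℕ} {O : Set (Space d)}
    (hO : IsConvexPolyhedralDomain O) : (closure O : Set (Space d)) =ᵐ[volume] O := by
  have h0 : volume (frontier O) = 0 := hO.convex.addHaar_frontier volume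
  have : closure O = O ∪ frontier O := by
    rw [closure_eq_self_union_frontier]
  rw [this]
  exact union_ae_eq_left_of_ae_eq_empty (ae_eq_empty.2 h0)

theorem IsConvexPolyhedralDomain.isCompact_closure {d : ℕ} {O : Set (Space d)}
    (hO : IsConvexPolyhedralDomain O) : IsCompact (closure O) :=
  hO.bounded.isCompact_closure

theorem IsConvexPolyhedralDomain.volume_lt_top {d : ℕ} {O : Set (Space d)}
    (hO : IsConvexPolyhedralDomain O) : volume O < ∞ :=
  hO.bounded.measure_lt_top

theorem IsConvexPolyhedralDomain.volume_pos {d : ℕ} {O : Set (Space d)}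
    (hO : IsConvexPolyhedralDomain O) : 0 < volume O :=
  hO.isOpen.measure_pos _ hO.nonempty

theorem IsConvexPolyhedralDomain.volume_real_pos {d : ℕ} {O : Set (Space d)}
    (hO : IsConvexPolyhedralDomain O) : 0 < volume.real O :=
  ENNReal.toReal_pos hO.volume_pos.ne' hO.volume_lt_top.ne

namespace Triangulation

variable {d : ℕ} {O : Set (Space d)}

theorem affineSpan_cell (𝒯 : Triangulation O) {s : Finset (Space d)} (hs : s ∈ 𝒯.cells) :
    affineSpan ℝ (s : Set (Space d)) = ⊤ := by
  have := ((𝒯.affineIndependent s hs).affineSpan_eq_top_iff_card_eq_finrank_add_one).2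
    (by simp [𝒯.card_cell s hs])
  rwa [Subtype.range_coe_subtype] at this

theorem interior_cell_nonempty (𝒯 : Triangulation O) {s : Finset (Space d)} (hs : s ∈ 𝒯.cells) :
    (interior (cell s)).Nonempty :=
  interior_convexHull_nonempty_iff_affineSpan_eq_top.2 (𝒯.affineSpan_cell hs)

theorem cell_subset (𝒯 : Triangulation O) {s : Finset (Space d)} (hs : s ∈ 𝒯.cells) :
    cell s ⊆ closure O := by
  rw [𝒯.cover]
  exact subset_biUnion_of_mem (u := fun s : Finset (Space d) => cell s) hs

theorem exists_cell (𝒯 : Triangulation O) {x : Space d} (hx : x ∈ closure O) :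
    ∃ s ∈ 𝒯.cells, x ∈ cell s := by
  rw [𝒯.cover] at hx
  simpa using hx

/-- The constant gradient on the cell `s` of a finite element function, taken at an arbitrary
interior point of the cell. -/
def slope (s : Finset (Space d)) (u : Space d → ℝ) : Space d :=
  gradient u (Classical.epsilon fun x => x ∈ interior (cell s))

theorem exists_gradient_affine (a : Space d →ᵃ[ℝ] ℝ) :
    ∃ p : Space d, (∀ x y, a y - a x = inner ℝ p (y - x)) ∧ ∀ x, HasGradientAt a p x := by
  let L : Space d →L[ℝ] ℝ := a.linear.toContinuousLinearMap
  refine ⟨(InnerProductSpace.toDual ℝ (Space d)).symm L, fun x y => ?_, fun x => ?_⟩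
  · rw [InnerProductSpace.toDual_symm_apply]
    have := a.linearMap_vsub y x
    simp only [vsub_eq_sub] at this
    simp [L, ← this]
  · rw [hasGradientAt_iff_hasFDerivAt]
    simp only [LinearIsometryEquiv.apply_symm_apply]
    have h : (a : Space d → ℝ) = fun x => L x + a 0 := by
      funext x
      have := a.linearMap_vsub x 0
      simp only [vsub_eq_sub, sub_zero] at this
      simp [L, this]
    rw [h]
    exact (L.hasFDerivAt).add_const _

theorem hasGradientAt_slope (𝒯 : Triangulation O) {s : Finset (Space d)} (hs : s ∈ 𝒯.cells)
    {u : Space d → ℝ} (hu : u ∈ 𝒯.femSpace) :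
    (∀ x ∈ interior (cell s), HasGradientAt u (slope s u) x) ∧
      ∀ x ∈ cell s, ∀ y ∈ cell s, u y - u x = inner ℝ (slope s u) (y - x) := by
  obtain ⟨a, ha⟩ := hu.2.1 s hs
  obtain ⟨p, hp, hp'⟩ := exists_gradient_affine a
  have h1 : ∀ x ∈ interior (cell s), HasGradientAt u p x := by
    intro x hx
    refine (hp' x).congr_of_eventuallyEq ?_
    filter_upwards [isOpen_interior.mem_nhds hx] with y hy
    exact ha (interior_subset hy)
  have h2 : slope s u = p :=
    (h1 _ (Classical.epsilon_spec (𝒯.interior_cell_nonempty hs))).gradient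
  rw [h2]
  refine ⟨h1, fun x hx y hy => ?_⟩
  rw [ha hx, ha hy, hp]

theorem gradient_eq_slope (𝒯 : Triangulation O) {s : Finset (Space d)} (hs : s ∈ 𝒯.cells)
    {u : Space d → ℝ} (hu : u ∈ 𝒯.femSpace) {x : Space d} (hx : x ∈ interior (cell s)) :
    gradient u x = slope s u :=
  ((𝒯.hasGradientAt_slope hs hu).1 x hx).gradient

theorem sub_eq_inner_slope (𝒯 : Triangulation O) {s : Finset (Space d)} (hs : s ∈ 𝒯.cells)
    {u : Space d → ℝ} (hu : u ∈ 𝒯.femSpace) {x y : Space d} (hx : x ∈ cell s) (hy : y ∈ cell s) :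
    u y - u x = inner ℝ (slope s u) (y - x) :=
  (𝒯.hasGradientAt_slope hs hu).2 x hx y hy

theorem slope_add (𝒯 : Triangulation O) {s : Finset (Space d)} (hs : s ∈ 𝒯.cells)
    {u w : Space d → ℝ} (hu : u ∈ 𝒯.femSpace) (hw : w ∈ 𝒯.femSpace) :
    slope s (u + w) = slope s u + slope s w := by
  have hx := Classical.epsilon_spec (𝒯.interior_cell_nonempty hs)
  have h1 := ((𝒯.hasGradientAt_slope hs hu).1 _ hx).hasFDerivAt
  have h2 := ((𝒯.hasGradientAt_slope hs hw).1 _ hx).hasFDerivAt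
  have h3 := h1.add h2
  rw [← map_add] at h3
  exact (hasGradientAt_iff_hasFDerivAt.2 h3).gradient

theorem slope_smul (𝒯 : Triangulation O) {s : Finset (Space d)} (hs : s ∈ 𝒯.cells)
    {u : Space d → ℝ} (hu : u ∈ 𝒯.femSpace) (c : ℝ) :
    slope s (c • u) = c • slope s u := by
  have hx := Classical.epsilon_spec (𝒯.interior_cell_nonempty hs)
  have h1 := ((𝒯.hasGradientAt_slope hs hu).1 _ hx).hasFDerivAt
  have h3 := h1.const_smul c
  rw [← map_smul] at h3
  exact (hasGradientAt_iff_hasFDerivAt.2 h3).gradient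

theorem slope_sum (𝒯 : Triangulation O) {s : Finset (Space d)} (hs : s ∈ 𝒯.cells)
    {ι : Type*} (t : Finset ι) (a : ι → ℝ) (u : ι → Space d → ℝ)
    (hu : ∀ i ∈ t, u i ∈ 𝒯.femSpace) :
    slope s (∑ i ∈ t, a i • u i) = ∑ i ∈ t, a i • slope s (u i) := by
  classical
  induction t using Finset.induction_on with
  | empty =>
    simpa using 𝒯.slope_smul hs (𝒯.femSpace.zero_mem) (0 : ℝ)
  | insert i t hi ih =>
    have h1 : ∀ j ∈ t, u j ∈ 𝒯.femSpace := fun j hj => hu j (Finset.mem_insert_of_mem hj)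
    have h2 := hu i (Finset.mem_insert_self _ _)
    rw [Finset.sum_insert hi, Finset.sum_insert hi, ← ih h1, ← 𝒯.slope_smul hs h2]
    exact 𝒯.slope_add hs (𝒯.femSpace.smul_mem _ h2)
      (𝒯.femSpace.sum_mem fun j hj => 𝒯.femSpace.smul_mem _ (h1 j hj))

theorem eq_sum_hat (𝒯 : Triangulation O) {u : Space d → ℝ} (hu : u ∈ 𝒯.femSpace) :
    u = ∑ v ∈ 𝒯.vertices, u v • 𝒯.hat v :=
  𝒯.femSpace_ext hu (𝒯.interp_mem u) fun _ hv => (𝒯.interp_apply u hv).symm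

theorem slope_eq_sum (𝒯 : Triangulation O) {s : Finset (Space d)} (hs : s ∈ 𝒯.cells)
    {u : Space d → ℝ} (hu : u ∈ 𝒯.femSpace) :
    slope s u = ∑ v ∈ 𝒯.vertices, u v • slope s (𝒯.hat v) := by
  conv_lhs => rw [𝒯.eq_sum_hat hu]
  exact 𝒯.slope_sum hs _ _ _ fun v _ => 𝒯.hat_mem v

theorem mem_cell_of_mem {s : Finset (Space d)} {v : Space d} (hv : v ∈ s) : v ∈ cell s :=
  subset_convexHull ℝ _ hv

theorem vertex_mem_closure (𝒯 : Triangulation O) {v : Space d} (hv : v ∈ 𝒯.vertices) :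
    v ∈ closure O := by
  obtain ⟨s, hs, hvs⟩ := 𝒯.mem_vertices.1 hv
  exact 𝒯.cell_subset hs (mem_cell_of_mem hvs)

/-- Distinct cells overlap in a null set: their intersection lies in a proper affine subspace. -/
theorem volume_inter_cell (𝒯 : Triangulation O) {s t : Finset (Space d)} (hs : s ∈ 𝒯.cells)
    (ht : t ∈ 𝒯.cells) (hst : s ≠ t) : volume (cell s ∩ cell t) = 0 := by
  classical
  have hne : ((s ∩ t : Finset (Space d))) ≠ s := by
    intro h
    have h1 : s ⊆ t := Finset.inter_eq_left.1 h
    exact hst (Finset.eq_of_subset_of_card_le h1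
      (by rw [𝒯.card_cell s hs, 𝒯.card_cell t ht]))
  have hlt : (s ∩ t).card < d + 1 := by
    rw [← 𝒯.card_cell s hs]
    exact Finset.card_lt_card (Finset.inter_subset_left.ssubset_of_ne hne)
  have hspan : affineSpan ℝ ((s ∩ t : Finset (Space d)) : Set (Space d)) ≠ ⊤ := by
    intro htop
    have h2 := finrank_vectorSpan_image_finset_le ℝ (id : Space d → Space d) (s ∩ t)
      (n := d - 1)
    rcases Nat.eq_zero_or_pos (s ∩ t).card with h0 | h0
    · rw [Finset.card_eq_zero] at h0
      rw [h0] at htop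
      simp at htop
    · obtain ⟨k, hk⟩ : ∃ k, (s ∩ t).card = k + 1 := ⟨_, (Nat.succ_pred_eq_of_pos h0).symm⟩
      have h3 := finrank_vectorSpan_image_finset_le ℝ (id : Space d → Space d) (s ∩ t) hk
      rw [Finset.image_id, ← direction_affineSpan, htop, AffineSubspace.direction_top,
        finrank_top, finrank_euclideanSpace, Fintype.card_fin] at h3
      omega
  refine measure_mono_null ?_ (Measure.addHaar_affineSubspace volume _ hspan)
  refine (𝒯.conforming s hs t ht).trans ?_
  rw [Finset.coe_inter]
  exact convexHull_subset_affineSpan _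

/-- Integrals over the domain split into integrals over the cells. -/
theorem setIntegral_eq_sum (hO : IsConvexPolyhedralDomain O) (𝒯 : Triangulation O)
    {f : Space d → ℝ} (hf : ∀ s ∈ 𝒯.cells, IntegrableOn f (cell s)) :
    ∫ x in O, f x = ∑ s ∈ 𝒯.cells, ∫ x in cell s, f x := by
  rw [← setIntegral_congr_set hO.closure_ae_eq, 𝒯.cover]
  rw [← Finset.set_biUnion_coe, biUnion_eq_iUnion, integral_iUnion_ae]
  · rw [tsum_fintype]
    exact Finset.sum_coe_sort 𝒯.cells fun s => ∫ x in cell s, f x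
  · exact fun s => (measurableSet_cell _).nullMeasurableSet
  · intro s t hst
    exact 𝒯.volume_inter_cell s.2 t.2 fun h => hst (Subtype.ext h)
  · exact integrableOn_finite_iUnion.2 fun s => hf s.1 s.2

theorem setIntegral_eq_sum_const (hO : IsConvexPolyhedralDomain O) (𝒯 : Triangulation O)
    {f : Space d → ℝ} (c : Finset (Space d) → ℝ)
    (hf : ∀ s ∈ 𝒯.cells, ∀ x ∈ interior (cell s), f x = c s) :
    ∫ x in O, f x = ∑ s ∈ 𝒯.cells, volume.real (cell s) * c s := by
  have hae : ∀ s ∈ 𝒯.cells, f =ᵐ[volume.restrict (cell s)] fun _ => c s := by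
    intro s hs
    have h := measure_eq_zero_iff_ae_notMem.1 (volume_frontier_cell s)
    filter_upwards [ae_restrict_of_ae h, ae_restrict_mem (measurableSet_cell s)] with x hx hxs
    refine hf s hs x ?_
    by_contra hcon
    exact hx ⟨subset_closure hxs, hcon⟩
  rw [setIntegral_eq_sum hO 𝒯 fun s hs => ?_]
  · refine Finset.sum_congr rfl fun s hs => ?_
    rw [integral_congr_ae (hae s hs)]
    simp [mul_comm, Measure.real]
  · exact (integrableOn_const (isCompact_cell s).measure_lt_top.ne).congr (hae s hs).symm

theorem dirichletForm_eq_sum (hO : IsConvexPolyhedralDomain O) (𝒯 : Triangulation O)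
    {u w : Space d → ℝ} (hu : u ∈ 𝒯.femSpace) (hw : w ∈ 𝒯.femSpace) :
    dirichletForm O u w
      = ∑ s ∈ 𝒯.cells, volume.real (cell s) * inner ℝ (slope s u) (slope s w) := by
  refine setIntegral_eq_sum_const hO 𝒯 _ fun s hs x hx => ?_
  rw [𝒯.gradient_eq_slope hs hu hx, 𝒯.gradient_eq_slope hs hw hx]

theorem integral_norm_gradient_sq (u : Space d → ℝ) :
    ∫ x in O, ‖gradient u x‖ ^ 2 = dirichletForm O u u := by
  simp [dirichletForm]

/-! ### Mass lumping -/

/-- The weight `∫_O χ_v` of a vertex in the lumped quadrature. -/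
def nodeWeight (𝒯 : Triangulation O) (v : Space d) : ℝ := ∫ x in O, 𝒯.hat v x

theorem integrableOn_of_mem_femSpace (hO : IsConvexPolyhedralDomain O) (𝒯 : Triangulation O)
    {u : Space d → ℝ} (hu : u ∈ 𝒯.femSpace) : IntegrableOn u O :=
  (hu.1.integrableOn_compact hO.isCompact_closure).mono_set subset_closure

theorem lumped_eq_sum (hO : IsConvexPolyhedralDomain O) (𝒯 : Triangulation O)
    (a : Space d → ℝ) : lumped 𝒯 a = ∑ v ∈ 𝒯.vertices, 𝒯.nodeWeight v * a v := by
  simp only [lumped, interp, Finset.sum_apply, Pi.smul_apply, smul_eq_mul, nodeWeight]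
  rw [integral_finsetSum]
  · simp [integral_const_mul, mul_comm]
  · intro v _
    exact (integrableOn_of_mem_femSpace hO 𝒯 (𝒯.hat_mem v)).const_mul _

/-- On each cell a finite element function is bounded below by its smallest vertex value. -/
theorem le_of_forall_vertex (𝒯 : Triangulation O) {s : Finset (Space d)} (hs : s ∈ 𝒯.cells)
    {u : Space d → ℝ} (hu : u ∈ 𝒯.femSpace) {c : ℝ} (h : ∀ v ∈ s, c ≤ u v) {x : Space d}
    (hx : x ∈ cell s) : c ≤ u x := by
  obtain ⟨a, ha⟩ := hu.2.1 s hs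
  have hc : Convex ℝ {x | c ≤ a x} := by
    intro x hx y hy s t hs ht hst
    simp only [mem_ofPred_eq] at *
    rw [Convex.combo_affine_apply hst]
    simp only [smul_eq_mul]
    calc c = s * c + t * c := by rw [← add_mul, hst, one_mul]
      _ ≤ _ := by gcongr
  rw [ha hx]
  exact convexHull_min (s := (s : Set (Space d)))
    (fun v hv => by
      simpa only [mem_ofPred_eq, ← ha (mem_cell_of_mem hv)] using h v hv) hc hx

theorem hat_nonneg (𝒯 : Triangulation O) {v : Space d} (x : Space d) : 0 ≤ 𝒯.hat v x := by
  classical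
  by_cases hx : x ∈ closure O
  · obtain ⟨s, hs, hxs⟩ := 𝒯.exists_cell hx
    refine 𝒯.le_of_forall_vertex hs (𝒯.hat_mem v) (fun w hw => ?_) hxs
    rw [𝒯.hat_apply v (𝒯.mem_vertices.2 ⟨s, hs, hw⟩)]
    split_ifs <;> norm_num
  · exact ((𝒯.hat_mem v).2.2 x hx).ge

theorem sum_hat (𝒯 : Triangulation O) {x : Space d} (hx : x ∈ closure O) :
    ∑ v ∈ 𝒯.vertices, 𝒯.hat v x = 1 := by
  obtain ⟨s, hs, hxs⟩ := 𝒯.exists_cell hx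
  have hmem : 𝒯.interp (fun _ => 1) ∈ 𝒯.femSpace := 𝒯.interp_mem _
  have hone : ∀ v ∈ s, 𝒯.interp (fun _ => 1) v = 1 := fun v hv =>
    𝒯.interp_apply _ (𝒯.mem_vertices.2 ⟨s, hs, hv⟩)
  have h1 := 𝒯.le_of_forall_vertex hs hmem (c := 1) (fun v hv => (hone v hv).ge) hxs
  have h2 := 𝒯.le_of_forall_vertex hs (𝒯.femSpace.smul_mem (-1) hmem) (c := -1)
    (fun v hv => by simp [hone v hv]) hxs
  have h3 : 𝒯.interp (fun _ => 1) x = 1 := by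
    simp only [Pi.smul_apply, smul_eq_mul] at h2
    linarith
  simpa [interp, Finset.sum_apply] using h3

theorem nodeWeight_nonneg (𝒯 : Triangulation O) (v : Space d) : 0 ≤ 𝒯.nodeWeight v :=
  integral_nonneg fun x => 𝒯.hat_nonneg x

theorem sum_nodeWeight (hO : IsConvexPolyhedralDomain O) (𝒯 : Triangulation O) :
    ∑ v ∈ 𝒯.vertices, 𝒯.nodeWeight v = volume.real O := by
  simp only [nodeWeight]
  rw [← integral_finsetSum _ fun v _ => integrableOn_of_mem_femSpace hO 𝒯 (𝒯.hat_mem v)]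
  rw [setIntegral_congr_fun (g := fun _ => (1 : ℝ)) hO.isOpen.measurableSet
    fun x hx => 𝒯.sum_hat (subset_closure hx)]
  simp [Measure.real]

theorem eq_sum_hat_apply (𝒯 : Triangulation O) {u : Space d → ℝ} (hu : u ∈ 𝒯.femSpace)
    (x : Space d) : u x = ∑ v ∈ 𝒯.vertices, u v * 𝒯.hat v x := by
  conv_lhs => rw [𝒯.eq_sum_hat hu]
  simp [Finset.sum_apply]

/-- The `L²` norm is dominated by its lumped version (Jensen). -/
theorem integral_sq_le_lumped (hO : IsConvexPolyhedralDomain O) (𝒯 : Triangulation O)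
    {u : Space d → ℝ} (hu : u ∈ 𝒯.femSpace) :
    ∫ x in O, u x ^ 2 ≤ lumped 𝒯 fun x => u x ^ 2 := by
  have hc : ContinuousOn (fun x => u x ^ 2) (closure O) := hu.1.pow 2
  refine setIntegral_mono_on
    ((hc.integrableOn_compact hO.isCompact_closure).mono_set subset_closure)
    (integrableOn_of_mem_femSpace hO 𝒯 (𝒯.interp_mem _)) hO.isOpen.measurableSet fun x hx => ?_
  have h1 := 𝒯.sum_hat (subset_closure hx)
  rw [𝒯.eq_sum_hat_apply hu x]
  have h3 := Finset.sum_sq_le_sum_mul_sum_of_sq_le_mul 𝒯.vertices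
    (r := fun v => u v * 𝒯.hat v x) (f := fun v => u v ^ 2 * 𝒯.hat v x) (g := fun v => 𝒯.hat v x)
    (fun v _ => mul_nonneg (sq_nonneg _) (𝒯.hat_nonneg x)) (fun v _ => 𝒯.hat_nonneg x)
    (fun v _ => le_of_eq (by ring))
  rw [h1, mul_one] at h3
  refine h3.trans (le_of_eq ?_)
  simp [interp, Finset.sum_apply]

end Triangulation

/-! ### Lumped norms are dominated by integral norms -/

namespace Triangulation

variable {d : ℕ} {O : Set (Space d)}

theorem le_of_vertex_le (𝒯 : Triangulation O) {s : Finset (Space d)} (hs : s ∈ 𝒯.cells)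
    {u : Space d → ℝ} (hu : u ∈ 𝒯.femSpace) {c : ℝ} (h : ∀ v ∈ s, u v ≤ c) {x : Space d}
    (hx : x ∈ cell s) : u x ≤ c := by
  have := 𝒯.le_of_forall_vertex hs (𝒯.femSpace.smul_mem (-1) hu) (c := -c)
    (fun v hv => by simpa using h v hv) hx
  simpa using this

theorem abs_le_of_vertex (𝒯 : Triangulation O) {s : Finset (Space d)} (hs : s ∈ 𝒯.cells)
    {u : Space d → ℝ} (hu : u ∈ 𝒯.femSpace) {c : ℝ} (h : ∀ v ∈ s, |u v| ≤ c) {x : Space d}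
    (hx : x ∈ cell s) : |u x| ≤ c :=
  abs_le.2 ⟨𝒯.le_of_forall_vertex hs hu (fun v hv => (abs_le.1 (h v hv)).1) hx,
    𝒯.le_of_vertex_le hs hu (fun v hv => (abs_le.1 (h v hv)).2) hx⟩

theorem continuousOn_cell (𝒯 : Triangulation O) {s : Finset (Space d)} (hs : s ∈ 𝒯.cells)
    {u : Space d → ℝ} (hu : u ∈ 𝒯.femSpace) : ContinuousOn u (cell s) :=
  hu.1.mono (𝒯.cell_subset hs)

/-- The largest vertex value on a cell is controlled by the integral over the cell: close to the
vertex where it is attained, the function has at least half of that size. -/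
theorem pow_le_integral_cell (𝒯 : Triangulation O) {s : Finset (Space d)} (hs : s ∈ 𝒯.cells)
    {u : Space d → ℝ} (hu : u ∈ 𝒯.femSpace) (q : ℕ) {v₀ : Space d} (hv₀ : v₀ ∈ s)
    (hmax : ∀ v ∈ s, |u v| ≤ |u v₀|) :
    volume.real (cell s) * |u v₀| ^ q ≤ 2 ^ q * 4 ^ d * ∫ x in cell s, |u x| ^ q := by
  have hv := mem_cell_of_mem hv₀
  set S : Set (Space d) := AffineMap.homothety v₀ (1 / 4 : ℝ) '' cell s with hS
  have hcomp : IsCompact S :=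
    (isCompact_cell s).image (AffineMap.continuous_of_finiteDimensional _)
  have hsub : S ⊆ cell s := by
    rintro _ ⟨x, hx, rfl⟩
    have := (convex_convexHull ℝ (s : Set (Space d))).lineMap_mem hv hx
      (t := 1 / 4) ⟨by norm_num, by norm_num⟩
    rwa [← AffineMap.homothety_eq_lineMap] at this
  have hlow : ∀ y ∈ S, |u v₀| / 2 ≤ |u y| := by
    intro y hy
    obtain ⟨x, hx, rfl⟩ := id hy
    have h1 := 𝒯.sub_eq_inner_slope hs hu hv hx
    have h2 := 𝒯.sub_eq_inner_slope hs hu hv (hsub hy)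
    have h3 : AffineMap.homothety v₀ (1 / 4 : ℝ) x - v₀ = (1 / 4 : ℝ) • (x - v₀) := by
      simp [AffineMap.homothety_apply]
    rw [h3, inner_smul_right, ← h1] at h2
    have h4 := 𝒯.abs_le_of_vertex hs hu hmax hx
    have h5 : u (AffineMap.homothety v₀ (1 / 4 : ℝ) x) = 3 / 4 * u v₀ + 1 / 4 * u x := by linarith
    have h6 : |3 / 4 * u v₀| ≤ |u (AffineMap.homothety v₀ (1 / 4 : ℝ) x)| + |1 / 4 * u x| := by
      rw [h5]
      simpa using abs_sub_abs_le_abs_sub (3 / 4 * u v₀) (-(1 / 4 * u x))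
    rw [abs_mul, abs_mul, abs_of_pos (by norm_num : (0 : ℝ) < 3 / 4),
      abs_of_pos (by norm_num : (0 : ℝ) < 1 / 4)] at h6
    linarith
  have hvol : volume.real S = (1 / 4) ^ d * volume.real (cell s) := by
    rw [Measure.real, hS, Measure.addHaar_image_homothety]
    simp only [finrank_euclideanSpace, Fintype.card_fin, ENNReal.toReal_mul]
    rw [ENNReal.toReal_ofReal (abs_nonneg _), abs_of_nonneg (by positivity)]
    rfl
  have hc : ContinuousOn (fun x => |u x| ^ q) (cell s) := (𝒯.continuousOn_cell hs hu).abs.pow q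
  have hint : IntegrableOn (fun x => |u x| ^ q) (cell s) :=
    hc.integrableOn_compact (isCompact_cell s)
  have h7 : ∫ _ in S, (|u v₀| / 2) ^ q ≤ ∫ x in cell s, |u x| ^ q := by
    refine (setIntegral_mono_on (integrableOn_const hcomp.measure_lt_top.ne)
      (hint.mono_set hsub) hcomp.isClosed.measurableSet fun x hx => ?_).trans
      (setIntegral_mono_set hint (ae_of_all _ fun x => by positivity) hsub.eventuallyLE)
    exact pow_le_pow_left₀ (by positivity) (hlow x hx) q
  rw [setIntegral_const, smul_eq_mul, hvol, div_pow |u v₀| 2 q] at h7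
  have h8 : volume.real (cell s) * |u v₀| ^ q
      = 2 ^ q * 4 ^ d * ((1 / 4) ^ d * volume.real (cell s) * (|u v₀| ^ q / 2 ^ q)) := by
    rw [one_div_pow]
    field_simp
  rw [h8]
  gcongr

theorem cell_vertices_nonempty (𝒯 : Triangulation O) {s : Finset (Space d)} (hs : s ∈ 𝒯.cells) :
    s.Nonempty := by
  rw [← Finset.card_pos, 𝒯.card_cell s hs]
  exact Nat.succ_pos _

/-- On finite element functions the lumped `L^q` norm is dominated by the `L^q` norm, with a constant
that does not depend on the triangulation. -/
theorem lumped_abs_pow_le (hO : IsConvexPolyhedralDomain O) (𝒯 : Triangulation O)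
    {u : Space d → ℝ} (hu : u ∈ 𝒯.femSpace) (q : ℕ) :
    lumped 𝒯 (fun x => |u x| ^ q) ≤ 2 ^ q * 4 ^ d * ∫ x in O, |u x| ^ q := by
  have hmem := 𝒯.interp_mem fun x => |u x| ^ q
  rw [lumped, setIntegral_eq_sum hO 𝒯 fun s hs =>
      (𝒯.continuousOn_cell hs hmem).integrableOn_compact (isCompact_cell s),
    setIntegral_eq_sum hO 𝒯 (f := fun x => |u x| ^ q) fun s hs =>
      ((𝒯.continuousOn_cell hs hu).abs.pow q).integrableOn_compact (isCompact_cell s),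
    Finset.mul_sum]
  refine Finset.sum_le_sum fun s hs => ?_
  obtain ⟨v₀, hv₀, hmax⟩ := s.exists_max_image (fun v => |u v|) (𝒯.cell_vertices_nonempty hs)
  refine le_trans ?_ (𝒯.pow_le_integral_cell hs hu q hv₀ hmax)
  have h : ∫ x in cell s, 𝒯.interp (fun x => |u x| ^ q) x ≤ ∫ _ in cell s, |u v₀| ^ q := by
    refine setIntegral_mono_on
      ((𝒯.continuousOn_cell hs hmem).integrableOn_compact (isCompact_cell s))
      (integrableOn_const (isCompact_cell s).measure_lt_top.ne) (measurableSet_cell s)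
      fun x hx => ?_
    refine 𝒯.le_of_vertex_le hs hmem (fun v hv => ?_) hx
    rw [𝒯.interp_apply _ (𝒯.mem_vertices.2 ⟨s, hs, hv⟩)]
    exact pow_le_pow_left₀ (abs_nonneg _) (hmax v hv) q
  simpa using h

theorem volume_cell_pos (𝒯 : Triangulation O) {s : Finset (Space d)} (hs : s ∈ 𝒯.cells) :
    0 < volume.real (cell s) :=
  ENNReal.toReal_pos
    (Measure.measure_pos_of_nonempty_interior _ (𝒯.interior_cell_nonempty hs)).ne'
    (isCompact_cell s).measure_lt_top.ne

theorem nodeWeight_pos (hO : IsConvexPolyhedralDomain O) (𝒯 : Triangulation O) {v : Space d}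
    (hv : v ∈ 𝒯.vertices) : 0 < 𝒯.nodeWeight v := by
  obtain ⟨s, hs, hvs⟩ := 𝒯.mem_vertices.1 hv
  have hone : 𝒯.hat v v = 1 := by rw [𝒯.hat_apply v hv, if_pos rfl]
  have hle : ∀ w ∈ s, |𝒯.hat v w| ≤ |𝒯.hat v v| := by
    intro w hw
    rw [hone, 𝒯.hat_apply v (𝒯.mem_vertices.2 ⟨s, hs, hw⟩)]
    split_ifs <;> simp
  have h := 𝒯.pow_le_integral_cell hs (𝒯.hat_mem v) 1 hvs hle
  simp only [hone, abs_one, pow_one, mul_one] at h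
  have h1 : ∫ x in cell s, |𝒯.hat v x| ≤ 𝒯.nodeWeight v := by
    rw [nodeWeight, ← setIntegral_congr_set hO.closure_ae_eq]
    simp only [abs_of_nonneg (𝒯.hat_nonneg _)]
    exact setIntegral_mono_set ((𝒯.hat_mem v).1.integrableOn_compact hO.isCompact_closure)
      (ae_of_all _ fun x => 𝒯.hat_nonneg x) (𝒯.cell_subset hs).eventuallyLE
  have h2 := 𝒯.volume_cell_pos hs
  by_contra hcon
  have h3 : ∫ x in cell s, |𝒯.hat v x| ≤ 0 := h1.trans (not_lt.1 hcon)
  have h4 : (2 * 4 ^ d : ℝ) * ∫ x in cell s, |𝒯.hat v x| ≤ 0 :=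
    mul_nonpos_of_nonneg_of_nonpos (by positivity) h3
  linarith

end Triangulation

/-! ### The Sobolev inequality on a bounded convex domain -/

/-- Integrating a function along the direction `b i` amounts to integrating out the `i`-th coordinate
with respect to the basis `b`. -/
theorem lintegral_line_update {d : ℕ} (b : Module.Basis (Fin d) ℝ (Space d))
    {f : Space d → ℝ≥0∞} (x : Fin d → ℝ) (i : Fin d) :
    ∫⁻ s : ℝ, f (b.equivFun.symm x + s • b i)
      = ∫⁻ s : ℝ, f (b.equivFun.symm (Function.update x i s)) := by
  rw [← lintegral_add_left_eq_self (fun s => f (b.equivFun.symm (Function.update x i s))) (x i)]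
  refine lintegral_congr fun s => ?_
  congr 1
  have h : Function.update x i (x i + s) = x + s • Pi.single i 1 := by
    ext j
    by_cases hj : j = i
    · subst hj; simp
    · simp [hj]
  rw [h, map_add, map_smul]
  congr 2
  simp [Module.Basis.equivFun_symm_apply, Pi.single_apply]

/-- The Loomis–Whitney type inequality underlying the Gagliardo–Nirenberg–Sobolev inequality, for
integrals over lines in the directions of an arbitrary basis. -/
theorem exists_lintegral_prod_line_le {d : ℕ} (hd : 2 ≤ d)
    (b : Module.Basis (Fin d) ℝ (Space d)) :
    ∃ C : ℝ≥0, ∀ f : Space d → ℝ≥0∞, Measurable f →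
      ∫⁻ x, ∏ i, (∫⁻ s : ℝ, f (x + s • b i)) ^ ((1 : ℝ) / (d - 1 : ℝ))
        ≤ C * (∫⁻ x, f x) ^ ((d : ℝ) / (d - 1)) := by
  have hd' : (1 : ℝ) < d := by exact_mod_cast hd
  have hp : (d : ℝ).HolderConjugate ((d : ℝ) / (d - 1)) := by
    have := Real.HolderConjugate.conjExponent hd'
    simpa [Real.conjExponent] using this
  let e : (Fin d → ℝ) ≃L[ℝ] Space d := b.equivFun.symm.toContinuousLinearEquiv
  have he : ∀ x, e x = b.equivFun.symm x := fun x => rfl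
  let μ : Measure (Space d) := Measure.map e volume
  have : μ.IsAddHaarMeasure := e.isAddHaarMeasure_map _
  have hm : Measurable e := e.continuous.measurable
  obtain ⟨c₁, h1⟩ : ∃ c : ℝ≥0, (volume : Measure (Space d)) = (c : ℝ≥0∞) • μ :=
    ⟨_, Measure.isAddLeftInvariant_eq_smul (volume : Measure (Space d)) μ⟩
  obtain ⟨c₂, h2⟩ : ∃ c : ℝ≥0, μ = (c : ℝ≥0∞) • (volume : Measure (Space d)) :=
    ⟨_, Measure.isAddLeftInvariant_eq_smul μ (volume : Measure (Space d))⟩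
  have h1' : ∀ F : Space d → ℝ≥0∞, ∫⁻ x, F x = c₁ * ∫⁻ x, F x ∂μ := fun F => by
    conv_lhs => rw [h1, lintegral_smul_measure, smul_eq_mul]
  refine ⟨c₁ * c₂ ^ ((d : ℝ) / (d - 1)), fun f hf => ?_⟩
  have hline : ∀ i, Measurable fun x => ∫⁻ s : ℝ, f (x + s • b i) := by
    intro i
    refine Measurable.lintegral_prod_right' (f := fun z : Space d × ℝ => f (z.1 + z.2 • b i)) ?_
    exact hf.comp (by fun_prop)
  have hmeas : Measurable fun x =>
      ∏ i, (∫⁻ s : ℝ, f (x + s • b i)) ^ ((1 : ℝ) / (d - 1 : ℝ)) :=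
    Finset.measurable_prod _ fun i _ => (hline i).pow_const _
  have h3 : ∫⁻ x, f (e x) = c₂ * ∫⁻ x, f x := by
    rw [← lintegral_map hf hm]
    change ∫⁻ x, f x ∂μ = _
    rw [h2, lintegral_smul_measure, smul_eq_mul]
  rw [h1', lintegral_map hmeas hm]
  have h4 := lintegral_prod_lintegral_pow_le (fun _ : Fin d => (volume : Measure ℝ))
    (p := (d : ℝ) / (d - 1)) (by simpa using hp) (f := fun x => f (e x)) (hf.comp hm)
  have h5 : ∫⁻ x : Fin d → ℝ, ∏ i, (∫⁻ s : ℝ, f (e x + s • b i)) ^ ((1 : ℝ) / (d - 1 : ℝ))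
      ≤ (c₂ * ∫⁻ x, f x) ^ ((d : ℝ) / (d - 1)) := by
    rw [← h3]
    refine le_trans (le_of_eq ?_) h4
    refine lintegral_congr fun x => Finset.prod_congr rfl fun i _ => ?_
    rw [he, lintegral_line_update]
    simp [he]
  have h6 : 0 ≤ (d : ℝ) / (d - 1) := hp.symm.nonneg
  rw [ENNReal.mul_rpow_of_nonneg _ _ h6] at h5
  rw [ENNReal.coe_mul, mul_assoc, ENNReal.coe_rpow_of_nonneg _ h6]
  exact mul_le_mul_right h5 _

/-- `w` is controlled along segments of `O` by the line integrals of `g`, as is the absolute value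
of a function with a gradient bounded by `g`. -/
def LineControlled {d : ℕ} (O : Set (Space d)) (w g : Space d → ℝ≥0∞) : Prop :=
  ∀ x ∈ O, ∀ b : Space d, x + b ∈ O → ∀ τ ∈ Icc (0 : ℝ) 1,
    w x ≤ w (x + τ • b) + ‖b‖ₑ * ∫⁻ t in Icc (0 : ℝ) 1, g (x + t • b)

theorem exists_basis_mem_of_isOpen {d : ℕ} {U : Set (Space d)} (hU : IsOpen U)
    (hne : U.Nonempty) : ∃ b : Module.Basis (Fin d) ℝ (Space d), ∀ i, b i ∈ U := by
  have hspan : Submodule.span ℝ U = ⊤ := by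
    refine Submodule.eq_top_of_nonempty_interior' _ ?_
    obtain ⟨x, hx⟩ := hne
    exact ⟨x, interior_mono Submodule.subset_span (by rwa [hU.interior_eq])⟩
  let b := Module.Basis.ofSpan hspan.ge
  have hb : range b ⊆ U := Module.Basis.ofSpan_subset hspan.ge
  have := Module.Finite.finite_basis b
  have := Fintype.ofFinite ((linearIndepOn_empty ℝ id).extend (empty_subset U))
  have hcard := Module.finrank_eq_card_basis b
  rw [finrank_euclideanSpace, Fintype.card_fin] at hcard
  let e := Fintype.equivFinOfCardEq hcard.symm
  refine ⟨b.reindex e, fun i => hb ?_⟩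
  rw [Module.Basis.reindex_apply]
  exact mem_range_self _

/-- The embedding `W^{1,1} ⊆ L^{d/(d-1)}` close to a point of the closure of a convex open set: all
segments that start near the point in the directions of a suitable basis stay in the set. -/
theorem exists_local_sobolev {d : ℕ} (hd : 2 ≤ d) {O : Set (Space d)} (hopen : IsOpen O)
    (hconv : Convex ℝ O) (hne : O.Nonempty) (x₀ : Space d) :
    ∃ U ∈ 𝓝 x₀, ∃ C : ℝ≥0, ∀ w g : Space d → ℝ≥0∞, Measurable w → Measurable g →
      LineControlled O w g →
      ∫⁻ x in O ∩ U, w x ^ ((d : ℝ) / (d - 1))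
        ≤ C * (∫⁻ x in O, w x + g x) ^ ((d : ℝ) / (d - 1)) := by
  have hd' : (1 : ℝ) < d := by exact_mod_cast hd
  have hq : 0 ≤ (d : ℝ) / (d - 1) := div_nonneg (by linarith) (by linarith)
  obtain ⟨b, hb⟩ := exists_basis_mem_of_isOpen
    (U := (fun v => x₀ + v) ⁻¹' O) (hopen.preimage (by fun_prop))
    (by obtain ⟨c, hc⟩ := hne; exact ⟨c - x₀, by simpa using hc⟩)
  obtain ⟨C, hC⟩ := exists_lintegral_prod_line_le hd b
  have hU : ∀ᶠ x in 𝓝 x₀, ∀ i, x + b i ∈ O := by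
    rw [Filter.eventually_all]
    intro i
    exact (by fun_prop : Continuous fun x => x + b i).continuousAt.preimage_mem_nhds
      (hopen.mem_nhds (hb i))
  let β : ℝ≥0 := 1 + ∑ i, ‖b i‖₊
  refine ⟨{x | ∀ i, x + b i ∈ O}, hU, C * β ^ ((d : ℝ) / (d - 1)), fun w g hw hg hwg => ?_⟩
  have hsum : Measurable fun x => w x + g x := hw.add hg
  let f : Space d → ℝ≥0∞ := O.indicator fun x => β * (w x + g x)
  have hf : Measurable f := (hsum.const_mul _).indicator hopen.measurableSet
  have hfint : ∫⁻ x, f x = β * ∫⁻ x in O, w x + g x := by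
    rw [lintegral_indicator hopen.measurableSet, lintegral_const_mul _ hsum]
  have key : ∀ x ∈ O ∩ {x | ∀ i, x + b i ∈ O}, ∀ i, w x ≤ ∫⁻ s : ℝ, f (x + s • b i) := by
    rintro x ⟨hx, hxb⟩ i
    have hseg : ∀ t ∈ Icc (0 : ℝ) 1, x + t • b i ∈ O := fun t ht =>
      hconv.add_smul_mem hx (hxb i) ht
    have hlin : Measurable fun t : ℝ => x + t • b i := by fun_prop
    have hwlin : Measurable fun t : ℝ => w (x + t • b i) := hw.comp hlin
    have hslin : Measurable fun t : ℝ => w (x + t • b i) + g (x + t • b i) := hsum.comp hlin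
    have h1 : w x = ∫⁻ _ in Icc (0 : ℝ) 1, w x := by simp
    have h2 : ‖b i‖ₑ ≤ β := by
      have : ‖b i‖₊ ≤ β := le_add_left (Finset.single_le_sum (f := fun i => ‖b i‖₊)
        (fun _ _ => zero_le) (Finset.mem_univ i))
      exact_mod_cast this
    have h3 : (1 : ℝ≥0∞) ≤ β := by
      have : (1 : ℝ≥0) ≤ β := le_add_right le_rfl
      exact_mod_cast this
    calc w x = ∫⁻ _ in Icc (0 : ℝ) 1, w x := h1
      _ ≤ ∫⁻ τ in Icc (0 : ℝ) 1,
            (w (x + τ • b i) + ‖b i‖ₑ * ∫⁻ t in Icc (0 : ℝ) 1, g (x + t • b i)) :=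
          setLIntegral_mono' measurableSet_Icc fun τ hτ => hwg x hx (b i) (hxb i) τ hτ
      _ = (∫⁻ τ in Icc (0 : ℝ) 1, w (x + τ • b i))
            + ‖b i‖ₑ * ∫⁻ t in Icc (0 : ℝ) 1, g (x + t • b i) := by
          rw [lintegral_add_left hwlin]
          simp
      _ ≤ β * (∫⁻ τ in Icc (0 : ℝ) 1, w (x + τ • b i))
            + β * ∫⁻ t in Icc (0 : ℝ) 1, g (x + t • b i) := by
          gcongr
          exact le_mul_of_one_le_left (zero_le) h3
      _ = ∫⁻ t in Icc (0 : ℝ) 1, β * (w (x + t • b i) + g (x + t • b i)) := by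
          rw [lintegral_const_mul _ hslin,
            lintegral_add_left hwlin, mul_add]
      _ = ∫⁻ t in Icc (0 : ℝ) 1, f (x + t • b i) :=
          setLIntegral_congr_fun measurableSet_Icc fun t ht => by
            simp only [f, indicator_of_mem (hseg t ht)]
      _ ≤ ∫⁻ s : ℝ, f (x + s • b i) := setLIntegral_le_lintegral _ _
  have h7 : ∫⁻ x in O ∩ {x | ∀ i, x + b i ∈ O}, w x ^ ((d : ℝ) / (d - 1))
      ≤ ∫⁻ x, ∏ i, (∫⁻ s : ℝ, f (x + s • b i)) ^ ((1 : ℝ) / (d - 1 : ℝ)) := by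
    have hms : MeasurableSet (O ∩ {x | ∀ i, x + b i ∈ O}) := by
      refine hopen.measurableSet.inter (IsOpen.measurableSet ?_)
      rw [ofPred_forall]
      exact isOpen_iInter_of_finite fun i => hopen.preimage (by fun_prop)
    refine (setLIntegral_mono' hms fun x hx => ?_).trans (setLIntegral_le_lintegral _ _)
    have h8 : w x ^ ((d : ℝ) / (d - 1)) = ∏ _i : Fin d, w x ^ ((1 : ℝ) / (d - 1 : ℝ)) := by
      rw [Finset.prod_const, Finset.card_univ, Fintype.card_fin, ← ENNReal.rpow_mul_natCast]
      congr 1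
      ring
    rw [h8]
    exact Finset.prod_le_prod' fun i _ =>
      ENNReal.rpow_le_rpow (key x hx i) (div_nonneg zero_le_one (by linarith))
  refine h7.trans ((hC f hf).trans (le_of_eq ?_))
  rw [hfint, ENNReal.mul_rpow_of_nonneg _ _ hq, ENNReal.coe_mul, ENNReal.coe_rpow_of_nonneg _ hq,
    mul_assoc]

/-- The embedding `W^{1,1} ⊆ L^{d/(d-1)}` on a bounded convex open set: the closure is compact, so
finitely many of the local embeddings suffice. -/
theorem exists_sobolev {d : ℕ} (hd : 2 ≤ d) {O : Set (Space d)}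
    (hO : IsConvexPolyhedralDomain O) :
    ∃ C : ℝ≥0, ∀ w g : Space d → ℝ≥0∞, Measurable w → Measurable g → LineControlled O w g →
      ∫⁻ x in O, w x ^ ((d : ℝ) / (d - 1))
        ≤ C * (∫⁻ x in O, w x + g x) ^ ((d : ℝ) / (d - 1)) := by
  obtain ⟨C, hC⟩ := hO.isCompact_closure.induction_on
    (p := fun S => ∃ C : ℝ≥0, ∀ w g : Space d → ℝ≥0∞, Measurable w → Measurable g →
      LineControlled O w g → ∫⁻ x in O ∩ S, w x ^ ((d : ℝ) / (d - 1))
        ≤ C * (∫⁻ x in O, w x + g x) ^ ((d : ℝ) / (d - 1)))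
    ⟨0, fun w g _ _ _ => by simp⟩
    (fun S T hST ⟨C, hC⟩ => ⟨C, fun w g hw hg hwg =>
      (lintegral_mono_set (inter_subset_inter_right O hST)).trans (hC w g hw hg hwg)⟩)
    (fun S T ⟨C, hC⟩ ⟨C', hC'⟩ => ⟨C + C', fun w g hw hg hwg => by
      rw [inter_union_distrib_left, ENNReal.coe_add, add_mul]
      exact (lintegral_union_le _ _ _).trans (add_le_add (hC w g hw hg hwg) (hC' w g hw hg hwg))⟩)
    (fun x _ => by
      obtain ⟨U, hU, h⟩ := exists_local_sobolev hd hO.isOpen hO.convex hO.nonempty x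
      exact ⟨U, mem_nhdsWithin_of_mem_nhds hU, h⟩)
  rw [inter_eq_left.2 subset_closure] at hC
  exact ⟨C, hC⟩


/-! ### The discrete Sobolev inequality -/

namespace Triangulation

variable {d : ℕ} {O : Set (Space d)}

/-- The norm of the gradient of a finite element function, as a function which is defined in every
point; at the interfaces the contributions of all adjacent cells are added. -/
def slopeNorm (𝒯 : Triangulation O) (u : Space d → ℝ) (x : Space d) : ℝ :=
  ∑ s ∈ 𝒯.cells, (cell s).indicator (fun _ => ‖slope s u‖) x

theorem slopeNorm_nonneg (𝒯 : Triangulation O) (u : Space d → ℝ) (x : Space d) :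
    0 ≤ 𝒯.slopeNorm u x :=
  Finset.sum_nonneg fun _ _ => indicator_nonneg (fun _ _ => norm_nonneg _) _

theorem measurable_slopeNorm (𝒯 : Triangulation O) (u : Space d → ℝ) :
    Measurable (𝒯.slopeNorm u) :=
  Finset.measurable_sum _ fun s _ => measurable_const.indicator (measurableSet_cell s)

theorem norm_slope_le_slopeNorm (𝒯 : Triangulation O) {s : Finset (Space d)} (hs : s ∈ 𝒯.cells)
    (u : Space d → ℝ) {x : Space d} (hx : x ∈ cell s) : ‖slope s u‖ ≤ 𝒯.slopeNorm u x := by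
  have := Finset.single_le_sum (f := fun s => (cell s).indicator (fun _ => ‖slope s u‖) x)
    (fun _ _ => indicator_nonneg (fun _ _ => norm_nonneg _) _) hs
  simpa only [slopeNorm, indicator_of_mem hx] using this

theorem slopeNorm_le (𝒯 : Triangulation O) (u : Space d → ℝ) (x : Space d) :
    𝒯.slopeNorm u x ≤ ∑ s ∈ 𝒯.cells, ‖slope s u‖ :=
  Finset.sum_le_sum fun _ _ => indicator_le_self' (fun _ _ => norm_nonneg _) _

theorem slopeNorm_eq (𝒯 : Triangulation O) {s : Finset (Space d)} (hs : s ∈ 𝒯.cells)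
    (u : Space d → ℝ) :
    𝒯.slopeNorm u =ᵐ[volume.restrict (cell s)] fun _ => ‖slope s u‖ := by
  classical
  have h : ∀ᵐ x ∂(volume.restrict (cell s)), ∀ t ∈ 𝒯.cells, t ≠ s → x ∉ cell t := by
    rw [Filter.eventually_all_finset]
    intro t ht
    by_cases hts : t = s
    · simp [hts]
    · have h0 := 𝒯.volume_inter_cell ht hs hts
      rw [← Measure.restrict_apply (measurableSet_cell t)] at h0
      filter_upwards [measure_eq_zero_iff_ae_notMem.1 h0] with x hx _ using hx
  filter_upwards [h, ae_restrict_mem (measurableSet_cell s)] with x hx hxs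
  rw [slopeNorm, Finset.sum_eq_single_of_mem s hs, indicator_of_mem hxs]
  intro t ht hts
  exact indicator_of_notMem (hx t ht hts) _

theorem integrableOn_slopeNorm_sq (𝒯 : Triangulation O) (u : Space d → ℝ) {S : Set (Space d)}
    (hS : volume S ≠ ∞) : IntegrableOn (fun x => 𝒯.slopeNorm u x ^ 2) S := by
  refine Measure.integrableOn_of_bounded hS
    ((𝒯.measurable_slopeNorm u).pow_const 2).aestronglyMeasurable
    (M := (∑ s ∈ 𝒯.cells, ‖slope s u‖) ^ 2) (ae_of_all _ fun x => ?_)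
  rw [Real.norm_of_nonneg (by positivity)]
  exact pow_le_pow_left₀ (𝒯.slopeNorm_nonneg u x) (𝒯.slopeNorm_le u x) 2

theorem integral_slopeNorm_sq (hO : IsConvexPolyhedralDomain O) (𝒯 : Triangulation O)
    {u : Space d → ℝ} (hu : u ∈ 𝒯.femSpace) :
    ∫ x in O, 𝒯.slopeNorm u x ^ 2 = dirichletForm O u u := by
  rw [dirichletForm_eq_sum hO 𝒯 hu hu, setIntegral_eq_sum hO 𝒯 fun s _ =>
    𝒯.integrableOn_slopeNorm_sq u (isCompact_cell s).measure_lt_top.ne]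
  refine Finset.sum_congr rfl fun s hs => ?_
  have h : (fun x => 𝒯.slopeNorm u x ^ 2) =ᵐ[volume.restrict (cell s)] fun _ => ‖slope s u‖ ^ 2 :=
    (𝒯.slopeNorm_eq hs u).fun_comp fun y => y ^ 2
  rw [integral_congr_ae h]
  simp [Measure.real]

theorem measurable_of_mem (𝒯 : Triangulation O) {u : Space d → ℝ} (hu : u ∈ 𝒯.femSpace) :
    Measurable u := by
  classical
  have h : u = (closure O).piecewise u (fun _ => 0) := by
    funext x
    by_cases hx : x ∈ closure O
    · rw [piecewise_eq_of_mem _ _ _ hx]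
    · rw [piecewise_eq_of_notMem _ _ _ hx, hu.2.2 x hx]
  rw [h]
  exact hu.1.measurable_piecewise continuousOn_const isClosed_closure.measurableSet

/-- Near a point `x`, increments from `x` are bounded by `slopeNorm` at `x`.  At an interface the other
point may lie in any of the adjacent cells, whose slopes are all contained in `slopeNorm`. -/
theorem eventually_abs_sub_le (𝒯 : Triangulation O) {u : Space d → ℝ} (hu : u ∈ 𝒯.femSpace)
    (x : Space d) :
    ∀ᶠ y in 𝓝 x, y ∈ closure O → |u y - u x| ≤ 𝒯.slopeNorm u x * ‖y - x‖ := by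
  have h : ∀ᶠ y in 𝓝 x, ∀ s ∈ 𝒯.cells, x ∉ cell s → y ∉ cell s := by
    rw [Filter.eventually_all_finset]
    intro s _
    by_cases hx : x ∈ cell s
    · simp [hx]
    · filter_upwards [(isCompact_cell s).isClosed.isOpen_compl.mem_nhds hx] with y hy _ using hy
  filter_upwards [h] with y hy hyO
  obtain ⟨s, hs, hys⟩ := 𝒯.exists_cell hyO
  have hxs : x ∈ cell s := by
    by_contra hcon
    exact hy s hs hcon hys
  rw [𝒯.sub_eq_inner_slope hs hu hxs hys]
  exact (abs_real_inner_le_norm _ _).trans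
    (mul_le_mul_of_nonneg_right (𝒯.norm_slope_le_slopeNorm hs u hxs) (norm_nonneg _))

theorem lipschitz_on_segment (𝒯 : Triangulation O) {u : Space d → ℝ} (hu : u ∈ 𝒯.femSpace)
    {x b : Space d} (hseg : ∀ t ∈ Icc (0 : ℝ) 1, x + t • b ∈ closure O) {t₁ t₂ : ℝ}
    (h0 : 0 ≤ t₁) (h12 : t₁ ≤ t₂) (h1 : t₂ ≤ 1) :
    |u (x + t₂ • b) - u (x + t₁ • b)|
      ≤ (∑ s ∈ 𝒯.cells, ‖slope s u‖) * ‖b‖ * (t₂ - t₁) := by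
  set K := (∑ s ∈ 𝒯.cells, ‖slope s u‖) * ‖b‖ with hK
  have hsub : Icc t₁ t₂ ⊆ Icc (0 : ℝ) 1 := Icc_subset_Icc h0 h1
  have hcont : ContinuousOn (fun t : ℝ => u (x + t • b)) (Icc t₁ t₂) :=
    hu.1.comp (by fun_prop) fun t ht => hseg t (hsub ht)
  have key := image_le_of_liminf_slope_right_le_deriv_boundary
    (f := fun t => |u (x + t • b) - u (x + t₁ • b)|) (a := t₁) (b := t₂)
    (hcont.sub continuousOn_const).abs (B := fun t => K * (t - t₁)) (B' := fun _ => K)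
    (by simp) (by fun_prop)
    (fun t _ => by
      simpa using (((hasDerivAt_id t).sub_const t₁).const_mul K).hasDerivWithinAt) ?_
    (right_mem_Icc.2 h12)
  · exact key
  · intro t ht r hr
    refine Filter.Eventually.frequently ?_
    have hev := (by fun_prop : Continuous fun z : ℝ => x + z • b).continuousAt.eventually
      (𝒯.eventually_abs_sub_le hu (x + t • b))
    filter_upwards [mem_nhdsWithin_of_mem_nhds hev, Ioo_mem_nhdsGT ht.2] with z hz hz2
    refine lt_of_le_of_lt ?_ hr
    rw [slope_def_field, div_le_iff₀ (by linarith [hz2.1])]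
    have h2 := hz (hseg z ⟨by linarith [hz2.1, ht.1], by linarith [hz2.2]⟩)
    have h3 : x + z • b - (x + t • b) = (z - t) • b := by module
    rw [h3, norm_smul, Real.norm_of_nonneg (by linarith [hz2.1])] at h2
    have h4 := 𝒯.slopeNorm_le u (x + t • b)
    have h5 := abs_sub_abs_le_abs_sub (u (x + z • b) - u (x + t₁ • b))
      (u (x + t • b) - u (x + t₁ • b))
    rw [sub_sub_sub_cancel_right] at h5
    refine h5.trans (h2.trans ?_)
    have h6 : 0 ≤ (z - t) * ‖b‖ := mul_nonneg (by linarith [hz2.1]) (norm_nonneg _)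
    calc _ ≤ (∑ s ∈ 𝒯.cells, ‖slope s u‖) * ((z - t) * ‖b‖) :=
          mul_le_mul_of_nonneg_right h4 h6
      _ = K * (z - t) := by rw [hK]; ring

/-- The fourth power of a finite element function is controlled along segments; it is locally
Lipschitz there, so the fundamental theorem of calculus applies. -/
theorem lineControlled_pow (hO : IsConvexPolyhedralDomain O) (𝒯 : Triangulation O)
    {u : Space d → ℝ} (hu : u ∈ 𝒯.femSpace) :
    LineControlled O (fun x => ENNReal.ofReal (u x ^ 4))
      (fun x => ENNReal.ofReal (4 * |u x| ^ 3 * 𝒯.slopeNorm u x)) := by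
  intro x hx b hb τ hτ
  have hseg' : ∀ t ∈ Icc (0 : ℝ) 1, x + t • b ∈ O := fun t ht => hO.convex.add_smul_mem hx hb ht
  have hseg : ∀ t ∈ Icc (0 : ℝ) 1, x + t • b ∈ closure O := fun t ht => subset_closure (hseg' t ht)
  set f : ℝ → ℝ := fun t => u (x + t • b) with hf
  have hsub : uIcc 0 τ ⊆ Icc (0 : ℝ) 1 := by
    rw [uIcc_of_le hτ.1]
    exact Icc_subset_Icc_right hτ.2
  have hK : 0 ≤ (∑ s ∈ 𝒯.cells, ‖slope s u‖) * ‖b‖ := by positivity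
  have hlip : LipschitzOnWith (Real.toNNReal ((∑ s ∈ 𝒯.cells, ‖slope s u‖) * ‖b‖)) f
      (uIcc 0 τ) := by
    refine LipschitzOnWith.of_dist_le_mul fun s hs t ht => ?_
    rw [Real.coe_toNNReal _ hK, Real.dist_eq, Real.dist_eq]
    have hs' := hsub hs
    have ht' := hsub ht
    rcases le_total s t with hst | hst
    · rw [abs_sub_comm, abs_sub_comm s t, abs_of_nonneg (by linarith : 0 ≤ t - s)]
      exact 𝒯.lipschitz_on_segment hu hseg hs'.1 hst ht'.2
    · rw [abs_of_nonneg (by linarith : 0 ≤ s - t)]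
      exact 𝒯.lipschitz_on_segment hu hseg ht'.1 hst hs'.2
  have hac := hlip.absolutelyContinuousOnInterval
  have hac4 : AbsolutelyContinuousOnInterval (fun t => f t ^ 4) 0 τ := by
    convert! (hac.fun_mul hac).fun_mul (hac.fun_mul hac) using 1
    funext t
    ring
  have hftc := hac4.integral_deriv_eq_sub
  have hderiv : ∀ᵐ t : ℝ, t ∈ Ioc 0 τ → t ≠ τ →
      ‖deriv (fun t => f t ^ 4) t‖ₑ
        ≤ ‖b‖ₑ * ENNReal.ofReal (4 * |u (x + t • b)| ^ 3 * 𝒯.slopeNorm u (x + t • b)) := by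
    filter_upwards [hac.ae_differentiableAt] with t ht ht1 ht2
    have htτ : t ∈ Ioo 0 τ := ⟨ht1.1, lt_of_le_of_ne ht1.2 ht2⟩
    have hdiff := ht (by rw [uIcc_of_le hτ.1]; exact Ioc_subset_Icc_self ht1)
    have h1 : deriv (fun t => f t ^ 4) t = 4 * f t ^ 3 * deriv f t := by
      simpa using (hdiff.hasDerivAt.fun_pow 4).deriv
    have h2 : ‖deriv f t‖ ≤ 𝒯.slopeNorm u (x + t • b) * ‖b‖ := by
      refine norm_deriv_le_of_lip' (mul_nonneg (𝒯.slopeNorm_nonneg _ _) (norm_nonneg _)) ?_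
      have hev := (by fun_prop : Continuous fun z : ℝ => x + z • b).continuousAt.eventually
        (𝒯.eventually_abs_sub_le hu (x + t • b))
      filter_upwards [hev, isOpen_Ioo.mem_nhds htτ] with z hz hz2
      have h2 := hz (hseg z ⟨hz2.1.le, hz2.2.le.trans hτ.2⟩)
      have h3 : x + z • b - (x + t • b) = (z - t) • b := by module
      rw [h3, norm_smul] at h2
      rw [Real.norm_eq_abs (f z - f t)]
      calc _ ≤ _ := h2
        _ = _ := by ring
    rw [h1, ← ofReal_norm, ← ofReal_norm (E := Space d),
      ← ENNReal.ofReal_mul (norm_nonneg _)]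
    refine ENNReal.ofReal_le_ofReal ?_
    rw [norm_mul, norm_mul, norm_pow]
    simp only [Real.norm_eq_abs] at h2 ⊢
    rw [abs_of_pos (by norm_num : (0 : ℝ) < 4)]
    calc 4 * |f t| ^ 3 * |deriv f t|
        ≤ 4 * |f t| ^ 3 * (𝒯.slopeNorm u (x + t • b) * ‖b‖) := by gcongr
      _ = _ := by rw [hf]; ring
  have hne : ∀ᵐ t : ℝ, t ≠ τ := by
    simp [ae_iff]
  have hbound : ENNReal.ofReal |f τ ^ 4 - f 0 ^ 4| ≤ ‖b‖ₑ * ∫⁻ t in Icc (0 : ℝ) 1,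
      ENNReal.ofReal (4 * |u (x + t • b)| ^ 3 * 𝒯.slopeNorm u (x + t • b)) := by
    rw [← hftc, intervalIntegral.integral_of_le hτ.1, ← Real.norm_eq_abs, ofReal_norm]
    refine (enorm_integral_le_lintegral_enorm _).trans ?_
    rw [← lintegral_const_mul' _ _ enorm_ne_top]
    refine (setLIntegral_mono_ae' measurableSet_Ioc ?_).trans
      (lintegral_mono_set (Ioc_subset_Icc_self.trans (Icc_subset_Icc_right hτ.2)))
    filter_upwards [hderiv, hne] with t ht ht2 ht1 using ht ht1 ht2
  have h0 : f 0 = u x := by simp [hf]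
  rw [h0] at hbound
  have h3 : u x ^ 4 ≤ f τ ^ 4 + |f τ ^ 4 - u x ^ 4| := by
    have := neg_abs_le (f τ ^ 4 - u x ^ 4)
    linarith
  calc ENNReal.ofReal (u x ^ 4) ≤ ENNReal.ofReal (f τ ^ 4 + |f τ ^ 4 - u x ^ 4|) :=
        ENNReal.ofReal_le_ofReal h3
    _ ≤ ENNReal.ofReal (f τ ^ 4) + ENNReal.ofReal |f τ ^ 4 - u x ^ 4| := ENNReal.ofReal_add_le
    _ ≤ _ := add_le_add le_rfl hbound

theorem integral_mul_le_sqrt_mul_sqrt {α : Type*} [MeasurableSpace α] {μ : Measure α}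
    {f g : α → ℝ} (hf : 0 ≤ f) (hg : 0 ≤ g) (hf2 : MemLp f 2 μ) (hg2 : MemLp g 2 μ) :
    ∫ x, f x * g x ∂μ ≤ √(∫ x, f x ^ 2 ∂μ) * √(∫ x, g x ^ 2 ∂μ) := by
  have := integral_mul_le_Lp_mul_Lq_of_nonneg (μ := μ) (f := f) (g := g) (p := 2) (q := 2)
    Real.HolderConjugate.two_two (ae_of_all _ hf) (ae_of_all _ hg) (by simpa using hf2)
    (by simpa using hg2)
  simpa only [Real.rpow_two, Real.sqrt_eq_rpow] using this

/-- Absorption of the factor `√I`, where `I` stands for the integral of `u⁶`. -/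
theorem pow_six_bound {I c S : ℝ} (hI0 : 0 ≤ I) (hc : 0 ≤ c) (hS : 0 ≤ S)
    (h : I ^ (2 / 3 : ℝ) ≤ c * (√I * √S)) : I ≤ c ^ 6 * S ^ 3 := by
  set y : ℝ := I ^ (1 / 6 : ℝ) with hy
  have hy0 : 0 ≤ y := by positivity
  have h1 : I = y ^ 6 := by
    rw [hy, ← Real.rpow_natCast, ← Real.rpow_mul hI0]; norm_num
  have h2 : I ^ (2 / 3 : ℝ) = y ^ 4 := by
    rw [hy, ← Real.rpow_natCast, ← Real.rpow_mul hI0]; norm_num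
  have h3 : √I = y ^ 3 := by
    rw [h1, show y ^ 6 = (y ^ 3) ^ 2 by ring, Real.sqrt_sq (by positivity)]
  rw [h2, h3] at h
  have h5 : y ≤ c * √S := by
    rcases hy0.eq_or_lt with h0 | h0
    · rw [← h0]; positivity
    · refine le_of_mul_le_mul_left (a := y ^ 3) ?_ (by positivity)
      calc y ^ 3 * y = y ^ 4 := by ring
        _ ≤ c * (y ^ 3 * √S) := h
        _ = _ := by ring
  calc I = y ^ 6 := h1
    _ ≤ (c * √S) ^ 6 := pow_le_pow_left₀ hy0 h5 6
    _ = c ^ 6 * ((√S) ^ 2) ^ 3 := by ring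
    _ = _ := by rw [Real.sq_sqrt hS]

/-- The embedding of the discrete `H¹` norm into the lumped `L⁶` norm, with a constant that does not
depend on the triangulation. -/
theorem exists_lumped_pow_six_le (hd : d = 2 ∨ d = 3) (hO : IsConvexPolyhedralDomain O) :
    ∃ C > 0, ∀ 𝒯 : Triangulation O, ∀ u ∈ 𝒯.femSpace,
      lumped 𝒯 (fun x => u x ^ 6)
        ≤ C * (lumped 𝒯 (fun x => u x ^ 2) + dirichletForm O u u) ^ 3 := by
  have hd2 : 2 ≤ d := by omega
  obtain ⟨C, hC⟩ := exists_sobolev hd2 hO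
  set q : ℝ := (d : ℝ) / (d - 1) with hq
  have hq32 : 3 / 2 ≤ q := by
    rcases hd with rfl | rfl <;> norm_num [hq]
  have hq0 : 0 < q := by linarith
  set c : ℝ := ((C : ℝ≥0∞) ^ (1 / q) * volume O ^ (1 / (3 / 2 : ℝ) - 1 / q)).toReal with hc
  have hcfin : (C : ℝ≥0∞) ^ (1 / q) * volume O ^ (1 / (3 / 2 : ℝ) - 1 / q) ≠ ∞ := by
    refine ENNReal.mul_ne_top (ENNReal.rpow_ne_top_of_nonneg (by positivity) ENNReal.coe_ne_top)
      (ENNReal.rpow_ne_top_of_nonneg ?_ hO.volume_lt_top.ne)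
    rw [sub_nonneg]
    exact one_div_le_one_div_of_le (by norm_num) hq32
  refine ⟨2 ^ 6 * 4 ^ d * ((c + 1) ^ 6 * 32 ^ 3), by positivity, fun 𝒯 u hu => ?_⟩
  have hmu := 𝒯.measurable_of_mem hu
  have hmG := 𝒯.measurable_slopeNorm u
  have hint : ∀ k : ℕ, IntegrableOn (fun x => |u x| ^ k) O := fun k =>
    ((hu.1.abs.pow k).integrableOn_compact hO.isCompact_closure).mono_set subset_closure
  have hG2 := 𝒯.integrableOn_slopeNorm_sq u hO.volume_lt_top.ne
  set I : ℝ := ∫ x in O, |u x| ^ 6 with hI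
  set S : ℝ := (∫ x in O, u x ^ 2) + dirichletForm O u u with hS
  have hI0 : 0 ≤ I := integral_nonneg fun x => by positivity
  -- `h` majorizes `u⁴` plus the norm of its gradient, the right hand side of the embedding for `u⁴`
  set h : Space d → ℝ := fun x => |u x| ^ 3 * (|u x| + 4 * 𝒯.slopeNorm u x) with hh
  have hf2 : MemLp (fun x => |u x| ^ 3) 2 (volume.restrict O) := by
    rw [memLp_two_iff_integrable_sq (by fun_prop)]
    refine (hint 6).congr (ae_of_all _ fun x => ?_)
    simp only
    ring
  have hu2 : MemLp (fun x => |u x|) 2 (volume.restrict O) := by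
    rw [memLp_two_iff_integrable_sq (by fun_prop)]
    exact hint 2
  have hG : MemLp (𝒯.slopeNorm u) 2 (volume.restrict O) :=
    (memLp_two_iff_integrable_sq hmG.aestronglyMeasurable).2 hG2
  have hg2 : MemLp (fun x => |u x| + 4 * 𝒯.slopeNorm u x) 2 (volume.restrict O) :=
    hu2.add (hG.const_mul 4)
  have hhint : Integrable h (volume.restrict O) := hf2.integrable_mul hg2
  have hh0 : ∀ x, 0 ≤ h x := fun x =>
    mul_nonneg (by positivity) (add_nonneg (abs_nonneg _)
      (mul_nonneg (by norm_num) (𝒯.slopeNorm_nonneg u x)))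
  -- Cauchy-Schwarz inequality for the product `|u|³ · (|u| + 4 |∇u|)`
  have hcs : ∫ x in O, h x ≤ √I * √(32 * S) := by
    refine (integral_mul_le_sqrt_mul_sqrt (fun x => by simp)
      (fun x => by
        have := 𝒯.slopeNorm_nonneg u x
        simp only [Pi.zero_apply]; positivity) hf2 hg2).trans ?_
    have h1 : ∫ x in O, (|u x| ^ 3) ^ 2 = I := by
      rw [hI]
      refine integral_congr_ae (ae_of_all _ fun x => ?_)
      simp only
      ring
    have h2 : ∫ x in O, (|u x| + 4 * 𝒯.slopeNorm u x) ^ 2 ≤ 32 * S := by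
      rw [hS, ← integral_slopeNorm_sq hO 𝒯 hu]
      have hu2' : IntegrableOn (fun x => u x ^ 2) O := by simpa using hint 2
      rw [← integral_add hu2' hG2, ← integral_const_mul]
      refine integral_mono hg2.integrable_sq ((hu2'.add hG2).const_mul 32) fun x => ?_
      have := sq_abs (u x)
      simp only
      nlinarith [sq_nonneg (|u x| - 4 * 𝒯.slopeNorm u x), sq_nonneg (u x)]
    rw [h1]
    exact mul_le_mul_of_nonneg_left (Real.sqrt_le_sqrt h2) (Real.sqrt_nonneg _)
  -- the embedding bounds the `L^q` norm of `u⁴`; as `q ≥ 3/2`, it bounds the `L^{3/2}` norm, a power of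
  -- the integral of `u⁶`
  have hmain : I ^ (2 / 3 : ℝ) ≤ c * ∫ x in O, h x := by
    have h1 := hC _ _ (by fun_prop) (by fun_prop) (lineControlled_pow hO 𝒯 hu)
    have h2 : ∫⁻ x in O, ENNReal.ofReal (u x ^ 4)
        + ENNReal.ofReal (4 * |u x| ^ 3 * 𝒯.slopeNorm u x) = ENNReal.ofReal (∫ x in O, h x) := by
      rw [ofReal_integral_eq_lintegral_ofReal hhint (ae_of_all _ hh0)]
      refine lintegral_congr fun x => ?_
      have := 𝒯.slopeNorm_nonneg u x
      rw [← ENNReal.ofReal_add (by positivity) (by positivity), hh]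
      congr 1
      have h4 : u x ^ 4 = |u x| ^ 4 := by rw [← abs_pow, abs_of_nonneg (by positivity)]
      rw [h4]
      ring
    rw [h2] at h1
    have h3 := eLpNorm'_le_eLpNorm'_mul_rpow_measure_univ (μ := volume.restrict O)
      (f := fun x => u x ^ 4) (p := 3 / 2) (q := q) (by norm_num) hq32 (by fun_prop)
    rw [Measure.restrict_apply_univ, eLpNorm'_eq_lintegral_enorm,
      eLpNorm'_eq_lintegral_enorm] at h3
    have h4 : ∫⁻ x in O, ‖u x ^ 4‖ₑ ^ (3 / 2 : ℝ) = ENNReal.ofReal I := by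
      rw [hI, ofReal_integral_eq_lintegral_ofReal (hint 6) (ae_of_all _ fun x => by positivity)]
      refine lintegral_congr fun x => ?_
      rw [Real.enorm_eq_ofReal (by positivity),
        ENNReal.ofReal_rpow_of_nonneg (by positivity) (by norm_num)]
      congr 1
      have h4 : u x ^ 4 = |u x| ^ (4 : ℝ) := by
        rw [Real.rpow_ofNat, ← abs_pow, abs_of_nonneg (by positivity : (0 : ℝ) ≤ u x ^ 4)]
      rw [h4, ← Real.rpow_mul (abs_nonneg _), ← Real.rpow_natCast]
      norm_num
    have h5 : ∫⁻ x in O, ‖u x ^ 4‖ₑ ^ q = ∫⁻ x in O, ENNReal.ofReal (u x ^ 4) ^ q :=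
      lintegral_congr fun x => by rw [Real.enorm_eq_ofReal (by positivity)]
    rw [h4, h5] at h3
    have h6 : (∫⁻ x in O, ENNReal.ofReal (u x ^ 4) ^ q) ^ (1 / q)
        ≤ (C : ℝ≥0∞) ^ (1 / q) * ENNReal.ofReal (∫ x in O, h x) := by
      refine (ENNReal.rpow_le_rpow h1 (by positivity)).trans (le_of_eq ?_)
      rw [ENNReal.mul_rpow_of_nonneg _ _ (by positivity), ← ENNReal.rpow_mul,
        mul_one_div_cancel hq0.ne', ENNReal.rpow_one]
    have h7 : ENNReal.ofReal (I ^ (2 / 3 : ℝ)) ≤ ENNReal.ofReal (c * ∫ x in O, h x) := by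
      rw [← ENNReal.ofReal_rpow_of_nonneg hI0 (by norm_num), ENNReal.ofReal_mul
        ENNReal.toReal_nonneg, ENNReal.ofReal_toReal hcfin]
      calc ENNReal.ofReal I ^ (2 / 3 : ℝ) = ENNReal.ofReal I ^ (1 / (3 / 2) : ℝ) := by norm_num
        _ ≤ _ := h3
        _ ≤ (C : ℝ≥0∞) ^ (1 / q) * ENNReal.ofReal (∫ x in O, h x)
              * volume O ^ (1 / (3 / 2 : ℝ) - 1 / q) := mul_le_mul_left h6 _
        _ = _ := by ring
    exact (ENNReal.ofReal_le_ofReal_iff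
      (mul_nonneg ENNReal.toReal_nonneg (integral_nonneg hh0))).1 h7
  have hc0 : 0 ≤ c := ENNReal.toReal_nonneg
  have hS0 : 0 ≤ S := add_nonneg (integral_nonneg fun x => by positivity) (by
    rw [← integral_slopeNorm_sq hO 𝒯 hu]
    exact integral_nonneg fun x => by positivity)
  have hI6 : I ≤ (c + 1) ^ 6 * (32 * S) ^ 3 := by
    refine pow_six_bound hI0 (by positivity) (by positivity) (hmain.trans ?_)
    exact (mul_le_mul_of_nonneg_left hcs hc0).trans
      (mul_le_mul_of_nonneg_right (by linarith) (by positivity))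
  have h1 := lumped_abs_pow_le hO 𝒯 hu 6
  have h2 : (fun x => |u x| ^ 6) = fun x => u x ^ 6 := by
    funext x
    rw [← abs_pow, abs_of_nonneg (by positivity)]
  rw [h2] at h1
  have h3 : S ≤ lumped 𝒯 (fun x => u x ^ 2) + dirichletForm O u u :=
    add_le_add (integral_sq_le_lumped hO 𝒯 hu) le_rfl
  calc lumped 𝒯 (fun x => u x ^ 6) ≤ 2 ^ 6 * 4 ^ d * I := h1.trans_eq (by rw [hI, h2])
    _ ≤ 2 ^ 6 * 4 ^ d * ((c + 1) ^ 6 * (32 * S) ^ 3) := by gcongr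
    _ ≤ 2 ^ 6 * 4 ^ d * ((c + 1) ^ 6
          * (32 * (lumped 𝒯 (fun x => u x ^ 2) + dirichletForm O u u)) ^ 3) := by gcongr
    _ = _ := by ring

end Triangulation

/-! ### Lipschitz bounds for coefficient functions and their interpolants -/

/-- The mollification of a function with bounded weak gradient is Lipschitz continuous in points
whose distance to the boundary exceeds the radius of the mollifier. -/
theorem exists_hasFDerivAt_mollification {d : ℕ} {O : Set (Space d)}
    (hO : IsConvexPolyhedralDomain O) {g : Space d → ℝ} (hg : ContinuousOn g (closure O))
    {G : Space d → Space d} (hG : HasWeakGradient O g G) {K : ℝ} (hK : 0 ≤ K)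
    (hGK : ∀ᵐ x ∂(volume.restrict O), ‖G x‖ ≤ K) (φ : ContDiffBump (0 : Space d))
    {x : Space d} (hx : Metric.closedBall x φ.rOut ⊆ O) :
    ∃ L : Space d →L[ℝ] ℝ, ‖L‖ ≤ K ∧
      HasFDerivAt (fun y => ∫ z in O, φ.normed volume (y - z) * g z) L x := by
  set f := φ.normed (volume : Measure (Space d)) with hf
  have hint : IntegrableOn g O :=
    (hg.integrableOn_compact hO.isCompact_closure).mono_set subset_closure
  have hloc : LocallyIntegrable (O.indicator g) volume :=
    ((integrable_indicator_iff hO.isOpen.measurableSet).2 hint).locallyIntegrable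
  have hfc : ContDiff ℝ ((⊤ : ℕ∞) : WithTop ℕ∞) f := φ.contDiff_normed
  have hf1 : ContDiff ℝ 1 f := φ.contDiff_normed (n := 1)
  have hcs : HasCompactSupport f := φ.hasCompactSupport_normed
  have hder := hcs.hasFDerivAt_convolution_right (ContinuousLinearMap.lsmul ℝ ℝ) hloc hf1 x
  have heq : (MeasureTheory.convolution (O.indicator g) f (ContinuousLinearMap.lsmul ℝ ℝ) volume)
      = fun y => ∫ z in O, f (y - z) * g z := by
    funext y
    rw [convolution_def, ← integral_indicator hO.isOpen.measurableSet]
    refine integral_congr_ae (ae_of_all _ fun z => ?_)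
    by_cases hz : z ∈ O
    · simp [indicator_of_mem hz, mul_comm]
    · simp [indicator_of_notMem hz]
  rw [heq] at hder
  refine ⟨_, ?_, hder⟩
  refine ContinuousLinearMap.opNorm_le_bound _ hK fun b => ?_
  rw [convolution_precompR_apply (ContinuousLinearMap.lsmul ℝ ℝ) hloc (hcs.fderiv ℝ)
    (hf1.continuous_fderiv one_ne_zero)]
  set ψ : Space d → ℝ := fun z => f (x - z) with hψ
  have hψc : ContDiff ℝ ((⊤ : ℕ∞) : WithTop ℕ∞) ψ := hfc.comp (contDiff_const.sub contDiff_id)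
  have hsupp : tsupport ψ ⊆ Metric.closedBall x φ.rOut := by
    refine closure_minimal (fun z hz => ?_) Metric.isClosed_closedBall
    have h1 : x - z ∈ Function.support f := hz
    rw [hf, φ.support_normed_eq, mem_ball_zero_iff] at h1
    rw [mem_closedBall_iff_norm, norm_sub_rev]
    exact h1.le
  have hψcs : HasCompactSupport ψ :=
    (isCompact_closedBall x φ.rOut).of_isClosed_subset (isClosed_tsupport _) hsupp
  have hweak := hG.integral_eq ψ hψc hψcs (hsupp.trans hx)
  have hfd : ∀ z, inner ℝ b (gradient ψ z) = - fderiv ℝ f (x - z) b := by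
    intro z
    have h1 : HasFDerivAt ψ ((fderiv ℝ f (x - z)).comp (-ContinuousLinearMap.id ℝ (Space d))) z :=
      (hf1.differentiable one_ne_zero (x - z)).hasFDerivAt.comp z
        (by simpa using (hasFDerivAt_id z).const_sub x)
    rw [gradient, h1.fderiv, real_inner_comm, InnerProductSpace.toDual_symm_apply]
    simp
  have hgrad : Continuous (gradient ψ) :=
    (InnerProductSpace.toDual ℝ (Space d)).symm.continuous.comp
      (hψc.continuous_fderiv (by simp))
  have hint2 : IntegrableOn (fun z => g z • gradient ψ z) O :=
    ((hg.smul hgrad.continuousOn).integrableOn_compact hO.isCompact_closure).mono_set subset_closure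
  have h1 : MeasureTheory.convolution (O.indicator g) (fun a => fderiv ℝ f a b)
      (ContinuousLinearMap.lsmul ℝ ℝ) volume x = inner ℝ b (∫ z in O, ψ z • G z) := by
    have h2 : inner ℝ b (∫ z in O, ψ z • G z) = - inner ℝ b (∫ z in O, g z • gradient ψ z) := by
      rw [hweak, inner_neg_right, neg_neg]
    rw [h2, ← integral_inner hint2, ← integral_neg, convolution_def,
      ← integral_indicator hO.isOpen.measurableSet]
    refine integral_congr_ae (ae_of_all _ fun z => ?_)
    by_cases hz : z ∈ O
    · simp [indicator_of_mem hz, inner_smul_right, hfd]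
    · simp [indicator_of_notMem hz]
  rw [h1]
  refine (norm_inner_le_norm b _).trans ?_
  rw [mul_comm]
  refine mul_le_mul_of_nonneg_right ?_ (norm_nonneg _)
  have hψint : Integrable ψ volume := φ.integrable_normed.comp_sub_left x
  have hψ0 : ∀ z, 0 ≤ ψ z := fun z => φ.nonneg_normed _
  have h3 : ‖∫ z in O, ψ z • G z‖ ≤ ∫ z in O, ψ z * K := by
    refine norm_integral_le_of_norm_le (hψint.integrableOn.mul_const K) ?_
    filter_upwards [hGK] with z hz
    rw [norm_smul, Real.norm_of_nonneg (hψ0 z)]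
    exact mul_le_mul_of_nonneg_left hz (hψ0 z)
  refine h3.trans ?_
  rw [integral_mul_const]
  have h4 : ∫ z in O, ψ z ≤ 1 := by
    refine (setIntegral_le_integral hψint (ae_of_all _ hψ0)).trans (le_of_eq ?_)
    rw [hψ, integral_sub_left_eq_self f volume x]
    exact φ.integral_normed
  nlinarith

/-- Mollifications with radius small against the distance of the segment `[x, y]` from the boundary are
Lipschitz continuous along it; they converge to `g` at both endpoints as the radius tends to zero. -/
theorem abs_sub_le_of_weakGradient {d : ℕ} {O : Set (Space d)}
    (hO : IsConvexPolyhedralDomain O) {g : Space d → ℝ} (hg : ContinuousOn g (closure O))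
    {G : Space d → Space d} (hG : HasWeakGradient O g G) {K : ℝ} (hK : 0 ≤ K)
    (hGK : ∀ᵐ x ∂(volume.restrict O), ‖G x‖ ≤ K) {x y : Space d} (hx : x ∈ O) (hy : y ∈ O) :
    |g y - g x| ≤ K * ‖y - x‖ := by
  refine le_of_forall_pos_le_add fun ε hε => ?_
  have hsub : segment ℝ x y ⊆ O := hO.convex.segment_subset hx hy
  have hcomp : IsCompact (segment ℝ x y) := by
    rw [segment_eq_image_lineMap]
    exact isCompact_Icc.image (AffineMap.lineMap_continuous)
  obtain ⟨r₁, hr₁, hthick⟩ := hcomp.exists_cthickening_subset_open hO.isOpen hsub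
  have hcx : ∀ z ∈ O, ∃ r > 0, ∀ w ∈ Metric.ball z r, dist (g w) (g z) ≤ ε / 2 := by
    intro z hz
    have h1 : ContinuousAt g z :=
      hg.continuousAt (mem_of_superset (hO.isOpen.mem_nhds hz) subset_closure)
    obtain ⟨r, hr, h⟩ := Metric.continuousAt_iff.1 h1 (ε / 2) (by positivity)
    exact ⟨r, hr, fun w hw => (h hw).le⟩
  obtain ⟨r₂, hr₂, h₂⟩ := hcx x hx
  obtain ⟨r₃, hr₃, h₃⟩ := hcx y hy
  set r := min r₁ (min r₂ r₃) with hr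
  have hr0 : 0 < r := lt_min hr₁ (lt_min hr₂ hr₃)
  let φ : ContDiffBump (0 : Space d) := ⟨r / 2, r, by positivity, by linarith⟩
  set F : Space d → ℝ := fun y => ∫ z in O, φ.normed volume (y - z) * g z with hF
  have hball : ∀ z ∈ segment ℝ x y, Metric.closedBall z φ.rOut ⊆ O := by
    intro z hz
    refine (Metric.closedBall_subset_cthickening hz _).trans
      ((Metric.cthickening_mono ?_ _).trans hthick)
    exact min_le_left _ _
  have hlip : |F y - F x| ≤ K * ‖y - x‖ := by
    choose! L hL hL' using fun z (hz : z ∈ segment ℝ x y) =>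
      exists_hasFDerivAt_mollification hO hg hG hK hGK φ (hball z hz)
    exact (convex_segment x y).norm_image_sub_le_of_norm_hasFDerivWithin_le
      (fun z hz => (hL' z hz).hasFDerivWithinAt) hL (left_mem_segment ℝ x y)
      (right_mem_segment ℝ x y)
  have hint : IntegrableOn g O :=
    (hg.integrableOn_compact hO.isCompact_closure).mono_set subset_closure
  have hclose : ∀ z ∈ segment ℝ x y, (∀ w ∈ Metric.ball z r, dist (g w) (g z) ≤ ε / 2) →
      |F z - g z| ≤ ε / 2 := by
    intro z hz hw
    have h1 := φ.dist_normed_convolution_le (μ := volume) (g := O.indicator g) (x₀ := z)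
      (ε := ε / 2)
      ((integrable_indicator_iff hO.isOpen.measurableSet).2 hint).aestronglyMeasurable
      (fun w hw' => by
        rw [indicator_of_mem (hsub hz),
          indicator_of_mem (hball z hz (Metric.ball_subset_closedBall hw'))]
        exact hw w hw')
    rw [indicator_of_mem (hsub hz), convolution_lsmul_swap] at h1
    have h2 : ∫ t, φ.normed volume (z - t) • O.indicator g t = F z := by
      change _ = ∫ t in O, φ.normed volume (z - t) * g t
      rw [← integral_indicator hO.isOpen.measurableSet]
      refine integral_congr_ae (ae_of_all _ fun t => ?_)
      by_cases ht : t ∈ O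
      · simp [indicator_of_mem ht]
      · simp [indicator_of_notMem ht]
    rwa [h2, Real.dist_eq] at h1
  have h4 := hclose x (left_mem_segment ℝ x y) fun w hw => h₂ w
    (Metric.ball_subset_ball ((min_le_right _ _).trans (min_le_left _ _)) hw)
  have h5 := hclose y (right_mem_segment ℝ x y) fun w hw => h₃ w
    (Metric.ball_subset_ball ((min_le_right _ _).trans (min_le_right _ _)) hw)
  rw [abs_le] at *
  constructor <;> linarith [h4.1, h4.2, h5.1, h5.2, hlip.1, hlip.2]

/-- A continuous function of class `W^{1,∞}` on a convex domain is bounded by its norm, and Lipschitz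
continuous with its norm as Lipschitz constant. -/
theorem bound_of_w1infNorm {d : ℕ} {O : Set (Space d)} (hO : IsConvexPolyhedralDomain O)
    {g : Space d → ℝ} (hg : ContinuousOn g (closure O)) (hfin : w1infNorm O g ≠ ∞) :
    (∀ x ∈ closure O, |g x| ≤ (w1infNorm O g).toReal) ∧
      ∀ x ∈ closure O, ∀ y ∈ closure O, |g y - g x| ≤ (w1infNorm O g).toReal * ‖y - x‖ := by
  set W := (w1infNorm O g).toReal with hW
  have h1 : eLpNorm g ∞ (volume.restrict O) ≤ w1infNorm O g := le_self_add
  have hsup : ∀ᵐ x ∂(volume.restrict O), |g x| ≤ W := by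
    filter_upwards [ae_le_eLpNormEssSup (f := g) (μ := volume.restrict O)] with x hx
    rw [← eLpNorm_exponent_top] at hx
    have h2 := (ENNReal.toReal_le_toReal enorm_ne_top hfin).2 (hx.trans h1)
    simpa using h2
  have hlip : ∀ x ∈ O, ∀ y ∈ O, |g y - g x| ≤ W * ‖y - x‖ := by
    intro x hx y hy
    have key : ∀ ε > 0, |g y - g x| ≤ (W + ε) * ‖y - x‖ := by
      intro ε hε
      have h3 : (⨅ (G : Space d → Space d) (_ : HasWeakGradient O g G),
          eLpNorm G ∞ (volume.restrict O)) < ENNReal.ofReal (W + ε) := by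
        refine lt_of_le_of_lt (b := w1infNorm O g) le_add_self ?_
        rw [← ENNReal.ofReal_toReal hfin]
        exact (ENNReal.ofReal_lt_ofReal_iff (by positivity)).2 (by linarith)
      obtain ⟨G, h4⟩ := iInf_lt_iff.1 h3
      obtain ⟨hG, h5⟩ := iInf_lt_iff.1 h4
      refine abs_sub_le_of_weakGradient hO hg hG (by positivity) ?_ hx hy
      filter_upwards [ae_le_eLpNormEssSup (f := G) (μ := volume.restrict O)] with z hz
      rw [← eLpNorm_exponent_top] at hz
      have h6 := (ENNReal.toReal_le_toReal enorm_ne_top ENNReal.ofReal_ne_top).2 (hz.trans h5.le)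
      rwa [toReal_enorm, ENNReal.toReal_ofReal (by positivity)] at h6
    have hcont : Tendsto (fun ε : ℝ => (W + ε) * ‖y - x‖) (𝓝[>] 0) (𝓝 ((W + 0) * ‖y - x‖)) :=
      ((continuous_const.add continuous_id).mul continuous_const).continuousAt.tendsto.mono_left
        nhdsWithin_le_nhds
    rw [add_zero] at hcont
    exact ge_of_tendsto hcont (by filter_upwards [self_mem_nhdsWithin] with ε hε using key ε hε)
  have hsup' : ∀ x ∈ O, |g x| ≤ W := by
    intro x hx
    by_contra hcon
    have hopen : IsOpen (O ∩ {z | W < |g z|}) :=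
      (hg.mono subset_closure).abs.isOpen_inter_preimage hO.isOpen isOpen_Ioi
    have hpos := hopen.measure_pos volume ⟨x, hx, not_le.1 hcon⟩
    have h0 : volume (O ∩ {z | W < |g z|}) = 0 := by
      rw [ae_restrict_iff' hO.isOpen.measurableSet] at hsup
      refine measure_mono_null (fun z hz => ?_) (ae_iff.1 hsup)
      simp only [mem_ofPred_eq, not_forall, not_le]
      exact ⟨hz.1, hz.2⟩
    exact hpos.ne' h0
  constructor
  · intro x hx
    exact le_on_closure (f := fun x => |g x|) (g := fun _ => W) hsup' hg.abs continuousOn_const hx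
  · intro x hx y hy
    have h2 : ∀ y ∈ O, ∀ x ∈ closure O, |g y - g x| ≤ W * ‖y - x‖ := fun y hy x hx =>
      le_on_closure (f := fun x => |g y - g x|) (g := fun x => W * ‖y - x‖)
        (fun x hx => hlip x hx y hy) (continuousOn_const.sub hg).abs (by fun_prop) hx
    exact le_on_closure (f := fun y => |g y - g x|) (g := fun y => W * ‖y - x‖)
      (fun y hy => h2 y hy x hx) (hg.sub continuousOn_const).abs (by fun_prop) hy

namespace Triangulation

variable {d : ℕ} {O : Set (Space d)}

/-- The gradient of an interpolant on a cell which contains a ball of radius `R` is controlled by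
the oscillation of the vertex values. -/
theorem norm_slope_interp_le (𝒯 : Triangulation O) {s : Finset (Space d)} (hs : s ∈ 𝒯.cells)
    {c : Space d} {R : ℝ} (hR : 0 < R) (hball : Metric.ball c R ⊆ cell s) {a : Space d → ℝ} {ε : ℝ}
    (hosc : ∀ v ∈ s, ∀ w ∈ s, |a v - a w| ≤ ε) :
    ‖slope s (𝒯.interp a)‖ ≤ 2 * ε / R := by
  have hmem := 𝒯.interp_mem a
  have hval : ∀ v ∈ s, 𝒯.interp a v = a v := fun v hv =>
    𝒯.interp_apply a (𝒯.mem_vertices.2 ⟨s, hs, hv⟩)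
  have hosc2 : ∀ x ∈ cell s, ∀ y ∈ cell s, 𝒯.interp a x - 𝒯.interp a y ≤ ε := by
    intro x hx y hy
    have h1 : ∀ w ∈ s, 𝒯.interp a x - ε ≤ 𝒯.interp a w := by
      intro w hw
      have h2 : 𝒯.interp a x ≤ 𝒯.interp a w + ε := 𝒯.le_of_vertex_le hs hmem (fun v hv => by
        rw [hval v hv, hval w hw]
        linarith [(abs_le.1 (hosc v hv w hw)).2]) hx
      linarith
    linarith [𝒯.le_of_forall_vertex hs hmem h1 hy]
  set p := slope s (𝒯.interp a) with hp
  rcases eq_or_ne p 0 with h0 | h0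
  · obtain ⟨v, hv⟩ := 𝒯.cell_vertices_nonempty hs
    have : 0 ≤ ε := (abs_nonneg _).trans (hosc v hv v hv)
    rw [h0, norm_zero]
    positivity
  · have hn : 0 < ‖p‖ := norm_pos_iff.2 h0
    have hc : c ∈ cell s := hball (Metric.mem_ball_self hR)
    have hx : c + (R / 2 / ‖p‖) • p ∈ cell s := by
      refine hball ?_
      rw [mem_ball_iff_norm, add_sub_cancel_left, norm_smul, Real.norm_of_nonneg (by positivity),
        div_mul_cancel₀ _ hn.ne']
      linarith
    have h1 := hosc2 _ hx c hc
    rw [𝒯.sub_eq_inner_slope hs hmem hc hx, add_sub_cancel_left, inner_smul_right, ← hp,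
      real_inner_self_eq_norm_sq] at h1
    rw [le_div_iff₀ hR]
    have h2 : R / 2 / ‖p‖ * ‖p‖ ^ 2 = R / 2 * ‖p‖ := by field_simp
    linarith

end Triangulation

/-- The gradient of the interpolant of `σ(ζ) g` on a cell.  Vertex values oscillate by `O(h)` on a cell,
which by quasi-uniformity contains a ball of radius comparable to `h`. -/
theorem exists_norm_slope_coefficient_le {d : ℕ} {O : Set (Space d)}
    {𝒯 : ℝ → Triangulation O} (h𝒯 : QuasiUniform 𝒯) {σ : ℝ → ℝ} (hσ : IsNoiseCoefficient σ) :
    ∃ C > 0, ∀ h ∈ Ioc (0 : ℝ) 1, ∀ s ∈ (𝒯 h).cells, ∀ ζ ∈ (𝒯 h).femSpace, ∀ (g : Space d → ℝ)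
      (W : ℝ), (∀ v ∈ s, |g v| ≤ W) →
      (∀ v ∈ s, ∀ w ∈ s, |g v - g w| ≤ W * ‖v - w‖) →
      ‖Triangulation.slope s ((𝒯 h).interp fun x => σ (ζ x) * g x)‖
        ≤ C * W * (1 + ‖Triangulation.slope s ζ‖) := by
  obtain ⟨ρ, hρ, hq⟩ := h𝒯
  obtain ⟨M, hM⟩ := hσ.bounded
  obtain ⟨K, hK⟩ := hσ.lipschitz
  have hM0 : 0 ≤ M := (abs_nonneg _).trans (hM 0)
  refine ⟨2 * (M + K + 1) / ρ, by positivity, fun h hh s hs ζ hζ g W hW hL => ?_⟩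
  obtain ⟨hdiam, c, hball⟩ := hq h hh s hs
  have hh0 : 0 < h := hh.1
  have hW0 : 0 ≤ W := by
    obtain ⟨v, hv⟩ := (𝒯 h).cell_vertices_nonempty hs
    exact (abs_nonneg _).trans (hW v hv)
  have key := (𝒯 h).norm_slope_interp_le hs (by positivity : 0 < ρ * h) hball
    (a := fun x => σ (ζ x) * g x)
    (ε := (M + K + 1) * W * (1 + ‖Triangulation.slope s ζ‖) * h) ?_
  · refine key.trans (le_of_eq ?_)
    field_simp
  · intro v hv w hw
    have hvc := Triangulation.mem_cell_of_mem hv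
    have hwc := Triangulation.mem_cell_of_mem hw
    have hdist : ‖v - w‖ ≤ h := by
      rw [← dist_eq_norm]
      exact (Metric.dist_le_diam_of_mem (isCompact_cell s).isBounded hvc hwc).trans hdiam
    have h1 : |ζ v - ζ w| ≤ ‖Triangulation.slope s ζ‖ * h := by
      rw [(𝒯 h).sub_eq_inner_slope hs hζ hwc hvc]
      exact (abs_real_inner_le_norm _ _).trans
        (mul_le_mul_of_nonneg_left hdist (norm_nonneg _))
    have h2 : |σ (ζ v) - σ (ζ w)| ≤ K * (‖Triangulation.slope s ζ‖ * h) := by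
      have := hK.dist_le_mul (ζ v) (ζ w)
      rw [Real.dist_eq, Real.dist_eq] at this
      exact this.trans (mul_le_mul_of_nonneg_left h1 K.2)
    have h3 : |g v - g w| ≤ W * h :=
      (hL v hv w hw).trans
        (mul_le_mul_of_nonneg_left hdist hW0)
    have h4 : σ (ζ v) * g v - σ (ζ w) * g w
        = (σ (ζ v) - σ (ζ w)) * g v + σ (ζ w) * (g v - g w) := by ring
    rw [h4]
    refine (abs_add_le _ _).trans ?_
    rw [abs_mul, abs_mul]
    have h5 := mul_le_mul h2 (hW v hv) (abs_nonneg _) (by positivity)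
    have h6 := mul_le_mul (hM (ζ w)) h3 (abs_nonneg _) hM0
    have h7 : 0 ≤ ‖Triangulation.slope s ζ‖ := norm_nonneg _
    have hK0 : (0 : ℝ) ≤ K := K.2
    have e1 : 0 ≤ (K + 1) * (W * h) + (M + 1) * W * h * ‖Triangulation.slope s ζ‖ := by positivity
    calc _ ≤ _ := add_le_add h5 h6
      _ ≤ (M + K + 1) * W * (1 + ‖Triangulation.slope s ζ‖) * h := by linear_combination e1


/-! ### Taylor estimates for the potential -/

/-- Second order Taylor expansion, with a remainder controlled by the oscillation of the second
derivative. -/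
theorem abs_taylor_two_le {F : ℝ → ℝ} (hF : ContDiff ℝ 2 F) {x y c B : ℝ}
    (hB : ∀ z, |z - x| ≤ |y| → |iteratedDeriv 2 F z - c| ≤ B) :
    |F (x + y) - F x - deriv F x * y - c / 2 * y ^ 2| ≤ B * y ^ 2 := by
  have h2 : iteratedDeriv 2 F = deriv (deriv F) := by
    rw [iteratedDeriv_succ, iteratedDeriv_one]
  rw [h2] at hB
  have hd1 : Differentiable ℝ F := hF.differentiable (by norm_num)
  have hd2 : Differentiable ℝ (deriv F) := by
    simpa only [iteratedDeriv_one] using hF.differentiable_iteratedDeriv 1 (by norm_num)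
  have hconv : Convex ℝ (Metric.closedBall x |y|) := convex_closedBall x |y|
  have hx : x ∈ Metric.closedBall x |y| := Metric.mem_closedBall_self (abs_nonneg y)
  have hB0 : 0 ≤ B := (abs_nonneg _).trans (hB x (by simp))
  have hg1 : ∀ z ∈ Metric.closedBall x |y|, ‖deriv F z - deriv F x - c * (z - x)‖ ≤ B * |y| := by
    intro z hz
    have h3 := hconv.norm_image_sub_le_of_norm_hasDerivWithin_le
      (f := fun z => deriv F z - deriv F x - c * (z - x))
      (f' := fun z => deriv (deriv F) z - c) (C := B)
      (fun w _ => by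
        have := (((hd2 w).hasDerivAt.sub_const (deriv F x)).fun_sub
          (((hasDerivAt_id w).sub_const x).const_mul c)).hasDerivWithinAt
            (s := Metric.closedBall x |y|)
        simpa using this)
      (fun w hw => hB w (by simpa [Real.dist_eq] using hw)) hx hz
    have hz' : |z - x| ≤ |y| := by simpa [Real.dist_eq] using hz
    simp only [sub_self, mul_zero, sub_zero] at h3
    exact h3.trans (mul_le_mul_of_nonneg_left hz' hB0)
  have h4 := hconv.norm_image_sub_le_of_norm_hasDerivWithin_le
    (f := fun z => F z - F x - deriv F x * (z - x) - c / 2 * (z - x) ^ 2)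
    (f' := fun z => deriv F z - deriv F x - c * (z - x)) (C := B * |y|)
    (fun w _ => by
      have h5 := ((((hd1 w).hasDerivAt.sub_const (F x)).sub
        (((hasDerivAt_id w).sub_const x).const_mul (deriv F x))).sub
        ((((hasDerivAt_id w).sub_const x).fun_pow 2).const_mul (c / 2))).hasDerivWithinAt
            (s := Metric.closedBall x |y|)
      convert! h5 using 1
      simp only [id]
      ring)
    hg1 hx (y := x + y) (by simp)
  simp only [sub_self, mul_zero, add_sub_cancel_left, Real.norm_eq_abs] at h4
  calc _ ≤ _ := by simpa using h4
    _ = B * y ^ 2 := by rw [mul_assoc, ← sq, sq_abs]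

/-- The consequences of the assumptions on the potential that enter the estimates. -/
structure PotentialBounds (F : ℝ → ℝ) (ν K : ℝ) : Prop where
  one_le : 1 ≤ K
  deriv_le : ∀ x, |deriv F x| ≤ K * (1 + |x|) ^ 3
  deriv_two_le : ∀ x, |iteratedDeriv 2 F x| ≤ K * (1 + |x|) ^ 2
  lower : ∀ x, (1 + |x|) ^ 4 ≤ K * F x
  upper : ∀ x, F x ≤ K * (1 + |x|) ^ 4
  taylor_zero : ∀ x y, |F (x + y) - F x| ≤ K * ((1 + |x| + |y|) ^ 3 * |y|)
  taylor_one : ∀ x y, |F (x + y) - F x - deriv F x * y| ≤ K * ((1 + |x| + |y|) ^ 2 * y ^ 2)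
  taylor_two : ∀ x y, |F (x + y) - F x - deriv F x * y - iteratedDeriv 2 F x / 2 * y ^ 2|
    ≤ K * (|y| ^ ν * y ^ 2 + (1 + |x| + |y|) ^ 2 * |y| ^ 3)

/-- The second derivative of the potential: the part `F₁` is Hölder continuous, and the part `F₂` is
locally Lipschitz continuous with a constant of quadratic growth. -/
theorem IsPotential.exists_holder {F : ℝ → ℝ} {ν : ℝ} (hF : IsPotential F ν) :
    ∃ K ≥ 0, ∀ x y z, |z - x| ≤ |y| → |iteratedDeriv 2 F z - iteratedDeriv 2 F x|
      ≤ K * (|y| ^ ν + (1 + |x| + |y|) ^ 2 * |y|) := by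
  obtain ⟨F₁, F₂, hsum, h1, ⟨K, hK⟩, h2, C, hC⟩ := hF.decomposition
  have hC0 : 0 ≤ C := by
    have := (abs_nonneg _).trans (hC 0)
    simpa using this
  have hK0 : 0 ≤ K := by
    have := (abs_nonneg _).trans (hK 0 1)
    simpa using this
  have hadd : ∀ x, iteratedDeriv 2 F x = iteratedDeriv 2 F₁ x + iteratedDeriv 2 F₂ x := by
    intro x
    have hFF : F = fun x => F₁ x + F₂ x := funext hsum
    rw [hFF]
    exact iteratedDeriv_fun_add h1.contDiffAt (h2.of_le (by norm_num)).contDiffAt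
  have hd : Differentiable ℝ (iteratedDeriv 2 F₂) :=
    h2.differentiable_iteratedDeriv 2 (by norm_num)
  have h3 : iteratedDeriv 3 F₂ = deriv (iteratedDeriv 2 F₂) := by rw [iteratedDeriv_succ]
  refine ⟨K + C, by positivity, fun x y z hz => ?_⟩
  have h4 : |iteratedDeriv 2 F₂ z - iteratedDeriv 2 F₂ x| ≤ C * (1 + |x| + |y|) ^ 2 * |y| := by
    have h5 := (convex_closedBall x |y|).norm_image_sub_le_of_norm_deriv_le
      (f := iteratedDeriv 2 F₂) (C := C * (1 + |x| + |y|) ^ 2) (fun w _ => hd w)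
      (fun w hw => ?_) (Metric.mem_closedBall_self (abs_nonneg y))
      (y := z) (by simpa [Real.dist_eq] using hz)
    · refine h5.trans ?_
      exact mul_le_mul_of_nonneg_left hz (by positivity)
    · rw [← h3]
      refine (hC w).trans (mul_le_mul_of_nonneg_left ?_ hC0)
      have hw' : |w - x| ≤ |y| := by simpa [Real.dist_eq] using hw
      have hw2 : |w| ≤ |x| + |y| := by
        have := abs_sub_abs_le_abs_sub w x
        linarith
      have := abs_nonneg x
      have := abs_nonneg y
      nlinarith [abs_nonneg w]
  have h6 : |iteratedDeriv 2 F₁ z - iteratedDeriv 2 F₁ x| ≤ K * |y| ^ ν :=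
    (hK z x).trans (mul_le_mul_of_nonneg_left
      (Real.rpow_le_rpow (abs_nonneg _) hz hF.exponent_pos.le) hK0)
  rw [hadd, hadd, add_sub_add_comm]
  refine (abs_add_le _ _).trans ((add_le_add h6 h4).trans ?_)
  have e1 : 0 ≤ C * |y| ^ ν := by positivity
  have e2 : 0 ≤ K * ((1 + |x| + |y|) ^ 2 * |y|) := by positivity
  linear_combination e1 + e2

theorem IsPotential.exists_bounds {F : ℝ → ℝ} {ν : ℝ} (hF : IsPotential F ν) :
    ∃ K, PotentialBounds F ν K := by
  obtain ⟨c, hc, C, hC⟩ := hF.growth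
  obtain ⟨K, hK, hhol⟩ := hF.exists_holder
  have hC0 : 0 ≤ C := by
    have h1 := (abs_nonneg _).trans (hC 0).2.2.1
    simpa using h1
  set M : ℝ := 1 + 8 / c + C + K with hM
  have h8c : 0 < 8 / c := by positivity
  have hM1 : 1 ≤ M := by linarith
  have hCM : C ≤ M := by linarith
  have hKM : K ≤ M := by linarith
  have hcM : 8 / c ≤ M := by linarith
  have hd1 : ∀ x, |deriv F x| ≤ C * (1 + |x|) ^ 3 := fun x => by
    refine (hC x).2.2.1.trans (mul_le_mul_of_nonneg_left ?_ hC0)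
    have := abs_nonneg x
    have e : 0 ≤ 3 * |x| + 3 * |x| ^ 2 := by positivity
    linear_combination e
  have hd2 : ∀ x, |iteratedDeriv 2 F x| ≤ C * (1 + |x|) ^ 2 := fun x => by
    refine (hC x).2.2.2.trans (mul_le_mul_of_nonneg_left ?_ hC0)
    have := abs_nonneg x
    linear_combination 2 * this
  refine ⟨M, hM1, fun x => (hd1 x).trans (by gcongr), fun x => (hd2 x).trans (by gcongr),
    fun x => ?_, fun x => ?_, fun x y => ?_, fun x y => ?_, fun x y => ?_⟩
  · have h1 := (hC x).1
    have h2 : (1 + |x|) ^ 4 ≤ 8 * (1 + |x| ^ 4) := by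
      nlinarith [sq_nonneg (|x| - 1), sq_nonneg (|x| ^ 2 - 1), sq_nonneg (|x| + 1),
        sq_nonneg (|x| ^ 2 - |x|)]
    have h3 : 0 ≤ F x := le_trans (by positivity) h1
    calc (1 + |x|) ^ 4 ≤ 8 * (1 + |x| ^ 4) := h2
      _ = 8 / c * (c * (1 + |x| ^ 4)) := by field_simp
      _ ≤ 8 / c * F x := by gcongr
      _ ≤ M * F x := by gcongr
  · refine (hC x).2.1.trans ?_
    have : 1 + |x| ^ 4 ≤ (1 + |x|) ^ 4 := by
      have e : 0 ≤ 4 * |x| + 6 * |x| ^ 2 + 4 * |x| ^ 3 := by positivity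
      linear_combination e
    calc C * (1 + |x| ^ 4) ≤ C * (1 + |x|) ^ 4 := by gcongr
      _ ≤ _ := by gcongr
  · have hdiff : Differentiable ℝ F := hF.contDiff.differentiable (by norm_num)
    have h5 := (convex_closedBall x |y|).norm_image_sub_le_of_norm_deriv_le
      (f := F) (C := C * (1 + |x| + |y|) ^ 3) (fun w _ => hdiff w)
      (fun w hw => ?_) (Metric.mem_closedBall_self (abs_nonneg y))
      (y := x + y) (by simp)
    · simp only [Real.norm_eq_abs, add_sub_cancel_left] at h5
      refine h5.trans ?_
      rw [mul_assoc]
      gcongr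
    · refine (hd1 w).trans ?_
      have hw' : |w - x| ≤ |y| := by simpa [Real.dist_eq] using hw
      have hw2 : |w| ≤ |x| + |y| := by
        have := abs_sub_abs_le_abs_sub w x
        linarith
      have : 1 + |w| ≤ 1 + |x| + |y| := by linarith
      gcongr
  · have h6 := abs_taylor_two_le hF.contDiff (x := x) (y := y) (c := 0)
      (B := C * (1 + |x| + |y|) ^ 2) (fun z hz => ?_)
    · simp only [zero_div, zero_mul, sub_zero] at h6
      refine h6.trans ?_
      rw [mul_assoc]
      gcongr
    · rw [sub_zero]
      refine (hd2 z).trans ?_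
      have hw2 : |z| ≤ |x| + |y| := by
        have := abs_sub_abs_le_abs_sub z x
        linarith
      have : 1 + |z| ≤ 1 + |x| + |y| := by linarith
      gcongr
  · have h6 := abs_taylor_two_le hF.contDiff (x := x) (y := y) (c := iteratedDeriv 2 F x)
      (hhol x y)
    refine h6.trans ?_
    have h7 : |y| ^ 3 = |y| * y ^ 2 := by rw [← sq_abs y]; ring
    rw [mul_assoc, add_mul, h7, mul_assoc]
    gcongr

/-! ### Calculus of lumped integrals -/

namespace Triangulation

variable {d : ℕ} {O : Set (Space d)}

theorem lumped_mono (hO : IsConvexPolyhedralDomain O) (𝒯 : Triangulation O)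
    {a b : Space d → ℝ} (h : ∀ v, a v ≤ b v) : lumped 𝒯 a ≤ lumped 𝒯 b := by
  rw [lumped_eq_sum hO, lumped_eq_sum hO]
  exact Finset.sum_le_sum fun v _ => mul_le_mul_of_nonneg_left (h v) (𝒯.nodeWeight_nonneg v)

theorem lumped_nonneg (hO : IsConvexPolyhedralDomain O) (𝒯 : Triangulation O)
    {a : Space d → ℝ} (h : ∀ v, 0 ≤ a v) : 0 ≤ lumped 𝒯 a := by
  rw [lumped_eq_sum hO]
  exact Finset.sum_nonneg fun v _ => mul_nonneg (𝒯.nodeWeight_nonneg v) (h v)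

theorem lumped_add (hO : IsConvexPolyhedralDomain O) (𝒯 : Triangulation O)
    (a b : Space d → ℝ) : lumped 𝒯 (fun x => a x + b x) = lumped 𝒯 a + lumped 𝒯 b := by
  simp only [lumped_eq_sum hO, mul_add, Finset.sum_add_distrib]

theorem lumped_sub (hO : IsConvexPolyhedralDomain O) (𝒯 : Triangulation O)
    (a b : Space d → ℝ) : lumped 𝒯 (fun x => a x - b x) = lumped 𝒯 a - lumped 𝒯 b := by
  simp only [lumped_eq_sum hO, mul_sub, Finset.sum_sub_distrib]

theorem lumped_const_mul (hO : IsConvexPolyhedralDomain O) (𝒯 : Triangulation O)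
    (c : ℝ) (a : Space d → ℝ) : lumped 𝒯 (fun x => c * a x) = c * lumped 𝒯 a := by
  simp only [lumped_eq_sum hO, Finset.mul_sum]
  exact Finset.sum_congr rfl fun v _ => by ring

theorem lumped_const (hO : IsConvexPolyhedralDomain O) (𝒯 : Triangulation O)
    (c : ℝ) : lumped 𝒯 (fun _ => c) = c * volume.real O := by
  rw [lumped_eq_sum hO, ← Finset.sum_mul, sum_nodeWeight hO, mul_comm]

theorem abs_lumped_le (hO : IsConvexPolyhedralDomain O) (𝒯 : Triangulation O)
    {a b : Space d → ℝ} (h : ∀ v, |a v| ≤ b v) : |lumped 𝒯 a| ≤ lumped 𝒯 b := by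
  rw [abs_le]
  constructor
  · have h1 := lumped_mono hO 𝒯 (a := fun v => -1 * b v) (b := a)
      (fun v => by linarith [(abs_le.1 (h v)).1])
    rw [lumped_const_mul hO] at h1
    linarith
  · exact lumped_mono hO 𝒯 fun v => (abs_le.1 (h v)).2

/-- The Cauchy–Schwarz inequality for lumped integrals. -/
theorem lumped_mul_sq_le (hO : IsConvexPolyhedralDomain O) (𝒯 : Triangulation O)
    {a f g : Space d → ℝ} (hf : ∀ v, 0 ≤ f v) (hg : ∀ v, 0 ≤ g v) (h : ∀ v, a v ^ 2 ≤ f v * g v) :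
    lumped 𝒯 a ^ 2 ≤ lumped 𝒯 f * lumped 𝒯 g := by
  simp only [lumped_eq_sum hO]
  refine Finset.sum_sq_le_sum_mul_sum_of_sq_le_mul _
    (fun v _ => mul_nonneg (𝒯.nodeWeight_nonneg v) (hf v))
    (fun v _ => mul_nonneg (𝒯.nodeWeight_nonneg v) (hg v)) fun v _ => ?_
  have h1 := mul_le_mul_of_nonneg_left (h v) (sq_nonneg (𝒯.nodeWeight v))
  calc _ = 𝒯.nodeWeight v ^ 2 * a v ^ 2 := by ring
    _ ≤ _ := h1
    _ = _ := by ring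

/-- Hölder's inequality with the exponents `3/2` and `3`. -/
theorem lumped_holder (hO : IsConvexPolyhedralDomain O) (𝒯 : Triangulation O)
    (y w : Space d → ℝ) :
    lumped 𝒯 (fun x => y x ^ 4 * w x ^ 2) ^ 3
      ≤ lumped 𝒯 (fun x => y x ^ 6) ^ 2 * lumped 𝒯 (fun x => w x ^ 6) := by
  set P := lumped 𝒯 (fun x => y x ^ 4 * w x ^ 2) with hP
  set Q := lumped 𝒯 (fun x => y x ^ 2 * w x ^ 4) with hQ
  set Y := lumped 𝒯 (fun x => y x ^ 6) with hY
  set S := lumped 𝒯 (fun x => w x ^ 6) with hS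
  have hP0 : 0 ≤ P := lumped_nonneg hO 𝒯 fun v => by positivity
  have hQ0 : 0 ≤ Q := lumped_nonneg hO 𝒯 fun v => by positivity
  have hY0 : 0 ≤ Y := lumped_nonneg hO 𝒯 fun v => by positivity
  have hS0 : 0 ≤ S := lumped_nonneg hO 𝒯 fun v => by positivity
  -- two Cauchy-Schwarz inequalities, from which `Q` is eliminated
  have h1 : P ^ 2 ≤ Y * Q := lumped_mul_sq_le hO 𝒯 (fun v => by positivity)
    (fun v => by positivity) fun v => le_of_eq (by ring)
  have h2 : Q ^ 2 ≤ P * S := lumped_mul_sq_le hO 𝒯 (fun v => by positivity)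
    (fun v => by positivity) fun v => le_of_eq (by ring)
  rcases hP0.eq_or_lt with h0 | h0
  · calc P ^ 3 = 0 := by rw [← h0]; norm_num
      _ ≤ _ := by positivity
  · refine le_of_mul_le_mul_left (a := P) ?_ h0
    calc P * P ^ 3 = (P ^ 2) ^ 2 := by ring
      _ ≤ (Y * Q) ^ 2 := pow_le_pow_left₀ (by positivity) h1 2
      _ = Y ^ 2 * Q ^ 2 := by ring
      _ ≤ Y ^ 2 * (P * S) := by gcongr
      _ = P * (Y ^ 2 * S) := by ring

theorem lumped_holder_of_le (hO : IsConvexPolyhedralDomain O) (𝒯 : Triangulation O)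
    {y w : Space d → ℝ} {A β : ℝ} (hβ : 0 ≤ β)
    (hy : lumped 𝒯 (fun x => y x ^ 6) ≤ A ^ 3) (hw : lumped 𝒯 (fun x => w x ^ 6) ≤ β ^ 3) :
    lumped 𝒯 (fun x => y x ^ 4 * w x ^ 2) ≤ A ^ 2 * β := by
  have h1 := lumped_holder hO 𝒯 y w
  have hY0 : 0 ≤ lumped 𝒯 (fun x => y x ^ 6) := lumped_nonneg hO 𝒯 fun v => by positivity
  have hS0 : 0 ≤ lumped 𝒯 (fun x => w x ^ 6) := lumped_nonneg hO 𝒯 fun v => by positivity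
  refine le_of_pow_le_pow_left₀ (n := 3) (by norm_num) (by positivity) (h1.trans ?_)
  calc _ ≤ (A ^ 3) ^ 2 * β ^ 3 := by gcongr
    _ = _ := by ring

theorem lumped_sq_le_of_pow_six (hO : IsConvexPolyhedralDomain O) (𝒯 : Triangulation O)
    {w : Space d → ℝ} {β : ℝ} (hβ : 0 ≤ β) (hw : lumped 𝒯 (fun x => w x ^ 6) ≤ β ^ 3) :
    lumped 𝒯 (fun x => w x ^ 2) ≤ (1 + volume.real O) * β ∧
      lumped 𝒯 (fun x => w x ^ 4) ≤ (1 + volume.real O) * β ^ 2 := by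
  have hμ : 0 ≤ volume.real O := measureReal_nonneg
  have h1 : lumped 𝒯 (fun x => w x ^ 2) ≤ (1 + volume.real O) * β := by
    have h2 := lumped_holder_of_le hO 𝒯 (y := fun _ => 1) (w := w) (A := 1 + volume.real O)
      hβ ?_ hw
    · have h3 : lumped 𝒯 (fun x => w x ^ 2) ^ 3 ≤ ((1 + volume.real O) * β) ^ 3 := by
        have h4 := lumped_holder hO 𝒯 (fun _ => 1) w
        simp only [one_pow, one_mul] at h4
        rw [lumped_const hO, one_mul] at h4
        refine h4.trans ?_
        rw [mul_pow]
        have h5 : volume.real O ^ 2 ≤ (1 + volume.real O) ^ 3 := by nlinarith [sq_nonneg (volume.real O)]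
        gcongr
        exact lumped_nonneg hO 𝒯 fun v => by positivity
      exact le_of_pow_le_pow_left₀ (n := 3) (by norm_num) (by positivity) h3
    · simp only [one_pow]
      rw [lumped_const hO, one_mul]
      nlinarith [sq_nonneg (volume.real O)]
  refine ⟨h1, ?_⟩
  have h5 : lumped 𝒯 (fun x => w x ^ 4) ^ 2
      ≤ lumped 𝒯 (fun x => w x ^ 2) * lumped 𝒯 (fun x => w x ^ 6) :=
    lumped_mul_sq_le hO 𝒯 (fun v => by positivity) (fun v => by positivity)
      fun v => le_of_eq (by ring)
  refine le_of_pow_le_pow_left₀ (n := 2) (by norm_num) (by positivity) (h5.trans ?_)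
  calc _ ≤ (1 + volume.real O) * β * β ^ 3 := by
        gcongr
        exact lumped_nonneg hO 𝒯 fun v => by positivity
    _ ≤ (1 + volume.real O) ^ 2 * β ^ 4 := by
        have e : 0 ≤ (volume.real O + volume.real O ^ 2) * β ^ 4 := by positivity
        linear_combination e
    _ = _ := by ring

/-! ### The Dirichlet form on finite element functions -/

theorem dirichletForm_add_left (hO : IsConvexPolyhedralDomain O) (𝒯 : Triangulation O)
    {u v w : Space d → ℝ} (hu : u ∈ 𝒯.femSpace) (hv : v ∈ 𝒯.femSpace) (hw : w ∈ 𝒯.femSpace) :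
    dirichletForm O (u + v) w = dirichletForm O u w + dirichletForm O v w := by
  rw [dirichletForm_eq_sum hO 𝒯 (𝒯.femSpace.add_mem hu hv) hw, dirichletForm_eq_sum hO 𝒯 hu hw,
    dirichletForm_eq_sum hO 𝒯 hv hw, ← Finset.sum_add_distrib]
  exact Finset.sum_congr rfl fun s hs => by rw [𝒯.slope_add hs hu hv, inner_add_left, mul_add]

theorem dirichletForm_comm (u v : Space d → ℝ) : dirichletForm O u v = dirichletForm O v u := by
  simp only [dirichletForm, real_inner_comm]

theorem dirichletForm_sub_left (hO : IsConvexPolyhedralDomain O) (𝒯 : Triangulation O)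
    {u v w : Space d → ℝ} (hu : u ∈ 𝒯.femSpace) (hv : v ∈ 𝒯.femSpace) (hw : w ∈ 𝒯.femSpace) :
    dirichletForm O (u - v) w = dirichletForm O u w - dirichletForm O v w := by
  have h := dirichletForm_add_left hO 𝒯 (𝒯.femSpace.sub_mem hu hv) hv hw
  rw [sub_add_cancel] at h
  linarith

theorem dirichletForm_nonneg (u : Space d → ℝ) : 0 ≤ dirichletForm O u u :=
  integral_nonneg fun _ => real_inner_self_nonneg

theorem dirichletForm_sq_le (hO : IsConvexPolyhedralDomain O) (𝒯 : Triangulation O)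
    {u v : Space d → ℝ} (hu : u ∈ 𝒯.femSpace) (hv : v ∈ 𝒯.femSpace) :
    dirichletForm O u v ^ 2 ≤ dirichletForm O u u * dirichletForm O v v := by
  rw [dirichletForm_eq_sum hO 𝒯 hu hv, dirichletForm_eq_sum hO 𝒯 hu hu,
    dirichletForm_eq_sum hO 𝒯 hv hv]
  have hm : ∀ s : Finset (Space d), 0 ≤ volume.real (cell s) := fun s => measureReal_nonneg
  refine Finset.sum_sq_le_sum_mul_sum_of_sq_le_mul _
    (fun s _ => mul_nonneg (hm s) real_inner_self_nonneg)
    (fun s _ => mul_nonneg (hm s) real_inner_self_nonneg) fun s _ => ?_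
  have h1 := real_inner_mul_inner_self_le (slope s u) (slope s v)
  have h2 := mul_le_mul_of_nonneg_left h1 (sq_nonneg (volume.real (cell s)))
  calc _ = volume.real (cell s) ^ 2
        * (inner ℝ (slope s u) (slope s v) * inner ℝ (slope s u) (slope s v)) := by ring
    _ ≤ _ := h2
    _ = _ := by ring

end Triangulation

/-! ### The discrete energy inequality -/

namespace Triangulation

variable {d : ℕ} {O : Set (Space d)}

/-- The discrete Sobolev embedding with the constant inside the cube, also for the weight `1 + |u|` in
which the growth of the potential is measured. -/
theorem exists_lumped_pow_six_le_cube (hd : d = 2 ∨ d = 3) (hO : IsConvexPolyhedralDomain O) :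
    ∃ C ≥ 1, ∀ 𝒯 : Triangulation O, ∀ u ∈ 𝒯.femSpace,
      lumped 𝒯 (fun x => u x ^ 6)
          ≤ (C * (lumped 𝒯 (fun x => u x ^ 2) + dirichletForm O u u)) ^ 3 ∧
      lumped 𝒯 (fun x => (1 + |u x|) ^ 6)
          ≤ (C * (1 + lumped 𝒯 (fun x => u x ^ 2) + dirichletForm O u u)) ^ 3 := by
  obtain ⟨C, hC, h⟩ := exists_lumped_pow_six_le hd hO
  have hμ : 0 ≤ volume.real O := measureReal_nonneg
  refine ⟨1 + C + 32 * (volume.real O + C), by linarith, fun 𝒯 u hu => ?_⟩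
  set B := 1 + C + 32 * (volume.real O + C) with hB
  set N := lumped 𝒯 (fun x => u x ^ 2) + dirichletForm O u u with hN
  have hN0 : 0 ≤ N := add_nonneg (lumped_nonneg hO 𝒯 fun v => by positivity)
    (dirichletForm_nonneg u)
  have hB1 : 1 ≤ B := by linarith
  have hB3 : B ≤ B ^ 3 := le_self_pow₀ hB1 (by norm_num)
  have h6 := h 𝒯 u hu
  constructor
  · refine h6.trans ?_
    rw [mul_pow]
    have : C ≤ B ^ 3 := by linarith
    gcongr
  · rw [add_assoc, ← hN, mul_pow]
    have h1 : lumped 𝒯 (fun x => (1 + |u x|) ^ 6) ≤ lumped 𝒯 (fun x => 32 * (1 + u x ^ 6)) := by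
      refine lumped_mono hO 𝒯 fun v => ?_
      have h2 := add_pow_le (zero_le_one (α := ℝ)) (abs_nonneg (u v)) 6
      have h3 : |u v| ^ 6 = u v ^ 6 := Even.pow_abs (by decide) _
      rw [h3] at h2
      norm_num at h2
      linarith
    rw [lumped_const_mul hO, lumped_add hO, lumped_const hO, one_mul] at h1
    refine h1.trans ?_
    have h4 : N ^ 3 ≤ (1 + N) ^ 3 := by gcongr; linarith
    have h5 : (1 : ℝ) ≤ (1 + N) ^ 3 := one_le_pow₀ (by linarith)
    calc 32 * (volume.real O + lumped 𝒯 fun x => u x ^ 6)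
        ≤ 32 * (volume.real O * (1 + N) ^ 3 + C * (1 + N) ^ 3) := by
          have : C * N ^ 3 ≤ C * (1 + N) ^ 3 := by gcongr
          have : volume.real O * 1 ≤ volume.real O * (1 + N) ^ 3 := by gcongr
          linarith
      _ = 32 * (volume.real O + C) * (1 + N) ^ 3 := by ring
      _ ≤ B ^ 3 * (1 + N) ^ 3 := by
          gcongr
          linarith

end Triangulation

section Step

variable {d : ℕ} {O : Set (Space d)}

open Triangulation

/-- The modified energy controlled by the scheme.  The lumped `L²`-term is added to obtain
coercivity in `H¹`. -/
def energy (𝒯 : Triangulation O) (φ : Space d → ℝ) (r : ℝ) : ℝ :=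
  1 + r ^ 2 + 1 / 2 * dirichletForm O φ φ + 1 / 8 * lumped 𝒯 fun x => φ x ^ 2

/-- The part of the energy increment that is linear in the noise `Θ`. -/
def noisePairing (𝒯 : Triangulation O) (F : ℝ → ℝ) (φ : Space d → ℝ) (r : ℝ)
    (Θ : Space d → ℝ) : ℝ :=
  dirichletForm O φ Θ + r * (lumped 𝒯 (fun x => deriv F (φ x) * Θ x) / √(discEnergy 𝒯 F φ))
    + 1 / 4 * lumped 𝒯 fun x => φ x * Θ x

/-- The dissipation of one time step with increment `D` and noise `Θ`. -/
def dissipation (𝒯 : Triangulation O) (τ : ℝ) (D Θ : Space d → ℝ) : ℝ :=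
  1 / 4 * dirichletForm O D D + 1 / 2 * (lumped 𝒯 (fun x => (D x - Θ x) ^ 2) / τ)

/-- The linearization of the scalar auxiliary variable including the Itô correction:
`r₁ - r₀ = 1/2 * correctedSlope … (φ₁ - φ₀)`. -/
def correctedSlope (𝒯 : Triangulation O) (F : ℝ → ℝ) (φ Θ ψ : Space d → ℝ) : ℝ :=
  lumped 𝒯 (fun x => deriv F (φ x) * ψ x) / √(discEnergy 𝒯 F φ)
    - lumped 𝒯 (fun x => deriv F (φ x) * Θ x) * lumped 𝒯 (fun x => deriv F (φ x) * ψ x)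
        / (4 * √(discEnergy 𝒯 F φ) ^ 3)
    + lumped 𝒯 (fun x => iteratedDeriv 2 F (φ x) * Θ x * ψ x) / (2 * √(discEnergy 𝒯 F φ))

theorem dissipation_nonneg (hO : IsConvexPolyhedralDomain O) (𝒯 : Triangulation O) {τ : ℝ}
    (hτ : 0 < τ) (D Θ : Space d → ℝ) : 0 ≤ dissipation 𝒯 τ D Θ := by
  have h1 := dirichletForm_nonneg (O := O) D
  have h2 : 0 ≤ lumped 𝒯 (fun x => (D x - Θ x) ^ 2) := lumped_nonneg hO 𝒯 fun v => sq_nonneg _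
  unfold dissipation
  positivity

theorem one_le_energy (hO : IsConvexPolyhedralDomain O) (𝒯 : Triangulation O)
    (φ : Space d → ℝ) (r : ℝ) : 1 ≤ energy 𝒯 φ r := by
  have h1 := dirichletForm_nonneg (O := O) φ
  have h2 : 0 ≤ lumped 𝒯 (fun x => φ x ^ 2) := lumped_nonneg hO 𝒯 fun v => sq_nonneg _
  unfold energy
  nlinarith [sq_nonneg r]

theorem rpow_three_half {E : ℝ} (hE : 0 ≤ E) : E ^ (3 / 2 : ℝ) = √E ^ 3 := by
  rw [Real.sqrt_eq_rpow, ← Real.rpow_natCast, ← Real.rpow_mul hE]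
  norm_num

variable {𝒯 : Triangulation O} {F : ℝ → ℝ} {ν K τ : ℝ} {φ₀ φ₁ Θ : Space d → ℝ} {r₀ r₁ : ℝ}

/-- The discrete energy is bounded from below by a positive constant, uniformly in the triangulation;
so the divisions by it in the scheme are harmless. -/
theorem PotentialBounds.volume_le_discEnergy (hO : IsConvexPolyhedralDomain O)
    (hF : PotentialBounds F ν K) (𝒯 : Triangulation O) (φ : Space d → ℝ) :
    lumped 𝒯 (fun x => (1 + |φ x|) ^ 4) ≤ K * discEnergy 𝒯 F φ ∧
      volume.real O ≤ K * discEnergy 𝒯 F φ ∧ 0 < discEnergy 𝒯 F φ := by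
  have h1 : lumped 𝒯 (fun x => (1 + |φ x|) ^ 4) ≤ K * discEnergy 𝒯 F φ := by
    rw [discEnergy, ← lumped_const_mul hO]
    exact lumped_mono hO 𝒯 fun v => hF.lower _
  have h2 : volume.real O ≤ lumped 𝒯 (fun x => (1 + |φ x|) ^ 4) := by
    rw [← one_mul (volume.real O), ← lumped_const hO 𝒯]
    exact lumped_mono hO 𝒯 fun v => one_le_pow₀ (by linarith [abs_nonneg (φ v)])
  refine ⟨h1, h2.trans h1, ?_⟩
  have h3 := hO.volume_real_pos
  have h4 := hF.one_le
  by_contra h5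
  nlinarith

/-- The three terms with the auxiliary variable in the phase equation form `correctedSlope`. -/
theorem IsStep.phase_eq (hE : 0 < discEnergy 𝒯 F φ₀) (h : IsStep 𝒯 F τ Θ φ₀ r₀ φ₁ r₁)
    {ψ : Space d → ℝ} (hψ : ψ ∈ 𝒯.femSpace) :
    lumped 𝒯 (fun x => (φ₁ x - φ₀ x) * ψ x) + τ * dirichletForm O φ₁ ψ
      + τ * r₁ * correctedSlope 𝒯 F φ₀ Θ ψ = lumped 𝒯 (fun x => Θ x * ψ x) := by
  rw [← h.phase ψ hψ, rpow_three_half hE.le, correctedSlope]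
  have := Real.sqrt_pos.2 hE
  field_simp
  ring

theorem IsStep.auxiliary_eq (hE : 0 < discEnergy 𝒯 F φ₀) (h : IsStep 𝒯 F τ Θ φ₀ r₀ φ₁ r₁) :
    r₁ - r₀ = 1 / 2 * correctedSlope 𝒯 F φ₀ Θ (φ₁ - φ₀) := by
  have e : ∀ x, iteratedDeriv 2 F (φ₀ x) * (φ₁ x - φ₀ x) * Θ x
      = iteratedDeriv 2 F (φ₀ x) * Θ x * (φ₁ x - φ₀ x) := fun x => by ring
  rw [h.auxiliary, rpow_three_half hE.le, correctedSlope]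
  simp only [e, Pi.sub_apply]
  have := Real.sqrt_pos.2 hE
  field_simp
  ring

theorem correctedSlope_sub (hO : IsConvexPolyhedralDomain O) (ψ η : Space d → ℝ) :
    correctedSlope 𝒯 F φ₀ Θ (ψ - η)
      = correctedSlope 𝒯 F φ₀ Θ ψ - correctedSlope 𝒯 F φ₀ Θ η := by
  simp only [correctedSlope, Pi.sub_apply, mul_sub, lumped_sub hO]
  ring

/-- Testing the phase equation with `φ₁ - φ₀ - Θ`. -/
theorem IsStep.energy_identity (hO : IsConvexPolyhedralDomain O)
    (hE : 0 < discEnergy 𝒯 F φ₀) (hτ : 0 < τ) (h₀ : φ₀ ∈ 𝒯.femSpace) (h₁ : φ₁ ∈ 𝒯.femSpace)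
    (hΘ : Θ ∈ 𝒯.femSpace) (h : IsStep 𝒯 F τ Θ φ₀ r₀ φ₁ r₁) :
    lumped 𝒯 (fun x => (φ₁ x - φ₀ x - Θ x) ^ 2) / τ
      + 1 / 2 * (dirichletForm O φ₁ φ₁ - dirichletForm O φ₀ φ₀
          + dirichletForm O (φ₁ - φ₀) (φ₁ - φ₀))
      + (r₁ ^ 2 - r₀ ^ 2 + (r₁ - r₀) ^ 2)
      = dirichletForm O φ₁ Θ + r₁ * correctedSlope 𝒯 F φ₀ Θ Θ := by
  have hD := 𝒯.femSpace.sub_mem h₁ h₀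
  have h1 := h.phase_eq hE (𝒯.femSpace.sub_mem hD hΘ)
  have h2 := h.auxiliary_eq hE
  rw [correctedSlope_sub hO] at h1
  have h3 : lumped 𝒯 (fun x => (φ₁ x - φ₀ x - Θ x) ^ 2)
      = lumped 𝒯 (fun x => (φ₁ x - φ₀ x) * (φ₁ - φ₀ - Θ) x)
        - lumped 𝒯 (fun x => Θ x * (φ₁ - φ₀ - Θ) x) := by
    rw [← lumped_sub hO]
    congr 1
    funext x
    simp only [Pi.sub_apply]
    ring
  have h4 : dirichletForm O φ₁ (φ₁ - φ₀ - Θ)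
      = dirichletForm O φ₁ φ₁ - dirichletForm O φ₀ φ₁ - dirichletForm O φ₁ Θ := by
    rw [dirichletForm_comm, dirichletForm_sub_left hO 𝒯 hD hΘ h₁,
      dirichletForm_sub_left hO 𝒯 h₁ h₀ h₁, dirichletForm_comm Θ φ₁]
  have h5 : dirichletForm O (φ₁ - φ₀) (φ₁ - φ₀)
      = dirichletForm O φ₁ φ₁ - 2 * dirichletForm O φ₀ φ₁ + dirichletForm O φ₀ φ₀ := by
    rw [dirichletForm_sub_left hO 𝒯 h₁ h₀ hD, dirichletForm_comm φ₁, dirichletForm_comm φ₀,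
      dirichletForm_sub_left hO 𝒯 h₁ h₀ h₁, dirichletForm_sub_left hO 𝒯 h₁ h₀ h₀,
      dirichletForm_comm φ₁ φ₀]
    ring
  rw [h3, h5]
  rw [h4] at h1
  have h6 : correctedSlope 𝒯 F φ₀ Θ (φ₁ - φ₀) = 2 * (r₁ - r₀) := by linarith
  rw [h6] at h1
  field_simp
  linear_combination 2 * h1

/-- Bounds for the terms containing the noise `Θ` if `⟨Θ⁶⟩ ≤ t³`; here `H` is the energy. -/
theorem exists_noise_bounds (hd : d = 2 ∨ d = 3) (hO : IsConvexPolyhedralDomain O)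
    (hF : PotentialBounds F ν K) :
    ∃ C ≥ 1, ∀ (𝒯 : Triangulation O) (φ₀ Θ : Space d → ℝ) (r₀ t : ℝ), φ₀ ∈ 𝒯.femSpace → 0 ≤ t →
      lumped 𝒯 (fun x => Θ x ^ 6) ≤ t ^ 3 →
      (lumped 𝒯 (fun x => deriv F (φ₀ x) * Θ x) / √(discEnergy 𝒯 F φ₀)) ^ 2
        ≤ C * (t * energy 𝒯 φ₀ r₀) ∧
      |correctedSlope 𝒯 F φ₀ Θ Θ
        - lumped 𝒯 (fun x => deriv F (φ₀ x) * Θ x) / √(discEnergy 𝒯 F φ₀)| ≤ C * t ∧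
      lumped 𝒯 (fun x => Θ x ^ 2) ≤ C * t := by
  obtain ⟨S, hS, hSob⟩ := exists_lumped_pow_six_le_cube hd hO
  have hμ : 0 ≤ volume.real O := measureReal_nonneg
  have hK := hF.one_le
  set κ := 1 + volume.real O with hκ
  have hκ1 : 1 ≤ κ := by linarith
  -- all constants are products of powers of `K`, `κ` and `S`
  refine ⟨K ^ 3 * κ * (8 * S + K), ?_, fun 𝒯 φ₀ Θ r₀ t h₀ ht hΘ => ?_⟩
  · have : 1 ≤ K ^ 3 * κ := one_le_mul_of_one_le_of_one_le (one_le_pow₀ hK) hκ1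
    exact one_le_mul_of_one_le_of_one_le this (by linarith)
  obtain ⟨hE4, -, hE⟩ := hF.volume_le_discEnergy hO 𝒯 φ₀
  set E := discEnergy 𝒯 F φ₀ with hEdef
  have ha : 0 < √E := Real.sqrt_pos.2 hE
  have haE : √E ^ 2 = E := Real.sq_sqrt hE.le
  set a := √E with hadef
  set H := energy 𝒯 φ₀ r₀ with hH
  have hH1 : 1 ≤ H := one_le_energy hO 𝒯 φ₀ r₀
  obtain ⟨hΘ2, hΘ4⟩ := lumped_sq_le_of_pow_six hO 𝒯 ht hΘ
  rw [← hκ] at hΘ2 hΘ4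
  have hdir := dirichletForm_nonneg (O := O) φ₀
  have hL2 : 0 ≤ lumped 𝒯 (fun x => φ₀ x ^ 2) := lumped_nonneg hO 𝒯 fun v => sq_nonneg _
  have hN : 1 + lumped 𝒯 (fun x => φ₀ x ^ 2) + dirichletForm O φ₀ φ₀ ≤ 8 * H := by
    rw [hH, energy]
    nlinarith [sq_nonneg r₀]
  have h6 : lumped 𝒯 (fun x => (1 + |φ₀ x|) ^ 6) ≤ (8 * S * H) ^ 3 := by
    refine (hSob 𝒯 φ₀ h₀).2.trans ?_
    rw [show 8 * S * H = S * (8 * H) by ring]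
    gcongr
  have h4 := (lumped_sq_le_of_pow_six hO 𝒯 (by positivity) h6).2
  rw [← hκ] at h4
  set P := lumped 𝒯 (fun x => (1 + |φ₀ x|) ^ 2 * Θ x ^ 2) with hP
  have hP0 : 0 ≤ P := lumped_nonneg hO 𝒯 fun v => by positivity
  have hQ0 : 0 ≤ lumped 𝒯 (fun x => Θ x ^ 4) := lumped_nonneg hO 𝒯 fun v => by positivity
  have hY0 : 0 ≤ lumped 𝒯 (fun x => (1 + |φ₀ x|) ^ 4) := lumped_nonneg hO 𝒯 fun v => by positivity
  have hPP : P ^ 2 ≤ lumped 𝒯 (fun x => (1 + |φ₀ x|) ^ 4) * lumped 𝒯 (fun x => Θ x ^ 4) :=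
    lumped_mul_sq_le hO 𝒯 (fun v => by positivity) (fun v => by positivity)
      fun v => le_of_eq (by ring)
  have hPE : P ≤ K * κ * (a * t) := by
    refine le_of_pow_le_pow_left₀ (n := 2) (by norm_num) (by positivity) (hPP.trans ?_)
    calc _ ≤ (K * E) * (κ * t ^ 2) := by gcongr
      _ = (K * κ) * (a ^ 2 * t ^ 2) := by rw [haE]; ring
      _ ≤ (K * κ) ^ 2 * (a ^ 2 * t ^ 2) := by
        gcongr
        exact le_self_pow₀ (one_le_mul_of_one_le_of_one_le hK hκ1) (by norm_num)
      _ = _ := by ring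
  have hPH : P ≤ κ * (8 * S * H) * t := by
    refine le_of_pow_le_pow_left₀ (n := 2) (by norm_num) (by positivity) (hPP.trans ?_)
    calc _ ≤ (κ * (8 * S * H) ^ 2) * (κ * t ^ 2) := by gcongr
      _ = _ := by ring
  set p := lumped 𝒯 (fun x => deriv F (φ₀ x) * Θ x) with hp
  have hpp : p ^ 2 ≤ K ^ 3 * (a ^ 2 * P) := by
    have h7 : p ^ 2 ≤ lumped 𝒯 (fun x => K ^ 2 * (1 + |φ₀ x|) ^ 4) * P := by
      refine lumped_mul_sq_le hO 𝒯 (fun v => by positivity) (fun v => by positivity) fun v => ?_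
      have h8 : deriv F (φ₀ v) ^ 2 ≤ (K * (1 + |φ₀ v|) ^ 3) ^ 2 := by
        rw [← sq_abs]
        gcongr
        exact hF.deriv_le _
      calc _ = deriv F (φ₀ v) ^ 2 * Θ v ^ 2 := by ring
        _ ≤ (K * (1 + |φ₀ v|) ^ 3) ^ 2 * Θ v ^ 2 := by gcongr
        _ = _ := by ring
    rw [lumped_const_mul hO] at h7
    refine h7.trans ?_
    calc _ ≤ K ^ 2 * (K * E) * P := by gcongr
      _ = _ := by rw [haE]; ring
  have hq : |lumped 𝒯 (fun x => iteratedDeriv 2 F (φ₀ x) * Θ x * Θ x)| ≤ K * P := by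
    rw [hP, ← lumped_const_mul hO]
    refine abs_lumped_le hO 𝒯 fun v => ?_
    rw [mul_assoc, abs_mul, ← sq, abs_of_nonneg (sq_nonneg (Θ v)), ← mul_assoc]
    gcongr
    exact hF.deriv_two_le _
  set q := lumped 𝒯 (fun x => iteratedDeriv 2 F (φ₀ x) * Θ x * Θ x) with hqdef
  have hK3 : 1 ≤ K ^ 3 := one_le_pow₀ hK
  refine ⟨?_, ?_, ?_⟩
  · rw [div_pow, div_le_iff₀ (by positivity)]
    calc p ^ 2 ≤ K ^ 3 * (a ^ 2 * P) := hpp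
      _ ≤ K ^ 3 * (a ^ 2 * (κ * (8 * S * H) * t)) := by gcongr
      _ ≤ _ := by
        have : 0 ≤ K ^ 3 * κ * K * (t * H) * a ^ 2 := by positivity
        linear_combination this
  · have e1 : correctedSlope 𝒯 F φ₀ Θ Θ - p / a = q / (2 * a) - p ^ 2 / (4 * a ^ 3) := by
      rw [correctedSlope, ← hp, ← hqdef, ← hEdef, ← hadef]
      ring
    rw [e1]
    have h9 : |q / (2 * a)| ≤ K ^ 2 * κ * t := by
      rw [abs_div, abs_of_pos (show 0 < 2 * a by positivity), div_le_iff₀ (by positivity)]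
      calc |q| ≤ K * P := hq
        _ ≤ K * (K * κ * (a * t)) := by gcongr
        _ ≤ _ := by
          have : 0 ≤ K ^ 2 * κ * (a * t) := by positivity
          linear_combination this
    have h10 : |p ^ 2 / (4 * a ^ 3)| ≤ K ^ 4 * κ * t := by
      rw [abs_of_nonneg (by positivity), div_le_iff₀ (by positivity)]
      calc p ^ 2 ≤ K ^ 3 * (a ^ 2 * P) := hpp
        _ ≤ K ^ 3 * (a ^ 2 * (K * κ * (a * t))) := by gcongr
        _ ≤ _ := by
          have : 0 ≤ K ^ 4 * κ * t * a ^ 3 := by positivity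
          linear_combination 3 * this
    refine (abs_sub _ _).trans ((add_le_add h9 h10).trans ?_)
    have h11 : K ^ 2 ≤ K ^ 3 := pow_le_pow_right₀ hK (by norm_num)
    have h12 : K ^ 2 * κ * t ≤ K ^ 3 * κ * t := by gcongr
    have h13 : K ^ 3 * κ * t * 1 ≤ K ^ 3 * κ * t * (8 * S) := by gcongr; linarith
    linear_combination h12 + h13
  · refine hΘ2.trans ?_
    gcongr
    have : κ * 1 ≤ κ * (8 * S + K) := by gcongr; linarith
    have h14 : 1 * (κ * (8 * S + K)) ≤ K ^ 3 * (κ * (8 * S + K)) := by gcongr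
    linarith

/-- The martingale increment of the energy is of order `√t` relative to the energy. -/
theorem exists_noisePairing_sq_le (hd : d = 2 ∨ d = 3) (hO : IsConvexPolyhedralDomain O)
    (hF : PotentialBounds F ν K) :
    ∃ C ≥ 1, ∀ (𝒯 : Triangulation O) (φ₀ Θ : Space d → ℝ) (r₀ t : ℝ), φ₀ ∈ 𝒯.femSpace →
      Θ ∈ 𝒯.femSpace → 0 ≤ t → lumped 𝒯 (fun x => Θ x ^ 6) ≤ t ^ 3 →
      dirichletForm O Θ Θ ≤ t * (1 + dirichletForm O φ₀ φ₀) →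
      noisePairing 𝒯 F φ₀ r₀ Θ ^ 2 ≤ C * (t * energy 𝒯 φ₀ r₀ ^ 2) := by
  obtain ⟨C, hC, h⟩ := exists_noise_bounds hd hO hF
  refine ⟨12 + 5 * C, by linarith, fun 𝒯 φ₀ Θ r₀ t h₀ hΘ ht h6 hd1 => ?_⟩
  obtain ⟨hA, -, h2⟩ := h 𝒯 φ₀ Θ r₀ t h₀ ht h6
  have hdir := dirichletForm_nonneg (O := O) φ₀
  have hL2 : 0 ≤ lumped 𝒯 (fun x => φ₀ x ^ 2) := lumped_nonneg hO 𝒯 fun v => sq_nonneg _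
  have hT2 : 0 ≤ lumped 𝒯 (fun x => Θ x ^ 2) := lumped_nonneg hO 𝒯 fun v => sq_nonneg _
  have hH1 := one_le_energy hO 𝒯 φ₀ r₀
  have hHr : r₀ ^ 2 ≤ energy 𝒯 φ₀ r₀ := by rw [energy]; linarith
  have hHd : 1 + dirichletForm O φ₀ φ₀ ≤ 2 * energy 𝒯 φ₀ r₀ := by
    rw [energy]; nlinarith [sq_nonneg r₀]
  have hHl : lumped 𝒯 (fun x => φ₀ x ^ 2) ≤ 8 * energy 𝒯 φ₀ r₀ := by
    rw [energy]; nlinarith [sq_nonneg r₀]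
  have hc1 := dirichletForm_sq_le hO 𝒯 h₀ hΘ
  have hc2 : lumped 𝒯 (fun x => φ₀ x * Θ x) ^ 2
      ≤ lumped 𝒯 (fun x => φ₀ x ^ 2) * lumped 𝒯 (fun x => Θ x ^ 2) :=
    lumped_mul_sq_le hO 𝒯 (fun v => sq_nonneg _) (fun v => sq_nonneg _)
      fun v => le_of_eq (by ring)
  rw [noisePairing]
  set H := energy 𝒯 φ₀ r₀
  set x := dirichletForm O φ₀ Θ
  set A := lumped 𝒯 (fun x => deriv F (φ₀ x) * Θ x) / √(discEnergy 𝒯 F φ₀)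
  set z := lumped 𝒯 (fun x => φ₀ x * Θ x)
  have b1 : x ^ 2 ≤ 4 * (t * H ^ 2) := by
    calc x ^ 2 ≤ _ := hc1
      _ ≤ (2 * H) * (t * (2 * H)) := by
        refine mul_le_mul (by linarith) (hd1.trans (by gcongr)) (dirichletForm_nonneg Θ)
          (by positivity)
      _ = _ := by ring
  have b2 : (r₀ * A) ^ 2 ≤ C * (t * H ^ 2) := by
    calc (r₀ * A) ^ 2 = r₀ ^ 2 * A ^ 2 := by ring
      _ ≤ H * (C * (t * H)) := by gcongr
      _ = _ := by ring
  have b3 : z ^ 2 ≤ 8 * C * (t * H ^ 2) := by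
    calc z ^ 2 ≤ _ := hc2
      _ ≤ (8 * H) * (C * t) := by gcongr
      _ ≤ (8 * H) * (C * t) * H := le_mul_of_one_le_right (by positivity) hH1
      _ = _ := by ring
  have b4 : (x + r₀ * A + 1 / 4 * z) ^ 2 ≤ 3 * (x ^ 2 + (r₀ * A) ^ 2 + (1 / 4 * z) ^ 2) := by
    nlinarith [sq_nonneg (x - r₀ * A), sq_nonneg (x - 1 / 4 * z), sq_nonneg (r₀ * A - 1 / 4 * z)]
  have b5 : 0 ≤ C * (t * H ^ 2) := by positivity
  refine b4.trans ?_
  linear_combination 3 * b1 + 3 * b2 + 3 / 16 * b3 + 1 / 2 * b5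

set_option maxHeartbeats 1000000 in
/-- The energy inequality: the energy grows by the martingale increment `noisePairing` and a term
of order `τ`, and the dissipation of the step is controlled. -/
theorem exists_energy_step (hd : d = 2 ∨ d = 3) (hO : IsConvexPolyhedralDomain O)
    (hF : PotentialBounds F ν K) :
    ∃ C ≥ 1, ∀ (𝒯 : Triangulation O) (τ χ : ℝ) (φ₀ φ₁ Θ : Space d → ℝ) (r₀ r₁ : ℝ),
      0 < τ → τ < 1 → 1 ≤ χ → φ₀ ∈ 𝒯.femSpace → φ₁ ∈ 𝒯.femSpace → Θ ∈ 𝒯.femSpace →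
      lumped 𝒯 (fun x => Θ x ^ 6) ≤ (τ * χ) ^ 3 →
      dirichletForm O Θ Θ ≤ τ * χ * (1 + dirichletForm O φ₀ φ₀) →
      IsStep 𝒯 F τ Θ φ₀ r₀ φ₁ r₁ →
      energy 𝒯 φ₁ r₁ + dissipation 𝒯 τ (φ₁ - φ₀) Θ
        ≤ energy 𝒯 φ₀ r₀ + noisePairing 𝒯 F φ₀ r₀ Θ + C * (τ * χ ^ 2 * energy 𝒯 φ₀ r₀) := by
  obtain ⟨C, hC, h⟩ := exists_noise_bounds hd hO hF
  refine ⟨3 + 5 * C + C ^ 2, by nlinarith, fun 𝒯 τ χ φ₀ φ₁ Θ r₀ r₁ hτ hτ1 hχ h₀ h₁ hΘ h6 hd1 hst => ?_⟩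
  have ht : 0 ≤ τ * χ := by positivity
  obtain ⟨hA, hB, h2⟩ := h 𝒯 φ₀ Θ r₀ (τ * χ) h₀ ht h6
  obtain ⟨-, -, hE⟩ := hF.volume_le_discEnergy hO 𝒯 φ₀
  have hid := hst.energy_identity hO hE hτ h₀ h₁ hΘ
  have hdir := dirichletForm_nonneg (O := O) φ₀
  have hL2 : 0 ≤ lumped 𝒯 (fun x => φ₀ x ^ 2) := lumped_nonneg hO 𝒯 fun v => sq_nonneg _
  have hH1 := one_le_energy hO 𝒯 φ₀ r₀
  have hHr : r₀ ^ 2 + 1 ≤ energy 𝒯 φ₀ r₀ := by rw [energy]; linarith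
  have hHd : 1 + dirichletForm O φ₀ φ₀ ≤ 2 * energy 𝒯 φ₀ r₀ := by
    rw [energy]; nlinarith [sq_nonneg r₀]
  have hHl : lumped 𝒯 (fun x => φ₀ x ^ 2) ≤ 8 * energy 𝒯 φ₀ r₀ := by
    rw [energy]; nlinarith [sq_nonneg r₀]
  have hD := 𝒯.femSpace.sub_mem h₁ h₀
  -- the Dirichlet form of `φ₁` and the noise
  have d1 : dirichletForm O φ₁ Θ ≤ dirichletForm O φ₀ Θ
      + 1 / 4 * dirichletForm O (φ₁ - φ₀) (φ₁ - φ₀) + dirichletForm O Θ Θ := by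
    have e1 : dirichletForm O φ₁ Θ = dirichletForm O (φ₁ - φ₀) Θ + dirichletForm O φ₀ Θ := by
      rw [dirichletForm_sub_left hO 𝒯 h₁ h₀ hΘ]; ring
    have e2 := dirichletForm_sq_le hO 𝒯 hD hΘ
    have e3 := dirichletForm_nonneg (O := O) Θ
    have e4 := dirichletForm_nonneg (O := O) (φ₁ - φ₀)
    have e5 : dirichletForm O (φ₁ - φ₀) Θ
        ≤ 1 / 4 * dirichletForm O (φ₁ - φ₀) (φ₁ - φ₀) + dirichletForm O Θ Θ := by
      refine abs_le_of_sq_le_sq' ?_ (by positivity) |>.2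
      refine e2.trans ?_
      nlinarith [sq_nonneg (1 / 4 * dirichletForm O (φ₁ - φ₀) (φ₁ - φ₀) - dirichletForm O Θ Θ)]
    linarith
  -- the increment of the lumped `L²`-norm
  have d2 : 1 / 8 * lumped 𝒯 (fun x => φ₁ x ^ 2) ≤ 1 / 8 * lumped 𝒯 (fun x => φ₀ x ^ 2)
      + 1 / 4 * lumped 𝒯 (fun x => φ₀ x * Θ x) + τ / 8 * lumped 𝒯 (fun x => φ₀ x ^ 2)
      + (1 / (8 * τ) + 1 / 4) * lumped 𝒯 (fun x => (φ₁ x - φ₀ x - Θ x) ^ 2)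
      + 1 / 4 * lumped 𝒯 (fun x => Θ x ^ 2) := by
    simp only [← lumped_const_mul hO, ← lumped_add hO]
    refine lumped_mono hO 𝒯 fun v => ?_
    set z := φ₁ v - φ₀ v - Θ v with hz
    have e1 : φ₁ v = φ₀ v + z + Θ v := by rw [hz]; ring
    have e2 : 1 / 4 * (φ₀ v * z) ≤ τ / 8 * φ₀ v ^ 2 + 1 / (8 * τ) * z ^ 2 := by
      have : 0 ≤ (τ * φ₀ v - z) ^ 2 / (8 * τ) := by positivity
      have e3 : (τ * φ₀ v - z) ^ 2 / (8 * τ)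
          = τ / 8 * φ₀ v ^ 2 + 1 / (8 * τ) * z ^ 2 - 1 / 4 * (φ₀ v * z) := by
        field_simp
        ring
      linarith
    rw [e1]
    linear_combination e2 + 1 / 8 * sq_nonneg (z - Θ v)
  rw [energy, dissipation, noisePairing]
  have hd1' : dirichletForm O Θ Θ ≤ τ * χ * (2 * energy 𝒯 φ₀ r₀) :=
    hd1.trans (by gcongr)
  rw [show (energy 𝒯 φ₀ r₀ : ℝ) + _ + _ = (1 + r₀ ^ 2 + 1 / 2 * dirichletForm O φ₀ φ₀
    + 1 / 8 * lumped 𝒯 fun x => φ₀ x ^ 2) + (dirichletForm O φ₀ Θ + r₀ * (lumped 𝒯 (fun x =>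
    deriv F (φ₀ x) * Θ x) / √(discEnergy 𝒯 F φ₀)) + 1 / 4 * lumped 𝒯 fun x => φ₀ x * Θ x)
    + (3 + 5 * C + C ^ 2) * (τ * χ ^ 2 * energy 𝒯 φ₀ r₀) from rfl]
  simp only [Pi.sub_apply]
  set H := energy 𝒯 φ₀ r₀
  set A := lumped 𝒯 (fun x => deriv F (φ₀ x) * Θ x) / √(discEnergy 𝒯 F φ₀)
  set L := correctedSlope 𝒯 F φ₀ Θ Θ
  set ζ := lumped 𝒯 (fun x => (φ₁ x - φ₀ x - Θ x) ^ 2) with hζ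
  have hζ0 : 0 ≤ ζ := lumped_nonneg hO 𝒯 fun v => sq_nonneg _
  -- replace `r₁` by `r₀` in the last term of the energy identity
  have d3 : r₁ * L ≤ r₀ * A + H * (C * (τ * χ)) + (r₁ - r₀) ^ 2 + (1 / 2 * (C * (τ * χ * H))
      + 1 / 2 * (C * (τ * χ)) ^ 2) := by
    have e0 : |r₀| ≤ H := by
      have := sq_abs r₀
      nlinarith [sq_nonneg (|r₀| - 1)]
    have e1 : r₀ * (L - A) ≤ H * (C * (τ * χ)) := by
      refine (le_abs_self _).trans ?_
      rw [abs_mul]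
      gcongr
    have e2 : (r₁ - r₀) * A ≤ 1 / 2 * (r₁ - r₀) ^ 2 + 1 / 2 * A ^ 2 := by
      nlinarith [sq_nonneg (r₁ - r₀ - A)]
    have e3 : (r₁ - r₀) * (L - A) ≤ 1 / 2 * (r₁ - r₀) ^ 2 + 1 / 2 * (L - A) ^ 2 := by
      nlinarith [sq_nonneg (r₁ - r₀ - (L - A))]
    have e4 : (L - A) ^ 2 ≤ (C * (τ * χ)) ^ 2 := by
      rw [← sq_abs]
      gcongr
    linear_combination e1 + e2 + e3 + 1 / 2 * e4 + 1 / 2 * hA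
  set e := τ * χ ^ 2 * H with he
  have f1 : τ * χ * H ≤ e := by
    rw [he, mul_assoc, mul_assoc]
    gcongr
    exact le_self_pow₀ hχ (by norm_num)
  have f2 : τ * χ ≤ τ * χ * H := le_mul_of_one_le_right ht hH1
  have f3 : (τ * χ) ^ 2 ≤ e := by
    calc (τ * χ) ^ 2 = τ * (τ * χ ^ 2) * 1 := by ring
      _ ≤ 1 * (τ * χ ^ 2) * H := by gcongr
      _ = e := by rw [he]; ring
  have f4 : τ * H ≤ e := by
    rw [he]
    have : τ * 1 ≤ τ * χ ^ 2 := by gcongr; exact one_le_pow₀ hχ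
    gcongr
    linarith
  have f5 : τ / 8 * lumped 𝒯 (fun x => φ₀ x ^ 2) ≤ e := by
    calc _ ≤ τ / 8 * (8 * H) := by gcongr
      _ = τ * H := by ring
      _ ≤ e := f4
  have f6 : (1 / (8 * τ) + 1 / 4) * ζ ≤ 1 / 2 * (ζ / τ) := by
    have e1 : ζ ≤ ζ / τ := le_div_self hζ0 hτ hτ1.le
    have e2 : 1 / (8 * τ) * ζ = 1 / 8 * (ζ / τ) := by field_simp
    rw [add_mul, e2]
    linarith
  have g1 := mul_le_mul_of_nonneg_left f1 (by positivity : 0 ≤ C)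
  have g2 := mul_le_mul_of_nonneg_left f2 (by positivity : 0 ≤ C)
  have g3 := mul_le_mul_of_nonneg_left f3 (by positivity : 0 ≤ C ^ 2)
  have e0 : 0 ≤ e := by positivity
  have g4 : 0 ≤ C * e := by positivity
  have g5 : 0 ≤ C ^ 2 * e := by positivity
  clear_value H A L ζ e
  clear hst h6 hD hL2 hdir hA hB h hd1 hHd hHl hHr
  generalize lumped 𝒯 (fun x => φ₁ x ^ 2) = l₁ at *
  generalize lumped 𝒯 (fun x => φ₀ x ^ 2) = l₀ at *
  generalize lumped 𝒯 (fun x => φ₀ x * Θ x) = z at *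
  generalize lumped 𝒯 (fun x => Θ x ^ 2) = w at *
  generalize dirichletForm O φ₁ Θ = x₁ at *
  generalize dirichletForm O φ₀ Θ = x₀ at *
  generalize dirichletForm O (φ₁ - φ₀) (φ₁ - φ₀) = x₂ at *
  generalize dirichletForm O Θ Θ = x₃ at *
  generalize dirichletForm O φ₁ φ₁ = x₄ at *
  generalize dirichletForm O φ₀ φ₀ = x₅ at *
  generalize ζ / τ = ζ₁ at *
  linear_combination hid + d1 + d2 + d3 + hd1' + f5 + f6 + 1 / 4 * h2 + 2 * f1 + 7 / 4 * g1
    + 1 / 4 * g2 + 1 / 2 * g3 + 13 / 4 * g4 + 1 / 2 * g5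

end Step


/-! ### Consistency of the scalar auxiliary variable in one step -/

section Consistency

variable {d : ℕ} {O : Set (Space d)}

open Triangulation

set_option maxHeartbeats 1000000 in
/-- Moment bounds for the increment `D = φ₁ - φ₀`, the noise `Θ` and `Z = D - Θ` in terms of the
dissipation `s` and of `e = τ χ²`.  Here `a = τ^(1/4)` and `t = τ χ`. -/
theorem exists_step_moments (hd : d = 2 ∨ d = 3) (hO : IsConvexPolyhedralDomain O) :
    ∃ B ≥ 1, ∀ (𝒯 : Triangulation O) (a χ W s e : ℝ) (φ₀ φ₁ Θ : Space d → ℝ) (r₀ r₁ : ℝ),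
      0 < a → a ≤ 1 → 1 ≤ χ → φ₀ ∈ 𝒯.femSpace → φ₁ ∈ 𝒯.femSpace →
      lumped 𝒯 (fun x => Θ x ^ 6) ≤ (a ^ 4 * χ) ^ 3 →
      s = dissipation 𝒯 (a ^ 4) (φ₁ - φ₀) Θ → e = a ^ 4 * χ ^ 2 →
      W = energy 𝒯 φ₀ r₀ + energy 𝒯 φ₁ r₁ + (s + e) →
      lumped 𝒯 (fun x => (φ₁ x - φ₀ x - Θ x) ^ 2) ≤ 2 * (a ^ 4 * s) ∧
      lumped 𝒯 (fun x => (φ₁ x - φ₀ x - Θ x) ^ 4) ≤ B * (W * (s + e)) ∧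
      lumped 𝒯 (fun x => (φ₁ x - φ₀ x - Θ x) ^ 6) ≤ B * (W ^ 2 * (s + e)) ∧
      lumped 𝒯 (fun x => Θ x ^ 2) ≤ B * (a ^ 4 * χ) ∧
      lumped 𝒯 (fun x => Θ x ^ 4) ≤ B * (a ^ 4 * e) ∧
      lumped 𝒯 (fun x => (φ₁ x - φ₀ x) ^ 2) ≤ B * (a ^ 4 * (s + χ)) ∧
      lumped 𝒯 (fun x => (1 + |φ₀ x| + |φ₁ x - φ₀ x|) ^ 6) ≤ B * W ^ 3 ∧
      lumped 𝒯 (fun x => (1 + |φ₀ x| + |φ₁ x - φ₀ x|) ^ 4 * (φ₁ x - φ₀ x) ^ 2)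
        ≤ B * (W ^ 2 * (s + e)) ∧
      lumped 𝒯 (fun x => (1 + |φ₀ x| + |φ₁ x - φ₀ x|) ^ 4 * (φ₁ x - φ₀ x - Θ x) ^ 2)
        ≤ B * (W ^ 2 * (s + e)) ∧
      lumped 𝒯 (fun x => (1 + |φ₀ x| + |φ₁ x - φ₀ x|) ^ 4 * Θ x ^ 2)
        ≤ B * (W ^ 2 * (a ^ 4 * χ)) := by
  obtain ⟨S, hS, hSob⟩ := exists_lumped_pow_six_le_cube hd hO
  have hμ : 0 ≤ volume.real O := measureReal_nonneg
  set κ := 1 + volume.real O with hκ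
  have hκ1 : 1 ≤ κ := by linarith
  have hκS : 1 ≤ κ * S := one_le_mul_of_one_le_of_one_le hκ1 hS
  have hB1 : 1 ≤ 128 * (κ * S) := by linarith
  refine ⟨(128 * (κ * S)) ^ 3, one_le_pow₀ hB1, ?_⟩
  intro 𝒯 a χ W s e φ₀ φ₁ Θ r₀ r₁ ha ha1 hχ h₀ h₁ hΘ hs he hW
  have hs0 : 0 ≤ s := hs ▸ dissipation_nonneg hO 𝒯 (by positivity) _ _
  have he0 : 0 ≤ e := he ▸ by positivity
  have hχ0 : 0 ≤ χ := by linarith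
  have hH0 := one_le_energy hO 𝒯 φ₀ r₀
  have hH1 := one_le_energy hO 𝒯 φ₁ r₁
  have hW1 : 1 ≤ W := by linarith
  have ht : 0 ≤ a ^ 4 * χ := by positivity
  have hte : a ^ 4 * χ ≤ e := by
    rw [he]
    gcongr
    exact le_self_pow₀ hχ (by norm_num)
  have ha4 : a ^ 4 ≤ 1 := pow_le_one₀ ha.le ha1
  obtain ⟨hΘ2, hΘ4⟩ := lumped_sq_le_of_pow_six hO 𝒯 ht hΘ
  rw [← hκ] at hΘ2 hΘ4
  have hD := 𝒯.femSpace.sub_mem h₁ h₀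
  have hZ0 : 0 ≤ lumped 𝒯 (fun x => (φ₁ x - φ₀ x - Θ x) ^ 2) :=
    lumped_nonneg hO 𝒯 fun v => sq_nonneg _
  have hdD := dirichletForm_nonneg (O := O) (φ₁ - φ₀)
  have hZ2 : lumped 𝒯 (fun x => (φ₁ x - φ₀ x - Θ x) ^ 2) ≤ 2 * (a ^ 4 * s) := by
    have h1 : 1 / 2 * (lumped 𝒯 (fun x => (φ₁ x - φ₀ x - Θ x) ^ 2) / a ^ 4) ≤ s := by
      rw [hs, dissipation]
      simp only [Pi.sub_apply]
      linarith
    have h2 : lumped 𝒯 (fun x => (φ₁ x - φ₀ x - Θ x) ^ 2) / a ^ 4 ≤ 2 * s := by linarith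
    rw [div_le_iff₀ (by positivity)] at h2
    linarith
  have hdDs : dirichletForm O (φ₁ - φ₀) (φ₁ - φ₀) ≤ 4 * s := by
    have h1 : 0 ≤ lumped 𝒯 (fun x => (φ₁ x - φ₀ x - Θ x) ^ 2) / a ^ 4 := by positivity
    rw [hs, dissipation]
    simp only [Pi.sub_apply]
    linarith
  have hD2 : lumped 𝒯 (fun x => (φ₁ x - φ₀ x) ^ 2) ≤ 4 * (a ^ 4 * s) + 2 * (κ * (a ^ 4 * χ)) := by
    have h1 : lumped 𝒯 (fun x => (φ₁ x - φ₀ x) ^ 2)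
        ≤ 2 * lumped 𝒯 (fun x => (φ₁ x - φ₀ x - Θ x) ^ 2) + 2 * lumped 𝒯 (fun x => Θ x ^ 2) := by
      rw [← lumped_const_mul hO, ← lumped_const_mul hO, ← lumped_add hO]
      refine lumped_mono hO 𝒯 fun v => ?_
      nlinarith [sq_nonneg (φ₁ v - φ₀ v - 2 * Θ v)]
    linarith
  have hDN : lumped 𝒯 (fun x => (φ₁ - φ₀) x ^ 2) + dirichletForm O (φ₁ - φ₀) (φ₁ - φ₀)
      ≤ 8 * κ * (s + e) := by
    simp only [Pi.sub_apply]
    have h1 : a ^ 4 * s ≤ 1 * s := by gcongr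
    have h2 : κ * (a ^ 4 * χ) ≤ κ * e := by gcongr
    have h3 : 1 * s ≤ κ * s := by gcongr
    have h4 : 0 ≤ κ * e := by positivity
    linear_combination hD2 + hdDs + 4 * h1 + 2 * h2 + 8 * h3 + 6 * h4
  have hD6 : lumped 𝒯 (fun x => (φ₁ x - φ₀ x) ^ 6) ≤ (8 * (κ * S) * (s + e)) ^ 3 := by
    refine (hSob 𝒯 _ hD).1.trans ?_
    rw [show 8 * (κ * S) * (s + e) = S * (8 * κ * (s + e)) by ring]
    refine pow_le_pow_left₀ ?_ (mul_le_mul_of_nonneg_left hDN (by positivity)) 3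
    exact mul_nonneg (by positivity) (add_nonneg (lumped_nonneg hO 𝒯 fun v => sq_nonneg _) hdD)
  have hZ6 : lumped 𝒯 (fun x => (φ₁ x - φ₀ x - Θ x) ^ 6) ≤ (32 * (κ * S) * (s + e)) ^ 3 := by
    have h1 : lumped 𝒯 (fun x => (φ₁ x - φ₀ x - Θ x) ^ 6)
        ≤ 32 * (lumped 𝒯 (fun x => (φ₁ x - φ₀ x) ^ 6) + lumped 𝒯 (fun x => Θ x ^ 6)) := by
      rw [← lumped_add hO, ← lumped_const_mul hO]
      refine lumped_mono hO 𝒯 fun v => ?_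
      have h2 := add_pow_le (abs_nonneg (φ₁ v - φ₀ v)) (abs_nonneg (Θ v)) 6
      rw [Even.pow_abs (by decide), Even.pow_abs (by decide)] at h2
      have h3 : (φ₁ v - φ₀ v - Θ v) ^ 6 ≤ (|φ₁ v - φ₀ v| + |Θ v|) ^ 6 := by
        rw [← Even.pow_abs (n := 6) (by decide)]
        exact pow_le_pow_left₀ (abs_nonneg _) (abs_sub _ _) 6
      norm_num at h2
      linarith
    have h4 : (a ^ 4 * χ) ^ 3 ≤ (8 * (κ * S) * (s + e)) ^ 3 := by
      refine pow_le_pow_left₀ ht ?_ 3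
      have : 1 * (s + e) ≤ 8 * (κ * S) * (s + e) := by gcongr; linarith
      linarith
    refine h1.trans ?_
    rw [show (32 * (κ * S) * (s + e)) ^ 3 = 32 * (2 * (8 * (κ * S) * (s + e)) ^ 3) by ring]
    gcongr
    linarith
  have hD6' : lumped 𝒯 (fun x => (φ₁ x - φ₀ x) ^ 6) ≤ (32 * (κ * S) * (s + e)) ^ 3 := by
    refine hD6.trans ?_
    gcongr
    norm_num
  have hN : ∀ (φ : Space d → ℝ) (r : ℝ),
      1 + lumped 𝒯 (fun x => φ x ^ 2) + dirichletForm O φ φ ≤ 8 * energy 𝒯 φ r := by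
    intro φ r
    have h1 := dirichletForm_nonneg (O := O) φ
    rw [energy]
    nlinarith [sq_nonneg r]
  have hφ : ∀ φ ∈ 𝒯.femSpace, ∀ r, energy 𝒯 φ r ≤ W →
      lumped 𝒯 (fun x => (1 + |φ x|) ^ 6) ≤ (8 * S * W) ^ 3 := by
    intro φ hφ r hr
    refine (hSob 𝒯 φ hφ).2.trans ?_
    rw [show 8 * S * W = S * (8 * W) by ring]
    refine pow_le_pow_left₀ ?_ (mul_le_mul_of_nonneg_left ((hN φ r).trans (by linarith))
      (by positivity)) 3
    have h1 := dirichletForm_nonneg (O := O) φ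
    have h2 : 0 ≤ lumped 𝒯 (fun x => φ x ^ 2) := lumped_nonneg hO 𝒯 fun v => sq_nonneg _
    positivity
  have hy : lumped 𝒯 (fun x => (1 + |φ₀ x| + |φ₁ x - φ₀ x|) ^ 6) ≤ (128 * S * W) ^ 3 := by
    have h1 : lumped 𝒯 (fun x => (1 + |φ₀ x| + |φ₁ x - φ₀ x|) ^ 6)
        ≤ 2048 * (lumped 𝒯 (fun x => (1 + |φ₀ x|) ^ 6) + lumped 𝒯 (fun x => (1 + |φ₁ x|) ^ 6)) := by
      rw [← lumped_add hO, ← lumped_const_mul hO]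
      refine lumped_mono hO 𝒯 fun v => ?_
      have h2 := add_pow_le (show 0 ≤ 1 + |φ₀ v| by positivity) (show 0 ≤ 1 + |φ₁ v| by positivity) 6
      have h3 : (1 + |φ₀ v| + |φ₁ v - φ₀ v|) ^ 6 ≤ (2 * (1 + |φ₀ v| + (1 + |φ₁ v|))) ^ 6 := by
        refine pow_le_pow_left₀ (by positivity) ?_ 6
        have := abs_sub (φ₁ v) (φ₀ v)
        have := abs_nonneg (φ₁ v)
        linarith
      rw [mul_pow] at h3
      norm_num at h2 h3
      linarith
    have h4 := hφ φ₀ h₀ r₀ (by linarith)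
    have h5 := hφ φ₁ h₁ r₁ (by linarith)
    refine h1.trans ?_
    rw [show (128 * S * W) ^ 3 = 2048 * ((8 * S * W) ^ 3 + (8 * S * W) ^ 3) by ring]
    gcongr
  have hβ : 0 ≤ 32 * (κ * S) * (s + e) := by positivity
  -- the weight enters with the power four only, so that the sixth moments suffice
  have hyD := lumped_holder_of_le hO 𝒯 hβ hy hD6'
  have hyZ := lumped_holder_of_le hO 𝒯 hβ hy hZ6
  have hyΘ := lumped_holder_of_le hO 𝒯 ht hy hΘ
  have hZ4 := (lumped_sq_le_of_pow_six hO 𝒯 hβ hZ6).2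
  rw [← hκ] at hZ4
  have hSκ : S ≤ κ * S := le_mul_of_one_le_left (by linarith) hκ1
  have hκκ : κ ≤ κ * S := le_mul_of_one_le_right (by linarith) hS
  set B := κ * S with hB
  have hB2 : B ≤ B ^ 3 := le_self_pow₀ hκS (by norm_num)
  have hse : s + e ≤ W := by linarith
  have hse0 : 0 ≤ s + e := by linarith
  have hyZ' : (128 * S * W) ^ 2 * (32 * B * (s + e)) ≤ (128 * B) ^ 3 * (W ^ 2 * (s + e)) := by
    calc _ ≤ (128 * B * W) ^ 2 * (128 * B * (s + e)) := by gcongr; norm_num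
      _ = _ := by ring
  have hκB : κ ≤ (128 * B) ^ 3 := by rw [mul_pow]; linarith
  refine ⟨hZ2, ?_, ?_, ?_, ?_, ?_, ?_, hyD.trans hyZ', hyZ.trans hyZ', ?_⟩
  · refine hZ4.trans ?_
    calc _ ≤ B * (128 * B * (s + e)) ^ 2 := by gcongr; norm_num
      _ = 128 ^ 2 * B ^ 3 * ((s + e) * (s + e)) := by ring
      _ ≤ (128 ^ 3 * B ^ 3) * (W * (s + e)) := by gcongr <;> norm_num
      _ = _ := by ring
  · refine hZ6.trans ?_
    calc _ ≤ (128 * B * (s + e)) ^ 3 := by gcongr; norm_num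
      _ = (128 * B) ^ 3 * ((s + e) ^ 2 * (s + e)) := by ring
      _ ≤ _ := by gcongr
  · refine hΘ2.trans ?_
    gcongr
  · refine hΘ4.trans ?_
    rw [show (a ^ 4 * χ) ^ 2 = a ^ 4 * e by rw [he]; ring]
    gcongr
  · refine hD2.trans ?_
    have h1 : 4 ≤ (128 * B) ^ 3 := by rw [mul_pow]; linarith
    have h2 : 2 * κ ≤ (128 * B) ^ 3 := by rw [mul_pow]; linarith
    calc _ = 4 * (a ^ 4 * s) + (2 * κ) * (a ^ 4 * χ) := by ring
      _ ≤ (128 * B) ^ 3 * (a ^ 4 * s) + (128 * B) ^ 3 * (a ^ 4 * χ) := by gcongr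
      _ = _ := by ring
  · refine hy.trans ?_
    rw [← mul_pow]
    gcongr
  · refine hyΘ.trans ?_
    calc _ ≤ (128 * B * W) ^ 2 * (a ^ 4 * χ) := by gcongr
      _ = (128 * B) ^ 2 * (W ^ 2 * (a ^ 4 * χ)) := by ring
      _ ≤ _ := by
        gcongr
        norm_num

/-- The Taylor expansion of the square root, with its remainder expressed by the increment. -/
theorem sqrt_sub_sqrt_expansion {E₀ E₁ : ℝ} (h₀ : 0 < E₀) (h₁ : 0 ≤ E₁) :
    √E₁ - √E₀ = (E₁ - E₀) / (2 * √E₀) - (E₁ - E₀) ^ 2 / (8 * √E₀ ^ 3)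
      + (√E₁ - √E₀) ^ 3 / (2 * √E₀ ^ 2) + (√E₁ - √E₀) ^ 4 / (8 * √E₀ ^ 3) := by
  have h2 : √E₀ ^ 2 = E₀ := Real.sq_sqrt h₀.le
  have h3 : √E₁ ^ 2 = E₁ := Real.sq_sqrt h₁
  have h4 := Real.sqrt_pos.2 h₀
  rw [show E₁ - E₀ = √E₁ ^ 2 - √E₀ ^ 2 by rw [h2, h3]]
  field_simp
  ring

/-- The power `2 + ν` lies between the powers `2` and `3`; the parameter `b` balances the two. -/
theorem abs_rpow_mul_sq_le {ν b : ℝ} (hν : 0 < ν) (hν1 : ν ≤ 1) (hb : 0 < b) (x : ℝ) :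
    |x| ^ ν * x ^ 2 ≤ b ^ ν * (x ^ 2 + |x| ^ 3 / b) := by
  have h1 : (|x| / b) ^ ν ≤ 1 + |x| / b := by
    have hx : 0 ≤ |x| / b := by positivity
    rcases le_total (|x| / b) 1 with h | h
    · exact (Real.rpow_le_one hx h hν.le).trans (by linarith)
    · refine (Real.rpow_le_rpow_of_exponent_le h hν1).trans ?_
      rw [Real.rpow_one]
      linarith
  rw [Real.div_rpow (abs_nonneg x) hb.le, div_le_iff₀ (by positivity)] at h1
  calc _ ≤ (1 + |x| / b) * b ^ ν * x ^ 2 := by gcongr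
    _ = b ^ ν * (x ^ 2 + |x| * |x| ^ 2 / b) := by rw [sq_abs]; ring
    _ = _ := by ring

theorem abs_add_pow_three_le (x y : ℝ) : |x + y| ^ 3 ≤ 4 * (|x| ^ 3 + |y| ^ 3) := by
  have h := add_pow_le (abs_nonneg x) (abs_nonneg y) 3
  norm_num at h
  exact (pow_le_pow_left₀ (abs_nonneg _) (abs_add_le x y) 3).trans h

/-- Young's inequality for the cubic remainder, with weights adapted to `⟨Θ⁴⟩ ≈ a⁸` and
`⟨Z²⟩ ≈ a⁴`. -/
theorem mul_abs_pow_three_le {a : ℝ} (ha : 0 < a) (y z : ℝ) :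
    y ^ 2 * |z| ^ 3 ≤ a ^ 2 / 2 * (y ^ 4 * z ^ 2) + z ^ 4 / (2 * a ^ 2) ∧
    y ^ 2 * |z| ^ 3 ≤ a / 2 * (y ^ 4 * z ^ 2) + z ^ 2 / (4 * a ^ 3) + a / 4 * z ^ 6 := by
  obtain ⟨w, hw⟩ : ∃ w, w = |z| := ⟨_, rfl⟩
  have h2 : z ^ 2 = w ^ 2 := by rw [hw, sq_abs]
  have h4 : z ^ 4 = w ^ 4 := by rw [hw]; exact (Even.pow_abs (by decide) z).symm
  have h6 : z ^ 6 = w ^ 6 := by rw [hw]; exact (Even.pow_abs (by decide) z).symm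
  rw [h2, h4, h6, ← hw]
  constructor
  · have : 0 ≤ (a ^ 2 * (y ^ 2 * w) - w ^ 2) ^ 2 / (2 * a ^ 2) := by positivity
    have e : (a ^ 2 * (y ^ 2 * w) - w ^ 2) ^ 2 / (2 * a ^ 2)
        = a ^ 2 / 2 * (y ^ 4 * w ^ 2) + w ^ 4 / (2 * a ^ 2) - y ^ 2 * w ^ 3 := by
      field_simp
      ring
    linarith
  · have h7 : 0 ≤ (a * (y ^ 2 * w) - w ^ 2) ^ 2 / (2 * a) := by positivity
    have h8 : 0 ≤ (w - a ^ 2 * w ^ 3) ^ 2 / (4 * a ^ 3) := by positivity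
    have e : (a * (y ^ 2 * w) - w ^ 2) ^ 2 / (2 * a) + (w - a ^ 2 * w ^ 3) ^ 2 / (4 * a ^ 3)
        = a / 2 * (y ^ 4 * w ^ 2) + w ^ 2 / (4 * a ^ 3) + a / 4 * w ^ 6 - y ^ 2 * w ^ 3 := by
      field_simp
      ring
    linarith

end Consistency


section Consistency

variable {d : ℕ} {O : Set (Space d)}

open Triangulation

/-- The pointwise bound of the Taylor remainder of the potential, split into the contributions of
the noise `θ` and of `z`. -/
theorem PotentialBounds.abs_taylor_two_le_split {F : ℝ → ℝ} {ν K a : ℝ} (hF : PotentialBounds F ν K)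
    (hν : 0 < ν) (hν1 : ν ≤ 1) (ha : 0 < a) (x z θ : ℝ) :
    |F (x + (z + θ)) - F x - deriv F x * (z + θ) - iteratedDeriv 2 F x / 2 * (z + θ) ^ 2|
      ≤ K * ((a ^ 2) ^ ν * ((z + θ) ^ 2 + 2 * θ ^ 2 + 2 / a ^ 4 * θ ^ 4 + 2 / a ^ 4 * z ^ 2
          + 2 * z ^ 4)
        + (2 * a ^ 2 * ((1 + |x| + |z + θ|) ^ 4 * θ ^ 2) + 2 / a ^ 2 * θ ^ 4
          + 2 * a * ((1 + |x| + |z + θ|) ^ 4 * z ^ 2) + 1 / a ^ 3 * z ^ 2 + a * z ^ 6)) := by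
  refine (hF.taylor_two x (z + θ)).trans ?_
  have hK := hF.one_le
  have h3 := abs_add_pow_three_le z θ
  set y := 1 + |x| + |z + θ| with hy
  have h1 : |z + θ| ^ ν * (z + θ) ^ 2 ≤ (a ^ 2) ^ ν * ((z + θ) ^ 2 + 2 * θ ^ 2 + 2 / a ^ 4 * θ ^ 4
      + 2 / a ^ 4 * z ^ 2 + 2 * z ^ 4) := by
    refine (abs_rpow_mul_sq_le hν hν1 (by positivity : 0 < a ^ 2) _).trans ?_
    refine mul_le_mul_of_nonneg_left ?_ (by positivity)
    have e1 : |z + θ| ^ 3 / a ^ 2 ≤ 4 * (|z| ^ 3 + |θ| ^ 3) / a ^ 2 := by gcongr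
    have e2 : |θ| ^ 3 / a ^ 2 ≤ 1 / 2 * θ ^ 2 + 1 / (2 * a ^ 4) * θ ^ 4 := by
      have h := (mul_abs_pow_three_le ha 1 θ).1
      rw [div_le_iff₀ (by positivity)]
      refine (le_of_eq (by ring)).trans (h.trans (le_of_eq ?_))
      field_simp
    have e3 : |z| ^ 3 / a ^ 2 ≤ 1 / (2 * a ^ 4) * z ^ 2 + 1 / 2 * z ^ 4 := by
      have h := (mul_abs_pow_three_le (inv_pos.2 ha) 1 z).1
      rw [div_le_iff₀ (by positivity)]
      refine (le_of_eq (by ring)).trans (h.trans (le_of_eq ?_))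
      field_simp
    have e4 : 2 / a ^ 4 = 4 * (1 / (2 * a ^ 4)) := by field_simp; norm_num
    have e5 : 4 * (|z| ^ 3 + |θ| ^ 3) / a ^ 2 = 4 * (|z| ^ 3 / a ^ 2) + 4 * (|θ| ^ 3 / a ^ 2) := by
      ring
    rw [e4]
    linear_combination e1 + e5 + 4 * e2 + 4 * e3
  have h2 : y ^ 2 * |z + θ| ^ 3 ≤ 2 * a ^ 2 * (y ^ 4 * θ ^ 2) + 2 / a ^ 2 * θ ^ 4
      + 2 * a * (y ^ 4 * z ^ 2) + 1 / a ^ 3 * z ^ 2 + a * z ^ 6 := by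
    have e1 : y ^ 2 * |z + θ| ^ 3 ≤ 4 * (y ^ 2 * |z| ^ 3) + 4 * (y ^ 2 * |θ| ^ 3) := by
      calc _ ≤ y ^ 2 * (4 * (|z| ^ 3 + |θ| ^ 3)) := by gcongr
        _ = _ := by ring
    have e2 := (mul_abs_pow_three_le ha y θ).1
    have e3 := (mul_abs_pow_three_le ha y z).2
    have e4 : 4 * (θ ^ 4 / (2 * a ^ 2)) = 2 / a ^ 2 * θ ^ 4 := by field_simp; ring
    have e5 : 4 * (z ^ 2 / (4 * a ^ 3)) = 1 / a ^ 3 * z ^ 2 := by field_simp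
    linear_combination e1 + 4 * e2 + 4 * e3 + e4 + e5
  gcongr

/-- The triangle inequality for the six error terms in the expansion of the consistency error; `i` is
the reciprocal of the square root of the discrete energy, and `X` the common order of the terms. -/
theorem abs_consistency_sum_le {Λ X i ρ u q T x : ℝ} (hΛ : 1 ≤ Λ) (hX : 0 ≤ X) (hi : 0 ≤ i)
    (hiΛ : i ≤ Λ) (hρ : |ρ| ≤ 20 * Λ ^ 10 * X) (hu : |u| ≤ 2 * Λ ^ 10 * X)
    (hq : |q| ≤ 2 * Λ ^ 10 * X) (hT : |T| ≤ 3 * Λ ^ 10 * X) (hx3 : |x| ^ 3 ≤ 2 * Λ ^ 10 * X)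
    (hx4 : x ^ 4 ≤ 2 * Λ ^ 10 * X) :
    |-(ρ * i / 2) + u * i ^ 3 / 8 - q * i / 4 + T * i ^ 3 / 8 - x ^ 3 * i ^ 2 / 2
      - x ^ 4 * i ^ 3 / 8| ≤ 13 * Λ ^ 13 * X := by
  have b : ∀ (k : ℕ) (z c : ℝ), k ≤ 3 → 0 ≤ c → |z| ≤ c * Λ ^ 10 * X →
      |z * i ^ k| ≤ c * Λ ^ 13 * X := by
    intro k z c hk hc hz
    rw [abs_mul, abs_of_nonneg (pow_nonneg hi k)]
    calc |z| * i ^ k ≤ (c * Λ ^ 10 * X) * Λ ^ 3 := by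
          gcongr
          exact (pow_le_pow_left₀ hi hiΛ k).trans (pow_le_pow_right₀ hΛ hk)
      _ = _ := by ring
  have b1 := b 1 ρ 20 (by norm_num) (by norm_num) hρ
  have b2 := b 3 u 2 (by norm_num) (by norm_num) hu
  have b3 := b 1 q 2 (by norm_num) (by norm_num) hq
  have b4 := b 3 T 3 (by norm_num) (by norm_num) hT
  have b5 := b 2 (x ^ 3) 2 (by norm_num) (by norm_num) (by rwa [abs_pow])
  have b6 := b 3 (x ^ 4) 2 (by norm_num) (by norm_num) (by
    rwa [abs_of_nonneg (by positivity)])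
  rw [pow_one] at b1 b3
  rw [abs_le] at *
  have : 0 ≤ Λ ^ 13 * X := by positivity
  constructor <;> linarith [b1.1, b1.2, b2.1, b2.2, b3.1, b3.2, b4.1, b4.2, b5.1, b5.2, b6.1, b6.2]

/-- Bounds for the products of order three in the increment; `p` is the linear and `G` the full
increment of the energy, `x` the increment of its square root. -/
theorem cubic_bounds {Λ a W s e χ δ G p x : ℝ} (hΛ : 1 ≤ Λ) (ha : 0 < a) (ha1 : a ≤ 1)
    (hW : 1 ≤ W) (hs : 0 ≤ s) (he : e = a ^ 4 * χ ^ 2) (hχ : 1 ≤ χ) (hse : s + e ≤ W) (hδ0 : 0 ≤ δ)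
    (hδ : δ ≤ Λ * (a ^ 4 * (s + χ))) (hG : G ^ 2 ≤ Λ ^ 3 * (W ^ 3 * δ))
    (hp : p ^ 2 ≤ Λ ^ 3 * (W ^ 3 * δ)) (hGp : (G - p) ^ 2 ≤ Λ ^ 3 * (W ^ 2 * (s + e) * δ))
    (hx : x ^ 2 ≤ Λ * G ^ 2) :
    |G ^ 2 - p ^ 2| ≤ 3 * Λ ^ 10 * (a * W ^ 7 * (s + e)) ∧
    |x| ^ 3 ≤ 2 * Λ ^ 10 * (a * W ^ 7 * (s + e)) ∧
    x ^ 4 ≤ 2 * Λ ^ 10 * (a * W ^ 7 * (s + e)) := by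
  have he0 : 0 ≤ e := by rw [he]; positivity
  have hχ0 : 0 ≤ χ := by linarith
  have hse0 : 0 ≤ s + e := by linarith
  have ha4 : a ^ 4 ≤ 1 := pow_le_one₀ ha.le ha1
  have hδ2 : δ ^ 2 ≤ 2 * Λ ^ 2 * (a ^ 4 * (W * (s + e))) := by
    calc δ ^ 2 ≤ (Λ * (a ^ 4 * (s + χ))) ^ 2 := pow_le_pow_left₀ hδ0 hδ 2
      _ = Λ ^ 2 * (a ^ 4 * (a ^ 4 * (s + χ) ^ 2)) := by ring
      _ ≤ Λ ^ 2 * (a ^ 4 * (2 * (W * (s + e)))) := by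
        refine mul_le_mul_of_nonneg_left (mul_le_mul_of_nonneg_left ?_ (by positivity))
          (by positivity)
        have h1 : (s + χ) ^ 2 ≤ 2 * s ^ 2 + 2 * χ ^ 2 := by nlinarith [sq_nonneg (s - χ)]
        have h2 : a ^ 4 * (s + χ) ^ 2 ≤ a ^ 4 * (2 * s ^ 2 + 2 * χ ^ 2) := by gcongr
        have h3 : a ^ 4 * s ^ 2 ≤ 1 * s ^ 2 := by gcongr
        have h4 : s * s ≤ W * s := by gcongr; linarith
        have h5 : 1 * e ≤ W * e := by gcongr
        linear_combination h2 + 2 * h3 + 2 * h4 + 2 * h5 - 2 * he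
      _ = _ := by ring
  have hδ1 : δ ≤ Λ * (s + e) := by
    refine hδ.trans ?_
    gcongr
    rw [mul_add, he]
    have h3 : a ^ 4 * s ≤ 1 * s := by gcongr
    have h4 : a ^ 4 * χ ≤ a ^ 4 * χ ^ 2 := by
      gcongr
      exact le_self_pow₀ hχ (by norm_num)
    linarith
  have hsq : δ ^ 2 * (s + e) ≤ 2 * Λ ^ 2 * (a ^ 4 * (W * (s + e) ^ 2)) := by
    calc _ ≤ (2 * Λ ^ 2 * (a ^ 4 * (W * (s + e)))) * (s + e) := by gcongr
      _ = _ := by ring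
  have hxx : x ^ 2 ≤ Λ ^ 4 * (W ^ 3 * δ) := by
    calc x ^ 2 ≤ Λ * G ^ 2 := hx
      _ ≤ Λ * (Λ ^ 3 * (W ^ 3 * δ)) := by gcongr
      _ = _ := by ring
  refine ⟨?_, ?_, ?_⟩
  · refine abs_le_of_sq_le_sq ?_ (by positivity)
    have h1 : (G + p) ^ 2 ≤ 2 * G ^ 2 + 2 * p ^ 2 := by nlinarith [sq_nonneg (G - p)]
    calc (G ^ 2 - p ^ 2) ^ 2 = (G - p) ^ 2 * (G + p) ^ 2 := by ring
      _ ≤ (Λ ^ 3 * (W ^ 2 * (s + e) * δ)) * (4 * (Λ ^ 3 * (W ^ 3 * δ))) := by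
        gcongr
        linarith
      _ = 4 * Λ ^ 6 * W ^ 5 * (δ ^ 2 * (s + e)) := by ring
      _ ≤ 4 * Λ ^ 6 * W ^ 5 * (2 * Λ ^ 2 * (a ^ 4 * (W * (s + e) ^ 2))) := by gcongr
      _ = 8 * Λ ^ 8 * a ^ 4 * W ^ 6 * (s + e) ^ 2 := by ring
      _ ≤ 9 * Λ ^ 20 * a ^ 2 * W ^ 14 * (s + e) ^ 2 := by
        have h2 : a ^ 4 ≤ a ^ 2 := pow_le_pow_of_le_one ha.le ha1 (by norm_num)
        gcongr <;> norm_num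
      _ = _ := by ring
  · refine le_of_pow_le_pow_left₀ (n := 2) (by norm_num) (by positivity) ?_
    calc (|x| ^ 3) ^ 2 = (x ^ 2) ^ 3 := by rw [← sq_abs x]; ring
      _ ≤ (Λ ^ 4 * (W ^ 3 * δ)) ^ 3 := pow_le_pow_left₀ (sq_nonneg x) hxx 3
      _ = Λ ^ 12 * W ^ 9 * (δ ^ 2 * δ) := by ring
      _ ≤ Λ ^ 12 * W ^ 9 * (δ ^ 2 * (Λ * (s + e))) := by gcongr
      _ = Λ ^ 13 * W ^ 9 * (δ ^ 2 * (s + e)) := by ring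
      _ ≤ Λ ^ 13 * W ^ 9 * (2 * Λ ^ 2 * (a ^ 4 * (W * (s + e) ^ 2))) := by gcongr
      _ = 2 * Λ ^ 15 * a ^ 4 * W ^ 10 * (s + e) ^ 2 := by ring
      _ ≤ 4 * Λ ^ 20 * a ^ 2 * W ^ 14 * (s + e) ^ 2 := by
        have h2 : a ^ 4 ≤ a ^ 2 := pow_le_pow_of_le_one ha.le ha1 (by norm_num)
        gcongr <;> norm_num
      _ = _ := by ring
  · calc x ^ 4 = (x ^ 2) ^ 2 := by ring
      _ ≤ (Λ ^ 4 * (W ^ 3 * δ)) ^ 2 := pow_le_pow_left₀ (sq_nonneg x) hxx 2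
      _ = Λ ^ 8 * W ^ 6 * δ ^ 2 := by ring
      _ ≤ Λ ^ 8 * W ^ 6 * (2 * Λ ^ 2 * (a ^ 4 * (W * (s + e)))) := by gcongr
      _ = 2 * Λ ^ 10 * (a ^ 4 * W ^ 7 * (s + e)) := by ring
      _ ≤ _ := by
        have h2 : a ^ 4 ≤ a := pow_le_of_le_one ha.le ha1 (by norm_num)
        gcongr

set_option maxHeartbeats 2000000 in
/-- The scalar auxiliary variable and the square root of the discrete energy have the same
increments, up to an error that is small compared to the dissipation `s` plus `e = τ χ²`.  Here
`a = τ^(1/4)`, and `ϱ` stands for the rate `τ^min(ν/2, 1/4)`: the Hölder remainder of the potential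
contributes `(a²)^ν = τ^(ν/2)`, all other terms contribute `a`.  The part of the error that is quadratic
in the noise cancels, since the scheme contains the second derivative of the square root of the energy
in the direction of the noise. -/
theorem exists_consistency (hd : d = 2 ∨ d = 3) (hO : IsConvexPolyhedralDomain O)
    {F : ℝ → ℝ} {ν K : ℝ} (hF : PotentialBounds F ν K) (hν : 0 < ν) (hν1 : ν ≤ 1) :
    ∃ C ≥ 1, ∀ (𝒯 : Triangulation O) (a ϱ χ W s e : ℝ) (φ₀ φ₁ Θ : Space d → ℝ) (r₀ r₁ : ℝ),
      0 < a → a ≤ 1 → a ≤ ϱ → (a ^ 2) ^ ν ≤ ϱ → 1 ≤ χ → φ₀ ∈ 𝒯.femSpace → φ₁ ∈ 𝒯.femSpace →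
      lumped 𝒯 (fun x => Θ x ^ 6) ≤ (a ^ 4 * χ) ^ 3 →
      s = dissipation 𝒯 (a ^ 4) (φ₁ - φ₀) Θ → e = a ^ 4 * χ ^ 2 →
      W = energy 𝒯 φ₀ r₀ + energy 𝒯 φ₁ r₁ + (s + e) →
      IsStep 𝒯 F (a ^ 4) Θ φ₀ r₀ φ₁ r₁ →
      |r₁ - r₀ - (√(discEnergy 𝒯 F φ₁) - √(discEnergy 𝒯 F φ₀))| ≤ C * (ϱ * W ^ 7 * (s + e)) := by
  obtain ⟨B, hB, hmom⟩ := exists_step_moments hd hO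
  have hK := hF.one_le
  have hvol := hO.volume_real_pos
  set m := 1 + K / volume.real O with hm
  have hm1 : 1 ≤ m := by
    have : 0 ≤ K / volume.real O := by positivity
    linarith
  set Λ := m * K * B with hΛ
  have hΛ1 : 1 ≤ Λ := one_le_mul_of_one_le_of_one_le (one_le_mul_of_one_le_of_one_le hm1 hK) hB
  have hKΛ : K ≤ Λ := by
    rw [hΛ, mul_right_comm]
    exact le_mul_of_one_le_left (by linarith) (one_le_mul_of_one_le_of_one_le hm1 hB)
  have hBΛ : B ≤ Λ :=
    le_mul_of_one_le_left (by linarith) (one_le_mul_of_one_le_of_one_le hm1 hK)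
  have hmΛ : m ≤ Λ := by
    rw [hΛ, mul_assoc]
    exact le_mul_of_one_le_right (by linarith) (one_le_mul_of_one_le_of_one_le hK hB)
  clear_value Λ
  refine ⟨13 * Λ ^ 13, by linarith [one_le_pow₀ hΛ1 (n := 13)], ?_⟩
  intro 𝒯 a ϱ χ W s e φ₀ φ₁ Θ r₀ r₁ ha ha1 haϱ hνϱ hχ h₀ h₁ hΘ hs he hW hst
  obtain ⟨hZ2, hZ4, hZ6, hΘ2, hΘ4, hD2, hy6, hyD, hyZ, hyΘ⟩ :=
    hmom 𝒯 a χ W s e φ₀ φ₁ Θ r₀ r₁ ha ha1 hχ h₀ h₁ hΘ hs he hW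
  have hs0 : 0 ≤ s := hs ▸ dissipation_nonneg hO 𝒯 (by positivity) _ _
  have he0 : 0 ≤ e := he ▸ by positivity
  have hχ0 : 0 ≤ χ := by linarith
  have hW1 : 1 ≤ W := by
    have := one_le_energy hO 𝒯 φ₀ r₀
    have := one_le_energy hO 𝒯 φ₁ r₁
    linarith
  have hse : s + e ≤ W := by
    have := one_le_energy hO 𝒯 φ₀ r₀
    have := one_le_energy hO 𝒯 φ₁ r₁
    linarith
  have hse0 : 0 ≤ s + e := by linarith
  have hϱ : 0 < ϱ := ha.trans_le haϱ
  have ha4 : a ^ 4 ≤ 1 := pow_le_one₀ ha.le ha1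
  have hte : a ^ 4 * χ ≤ e := by
    rw [he]
    gcongr
    exact le_self_pow₀ hχ (by norm_num)
  obtain ⟨-, hvE, hE⟩ := hF.volume_le_discEnergy hO 𝒯 φ₀
  obtain ⟨-, -, hE1⟩ := hF.volume_le_discEnergy hO 𝒯 φ₁
  have haux := hst.auxiliary_eq hE
  have hsqrt := sqrt_sub_sqrt_expansion hE hE1.le
  have ha0 : 0 < √(discEnergy 𝒯 F φ₀) := Real.sqrt_pos.2 hE
  have ha0E : √(discEnergy 𝒯 F φ₀) ^ 2 = discEnergy 𝒯 F φ₀ := Real.sq_sqrt hE.le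
  -- the pointwise increment, the weight and their moments
  obtain ⟨Z, hZ⟩ : ∃ Z : Space d → ℝ, Z = fun x => φ₁ x - φ₀ x - Θ x := ⟨_, rfl⟩
  obtain ⟨D, hDdef⟩ : ∃ D : Space d → ℝ, D = fun x => φ₁ x - φ₀ x := ⟨_, rfl⟩
  obtain ⟨y, hy⟩ : ∃ y : Space d → ℝ, y = fun x => 1 + |φ₀ x| + |D x| := ⟨_, rfl⟩
  have hDx : ∀ x, φ₁ x - φ₀ x = D x := fun x => by rw [hDdef]
  have hZx : ∀ x, D x - Θ x = Z x := fun x => by rw [hZ, hDdef]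
  have hyx : ∀ x, 1 + |φ₀ x| + |D x| = y x := fun x => by rw [hy]
  simp only [hDx, hZx, hyx] at hZ2 hZ4 hZ6 hD2 hy6 hyD hyZ hyΘ
  have hDZ : ∀ x, D x = Z x + Θ x := fun x => by rw [← hZx]; ring
  have hφ1 : ∀ x, φ₁ x = φ₀ x + D x := fun x => by rw [← hDx]; ring
  have hy1 : ∀ x, 1 ≤ y x := fun x => by
    rw [← hyx]
    linarith [abs_nonneg (φ₀ x), abs_nonneg (D x)]
  have hy2 : ∀ x, 1 + |φ₀ x| ≤ y x := fun x => by
    rw [← hyx]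
    linarith [abs_nonneg (D x)]
  have hF1 : ∀ x, |deriv F (φ₀ x)| ≤ K * y x ^ 3 := fun x =>
    (hF.deriv_le _).trans (by have := hy2 x; gcongr)
  have hF2 : ∀ x, |iteratedDeriv 2 F (φ₀ x)| ≤ K * y x ^ 2 := fun x =>
    (hF.deriv_two_le _).trans (by have := hy2 x; gcongr)
  set δ := lumped 𝒯 (fun x => D x ^ 2) with hδ
  have hδ0 : 0 ≤ δ := lumped_nonneg hO 𝒯 fun v => sq_nonneg _
  have hZ20 : 0 ≤ lumped 𝒯 (fun x => Z x ^ 2) := lumped_nonneg hO 𝒯 fun v => sq_nonneg _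
  have hy60 : 0 ≤ lumped 𝒯 (fun x => y x ^ 6) := lumped_nonneg hO 𝒯 fun v => by
    have := hy1 v; positivity
  have hyD0 : 0 ≤ lumped 𝒯 (fun x => y x ^ 4 * D x ^ 2) := lumped_nonneg hO 𝒯 fun v => by
    positivity
  set p := lumped 𝒯 (fun x => deriv F (φ₀ x) * D x) with hp
  set pZ := lumped 𝒯 (fun x => deriv F (φ₀ x) * Z x) with hpZ
  set q := lumped 𝒯 (fun x => iteratedDeriv 2 F (φ₀ x) * D x ^ 2) with hq
  set qZ := lumped 𝒯 (fun x => iteratedDeriv 2 F (φ₀ x) * Z x * D x) with hqZ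
  obtain ⟨ρ, hρ⟩ : ∃ ρ, ρ = discEnergy 𝒯 F φ₁ - discEnergy 𝒯 F φ₀ - p - 1 / 2 * q := ⟨_, rfl⟩
  obtain ⟨G, hG⟩ : ∃ G, G = discEnergy 𝒯 F φ₁ - discEnergy 𝒯 F φ₀ := ⟨_, rfl⟩
  obtain ⟨x, hx⟩ : ∃ x, x = √(discEnergy 𝒯 F φ₁) - √(discEnergy 𝒯 F φ₀) := ⟨_, rfl⟩
  obtain ⟨i, hi⟩ : ∃ i, i = 1 / √(discEnergy 𝒯 F φ₀) := ⟨_, rfl⟩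
  have hi0 : 0 ≤ i := hi ▸ by positivity
  have hi2 : i ^ 2 ≤ m := by
    rw [hi, div_pow, one_pow, ha0E, div_le_iff₀ hE]
    have h1 : volume.real O ≤ (m * volume.real O) * discEnergy 𝒯 F φ₀ := by
      have h2 : m * volume.real O = volume.real O + K := by
        rw [hm]
        field_simp
      rw [h2]
      have := mul_pos hvol hE
      linarith
    have h3 : volume.real O * 1 ≤ volume.real O * (m * discEnergy 𝒯 F φ₀) := by linarith
    exact le_of_mul_le_mul_left h3 hvol
  have hiΛ : i ≤ Λ := by
    refine le_trans ?_ hmΛ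
    nlinarith
  -- after the cancellations every term is of order three in the increment, or contains the factor `Z`,
  -- which is smaller than `D` and `Θ`
  have hid : r₁ - r₀ - (√(discEnergy 𝒯 F φ₁) - √(discEnergy 𝒯 F φ₀))
      = -(ρ * i / 2) + (pZ * p) * i ^ 3 / 8 - qZ * i / 4 + (G ^ 2 - p ^ 2) * i ^ 3 / 8
        - x ^ 3 * i ^ 2 / 2 - x ^ 4 * i ^ 3 / 8 := by
    have e1 : lumped 𝒯 (fun x => deriv F (φ₀ x) * Θ x) = p - pZ := by
      rw [hp, hpZ, ← lumped_sub hO]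
      congr 1
      funext v
      rw [hDZ]
      ring
    have e2 : lumped 𝒯 (fun x => iteratedDeriv 2 F (φ₀ x) * Θ x * D x) = q - qZ := by
      rw [hq, hqZ, ← lumped_sub hO]
      congr 1
      funext v
      rw [hDZ]
      ring
    rw [haux, correctedSlope]
    simp only [Pi.sub_apply, hDx]
    rw [e1, e2, ← hp, hsqrt, ← hG, ← hx]
    have e3 : G = p + 1 / 2 * q + ρ := by rw [hρ, hG]; ring
    have e4 : ρ = G - p - 1 / 2 * q := by linarith
    rw [e4, hi]
    field_simp
    ring
  -- the Taylor remainder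
  have hρ' : |ρ| ≤ 20 * Λ ^ 10 * (ϱ * W ^ 7 * (s + e)) := by
    have h1 : ρ = lumped 𝒯 (fun x => F (φ₁ x) - F (φ₀ x) - deriv F (φ₀ x) * D x
        - 1 / 2 * (iteratedDeriv 2 F (φ₀ x) * D x ^ 2)) := by
      rw [lumped_sub hO, lumped_sub hO, lumped_sub hO, lumped_const_mul hO, hρ]
      rfl
    have h2 : |ρ| ≤ K * ((a ^ 2) ^ ν * (δ + 2 * lumped 𝒯 (fun x => Θ x ^ 2)
          + 2 / a ^ 4 * lumped 𝒯 (fun x => Θ x ^ 4) + 2 / a ^ 4 * lumped 𝒯 (fun x => Z x ^ 2)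
          + 2 * lumped 𝒯 (fun x => Z x ^ 4))
        + (2 * a ^ 2 * lumped 𝒯 (fun x => y x ^ 4 * Θ x ^ 2)
          + 2 / a ^ 2 * lumped 𝒯 (fun x => Θ x ^ 4)
          + 2 * a * lumped 𝒯 (fun x => y x ^ 4 * Z x ^ 2)
          + 1 / a ^ 3 * lumped 𝒯 (fun x => Z x ^ 2) + a * lumped 𝒯 (fun x => Z x ^ 6))) := by
      rw [h1, hδ]
      simp only [← lumped_const_mul hO, ← lumped_add hO]
      refine abs_lumped_le hO 𝒯 fun v => ?_
      have h3 := hF.abs_taylor_two_le_split hν hν1 ha (φ₀ v) (Z v) (Θ v)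
      rw [← hDZ, ← hφ1, hyx] at h3
      refine le_trans (le_of_eq ?_) h3
      congr 1
      ring
    have k1 : δ ≤ B * (s + e) := by
      refine hD2.trans ?_
      gcongr
      have : a ^ 4 * s ≤ 1 * s := by gcongr
      linarith
    have k2 : lumped 𝒯 (fun x => Θ x ^ 2) ≤ B * (s + e) := hΘ2.trans (by gcongr; linarith)
    have k3 : 2 / a ^ 4 * lumped 𝒯 (fun x => Θ x ^ 4) ≤ 2 * (B * (s + e)) := by
      calc _ ≤ 2 / a ^ 4 * (B * (a ^ 4 * e)) := by gcongr
        _ = 2 * (B * e) := by field_simp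
        _ ≤ _ := by gcongr; linarith
    have k4 : 2 / a ^ 4 * lumped 𝒯 (fun x => Z x ^ 2) ≤ 4 * (B * (s + e)) := by
      calc _ ≤ 2 / a ^ 4 * (2 * (a ^ 4 * s)) := by gcongr
        _ = 4 * (1 * s) := by field_simp; ring
        _ ≤ _ := by gcongr; linarith
    have k5 : B * (s + e) * 1 ≤ B * (s + e) * W := by gcongr
    have k6 : B * (W * (s + e)) * 1 ≤ B * (W * (s + e)) * W := by gcongr
    have k7 : 2 * a ^ 2 * lumped 𝒯 (fun x => y x ^ 4 * Θ x ^ 2) ≤ 2 * (a * (B * (W ^ 2 * (s + e)))) := by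
      calc _ ≤ 2 * a ^ 2 * (B * (W ^ 2 * (a ^ 4 * χ))) := by gcongr
        _ ≤ 2 * a * (B * (W ^ 2 * (s + e))) := by
          have : a ^ 2 ≤ a := pow_le_of_le_one ha.le ha1 (by norm_num)
          gcongr
          linarith
        _ = _ := by ring
    have k8 : 2 / a ^ 2 * lumped 𝒯 (fun x => Θ x ^ 4) ≤ 2 * (a * (B * (W ^ 2 * (s + e)))) := by
      calc _ ≤ 2 / a ^ 2 * (B * (a ^ 4 * e)) := by gcongr
        _ = 2 * (a ^ 2 * (B * (1 * e))) := by field_simp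
        _ ≤ _ := by
          have : a ^ 2 ≤ a := pow_le_of_le_one ha.le ha1 (by norm_num)
          have : 1 ≤ W ^ 2 := one_le_pow₀ hW1
          gcongr
          linarith
    have k9 : 2 * a * lumped 𝒯 (fun x => y x ^ 4 * Z x ^ 2) ≤ 2 * (a * (B * (W ^ 2 * (s + e)))) := by
      calc _ ≤ 2 * a * (B * (W ^ 2 * (s + e))) := by gcongr
        _ = _ := by ring
    have k10 : 1 / a ^ 3 * lumped 𝒯 (fun x => Z x ^ 2) ≤ 2 * (a * (B * (W ^ 2 * (s + e)))) := by
      calc _ ≤ 1 / a ^ 3 * (2 * (a ^ 4 * s)) := by gcongr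
        _ = 2 * (a * (1 * (1 * s))) := by field_simp
        _ ≤ _ := by
          have : 1 ≤ W ^ 2 := one_le_pow₀ hW1
          gcongr
          linarith
    have k11 : a * lumped 𝒯 (fun x => Z x ^ 6) ≤ a * (B * (W ^ 2 * (s + e))) := by gcongr
    refine h2.trans ?_
    have m1 : δ + 2 * lumped 𝒯 (fun x => Θ x ^ 2)
          + 2 / a ^ 4 * lumped 𝒯 (fun x => Θ x ^ 4) + 2 / a ^ 4 * lumped 𝒯 (fun x => Z x ^ 2)
          + 2 * lumped 𝒯 (fun x => Z x ^ 4) ≤ 11 * (B * (W ^ 2 * (s + e))) := by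
      linear_combination k1 + 2 * k2 + k3 + k4 + 2 * hZ4 + 9 * k5 + 11 * k6
    have m2 : (a ^ 2) ^ ν * (δ + 2 * lumped 𝒯 (fun x => Θ x ^ 2)
          + 2 / a ^ 4 * lumped 𝒯 (fun x => Θ x ^ 4) + 2 / a ^ 4 * lumped 𝒯 (fun x => Z x ^ 2)
          + 2 * lumped 𝒯 (fun x => Z x ^ 4)) ≤ ϱ * (11 * (B * (W ^ 2 * (s + e)))) :=
      (mul_le_mul_of_nonneg_left m1 (by positivity)).trans
        (mul_le_mul_of_nonneg_right hνϱ (by positivity))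
    have m3 : a * (B * (W ^ 2 * (s + e))) ≤ ϱ * (B * (W ^ 2 * (s + e))) := by gcongr
    calc _ ≤ K * (20 * (ϱ * (B * (W ^ 2 * (s + e))))) := by
          gcongr
          linarith
      _ = 20 * (K * B) * (ϱ * W ^ 2 * (s + e)) := by ring
      _ ≤ 20 * (Λ ^ 10) * (ϱ * W ^ 7 * (s + e)) := by
        have n1 : K * B ≤ Λ ^ 10 := by
          calc K * B ≤ Λ * Λ := by gcongr
            _ = Λ ^ 2 := by ring
            _ ≤ Λ ^ 10 := pow_le_pow_right₀ hΛ1 (by norm_num)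
        gcongr
        norm_num
  have hδs : δ ≤ B * (s + e) := by
    refine hD2.trans ?_
    gcongr
    have : a ^ 4 * s ≤ 1 * s := by gcongr
    linarith
  have hqZ' : |qZ| ≤ 2 * Λ ^ 10 * (ϱ * W ^ 7 * (s + e)) := by
    have h1 : |qZ| ≤ K * (a / 2 * lumped 𝒯 (fun x => y x ^ 4 * D x ^ 2)
        + 1 / (2 * a) * lumped 𝒯 (fun x => Z x ^ 2)) := by
      simp only [← lumped_const_mul hO, ← lumped_add hO]
      refine abs_lumped_le hO 𝒯 fun v => ?_
      rw [abs_mul, abs_mul]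
      have h2 : y v ^ 2 * |Z v| * |D v| ≤ a / 2 * (y v ^ 4 * D v ^ 2) + 1 / (2 * a) * Z v ^ 2 := by
        have h3 : 0 ≤ (a * (y v ^ 2 * |D v|) - |Z v|) ^ 2 / (2 * a) := by positivity
        have h4 : (a * (y v ^ 2 * |D v|) - |Z v|) ^ 2 / (2 * a)
            = a / 2 * (y v ^ 4 * |D v| ^ 2) + 1 / (2 * a) * |Z v| ^ 2 - y v ^ 2 * |Z v| * |D v| := by
          field_simp
          ring
        rw [← sq_abs (D v), ← sq_abs (Z v)]
        linarith
      calc _ ≤ (K * y v ^ 2) * |Z v| * |D v| := by gcongr; exact hF2 v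
        _ = K * (y v ^ 2 * |Z v| * |D v|) := by ring
        _ ≤ _ := by gcongr
    have k1 : a / 2 * lumped 𝒯 (fun x => y x ^ 4 * D x ^ 2) ≤ ϱ * (B * (W ^ 2 * (s + e))) := by
      gcongr
      linarith
    have k2 : 1 / (2 * a) * lumped 𝒯 (fun x => Z x ^ 2) ≤ ϱ * (B * (W ^ 2 * (s + e))) := by
      calc _ ≤ 1 / (2 * a) * (2 * (a ^ 4 * s)) := by gcongr
        _ = a ^ 3 * (1 * (1 * s)) := by field_simp
        _ ≤ _ := by
          have : 1 ≤ W ^ 2 := one_le_pow₀ hW1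
          have : a ^ 3 ≤ ϱ := (pow_le_of_le_one ha.le ha1 (by norm_num)).trans haϱ
          gcongr
          linarith
    calc _ ≤ K * (2 * (ϱ * (B * (W ^ 2 * (s + e))))) := h1.trans (by gcongr; linarith)
      _ = 2 * (K * B) * (ϱ * W ^ 2 * (s + e)) := by ring
      _ ≤ 2 * (Λ ^ 10) * (ϱ * W ^ 7 * (s + e)) := by
        have n1 : K * B ≤ Λ ^ 10 := by
          calc K * B ≤ Λ * Λ := by gcongr
            _ = Λ ^ 2 := by ring
            _ ≤ Λ ^ 10 := pow_le_pow_right₀ hΛ1 (by norm_num)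
        gcongr
        norm_num
  -- weighted Cauchy-Schwarz inequality for the first derivative
  have hlin : ∀ w : Space d → ℝ, ∀ b : Space d → ℝ, (∀ v, |b v| ≤ K * (y v ^ 3 * |w v|)) →
      lumped 𝒯 b ^ 2 ≤ K ^ 2 * (lumped 𝒯 (fun x => y x ^ 6) * lumped 𝒯 (fun x => w x ^ 2)) := by
    intro w b hb
    rw [← mul_assoc, ← lumped_const_mul hO 𝒯 (K ^ 2) (fun x => y x ^ 6)]
    refine lumped_mul_sq_le hO 𝒯 (fun v => by have := hy1 v; positivity)
      (fun v => sq_nonneg _) fun v => ?_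
    calc b v ^ 2 = |b v| ^ 2 := (sq_abs _).symm
      _ ≤ (K * (y v ^ 3 * |w v|)) ^ 2 := pow_le_pow_left₀ (abs_nonneg _) (hb v) 2
      _ = K ^ 2 * y v ^ 6 * |w v| ^ 2 := by ring
      _ = _ := by rw [sq_abs]
  have hderiv : ∀ w : Space d → ℝ, ∀ v, |deriv F (φ₀ v) * w v| ≤ K * (y v ^ 3 * |w v|) := by
    intro w v
    rw [abs_mul, ← mul_assoc]
    gcongr
    exact hF1 v
  have hp2 := hlin D _ (hderiv D)
  have hpZ2 := hlin Z _ (hderiv Z)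
  rw [← hp] at hp2
  rw [← hpZ] at hpZ2
  have hGl : G = lumped 𝒯 (fun x => F (φ₁ x) - F (φ₀ x)) := by
    rw [lumped_sub hO, hG]
    rfl
  have hG2 : G ^ 2 ≤ K ^ 2 * (lumped 𝒯 (fun x => y x ^ 6) * δ) := by
    rw [hGl]
    refine hlin D _ fun v => ?_
    rw [hφ1, ← hyx]
    exact hF.taylor_zero _ _
  -- `G - p` is quadratic in the increment, so one of its factors is smaller than those of `G` and `p`
  have hGp : (G - p) ^ 2 ≤ K ^ 2 * (lumped 𝒯 (fun x => y x ^ 4 * D x ^ 2) * δ) := by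
    rw [hGl, hp, ← lumped_sub hO, ← mul_assoc,
      ← lumped_const_mul hO 𝒯 (K ^ 2) (fun x => y x ^ 4 * D x ^ 2)]
    refine lumped_mul_sq_le hO 𝒯 (fun v => by positivity) (fun v => sq_nonneg _) fun v => ?_
    have h1 := hF.taylor_one (φ₀ v) (D v)
    rw [← hφ1, hyx] at h1
    rw [← sq_abs]
    calc _ ≤ (K * (y v ^ 2 * D v ^ 2)) ^ 2 := pow_le_pow_left₀ (abs_nonneg _) h1 2
      _ = _ := by ring
  have hΛ3 : ∀ z : ℝ, 0 ≤ z → K ^ 2 * (B * z) ≤ Λ ^ 3 * z := by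
    intro z hz
    calc K ^ 2 * (B * z) ≤ Λ ^ 2 * (Λ * z) := by gcongr
      _ = _ := by ring
  have hu : |pZ * p| ≤ 2 * Λ ^ 10 * (ϱ * W ^ 7 * (s + e)) := by
    have h1 : |pZ * p| ≤ 1 / (2 * a) * pZ ^ 2 + a / 2 * p ^ 2 := by
      rw [abs_mul]
      have h3 : 0 ≤ (a * |p| - |pZ|) ^ 2 / (2 * a) := by positivity
      have h4 : (a * |p| - |pZ|) ^ 2 / (2 * a)
          = 1 / (2 * a) * |pZ| ^ 2 + a / 2 * |p| ^ 2 - |pZ| * |p| := by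
        field_simp
        ring
      rw [← sq_abs p, ← sq_abs pZ]
      linarith
    have h5 : 1 / (2 * a) * pZ ^ 2 ≤ Λ ^ 3 * (ϱ * W ^ 3 * (s + e)) := by
      calc _ ≤ 1 / (2 * a) * (K ^ 2 * ((B * W ^ 3) * (2 * (a ^ 4 * s)))) := by
            gcongr
            exact hpZ2.trans (by gcongr)
        _ = K ^ 2 * (B * (a ^ 3 * W ^ 3 * s)) := by field_simp
        _ ≤ Λ ^ 3 * (a ^ 3 * W ^ 3 * s) := hΛ3 _ (by positivity)
        _ ≤ _ := by
          have : a ^ 3 ≤ ϱ := (pow_le_of_le_one ha.le ha1 (by norm_num)).trans haϱ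
          gcongr
          linarith
    have h6 : a / 2 * p ^ 2 ≤ Λ ^ 4 * (ϱ * W ^ 3 * (s + e)) := by
      calc _ ≤ a / 2 * (K ^ 2 * ((B * W ^ 3) * (B * (s + e)))) := by
            gcongr
            exact hp2.trans (by gcongr)
        _ = a / 2 * (K ^ 2 * (B * (W ^ 3 * (B * (s + e))))) := by ring
        _ ≤ a / 2 * (Λ ^ 3 * (W ^ 3 * (B * (s + e)))) := by
          gcongr ?_ * ?_
          exact hΛ3 _ (by positivity)
        _ ≤ ϱ * (Λ ^ 3 * (W ^ 3 * (Λ * (s + e)))) := by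
          gcongr
          linarith
        _ = _ := by ring
    have h7 : ∀ j ≤ 10, Λ ^ j * (ϱ * W ^ 3 * (s + e)) ≤ Λ ^ 10 * (ϱ * W ^ 7 * (s + e)) := by
      intro j hj
      gcongr
      norm_num
    have h8 := h7 3 (by norm_num)
    have h9 := h7 4 (by norm_num)
    linarith
  have hxG : x ^ 2 ≤ Λ * G ^ 2 := by
    have h1 : x * (√(discEnergy 𝒯 F φ₁) + √(discEnergy 𝒯 F φ₀)) = G := by
      rw [hx, hG]
      have := Real.sq_sqrt hE1.le
      linear_combination this - ha0E
    have h2 : x ^ 2 * discEnergy 𝒯 F φ₀ ≤ G ^ 2 := by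
      have h5 : x ^ 2 * √(discEnergy 𝒯 F φ₀) ^ 2 ≤ G ^ 2 := by
        rw [← h1, mul_pow]
        gcongr
        linarith [Real.sqrt_nonneg (discEnergy 𝒯 F φ₁)]
      rwa [ha0E] at h5
    have h3 : x ^ 2 = i ^ 2 * (x ^ 2 * discEnergy 𝒯 F φ₀) := by
      rw [hi, div_pow, one_pow, ha0E]
      field_simp
    rw [h3]
    have h4 : i ^ 2 ≤ Λ := hi2.trans hmΛ
    gcongr
  obtain ⟨hT, hx3, hx4⟩ := cubic_bounds (Λ := Λ) (p := p) (G := G) (x := x) hΛ1 ha ha1 hW1 hs0 he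
    hχ hse hδ0 (hD2.trans (by gcongr))
    (hG2.trans (by
      calc _ ≤ K ^ 2 * ((B * W ^ 3) * δ) := by gcongr
        _ = K ^ 2 * (B * (W ^ 3 * δ)) := by ring
        _ ≤ _ := hΛ3 _ (by positivity)))
    (hp2.trans (by
      calc _ ≤ K ^ 2 * ((B * W ^ 3) * δ) := by gcongr
        _ = K ^ 2 * (B * (W ^ 3 * δ)) := by ring
        _ ≤ _ := hΛ3 _ (by positivity)))
    (hGp.trans (by
      calc _ ≤ K ^ 2 * ((B * (W ^ 2 * (s + e))) * δ) := by gcongr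
        _ = K ^ 2 * (B * (W ^ 2 * (s + e) * δ)) := by ring
        _ ≤ _ := hΛ3 _ (by positivity))) hxG
  have hXa : a * W ^ 7 * (s + e) ≤ ϱ * W ^ 7 * (s + e) := by gcongr
  rw [hid]
  exact abs_consistency_sum_le hΛ1 (by positivity) hi0 hiΛ hρ' hu hqZ'
    (hT.trans (by gcongr)) (hx3.trans (by gcongr)) (hx4.trans (by gcongr))

end Consistency


/-! ### Moments of linear combinations of independent random variables -/

/-- The remainder of the expansion of a power to first order is of second order in the increment. -/
theorem abs_add_pow_sub_le (x y : ℝ) (n : ℕ) :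
    |(x + y) ^ (n + 2) - x ^ (n + 2) - (n + 2) * x ^ (n + 1) * y|
      ≤ (n + 2) ^ 2 * (y ^ 2 * (|x| + |y|) ^ n) := by
  induction n with
  | zero =>
    have e : (x + y) ^ (0 + 2) - x ^ (0 + 2) - ((0 : ℕ) + 2) * x ^ (0 + 1) * y = y ^ 2 := by
      push_cast; ring
    rw [e, abs_of_nonneg (sq_nonneg y)]
    push_cast
    nlinarith [sq_nonneg y]
  | succ n ih =>
    have e : (x + y) ^ (n + 1 + 2) - x ^ (n + 1 + 2) - ((n + 1 : ℕ) + 2) * x ^ (n + 1 + 1) * y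
        = (x + y) * ((x + y) ^ (n + 2) - x ^ (n + 2) - (n + 2) * x ^ (n + 1) * y)
          + (n + 2) * (x ^ (n + 1) * y ^ 2) := by
      push_cast; ring
    rw [e]
    refine (abs_add_le _ _).trans ?_
    rw [abs_mul, abs_mul ((n : ℝ) + 2), abs_of_nonneg (show (0 : ℝ) ≤ n + 2 by positivity),
      abs_mul (x ^ (n + 1)), abs_of_nonneg (sq_nonneg y), abs_pow]
    have h1 : |x + y| * |(x + y) ^ (n + 2) - x ^ (n + 2) - (n + 2) * x ^ (n + 1) * y|
        ≤ (|x| + |y|) * ((n + 2) ^ 2 * (y ^ 2 * (|x| + |y|) ^ n)) := by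
      gcongr
      exact abs_add_le x y
    have h2 : |x| ^ (n + 1) ≤ (|x| + |y|) ^ (n + 1) := by
      gcongr
      linarith [abs_nonneg y]
    have h3 : ((n : ℝ) + 2) * (|x| ^ (n + 1) * y ^ 2)
        ≤ (n + 2) * ((|x| + |y|) ^ (n + 1) * y ^ 2) := by gcongr
    have h4 : 0 ≤ ((n : ℝ) + 3) * (y ^ 2 * (|x| + |y|) ^ (n + 1)) := by positivity
    push_cast
    linear_combination h1 + h3 + h4

theorem add_pow_even_le (x y : ℝ) (m : ℕ) :
    (x + y) ^ (2 * m + 2) ≤ x ^ (2 * m + 2) + (2 * m + 2) * (x ^ (2 * m + 1) * y)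
      + (2 * m + 2) ^ 2 * 2 ^ (2 * m) * (x ^ (2 * m) * y ^ 2 + y ^ (2 * m + 2)) := by
  have h1 := (abs_le.1 (abs_add_pow_sub_le x y (2 * m))).2
  have h2 : (|x| + |y|) ^ (2 * m) ≤ 2 ^ (2 * m) * (x ^ (2 * m) + y ^ (2 * m)) := by
    have h3 := add_pow_le (abs_nonneg x) (abs_nonneg y) (2 * m)
    rw [(even_two_mul m).pow_abs, (even_two_mul m).pow_abs] at h3
    refine h3.trans ?_
    have : 0 ≤ x ^ (2 * m) := (even_two_mul m).pow_nonneg x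
    have : 0 ≤ y ^ (2 * m) := (even_two_mul m).pow_nonneg y
    gcongr
    · norm_num
    · omega
  have h4 : y ^ 2 * (|x| + |y|) ^ (2 * m) ≤ y ^ 2 * (2 ^ (2 * m) * (x ^ (2 * m) + y ^ (2 * m))) := by
    gcongr
  have h5 := mul_le_mul_of_nonneg_left h4 (show (0 : ℝ) ≤ (2 * m + 2) ^ 2 by positivity)
  push_cast at h1
  have h6 : y ^ (2 * m + 2) = y ^ 2 * y ^ (2 * m) := by ring
  rw [h6]
  linear_combination h1 + h5

section Moments

variable {Ω : Type*} {mΩ : MeasurableSpace Ω} {P : Measure Ω} [IsProbabilityMeasure P]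

theorem memLp_of_integrable_abs_pow {f : Ω → ℝ} (hf : Measurable f)
    (h : ∀ q : ℕ, 2 ≤ q → Integrable (fun ω => |f ω| ^ q) P) (q : ℕ) : MemLp f q P := by
  have h1 : MemLp f ((q + 2 : ℕ) : ℝ≥0∞) P := by
    rw [← integrable_norm_rpow_iff hf.aestronglyMeasurable (by simp) (by simp)]
    simpa only [ENNReal.toReal_natCast, Real.rpow_natCast, Real.norm_eq_abs] using
      h (q + 2) (by omega)
  exact h1.mono_exponent (by exact_mod_cast (by omega : q ≤ q + 2))

omit [IsProbabilityMeasure P] in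
theorem memLp_sum_mul {ι : Type*} {X : ι → Ω → ℝ} (hX : ∀ k, ∀ q : ℕ, MemLp (X k) q P)
    (Z : Finset ι) (b : ι → ℝ) (q : ℕ) : MemLp (fun ω => ∑ k ∈ Z, b k * X k ω) q P :=
  memLp_finsetSum Z fun k _ => (hX k q).const_mul (b k)

theorem integrable_pow_of_memLp {f : Ω → ℝ} {q : ℕ} (hf : MemLp f q P) :
    Integrable (fun ω => f ω ^ q) P := by
  have h := hf.integrable_norm_pow'
  refine h.mono (hf.aestronglyMeasurable.pow q) (ae_of_all _ fun ω => ?_)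
  simp

/-- An inequality of Marcinkiewicz–Zygmund type: the even moments of a linear combination of
independent centred random variables are controlled by the sum of the squared coefficients. -/
theorem exists_integral_sum_pow_le (Cmom : ℕ → ℝ) (m : ℕ) :
    ∃ C ≥ 1, ∀ {ι : Type} (X : ι → Ω → ℝ), (∀ k, Measurable (X k)) → iIndepFun X P →
      (∀ k, ∫ ω, X k ω ∂P = 0) →
      (∀ k, ∀ q : ℕ, 2 ≤ q → Integrable (fun ω => |X k ω| ^ q) P ∧ ∫ ω, |X k ω| ^ q ∂P ≤ Cmom q) →
      ∀ (Z : Finset ι) (b : ι → ℝ),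
        ∫ ω, (∑ k ∈ Z, b k * X k ω) ^ (2 * m) ∂P ≤ C * (∑ k ∈ Z, b k ^ 2) ^ m := by
  induction m with
  | zero => exact ⟨1, le_rfl, fun X _ _ _ _ Z b => by simp⟩
  | succ m ih =>
    obtain ⟨K, hK, ih⟩ := ih
    set A : ℝ := (2 * m + 2) ^ 2 * 2 ^ (2 * m) * (K * |Cmom 2| + |Cmom (2 * m + 2)|) with hA
    have hA0 : 0 ≤ A := by positivity
    refine ⟨1 + 2 * A, by linarith, fun {ι} X hXm hXi hX0 hXq Z b => ?_⟩
    classical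
    have hLp : ∀ k, ∀ q : ℕ, MemLp (X k) q P := fun k q =>
      memLp_of_integrable_abs_pow (hXm k) (fun q hq => (hXq k q hq).1) q
    induction Z using Finset.induction_on with
    | empty => simp
    | insert k Z hk ihZ =>
      have hS : ∀ q : ℕ, MemLp (fun ω => ∑ j ∈ Z, b j * X j ω) q P := memLp_sum_mul hLp Z b
      have hSm : Measurable (fun ω => ∑ j ∈ Z, b j * X j ω) :=
        Finset.measurable_fun_sum Z fun j _ => (hXm j).const_mul (b j)
      have hind : IndepFun (fun ω => ∑ j ∈ Z, b j * X j ω) (fun ω => b k * X k ω) P := by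
        have h1 : iIndepFun (fun j ω => b j * X j ω) P :=
          hXi.comp (fun j x => b j * x) fun j => measurable_const_mul (b j)
        have h2 := h1.indepFun_finsetSum_of_notMem (fun j => (hXm j).const_mul (b j)) hk
        convert! h2 using 1
        ext ω
        simp
      have hpow : ∀ i j : ℕ, IndepFun (fun ω => (∑ j ∈ Z, b j * X j ω) ^ i)
          (fun ω => (b k * X k ω) ^ j) P := fun i j =>
        hind.comp (measurable_id.pow_const i) (measurable_id.pow_const j)
      have hSi : ∀ i : ℕ, Integrable (fun ω => (∑ j ∈ Z, b j * X j ω) ^ i) P := fun i =>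
        integrable_pow_of_memLp (hS i)
      have hYi : ∀ i : ℕ, Integrable (fun ω => (b k * X k ω) ^ i) P := fun i =>
        integrable_pow_of_memLp ((hLp k i).const_mul (b k))
      have hprod : ∀ i j : ℕ, Integrable (fun ω => (∑ j ∈ Z, b j * X j ω) ^ i * (b k * X k ω) ^ j) P :=
        fun i j => (hpow i j).integrable_mul (hSi i) (hYi j)
      have hint : ∀ i j : ℕ, ∫ ω, (∑ j ∈ Z, b j * X j ω) ^ i * (b k * X k ω) ^ j ∂P
          = (∫ ω, (∑ j ∈ Z, b j * X j ω) ^ i ∂P) * ∫ ω, (b k * X k ω) ^ j ∂P := fun i j =>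
        (hpow i j).integral_fun_mul_eq_mul_integral (hSi i).aestronglyMeasurable
          (hYi j).aestronglyMeasurable
      have hY1 : ∫ ω, (b k * X k ω) ^ 1 ∂P = 0 := by
        simp only [pow_one]
        rw [integral_const_mul, hX0, mul_zero]
      have hY2 : ∫ ω, (b k * X k ω) ^ 2 ∂P ≤ b k ^ 2 * |Cmom 2| := by
        simp only [mul_pow]
        rw [integral_const_mul]
        have h1 := (hXq k 2 le_rfl).2
        simp only [sq_abs] at h1
        gcongr
        exact h1.trans (le_abs_self _)
      have hYm : ∫ ω, (b k * X k ω) ^ (2 * m + 2) ∂P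
          ≤ (b k ^ 2) ^ (m + 1) * |Cmom (2 * m + 2)| := by
        simp only [mul_pow]
        rw [integral_const_mul, show 2 * m + 2 = 2 * (m + 1) by ring, pow_mul (b k)]
        have h1 := (hXq k (2 * (m + 1)) (by omega)).2
        simp only [(even_two_mul (m + 1)).pow_abs] at h1
        gcongr
        exact h1.trans (le_abs_self _)
      have hSm' := ih X hXm hXi hX0 hXq Z b
      set σ := ∑ j ∈ Z, b j ^ 2 with hσ
      have hσ0 : 0 ≤ σ := Finset.sum_nonneg fun j _ => sq_nonneg _
      have key : ∫ ω, (∑ j ∈ Z, b j * X j ω + b k * X k ω) ^ (2 * m + 2) ∂P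
          ≤ ∫ ω, (∑ j ∈ Z, b j * X j ω) ^ (2 * m + 2) ∂P
            + (2 * m + 2) ^ 2 * 2 ^ (2 * m) * (K * σ ^ m * (b k ^ 2 * |Cmom 2|)
              + (b k ^ 2) ^ (m + 1) * |Cmom (2 * m + 2)|) := by
        have h0 : Integrable (fun ω => (∑ j ∈ Z, b j * X j ω) ^ (2 * m + 2)
            + (2 * m + 2) * ((∑ j ∈ Z, b j * X j ω) ^ (2 * m + 1) * (b k * X k ω) ^ 1)
            + (2 * m + 2) ^ 2 * 2 ^ (2 * m) * ((∑ j ∈ Z, b j * X j ω) ^ (2 * m)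
              * (b k * X k ω) ^ 2 + (b k * X k ω) ^ (2 * m + 2))) P :=
          ((hSi _).add ((hprod _ _).const_mul _)).add (((hprod _ _).add (hYi _)).const_mul _)
        have h1 := integral_mono (μ := P)
          (f := fun ω => (∑ j ∈ Z, b j * X j ω + b k * X k ω) ^ (2 * m + 2))
          (integrable_pow_of_memLp ((hS (2 * m + 2)).add ((hLp k (2 * m + 2)).const_mul (b k)))) h0
          (fun ω => by
            have := add_pow_even_le (∑ j ∈ Z, b j * X j ω) (b k * X k ω) m
            simpa only [pow_one] using this)
        refine h1.trans ?_
        have hlin : ∀ (f₁ f₂ f₃ f₄ : Ω → ℝ) (a c : ℝ), Integrable f₁ P → Integrable f₂ P →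
            Integrable f₃ P → Integrable f₄ P →
            ∫ ω, (f₁ ω + a * f₂ ω + c * (f₃ ω + f₄ ω)) ∂P
              = ∫ ω, f₁ ω ∂P + a * ∫ ω, f₂ ω ∂P + c * (∫ ω, f₃ ω ∂P + ∫ ω, f₄ ω ∂P) := by
          intro f₁ f₂ f₃ f₄ a c h₁ h₂ h₃ h₄
          have h₁₂ : Integrable (fun ω => f₁ ω + a * f₂ ω) P := h₁.add (h₂.const_mul a)
          have h₃₄ : Integrable (fun ω => c * (f₃ ω + f₄ ω)) P := (h₃.add h₄).const_mul c
          rw [integral_add h₁₂ h₃₄,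
            integral_add h₁ (h₂.const_mul a), integral_const_mul, integral_const_mul,
            integral_add h₃ h₄]
        rw [hlin _ _ _ _ _ _ (hSi _) (hprod _ _) (hprod _ _) (hYi _), hint, hint, hY1, mul_zero,
          mul_zero, add_zero]
        gcongr
      have e1 : (fun ω => (∑ j ∈ insert k Z, b j * X j ω) ^ (2 * (m + 1)))
          = fun ω => (∑ j ∈ Z, b j * X j ω + b k * X k ω) ^ (2 * m + 2) := by
        funext ω
        rw [Finset.sum_insert hk, add_comm, mul_add, mul_one]
      rw [e1, Finset.sum_insert hk, ← hσ]
      refine key.trans ?_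
      rw [show 2 * (m + 1) = 2 * m + 2 by ring] at ihZ
      set β := b k ^ 2 with hβ
      have hβ0 : 0 ≤ β := sq_nonneg _
      have g1 : σ ^ (m + 1) + σ ^ m * β ≤ (β + σ) ^ (m + 1) := by
        have : σ ^ m ≤ (β + σ) ^ m := by gcongr; linarith
        calc σ ^ (m + 1) + σ ^ m * β = σ ^ m * (β + σ) := by ring
          _ ≤ (β + σ) ^ m * (β + σ) := by gcongr
          _ = _ := by ring
      have g2 : σ ^ (m + 1) + β ^ (m + 1) ≤ (β + σ) ^ (m + 1) := by
        rw [add_comm]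
        exact pow_add_pow_le hβ0 hσ0 (by omega)
      have g3 : (2 * (m : ℝ) + 2) ^ 2 * 2 ^ (2 * m) * (K * σ ^ m * (β * |Cmom 2|)
            + β ^ (m + 1) * |Cmom (2 * m + 2)|) ≤ A * (σ ^ m * β + β ^ (m + 1)) := by
        have k1 : 0 ≤ (2 * (m : ℝ) + 2) ^ 2 * 2 ^ (2 * m) * (K * |Cmom 2| * β ^ (m + 1)) := by
          positivity
        have k2 : 0 ≤ (2 * (m : ℝ) + 2) ^ 2 * 2 ^ (2 * m) * (|Cmom (2 * m + 2)| * (σ ^ m * β)) := by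
          positivity
        rw [hA]
        linear_combination k1 + k2
      have g4 := mul_le_mul_of_nonneg_left g1 hA0
      have g5 := mul_le_mul_of_nonneg_left g2 hA0
      have g6 : σ ^ (m + 1) ≤ (β + σ) ^ (m + 1) := by gcongr; linarith
      linear_combination ihZ + g3 + g4 + g5 + g6

end Moments

/-! ### Weighted sums with random weights -/

/-- Jensen's inequality for a sum whose weights have total mass at most `A`. -/
theorem sum_mul_pow_le {ι : Type*} (I : Finset ι) {a ψ : ι → ℝ} {A : ℝ} (ha : ∀ i ∈ I, 0 ≤ a i)
    (hψ : ∀ i ∈ I, 0 ≤ ψ i) (hA : ∑ i ∈ I, a i ≤ A) (m : ℕ) :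
    (∑ i ∈ I, a i * ψ i) ^ (m + 1) ≤ A ^ m * ∑ i ∈ I, a i * ψ i ^ (m + 1) := by
  have hS0 : 0 ≤ ∑ i ∈ I, a i := Finset.sum_nonneg ha
  have hT0 : 0 ≤ ∑ i ∈ I, a i * ψ i ^ (m + 1) :=
    Finset.sum_nonneg fun i hi => mul_nonneg (ha i hi) (pow_nonneg (hψ i hi) _)
  refine le_trans ?_ (mul_le_mul_of_nonneg_right (pow_le_pow_left₀ hS0 hA m) hT0)
  rcases hS0.eq_or_lt with h0 | h0
  · have h1 : ∀ i ∈ I, a i = 0 := (Finset.sum_eq_zero_iff_of_nonneg ha).1 h0.symm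
    have h2 : ∑ i ∈ I, a i * ψ i = 0 := Finset.sum_eq_zero fun i hi => by rw [h1 i hi, zero_mul]
    rw [h2, zero_pow (by omega)]
    positivity
  · set S := ∑ i ∈ I, a i with hS
    have h1 := Real.pow_arith_mean_le_arith_mean_pow I (fun i => a i / S) ψ
      (fun i hi => div_nonneg (ha i hi) hS0) (by rw [← Finset.sum_div, ← hS, div_self h0.ne'])
      hψ (m + 1)
    have e1 : ∑ i ∈ I, a i / S * ψ i = (∑ i ∈ I, a i * ψ i) / S := by
      rw [Finset.sum_div]
      exact Finset.sum_congr rfl fun i _ => by ring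
    have e2 : ∑ i ∈ I, a i / S * ψ i ^ (m + 1) = (∑ i ∈ I, a i * ψ i ^ (m + 1)) / S := by
      rw [Finset.sum_div]
      exact Finset.sum_congr rfl fun i _ => by ring
    rw [e1, e2, div_pow, div_le_div_iff₀ (by positivity) h0] at h1
    refine le_of_mul_le_mul_right (h1.trans (le_of_eq ?_)) h0
    ring


section Independence

variable {Ω : Type*} {mΩ : MeasurableSpace Ω} {P : Measure Ω} [IsProbabilityMeasure P]

omit [IsProbabilityMeasure P] in
theorem indepFun_of_measurable {𝓗 𝓖 : MeasurableSpace Ω} (h : Indep 𝓗 𝓖 P) {f g : Ω → ℝ}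
    (hf : Measurable[𝓗] f) (hg : Measurable[𝓖] g) : IndepFun f g P := by
  rw [IndepFun_iff_Indep]
  exact indep_of_indep_of_le_left (indep_of_indep_of_le_right h hg.comap_le) hf.comap_le

/-- Moments of a weighted sum: the weights `a` are known at the beginning of the step, the terms
`ψ` are independent of the past. -/
theorem integral_mul_sum_pow_le {𝓗 𝓖 : MeasurableSpace Ω} (h𝓗 : 𝓗 ≤ mΩ) (h𝓖 : 𝓖 ≤ mΩ)
    (hind : Indep 𝓗 𝓖 P) {ι : Type*} (I : Finset ι) {a ψ : ι → Ω → ℝ} {A B : ℝ} {m : ℕ}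
    (hB : 0 ≤ B)
    (ha : ∀ i ∈ I, Measurable[𝓖] (a i)) (ha0 : ∀ i ∈ I, ∀ ω, 0 ≤ a i ω)
    (hA : ∀ ω, ∑ i ∈ I, a i ω ≤ A) (hψ : ∀ i ∈ I, Measurable[𝓗] (ψ i))
    (hψ0 : ∀ i ∈ I, ∀ ω, 0 ≤ ψ i ω) (hψi : ∀ i ∈ I, Integrable (fun ω => ψ i ω ^ (m + 1)) P)
    (hψB : ∀ i ∈ I, ∫ ω, ψ i ω ^ (m + 1) ∂P ≤ B) {v : Ω → ℝ} (hv : Measurable[𝓖] v)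
    (hv0 : ∀ ω, 0 ≤ v ω) (hvi : Integrable v P) :
    Integrable (fun ω => v ω * (∑ i ∈ I, a i ω * ψ i ω) ^ (m + 1)) P ∧
      ∫ ω, v ω * (∑ i ∈ I, a i ω * ψ i ω) ^ (m + 1) ∂P ≤ A ^ (m + 1) * B * ∫ ω, v ω ∂P := by
  have hA0 : 0 ≤ A := by
    obtain ⟨ω⟩ : Nonempty Ω := nonempty_of_isProbabilityMeasure P
    exact (Finset.sum_nonneg fun i hi => ha0 i hi ω).trans (hA ω)
  have hv' : Measurable[mΩ] v := hv.mono h𝓖 le_rfl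
  have ha' : ∀ i ∈ I, Measurable[mΩ] (a i) := fun i hi => (ha i hi).mono h𝓖 le_rfl
  have hψ' : ∀ i ∈ I, Measurable[mΩ] (ψ i) := fun i hi => (hψ i hi).mono h𝓗 le_rfl
  have haA : ∀ i ∈ I, ∀ ω, a i ω ≤ A := fun i hi ω =>
    (Finset.single_le_sum (fun j hj => ha0 j hj ω) hi).trans (hA ω)
  have hav : ∀ i ∈ I, Integrable (fun ω => v ω * a i ω) P := fun i hi => by
    refine (hvi.mul_const A).mono (hv'.mul (ha' i hi)).aestronglyMeasurable (ae_of_all _ fun ω => ?_)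
    rw [Real.norm_of_nonneg (mul_nonneg (hv0 ω) (ha0 i hi ω)),
      Real.norm_of_nonneg (mul_nonneg (hv0 ω) hA0)]
    exact mul_le_mul_of_nonneg_left (haA i hi ω) (hv0 ω)
  have hI : ∀ i ∈ I, IndepFun (fun ω => v ω * a i ω) (fun ω => ψ i ω ^ (m + 1)) P := fun i hi =>
    (indepFun_of_measurable hind ((hψ i hi).pow_const _) (hv.mul (ha i hi))).symm
  have hprod : ∀ i ∈ I, Integrable (fun ω => v ω * a i ω * ψ i ω ^ (m + 1)) P := fun i hi =>
    (hI i hi).integrable_mul (hav i hi) (hψi i hi)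
  have hsum : Integrable (fun ω => A ^ m * ∑ i ∈ I, v ω * a i ω * ψ i ω ^ (m + 1)) P :=
    (integrable_finsetSum I hprod).const_mul _
  have hle : ∀ ω, v ω * (∑ i ∈ I, a i ω * ψ i ω) ^ (m + 1)
      ≤ A ^ m * ∑ i ∈ I, v ω * a i ω * ψ i ω ^ (m + 1) := fun ω => by
    have h1 := mul_le_mul_of_nonneg_left (sum_mul_pow_le I (fun i hi => ha0 i hi ω)
      (fun i hi => hψ0 i hi ω) (hA ω) m) (hv0 ω)
    refine h1.trans (le_of_eq ?_)
    rw [mul_left_comm, Finset.mul_sum]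
    simp only [mul_assoc]
  have hnn : ∀ ω, 0 ≤ v ω * (∑ i ∈ I, a i ω * ψ i ω) ^ (m + 1) := fun ω =>
    mul_nonneg (hv0 ω) (pow_nonneg (Finset.sum_nonneg fun i hi =>
      mul_nonneg (ha0 i hi ω) (hψ0 i hi ω)) _)
  have hint : Integrable (fun ω => v ω * (∑ i ∈ I, a i ω * ψ i ω) ^ (m + 1)) P := by
    refine hsum.mono (Measurable.aestronglyMeasurable ?_) (ae_of_all _ fun ω => ?_)
    · exact hv'.mul ((Finset.measurable_fun_sum I fun i hi => (ha' i hi).mul (hψ' i hi)).pow_const _)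
    · rw [Real.norm_of_nonneg (hnn ω), Real.norm_of_nonneg ((hnn ω).trans (hle ω))]
      exact hle ω
  refine ⟨hint, (integral_mono hint hsum hle).trans ?_⟩
  rw [integral_const_mul, integral_finsetSum I hprod]
  have h2 : ∑ i ∈ I, ∫ ω, v ω * a i ω * ψ i ω ^ (m + 1) ∂P ≤ B * (A * ∫ ω, v ω ∂P) := by
    have h3 : ∀ i ∈ I, ∫ ω, v ω * a i ω * ψ i ω ^ (m + 1) ∂P ≤ (∫ ω, v ω * a i ω ∂P) * B := by
      intro i hi
      rw [(hI i hi).integral_fun_mul_eq_mul_integral (hav i hi).aestronglyMeasurable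
        (hψi i hi).aestronglyMeasurable]
      exact mul_le_mul_of_nonneg_left (hψB i hi)
        (integral_nonneg fun ω => mul_nonneg (hv0 ω) (ha0 i hi ω))
    refine (Finset.sum_le_sum h3).trans ?_
    rw [← Finset.sum_mul, ← integral_finsetSum I hav, mul_comm]
    refine mul_le_mul_of_nonneg_left ?_ hB
    rw [← integral_const_mul]
    refine integral_mono (integrable_finsetSum I hav) (hvi.const_mul A) fun ω => ?_
    simp only
    rw [← Finset.mul_sum, mul_comm]
    exact mul_le_mul_of_nonneg_right (hA ω) (hv0 ω)
  calc _ ≤ A ^ m * (B * (A * ∫ ω, v ω ∂P)) := by gcongr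
    _ = _ := by ring

end Independence

/-! ### A stochastic Gronwall inequality for the running maximum -/

set_option maxHeartbeats 1000000 in
/-- One step of the Lyapunov function `(S - Y)² + Y²` for the pair of a process `Y` and its running
maximum `S`.  The increment of `Y` is split into a part `M`, which enters linearly, and a
remainder. -/
theorem lyapunov_step {S Y M R χ τ K : ℝ} {q : ℕ} (hK : 1 ≤ K) (hτ : 0 < τ) (hτ1 : τ ≤ 1)
    (hχ : 1 ≤ χ) (hY : 1 ≤ Y) (hM : |M| ≤ K * (√τ * χ * Y)) (hR0 : 0 ≤ R)
    (hR : R ≤ K * (τ * χ ^ 2 * Y)) :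
    ((max S (Y + M + R) - (Y + M + R)) ^ 2 + (Y + M + R) ^ 2) ^ (q + 2)
      ≤ ((S - Y) ^ 2 + Y ^ 2) ^ (q + 2)
        + (q + 2) * ((S - Y) ^ 2 + Y ^ 2) ^ (q + 1) * (2 * (2 * Y - S)) * M
        + ((q + 2) * (16 * K ^ 2) + (q + 2) ^ 2 * (32 * K ^ 2) ^ 2 * (1 + 32 * K ^ 2) ^ q)
          * (τ * (((S - Y) ^ 2 + Y ^ 2) ^ (q + 2) * χ ^ (4 * (q + 2)))) := by
  set V := (S - Y) ^ 2 + Y ^ 2 with hV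
  set V' := (max S (Y + M + R) - (Y + M + R)) ^ 2 + (Y + M + R) ^ 2 with hV'
  set L := 16 * K ^ 2 with hL
  have hV'0 : 0 ≤ V' := by positivity
  have hYV : Y ^ 2 ≤ V := by rw [hV]; linarith [sq_nonneg (S - Y)]
  have hVpos : 0 < V := lt_of_lt_of_le (by positivity) hYV
  have hL0 : 0 ≤ L := by positivity
  have hst : 0 ≤ √τ := Real.sqrt_nonneg τ
  have hsτ : √τ ^ 2 = τ := Real.sq_sqrt hτ.le
  have hst1 : √τ ≤ 1 := Real.sqrt_le_one.2 hτ1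
  have hτs : τ ≤ √τ := by nlinarith
  have hχ0 : 0 < χ := by linarith
  have hY0 : 0 < Y := by linarith
  have hKK : K ≤ K ^ 2 := le_self_pow₀ hK (by norm_num)
  have hχ24 : χ ^ 2 ≤ χ ^ 4 := pow_le_pow_right₀ hχ (by norm_num)
  have hχ14 : χ ≤ χ ^ 4 := le_self_pow₀ hχ (by norm_num)
  have hSY : |2 * Y - S| * Y ≤ 2 * V := by
    have h1 : |2 * Y - S| ≤ Y + |S - Y| := by
      have : 2 * Y - S = Y - (S - Y) := by ring
      rw [this]
      refine (abs_sub _ _).trans ?_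
      rw [abs_of_pos hY0]
    have h2 := sq_abs (S - Y)
    nlinarith [sq_nonneg (|S - Y| - Y)]
  -- the elementary recursion for the Lyapunov function
  have h1 : V' ≤ V + 2 * (2 * Y - S) * (M + R) + 2 * (M + R) ^ 2 := by
    rw [hV, hV']
    rcases le_total S (Y + M + R) with h | h
    · rw [max_eq_right h]
      nlinarith [sq_nonneg (S - Y - (M + R))]
    · rw [max_eq_left h]
      nlinarith
  have h2 : 2 * (2 * Y - S) * R + 2 * (M + R) ^ 2 ≤ L * (τ * χ ^ 4) * V := by
    have e1 : 2 * (2 * Y - S) * R ≤ 4 * K * (τ * χ ^ 4) * V := by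
      calc 2 * (2 * Y - S) * R ≤ 2 * |2 * Y - S| * R := by
            gcongr
            exact le_abs_self _
        _ ≤ 2 * |2 * Y - S| * (K * (τ * χ ^ 2 * Y)) := by gcongr
        _ = 2 * K * (τ * χ ^ 2) * (|2 * Y - S| * Y) := by ring
        _ ≤ 2 * K * (τ * χ ^ 4) * (2 * V) := by gcongr
        _ = _ := by ring
    have e2 : M ^ 2 ≤ K ^ 2 * (τ * χ ^ 4) * V := by
      calc M ^ 2 = |M| ^ 2 := (sq_abs M).symm
        _ ≤ (K * (√τ * χ * Y)) ^ 2 := by gcongr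
        _ = K ^ 2 * (√τ ^ 2 * χ ^ 2) * Y ^ 2 := by ring
        _ ≤ K ^ 2 * (τ * χ ^ 4) * V := by rw [hsτ]; gcongr
    have e3 : R ^ 2 ≤ K ^ 2 * (τ * χ ^ 4) * V := by
      calc R ^ 2 ≤ (K * (τ * χ ^ 2 * Y)) ^ 2 := by gcongr
        _ = K ^ 2 * (τ ^ 2 * χ ^ 4) * Y ^ 2 := by ring
        _ ≤ K ^ 2 * (τ * χ ^ 4) * V := by
          gcongr
          nlinarith
    have e4 : K * ((τ * χ ^ 4) * V) ≤ K ^ 2 * ((τ * χ ^ 4) * V) := by gcongr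
    have e5 : 0 ≤ K ^ 2 * ((τ * χ ^ 4) * V) := by positivity
    rw [hL]
    linear_combination e1 + 4 * e2 + 4 * e3 + 4 * e4 + 4 * e5 + 2 * sq_nonneg (M - R)
  -- the relative increment
  set z := (2 * (2 * Y - S) * M + L * (τ * χ ^ 4) * V) / V with hz
  have hzV : V * z = 2 * (2 * Y - S) * M + L * (τ * χ ^ 4) * V := by
    rw [hz]
    field_simp
  have h3 : V' ≤ V * (1 + z) := by
    rw [mul_add, mul_one, hzV]
    linarith
  have hL2 : 4 * K + L ≤ L * 2 := by rw [hL]; nlinarith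
  have h4 : |z| ≤ 2 * L * (√τ * χ ^ 4) := by
    rw [hz, abs_div, abs_of_pos hVpos, div_le_iff₀ hVpos]
    refine (abs_add_le _ _).trans ?_
    have e1 : |2 * (2 * Y - S) * M| ≤ 4 * K * (√τ * χ ^ 4) * V := by
      rw [abs_mul, abs_mul, abs_two]
      calc 2 * |2 * Y - S| * |M| ≤ 2 * |2 * Y - S| * (K * (√τ * χ * Y)) := by gcongr
        _ = 2 * K * (√τ * χ) * (|2 * Y - S| * Y) := by ring
        _ ≤ 2 * K * (√τ * χ ^ 4) * (2 * V) := by gcongr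
        _ = _ := by ring
    have e2 : |L * (τ * χ ^ 4) * V| ≤ L * (√τ * χ ^ 4) * V := by
      rw [abs_of_nonneg (by positivity)]
      gcongr
    have e3 := mul_le_mul_of_nonneg_right hL2 (show 0 ≤ √τ * χ ^ 4 * V by positivity)
    linear_combination e1 + e2 + e3
  clear_value z V V' L
  clear h1 h2 hSY hYV hz
  have h5 : (1 + z) ^ (q + 2) ≤ 1 + (q + 2) * z + (q + 2) ^ 2 * (z ^ 2 * (1 + |z|) ^ q) := by
    have e1 := (abs_le.1 (abs_add_pow_sub_le 1 z q)).2
    rw [abs_one] at e1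
    simp only [one_pow, mul_one] at e1
    linarith
  have h6 : z ^ 2 * (1 + |z|) ^ q
      ≤ (2 * L) ^ 2 * (1 + 2 * L) ^ q * (τ * χ ^ (4 * (q + 2))) := by
    have hχ1 : 1 ≤ χ ^ 4 := one_le_pow₀ hχ
    have e1 : z ^ 2 ≤ (2 * L) ^ 2 * (τ * χ ^ 8) := by
      calc z ^ 2 = |z| ^ 2 := (sq_abs z).symm
        _ ≤ (2 * L * (√τ * χ ^ 4)) ^ 2 := by gcongr
        _ = (2 * L) ^ 2 * (√τ ^ 2 * χ ^ 8) := by ring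
        _ = _ := by rw [hsτ]
    have e2 : 1 + |z| ≤ (1 + 2 * L) * χ ^ 4 := by
      have e3 : 2 * L * (√τ * χ ^ 4) ≤ 2 * L * (1 * χ ^ 4) := by gcongr
      linarith
    calc z ^ 2 * (1 + |z|) ^ q
        ≤ ((2 * L) ^ 2 * (τ * χ ^ 8)) * ((1 + 2 * L) * χ ^ 4) ^ q := by gcongr
      _ = _ := by
        rw [mul_pow (1 + 2 * L), ← pow_mul, show 4 * (q + 2) = 8 + 4 * q by ring, pow_add]
        ring
  have h7 : V' ^ (q + 2) ≤ V ^ (q + 2) * (1 + z) ^ (q + 2) := by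
    rw [← mul_pow]
    exact pow_le_pow_left₀ hV'0 h3 _
  have h8 : V ^ (q + 2) * (1 + z) ^ (q + 2) ≤ V ^ (q + 2) * (1 + (q + 2) * z
      + (q + 2) ^ 2 * ((2 * L) ^ 2 * (1 + 2 * L) ^ q * (τ * χ ^ (4 * (q + 2))))) := by
    gcongr
    refine h5.trans ?_
    gcongr
  have h9 : V ^ (q + 2) * z = V ^ (q + 1) * (2 * (2 * Y - S)) * M
      + L * (τ * (V ^ (q + 2) * χ ^ 4)) := by
    calc V ^ (q + 2) * z = V ^ (q + 1) * (V * z) := by ring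
      _ = _ := by rw [hzV]; ring
  have h10 : L * (τ * (V ^ (q + 2) * χ ^ 4)) ≤ L * (τ * (V ^ (q + 2) * χ ^ (4 * (q + 2)))) := by
    gcongr
    omega
  have h11 := mul_le_mul_of_nonneg_left h10 (show (0 : ℝ) ≤ (q : ℝ) + 2 by positivity)
  have e32 : 32 * K ^ 2 = 2 * L := by rw [hL]; ring
  rw [e32]
  linear_combination h7 + h8 + ((q : ℝ) + 2) * h9 + h11

section Gronwall

variable {Ω : Type*} {mΩ : MeasurableSpace Ω} {P : Measure Ω} [IsProbabilityMeasure P]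

/-- The running maximum of a process. -/
def runningMax (Y : ℕ → Ω → ℝ) : ℕ → Ω → ℝ
  | 0 => Y 0
  | n + 1 => fun ω => max (runningMax Y n ω) (Y (n + 1) ω)

theorem le_runningMax (Y : ℕ → Ω → ℝ) {i n : ℕ} (h : i ≤ n) (ω : Ω) :
    Y i ω ≤ runningMax Y n ω := by
  induction n with
  | zero => rw [Nat.le_zero.1 h]; rfl
  | succ n ih =>
    rcases Nat.lt_or_ge n i with h1 | h1
    · rw [show i = n + 1 by omega]
      exact le_max_right _ _
    · exact (ih h1).trans (le_max_left _ _)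

theorem measurable_runningMax {Y : ℕ → Ω → ℝ} {𝒢 : ℕ → MeasurableSpace Ω} {N : ℕ}
    (hmono : ∀ i j, i ≤ j → j ≤ N → 𝒢 i ≤ 𝒢 j) (hY : ∀ n ≤ N, Measurable[𝒢 n] (Y n)) {n : ℕ}
    (hn : n ≤ N) : Measurable[𝒢 n] (runningMax Y n) := by
  induction n with
  | zero => exact hY 0 hn
  | succ n ih =>
    exact ((ih (by omega)).mono (hmono n (n + 1) (by omega) hn) le_rfl).max (hY _ hn)

/-- Moments of the running maximum of a process whose increments consist of a martingale part `M`
of order `√τ` and of a remainder `R` of order `τ`, both proportional to the process itself. -/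
theorem exists_integral_runningMax_pow_le (K B T : ℝ) (hK : 1 ≤ K) (hB : 0 ≤ B) (q : ℕ) :
    ∃ C > 0, ∀ (N : ℕ) (τ y₀ : ℝ) (Y M R χ : ℕ → Ω → ℝ) (𝒢 : ℕ → MeasurableSpace Ω),
      0 < τ → τ ≤ 1 → N * τ ≤ T → (∀ n ≤ N, 𝒢 n ≤ mΩ) → (∀ i j, i ≤ j → j ≤ N → 𝒢 i ≤ 𝒢 j) →
      (∀ n ≤ N, Measurable[𝒢 n] (Y n)) → (∀ n ≤ N, ∀ ω, 1 ≤ Y n ω) → (∀ ω, Y 0 ω = y₀) →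
      (∀ n < N, ∀ ω, Y (n + 1) ω = Y n ω + M n ω + R n ω) →
      (∀ n < N, ∀ ω, |M n ω| ≤ K * (√τ * χ n ω * Y n ω)) →
      (∀ n < N, ∀ ω, 0 ≤ R n ω) →
      (∀ n < N, ∀ ω, R n ω ≤ K * (τ * χ n ω ^ 2 * Y n ω)) →
      (∀ n < N, ∀ ω, 1 ≤ χ n ω) →
      (∀ n < N, ∀ G : Ω → ℝ, Measurable[𝒢 n] G → Integrable (fun ω => G ω * Y n ω) P →
        Integrable (fun ω => G ω * M n ω) P ∧ ∫ ω, G ω * M n ω ∂P = 0) →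
      (∀ n < N, ∀ v : Ω → ℝ, Measurable[𝒢 n] v → (∀ ω, 0 ≤ v ω) → Integrable v P →
        Integrable (fun ω => v ω * χ n ω ^ (4 * (q + 2))) P ∧
          ∫ ω, v ω * χ n ω ^ (4 * (q + 2)) ∂P ≤ B * ∫ ω, v ω ∂P) →
      Integrable (fun ω => runningMax Y N ω ^ (2 * (q + 2))) P ∧
        ∫ ω, runningMax Y N ω ^ (2 * (q + 2)) ∂P ≤ C * y₀ ^ (2 * (q + 2)) := by
  set c : ℝ := ((q + 2) * (16 * K ^ 2) + (q + 2) ^ 2 * (32 * K ^ 2) ^ 2 * (1 + 32 * K ^ 2) ^ q) * B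
    with hc
  have hc0 : 0 ≤ c := by positivity
  refine ⟨2 ^ (q + 2) * Real.exp (c * T), by positivity, ?_⟩
  intro N τ y₀ Y M R χ 𝒢 hτ hτ1 hNT h𝒢 hmono hYm hY1 hY0 hstep hM hR0 hR hχ horth hmom
  -- `V` is comparable with the square of the running maximum, but unlike the latter it is smooth in the
  -- increment: when the maximum increases, the first square vanishes
  set V : ℕ → Ω → ℝ := fun n ω => (runningMax Y n ω - Y n ω) ^ 2 + Y n ω ^ 2 with hV
  have hSm : ∀ n ≤ N, Measurable[𝒢 n] (runningMax Y n) := fun n hn =>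
    measurable_runningMax hmono hYm hn
  have hVm : ∀ n ≤ N, Measurable[𝒢 n] (V n) := fun n hn =>
    (((hSm n hn).sub (hYm n hn)).pow_const 2).add ((hYm n hn).pow_const 2)
  have hV0 : ∀ n ω, 0 ≤ V n ω := fun n ω => by simp only [hV]; positivity
  have main : ∀ n ≤ N, Integrable (fun ω => V n ω ^ (q + 2)) P ∧
      ∫ ω, V n ω ^ (q + 2) ∂P ≤ (1 + c * τ) ^ n * y₀ ^ (2 * (q + 2)) := by
    intro n
    induction n with
    | zero =>
      intro _
      have e : (fun ω => V 0 ω ^ (q + 2)) = fun _ => y₀ ^ (2 * (q + 2)) := by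
        funext ω
        simp only [hV, runningMax, hY0, sub_self]
        ring
      rw [e]
      simp
    | succ n ih =>
      intro hn
      have hnN : n < N := by omega
      obtain ⟨hi, hle⟩ := ih hnN.le
      -- `G` is the derivative of `V ^ (q + 2)` in `Y` at fixed maximum; the term `G * M` has mean zero
      set G : Ω → ℝ := fun ω => (q + 2) * V n ω ^ (q + 1) * (2 * (2 * Y n ω - runningMax Y n ω))
        with hG
      have hGm : Measurable[𝒢 n] G :=
        (((hVm n hnN.le).pow_const _).const_mul _).mul
          ((((hYm n hnN.le).const_mul 2).sub (hSm n hnN.le)).const_mul 2)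
      have hGY : Integrable (fun ω => G ω * Y n ω) P := by
        refine (hi.const_mul (4 * (q + 2))).mono (Measurable.aestronglyMeasurable
          ((hGm.mul (hYm n hnN.le)).mono (h𝒢 n hnN.le) le_rfl)) (ae_of_all _ fun ω => ?_)
        have h1 : |(2 * Y n ω - runningMax Y n ω) * Y n ω| ≤ 2 * V n ω := by
          simp only [hV]
          rw [abs_le]
          constructor <;> nlinarith [sq_nonneg (runningMax Y n ω - Y n ω + Y n ω),
            sq_nonneg (runningMax Y n ω - Y n ω - Y n ω), sq_nonneg (Y n ω),
            sq_nonneg (runningMax Y n ω - Y n ω)]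
        have h2 := pow_nonneg (hV0 n ω) (q + 1)
        have h3 := pow_nonneg (hV0 n ω) (q + 2)
        rw [Real.norm_eq_abs, Real.norm_of_nonneg (by positivity)]
        have e : G ω * Y n ω = (2 * (q + 2) * V n ω ^ (q + 1))
            * ((2 * Y n ω - runningMax Y n ω) * Y n ω) := by
          simp only [hG]
          ring
        rw [e, abs_mul, abs_of_nonneg (by positivity)]
        calc _ ≤ (2 * (q + 2) * V n ω ^ (q + 1)) * (2 * V n ω) := by gcongr
          _ = _ := by ring
      obtain ⟨hGi, hG0⟩ := horth n hnN G hGm hGY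
      obtain ⟨hχi, hχB⟩ := hmom n hnN (fun ω => V n ω ^ (q + 2)) ((hVm n hnN.le).pow_const _)
        (fun ω => pow_nonneg (hV0 n ω) _) hi
      set c' : ℝ := (q + 2) * (16 * K ^ 2) + (q + 2) ^ 2 * (32 * K ^ 2) ^ 2 * (1 + 32 * K ^ 2) ^ q
        with hc'
      have hc'0 : 0 ≤ c' := by positivity
      have hpt : ∀ ω, V (n + 1) ω ^ (q + 2) ≤ V n ω ^ (q + 2) + G ω * M n ω
          + c' * τ * (V n ω ^ (q + 2) * χ n ω ^ (4 * (q + 2))) := fun ω => by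
        have h1 := lyapunov_step (S := runningMax Y n ω) (q := q) hK hτ hτ1 (hχ n hnN ω)
          (hY1 n hnN.le ω) (hM n hnN ω) (hR0 n hnN ω) (hR n hnN ω)
        simp only [hV, hG, runningMax, hstep n hnN ω]
        rw [mul_assoc c']
        exact h1
      have hbi₁ : Integrable (fun ω => V n ω ^ (q + 2) + G ω * M n ω) P := hi.add hGi
      have hbi₂ : Integrable (fun ω => c' * τ * (V n ω ^ (q + 2) * χ n ω ^ (4 * (q + 2)))) P :=
        hχi.const_mul _
      have hVi : Integrable (fun ω => V (n + 1) ω ^ (q + 2)) P := by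
        refine (hbi₁.add hbi₂).mono (Measurable.aestronglyMeasurable
          (((hVm (n + 1) hn).mono (h𝒢 _ hn) le_rfl).pow_const _)) (ae_of_all _ fun ω => ?_)
        have h0 := pow_nonneg (hV0 (n + 1) ω) (q + 2)
        rw [Real.norm_of_nonneg h0]
        exact (hpt ω).trans (Real.le_norm_self _)
      refine ⟨hVi, (integral_mono hVi (hbi₁.add hbi₂) hpt).trans ?_⟩
      have e : ∫ ω, ((fun ω => V n ω ^ (q + 2) + G ω * M n ω)
          + fun ω => c' * τ * (V n ω ^ (q + 2) * χ n ω ^ (4 * (q + 2)))) ω ∂P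
          = ∫ ω, V n ω ^ (q + 2) ∂P
            + c' * τ * ∫ ω, V n ω ^ (q + 2) * χ n ω ^ (4 * (q + 2)) ∂P := by
        rw [integral_add' hbi₁ hbi₂, integral_add hi hGi, hG0, add_zero, integral_const_mul]
      rw [e]
      have h5 : c' * τ * ∫ ω, V n ω ^ (q + 2) * χ n ω ^ (4 * (q + 2)) ∂P
          ≤ c' * τ * (B * ∫ ω, V n ω ^ (q + 2) ∂P) := by gcongr
      have h6 : (1 + c * τ) * ∫ ω, V n ω ^ (q + 2) ∂P
          ≤ (1 + c * τ) * ((1 + c * τ) ^ n * y₀ ^ (2 * (q + 2))) := by gcongr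
      have h7 : c = c' * B := hc
      rw [h7] at h6 ⊢
      rw [pow_succ]
      linear_combination h5 + h6
  obtain ⟨hi, hle⟩ := main N le_rfl
  have hpt : ∀ ω, runningMax Y N ω ^ (2 * (q + 2)) ≤ 2 ^ (q + 2) * V N ω ^ (q + 2) := fun ω => by
    rw [pow_mul, ← mul_pow]
    refine pow_le_pow_left₀ (sq_nonneg _) ?_ _
    simp only [hV]
    nlinarith [sq_nonneg (runningMax Y N ω - 2 * Y N ω)]
  have h0 : ∀ ω, 0 ≤ runningMax Y N ω ^ (2 * (q + 2)) := fun ω => by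
    rw [pow_mul]
    positivity
  have hmi : Integrable (fun ω => runningMax Y N ω ^ (2 * (q + 2))) P := by
    refine (hi.const_mul (2 ^ (q + 2))).mono (Measurable.aestronglyMeasurable
      (((hSm N le_rfl).mono (h𝒢 N le_rfl) le_rfl).pow_const _)) (ae_of_all _ fun ω => ?_)
    rw [Real.norm_of_nonneg (h0 ω), Real.norm_of_nonneg ((h0 ω).trans (hpt ω))]
    exact hpt ω
  refine ⟨hmi, (integral_mono hmi (hi.const_mul (2 ^ (q + 2))) hpt).trans ?_⟩
  rw [integral_const_mul, mul_assoc]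
  have h1 : (1 + c * τ) ^ N ≤ Real.exp (c * T) := by
    calc (1 + c * τ) ^ N ≤ Real.exp (c * τ) ^ N := by
          gcongr
          linarith [Real.add_one_le_exp (c * τ)]
      _ = Real.exp (c * (N * τ)) := by rw [← Real.exp_nat_mul]; congr 1; ring
      _ ≤ _ := by gcongr
  have h2 : 0 ≤ y₀ ^ (2 * (q + 2)) := by rw [pow_mul]; positivity
  gcongr
  exact hle.trans (by gcongr)

end Gronwall


/-! ### The size of the discrete noise -/

section Noise

variable {d : ℕ} {O : Set (Space d)}

open Triangulation

/-- The random field `∑ₖ cₖ gₖ`, before it is multiplied by the coefficient function. -/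
def noiseField (Z : Finset ℤ) (g : ℤ → Space d → ℝ) (c : ℤ → ℝ) (x : Space d) : ℝ :=
  ∑ k ∈ Z, c k * g k x

theorem discPhi_eq_interp (𝒯 : Triangulation O) (Z : Finset ℤ) (σ : ℝ → ℝ)
    (𝔤 : HilbertBasis ℤ ℝ (L2 O)) (g : ℤ → Space d → ℝ) (ζ : Space d → ℝ) (f : L2 O) :
    discPhi 𝒯 Z σ 𝔤 g ζ f
      = 𝒯.interp fun x => σ (ζ x) * noiseField Z g (fun k => inner ℝ f (𝔤 k)) x := by
  simp only [discPhi, interp, noiseField, Finset.mul_sum, Finset.sum_smul]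
  rw [Finset.sum_comm]
  simp only [mul_assoc]

/-- The difference quotient of `γ` at two points; it is zero if the points agree. -/
def diffQuot (γ : Space d → ℝ) (v w : Space d) : ℝ := (γ v - γ w) / ‖v - w‖

theorem abs_sub_eq_diffQuot (γ : Space d → ℝ) (v w : Space d) :
    |γ v - γ w| = |diffQuot γ v w| * ‖v - w‖ := by
  rcases eq_or_ne v w with h | h
  · simp [h]
  · have : 0 < ‖v - w‖ := norm_pos_iff.2 (sub_ne_zero.2 h)
    rw [diffQuot, abs_div, abs_of_pos this]
    field_simp

/-- The cells together with a pair of their vertices. -/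
def vertexPairs (𝒯 : Triangulation O) :
    Finset ((_ : Finset (Space d)) × Space d × Space d) :=
  𝒯.cells.sigma fun s => s ×ˢ s

/-- The share of the cell `s` in the (normalized) Dirichlet energy of `ζ`, up to constants. -/
def gradWeight (O : Set (Space d)) (ζ : Space d → ℝ) (s : Finset (Space d)) : ℝ :=
  volume.real (cell s) * (1 + ‖slope s ζ‖) ^ 2 / (1 + dirichletForm O ζ ζ)

/-- A bound for the sixth moment and the Dirichlet energy of the discrete noise built from the
field `γ`, see `exists_noiseSize`. -/
def noiseSize (𝒯 : Triangulation O) (C : ℝ) (ζ γ : Space d → ℝ) : ℝ :=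
  1 + C * (∑ v ∈ 𝒯.vertices, 𝒯.nodeWeight v * γ v ^ 6
    + ∑ i ∈ vertexPairs 𝒯, gradWeight O ζ i.1 * (γ i.2.1 ^ 2 + diffQuot γ i.2.1 i.2.2 ^ 2))

theorem gradWeight_nonneg (ζ : Space d → ℝ) (s : Finset (Space d)) : 0 ≤ gradWeight O ζ s := by
  have := dirichletForm_nonneg (O := O) ζ
  rw [gradWeight]
  positivity

theorem one_le_noiseSize (𝒯 : Triangulation O) {C : ℝ} (hC : 0 ≤ C) (ζ γ : Space d → ℝ) :
    1 ≤ noiseSize 𝒯 C ζ γ := by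
  have h1 : 0 ≤ ∑ v ∈ 𝒯.vertices, 𝒯.nodeWeight v * γ v ^ 6 :=
    Finset.sum_nonneg fun v _ => mul_nonneg (𝒯.nodeWeight_nonneg v) (by positivity)
  have h2 : 0 ≤ ∑ i ∈ vertexPairs 𝒯, gradWeight O ζ i.1 *
      (γ i.2.1 ^ 2 + diffQuot γ i.2.1 i.2.2 ^ 2) :=
    Finset.sum_nonneg fun i _ => mul_nonneg (gradWeight_nonneg ζ i.1) (by positivity)
  rw [noiseSize]
  nlinarith [mul_nonneg hC (add_nonneg h1 h2)]

/-- The weights in `noiseSize` have bounded total mass, although the gradient of `ζ` need not be bounded: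
this is the effect of the normalization by the Dirichlet energy of `ζ`. -/
theorem sum_gradWeight_le (hO : IsConvexPolyhedralDomain O) (𝒯 : Triangulation O)
    {ζ : Space d → ℝ} (hζ : ζ ∈ 𝒯.femSpace) :
    ∑ i ∈ vertexPairs 𝒯, gradWeight O ζ i.1 ≤ (d + 1) ^ 2 * (2 * (1 + volume.real O)) := by
  have hdir := dirichletForm_nonneg (O := O) ζ
  have hμ : 0 ≤ volume.real O := measureReal_nonneg
  have h1 : ∑ i ∈ vertexPairs 𝒯, gradWeight O ζ i.1
      = (d + 1) ^ 2 * ∑ s ∈ 𝒯.cells, gradWeight O ζ s := by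
    rw [vertexPairs, Finset.sum_sigma, Finset.mul_sum]
    refine Finset.sum_congr rfl fun s hs => ?_
    simp only [Finset.sum_const, Finset.card_product, 𝒯.card_cell s hs, nsmul_eq_mul]
    push_cast
    ring
  rw [h1]
  refine mul_le_mul_of_nonneg_left ?_ (by positivity)
  simp only [gradWeight]
  rw [← Finset.sum_div, div_le_iff₀ (by positivity)]
  have h2 : ∑ s ∈ 𝒯.cells, volume.real (cell s) = volume.real O := by
    have h3 := setIntegral_eq_sum_const hO 𝒯 (f := fun _ => (1 : ℝ)) (fun _ => 1)
      fun _ _ _ _ => rfl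
    simpa using h3.symm
  have h4 : ∑ s ∈ 𝒯.cells, volume.real (cell s) * (1 + ‖slope s ζ‖) ^ 2
      ≤ 2 * ∑ s ∈ 𝒯.cells, volume.real (cell s)
        + 2 * ∑ s ∈ 𝒯.cells, volume.real (cell s) * inner ℝ (slope s ζ) (slope s ζ) := by
    rw [Finset.mul_sum, Finset.mul_sum, ← Finset.sum_add_distrib]
    refine Finset.sum_le_sum fun s _ => ?_
    rw [real_inner_self_eq_norm_sq]
    have h5 : (1 + ‖slope s ζ‖) ^ 2 ≤ 2 + 2 * ‖slope s ζ‖ ^ 2 := by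
      nlinarith [sq_nonneg (1 - ‖slope s ζ‖)]
    have h6 : 0 ≤ volume.real (cell s) := measureReal_nonneg
    nlinarith [mul_le_mul_of_nonneg_left h5 h6]
  rw [h2, ← dirichletForm_eq_sum hO 𝒯 hζ hζ] at h4
  nlinarith

/-- The quantity `noiseSize` of the normalized field bounds the sixth moment of the discrete noise, and
its Dirichlet energy relative to that of `ζ`: the gradient of `σ(ζ) γ` is at most proportional to
`1 + |∇ζ|`. -/
theorem exists_noiseSize {𝒯 : ℝ → Triangulation O} (hO : IsConvexPolyhedralDomain O)
    (h𝒯 : QuasiUniform 𝒯) {σ : ℝ → ℝ} (hσ : IsNoiseCoefficient σ) :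
    ∃ C ≥ 0, ∀ h ∈ Ioc (0 : ℝ) 1, ∀ ζ ∈ (𝒯 h).femSpace, ∀ γ : Space d → ℝ, ∀ τ : ℝ, 0 < τ →
      lumped (𝒯 h) (fun x => (𝒯 h).interp (fun x => σ (ζ x) * (√τ * γ x)) x ^ 6)
        ≤ (τ * noiseSize (𝒯 h) C ζ γ) ^ 3 ∧
      dirichletForm O ((𝒯 h).interp fun x => σ (ζ x) * (√τ * γ x))
          ((𝒯 h).interp fun x => σ (ζ x) * (√τ * γ x))
        ≤ τ * noiseSize (𝒯 h) C ζ γ * (1 + dirichletForm O ζ ζ) := by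
  obtain ⟨M, hM⟩ := hσ.bounded
  obtain ⟨C, hC, hs⟩ := exists_norm_slope_coefficient_le h𝒯 hσ
  refine ⟨M ^ 6 + C ^ 2, by positivity, fun h hh ζ hζ γ τ hτ => ?_⟩
  have hdir := dirichletForm_nonneg (O := O) ζ
  have hsτ : √τ ^ 2 = τ := Real.sq_sqrt hτ.le
  have h1 := one_le_noiseSize (𝒯 h) (C := M ^ 6 + C ^ 2) (by positivity) ζ γ
  have hS1 : 0 ≤ ∑ v ∈ (𝒯 h).vertices, (𝒯 h).nodeWeight v * γ v ^ 6 :=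
    Finset.sum_nonneg fun v _ => mul_nonneg ((𝒯 h).nodeWeight_nonneg v) (by positivity)
  have hS2 : 0 ≤ ∑ i ∈ vertexPairs (𝒯 h), gradWeight O ζ i.1 *
      (γ i.2.1 ^ 2 + diffQuot γ i.2.1 i.2.2 ^ 2) :=
    Finset.sum_nonneg fun i _ => mul_nonneg (gradWeight_nonneg ζ i.1) (by positivity)
  set χ := noiseSize (𝒯 h) (M ^ 6 + C ^ 2) ζ γ with hχ
  rw [noiseSize] at hχ
  set S₁ := ∑ v ∈ (𝒯 h).vertices, (𝒯 h).nodeWeight v * γ v ^ 6 with hS₁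
  set S₂ := ∑ i ∈ vertexPairs (𝒯 h), gradWeight O ζ i.1 *
      (γ i.2.1 ^ 2 + diffQuot γ i.2.1 i.2.2 ^ 2) with hS₂
  have hM6 : 0 ≤ M ^ 6 := by positivity
  have hC2 : 0 ≤ C ^ 2 := by positivity
  constructor
  · have h2 : lumped (𝒯 h) (fun x => (𝒯 h).interp (fun x => σ (ζ x) * (√τ * γ x)) x ^ 6)
        ≤ τ ^ 3 * (M ^ 6 * S₁) := by
      rw [lumped_eq_sum hO, hS₁, Finset.mul_sum, Finset.mul_sum]
      refine Finset.sum_le_sum fun v hv => ?_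
      rw [(𝒯 h).interp_apply _ hv]
      have h3 : σ (ζ v) ^ 6 ≤ M ^ 6 := by
        have := pow_le_pow_left₀ (abs_nonneg _) (hM (ζ v)) 6
        rwa [Even.pow_abs (by decide)] at this
      calc _ = (√τ ^ 2) ^ 3 * (σ (ζ v) ^ 6 * ((𝒯 h).nodeWeight v * γ v ^ 6)) := by ring
        _ ≤ _ := by
          rw [hsτ]
          have := (𝒯 h).nodeWeight_nonneg v
          gcongr
    refine h2.trans ?_
    rw [mul_pow]
    have h4 : M ^ 6 * S₁ ≤ χ := by
      rw [hχ]
      nlinarith [mul_nonneg hM6 hS2, mul_nonneg hC2 hS1, mul_nonneg hC2 hS2]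
    have h5 : χ ≤ χ ^ 3 := le_self_pow₀ h1 (by norm_num)
    gcongr
    exact h4.trans h5
  · have hmem := (𝒯 h).interp_mem fun x => σ (ζ x) * (√τ * γ x)
    have h2 : dirichletForm O ((𝒯 h).interp fun x => σ (ζ x) * (√τ * γ x))
          ((𝒯 h).interp fun x => σ (ζ x) * (√τ * γ x))
        ≤ τ * (C ^ 2 * S₂) * (1 + dirichletForm O ζ ζ) := by
      rw [dirichletForm_eq_sum hO (𝒯 h) hmem hmem, hS₂, vertexPairs, Finset.sum_sigma,
        Finset.mul_sum, Finset.mul_sum, Finset.sum_mul]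
      refine Finset.sum_le_sum fun s hs' => ?_
      rw [real_inner_self_eq_norm_sq]
      simp only
      rw [← Finset.mul_sum]
      -- the local size of the field, which bounds its nodal values and difference quotients
      set Q := ∑ i ∈ s ×ˢ s, (γ i.1 ^ 2 + diffQuot γ i.1 i.2 ^ 2) with hQ
      have hQ0 : 0 ≤ Q := Finset.sum_nonneg fun i _ => by positivity
      have hQi : ∀ v ∈ s, ∀ w ∈ s, γ v ^ 2 + diffQuot γ v w ^ 2 ≤ Q := fun v hv w hw =>
        Finset.single_le_sum (f := fun i : Space d × Space d => γ i.1 ^ 2 + diffQuot γ i.1 i.2 ^ 2)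
          (fun i _ => by positivity) (Finset.mem_product.2 ⟨hv, hw⟩ : (v, w) ∈ s ×ˢ s)
      have h3 := hs h hh s hs' ζ hζ (fun x => √τ * γ x) (√τ * √Q)
        (fun v hv => by
          rw [abs_mul, abs_of_nonneg (Real.sqrt_nonneg τ)]
          gcongr
          refine Real.abs_le_sqrt ?_
          have := hQi v hv v hv
          nlinarith [sq_nonneg (diffQuot γ v v)])
        (fun v hv w hw => by
          rw [← mul_sub, abs_mul, abs_of_nonneg (Real.sqrt_nonneg τ), abs_sub_eq_diffQuot,
            mul_assoc]
          gcongr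
          refine Real.abs_le_sqrt ?_
          have := hQi v hv w hw
          nlinarith [sq_nonneg (γ v)])
      have h4 : ‖slope s ((𝒯 h).interp fun x => σ (ζ x) * (√τ * γ x))‖ ^ 2
          ≤ C ^ 2 * (τ * Q) * (1 + ‖slope s ζ‖) ^ 2 := by
        calc _ ≤ (C * (√τ * √Q) * (1 + ‖slope s ζ‖)) ^ 2 := by gcongr
          _ = C ^ 2 * (√τ ^ 2 * √Q ^ 2) * (1 + ‖slope s ζ‖) ^ 2 := by ring
          _ = _ := by rw [hsτ, Real.sq_sqrt hQ0]
      have h5 : 0 ≤ volume.real (cell s) := measureReal_nonneg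
      calc _ ≤ volume.real (cell s) * (C ^ 2 * (τ * Q) * (1 + ‖slope s ζ‖) ^ 2) := by gcongr
        _ = _ := by
          rw [gradWeight]
          have : 1 + dirichletForm O ζ ζ ≠ 0 := by positivity
          field_simp
    refine h2.trans ?_
    gcongr
    rw [hχ]
    nlinarith [mul_nonneg hM6 hS2, mul_nonneg hM6 hS1, mul_nonneg hC2 hS1]

/-- The color of the noise controls the nodal values and the difference quotients. -/
theorem IsColored.exists_bound (hO : IsConvexPolyhedralDomain O) {𝔤 : HilbertBasis ℤ ℝ (L2 O)}
    {g : ℤ → Space d → ℝ} {lam : ℤ → ℝ} (hg : IsColored 𝔤 g lam) :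
    ∃ Λ ≥ 0, ∀ Z : Finset ℤ, ∀ v ∈ closure O,
      ∑ k ∈ Z, (lam k * g k v) ^ 2 ≤ Λ ∧
      ∀ w ∈ closure O, ∑ k ∈ Z, (lam k * diffQuot (g k) v w) ^ 2 ≤ Λ := by
  set β : ℤ → ℝ≥0∞ := fun k => ENNReal.ofReal (lam k ^ 2) * w1infNorm O (g k) ^ 2 with hβ
  have hsum : ∑' k, β k ≠ ∞ := hg.color.ne
  have hβk : ∀ k, β k ≠ ∞ := fun k => ENNReal.ne_top_of_tsum_ne_top hsum k
  have hZ : ∀ Z : Finset ℤ, ∑ k ∈ Z, (β k).toReal ≤ (∑' k, β k).toReal := fun Z => by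
    rw [← ENNReal.toReal_sum fun k _ => hβk k]
    exact ENNReal.toReal_mono hsum (ENNReal.sum_le_tsum Z)
  -- a vanishing coefficient makes up for a basis function that is not Lipschitz continuous
  have key : ∀ k, ∀ v ∈ closure O, (lam k * g k v) ^ 2 ≤ (β k).toReal ∧
      ∀ w ∈ closure O, (lam k * diffQuot (g k) v w) ^ 2 ≤ (β k).toReal := by
    intro k v hv
    rcases eq_or_ne (lam k) 0 with h0 | h0
    · simp [h0]
    · have hpos : 0 < lam k ^ 2 := by positivity
      have hfin : w1infNorm O (g k) ≠ ∞ := by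
        intro htop
        refine hβk k ?_
        simp only [hβ, htop]
        rw [ENNReal.top_pow (by norm_num), ENNReal.mul_top]
        simpa using h0
      have hval : (β k).toReal = lam k ^ 2 * (w1infNorm O (g k)).toReal ^ 2 := by
        simp only [hβ]
        rw [ENNReal.toReal_mul, ENNReal.toReal_ofReal hpos.le, ENNReal.toReal_pow]
      obtain ⟨hb, hL⟩ := bound_of_w1infNorm hO (hg.continuousOn k) hfin
      rw [hval]
      refine ⟨?_, fun w hw => ?_⟩
      · rw [mul_pow, ← sq_abs (g k v)]
        gcongr
        exact hb v hv
      · rw [mul_pow, ← sq_abs (diffQuot _ _ _)]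
        gcongr
        rw [diffQuot, abs_div, abs_norm]
        exact div_le_of_le_mul₀ (norm_nonneg _) ENNReal.toReal_nonneg (hL w hw v hv)
  exact ⟨(∑' k, β k).toReal, ENNReal.toReal_nonneg, fun Z v hv =>
    ⟨(Finset.sum_le_sum fun k _ => (key k v hv).1).trans (hZ Z), fun w hw =>
      (Finset.sum_le_sum fun k _ => (key k v hv).2 w hw).trans (hZ Z)⟩⟩

end Noise


/-! ### Measurability of finite element quantities -/

section Measurability

variable {d : ℕ} {O : Set (Space d)} {Ω : Type*} {m : MeasurableSpace Ω}

open Triangulation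

theorem measurable_lumped (hO : IsConvexPolyhedralDomain O) (𝒯 : Triangulation O)
    {a : Ω → Space d → ℝ} (ha : ∀ v, Measurable fun ω => a ω v) :
    Measurable fun ω => lumped 𝒯 (a ω) := by
  simp only [lumped_eq_sum hO]
  exact Finset.measurable_fun_sum _ fun v _ => (ha v).const_mul _

theorem measurable_slope (𝒯 : Triangulation O) {s : Finset (Space d)} (hs : s ∈ 𝒯.cells)
    {ζ : Ω → Space d → ℝ} (hζ : Measurable ζ) (hmem : ∀ ω, ζ ω ∈ 𝒯.femSpace) :
    Measurable fun ω => slope s (ζ ω) := by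
  simp only [fun ω => slope_eq_sum 𝒯 hs (hmem ω)]
  exact Finset.measurable_fun_sum _ fun v _ => ((measurable_pi_apply v).comp hζ).smul_const _

theorem measurable_dirichletForm (hO : IsConvexPolyhedralDomain O) (𝒯 : Triangulation O)
    {ζ ψ : Ω → Space d → ℝ} (hζ : Measurable ζ) (hmem : ∀ ω, ζ ω ∈ 𝒯.femSpace)
    (hψ : Measurable ψ) (hmem' : ∀ ω, ψ ω ∈ 𝒯.femSpace) :
    Measurable fun ω => dirichletForm O (ζ ω) (ψ ω) := by
  simp only [fun ω => dirichletForm_eq_sum hO 𝒯 (hmem ω) (hmem' ω)]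
  exact Finset.measurable_fun_sum _ fun s hs =>
    ((measurable_slope 𝒯 hs hζ hmem).inner (measurable_slope 𝒯 hs hψ hmem')).const_mul _

theorem measurable_gradWeight (hO : IsConvexPolyhedralDomain O) (𝒯 : Triangulation O)
    {s : Finset (Space d)} (hs : s ∈ 𝒯.cells) {ζ : Ω → Space d → ℝ} (hζ : Measurable ζ)
    (hmem : ∀ ω, ζ ω ∈ 𝒯.femSpace) : Measurable fun ω => gradWeight O (ζ ω) s :=
  ((((measurable_slope 𝒯 hs hζ hmem).norm.const_add 1).pow_const 2).const_mul _).div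
    ((measurable_dirichletForm hO 𝒯 hζ hmem hζ hmem).const_add 1)

theorem measurable_noiseSize (hO : IsConvexPolyhedralDomain O) (𝒯 : Triangulation O) (C : ℝ)
    {ζ γ : Ω → Space d → ℝ} (hζ : Measurable ζ) (hmem : ∀ ω, ζ ω ∈ 𝒯.femSpace)
    (hγ : ∀ v, Measurable fun ω => γ ω v) : Measurable fun ω => noiseSize 𝒯 C (ζ ω) (γ ω) := by
  refine (Measurable.add ?_ ?_).const_mul C |>.const_add 1
  · exact Finset.measurable_fun_sum _ fun v _ => ((hγ v).pow_const 6).const_mul _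
  · refine Finset.measurable_fun_sum _ fun i hi => ?_
    have hs : i.1 ∈ 𝒯.cells := (Finset.mem_sigma.1 hi).1
    exact (measurable_gradWeight hO 𝒯 hs hζ hmem).mul
      (((hγ _).pow_const 2).add ((((hγ _).sub (hγ _)).div_const _).pow_const 2))

end Measurability

/-! ### Moments of the discrete noise -/

section NoiseMoments

variable {d : ℕ} {O : Set (Space d)} {Ω : Type*} {mΩ : MeasurableSpace Ω} {P : Measure Ω}
  [IsProbabilityMeasure P] {𝓕 : Filtration ℝ≥0 mΩ} {T : ℝ} {N : ℕ} {𝔤 : HilbertBasis ℤ ℝ (L2 O)}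
  {g : ℤ → Space d → ℝ} {lam : ℤ → ℝ} {Cmom : ℕ → ℝ} {ξ : ℕ → Ω → L2 O}

open Triangulation

/-- The Fourier coefficients of the noise increment `f`, normalized by the square root of the step
size. -/
def noiseCoeff (𝔤 : HilbertBasis ℤ ℝ (L2 O)) (τ : ℝ) (f : L2 O) (k : ℤ) : ℝ :=
  inner ℝ f (𝔤 k) / √τ

theorem discPhi_eq_noiseCoeff (𝒯 : Triangulation O) (Z : Finset ℤ) (σ : ℝ → ℝ) {τ : ℝ}
    (hτ : 0 < τ) (ζ : Space d → ℝ) (f : L2 O) :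
    discPhi 𝒯 Z σ 𝔤 g ζ f
      = 𝒯.interp fun x => σ (ζ x) * (√τ * noiseField Z g (noiseCoeff 𝔤 τ f) x) := by
  rw [discPhi_eq_interp]
  congr 1
  funext x
  have := Real.sqrt_pos.2 hτ
  simp only [noiseField, noiseCoeff, Finset.mul_sum]
  exact Finset.sum_congr rfl fun k _ => by field_simp

theorem measurable_noiseCoeff (𝔤 : HilbertBasis ℤ ℝ (L2 O)) (τ : ℝ) (f : Ω → L2 O) (k : ℤ) :
    Measurable[MeasurableSpace.comap f (borel (L2 O))] fun ω => noiseCoeff 𝔤 τ (f ω) k := by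
  let _ : MeasurableSpace (L2 O) := borel (L2 O)
  have : BorelSpace (L2 O) := ⟨rfl⟩
  have h : Measurable fun f : L2 O => noiseCoeff 𝔤 τ f k :=
    (Continuous.measurable (by fun_prop : Continuous fun f : L2 O => inner ℝ f (𝔤 k))).div_const _
  exact h.comp (comap_measurable f)

omit [IsProbabilityMeasure P] in
/-- As the basis is orthonormal, the Fourier coefficients of the noise increment are almost surely the
multiples `λₖ Xₖ` of the independent random variables in its expansion. -/
theorem IsDiscreteIncrement.exists_coeff (h : IsDiscreteIncrement P 𝓕 T N 𝔤 lam Cmom ξ)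
    (hτ : 0 < T / N) {n : ℕ} (hn : n < N) :
    ∃ X : ℤ → Ω → ℝ, (∀ k, Measurable (X k)) ∧ iIndepFun X P ∧ (∀ k, ∫ ω, X k ω ∂P = 0) ∧
      (∀ k, ∀ q : ℕ, 2 ≤ q → Integrable (fun ω => |X k ω| ^ q) P ∧ ∫ ω, |X k ω| ^ q ∂P ≤ Cmom q) ∧
      ∀ k, (fun ω => noiseCoeff 𝔤 (T / N) (ξ (n + 1) ω) k) =ᵐ[P] fun ω => lam k * X k ω := by
  obtain ⟨X, hXm, hXi, -, hX0, -, hXq, hX⟩ := h.expansion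
  refine ⟨X ⟨n, hn⟩, hXm _, hXi.precomp (g := fun k : ℤ => ((⟨n, hn⟩ : Fin N), k))
    (fun a b hab => (Prod.mk.inj hab).2), hX0 _, hXq _, fun k => ?_⟩
  filter_upwards [hX ⟨n, hn⟩] with ω hω
  have h1 := hω.mapL (innerSL ℝ (𝔤 k))
  have h2 : HasSum (fun j => innerSL ℝ (𝔤 k) ((√(T / N) * lam j * X ⟨n, hn⟩ j ω) • 𝔤 j))
      (√(T / N) * lam k * X ⟨n, hn⟩ k ω) := by
    convert! hasSum_ite_eq k (√(T / N) * lam k * X ⟨n, hn⟩ k ω) using 1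
    funext j
    simp only [map_smul, innerSL_apply_apply, smul_eq_mul, orthonormal_iff_ite.1 𝔤.orthonormal k j]
    split_ifs with h3 h4 h5
    · rw [mul_one, h3]
    · exact absurd h3.symm h4
    · exact absurd h5.symm h3
    · rw [mul_zero]
  have h3 := h1.unique h2
  have h4 := Real.sqrt_pos.2 hτ
  rw [innerSL_apply_apply] at h3
  rw [noiseCoeff, real_inner_comm, h3]
  field_simp

theorem IsDiscreteIncrement.memLp_sum_coeff (h : IsDiscreteIncrement P 𝓕 T N 𝔤 lam Cmom ξ)
    (hτ : 0 < T / N) {n : ℕ} (hn : n < N) (Z : Finset ℤ) (b : ℤ → ℝ) (q : ℕ) :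
    MemLp (fun ω => ∑ k ∈ Z, b k * noiseCoeff 𝔤 (T / N) (ξ (n + 1) ω) k) q P := by
  obtain ⟨X, hXm, -, -, hXq, hX⟩ := h.exists_coeff hτ hn
  refine memLp_finsetSum Z fun k _ => MemLp.const_mul ?_ (b k)
  exact (memLp_congr_ae (hX k)).2
    ((memLp_of_integrable_abs_pow (hXm k) (fun q hq => (hXq k q hq).1) q).const_mul _)

theorem IsDiscreteIncrement.integral_coeff (h : IsDiscreteIncrement P 𝓕 T N 𝔤 lam Cmom ξ)
    (hτ : 0 < T / N) {n : ℕ} (hn : n < N) (k : ℤ) :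
    Integrable (fun ω => noiseCoeff 𝔤 (T / N) (ξ (n + 1) ω) k) P ∧
      ∫ ω, noiseCoeff 𝔤 (T / N) (ξ (n + 1) ω) k ∂P = 0 := by
  obtain ⟨X, hXm, -, hX0, hXq, hX⟩ := h.exists_coeff hτ hn
  constructor
  · have h1 := memLp_of_integrable_abs_pow (hXm k) (fun q hq => (hXq k q hq).1) 1
    exact (integrable_congr (hX k)).2 ((memLp_one_iff_integrable.1 (by exact_mod_cast h1)).const_mul _)
  · rw [integral_congr_ae (hX k), integral_const_mul, hX0, mul_zero]

theorem exists_integral_sum_coeff_pow_le (P : Measure Ω) [IsProbabilityMeasure P]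
    (𝔤 : HilbertBasis ℤ ℝ (L2 O)) (lam : ℤ → ℝ) (Cmom : ℕ → ℝ) (m : ℕ) :
    ∃ C ≥ 1, ∀ (𝓕 : Filtration ℝ≥0 mΩ) (T : ℝ) (N : ℕ) (ξ : ℕ → Ω → L2 O),
      IsDiscreteIncrement P 𝓕 T N 𝔤 lam Cmom ξ → 0 < T / N → ∀ n < N,
      ∀ (Z : Finset ℤ) (b : ℤ → ℝ),
        ∫ ω, (∑ k ∈ Z, b k * noiseCoeff 𝔤 (T / N) (ξ (n + 1) ω) k) ^ (2 * m) ∂P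
          ≤ C * (∑ k ∈ Z, (lam k * b k) ^ 2) ^ m := by
  obtain ⟨C, hC, hmom⟩ := exists_integral_sum_pow_le (P := P) Cmom m
  refine ⟨C, hC, fun 𝓕 T N ξ h hτ n hn Z b => ?_⟩
  obtain ⟨X, hXm, hXi, hX0, hXq, hX⟩ := h.exists_coeff hτ hn
  refine le_trans (le_of_eq (integral_congr_ae ?_)) (hmom X hXm hXi hX0 hXq Z fun k => lam k * b k)
  have h1 : ∀ᵐ ω ∂P, ∀ k ∈ Z, noiseCoeff 𝔤 (T / N) (ξ (n + 1) ω) k = lam k * X k ω :=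
    (Z.eventually_all).2 fun k _ => hX k
  filter_upwards [h1] with ω hω
  congr 1
  exact Finset.sum_congr rfl fun k hk => by rw [hω k hk]; ring

/-- The size of the discrete noise has moments which are bounded uniformly in the discretization
parameters, also when they are weighted by a variable known at the beginning of the step. -/
theorem exists_integral_noiseSize_pow_le (hO : IsConvexPolyhedralDomain O) (P : Measure Ω)
    [IsProbabilityMeasure P] (hg : IsColored 𝔤 g lam) (Cmom : ℕ → ℝ) {C : ℝ} (hC : 0 ≤ C) (m : ℕ) :
    ∃ B ≥ 0, ∀ (𝒯 : Triangulation O) (Z : Finset ℤ) (𝓕 : Filtration ℝ≥0 mΩ) (T : ℝ) (N : ℕ)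
      (ξ : ℕ → Ω → L2 O), IsDiscreteIncrement P 𝓕 T N 𝔤 lam Cmom ξ → 0 < T / N → ∀ n < N,
      ∀ ζ : Ω → Space d → ℝ, Measurable[𝓕 (gridTime T N n)] ζ → (∀ ω, ζ ω ∈ 𝒯.femSpace) →
      ∀ v : Ω → ℝ, Measurable[𝓕 (gridTime T N n)] v → (∀ ω, 0 ≤ v ω) → Integrable v P →
        Integrable (fun ω => v ω * noiseSize 𝒯 C (ζ ω)
          (noiseField Z g (noiseCoeff 𝔤 (T / N) (ξ (n + 1) ω))) ^ (m + 1)) P ∧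
        ∫ ω, v ω * noiseSize 𝒯 C (ζ ω)
          (noiseField Z g (noiseCoeff 𝔤 (T / N) (ξ (n + 1) ω))) ^ (m + 1) ∂P ≤ B * ∫ ω, v ω ∂P := by
  obtain ⟨Λ, hΛ, hcol⟩ := hg.exists_bound hO
  obtain ⟨C₁, hC₁, h₁⟩ := exists_integral_sum_coeff_pow_le P 𝔤 lam Cmom (3 * (m + 1))
  obtain ⟨C₂, hC₂, h₂⟩ := exists_integral_sum_coeff_pow_le P 𝔤 lam Cmom (m + 1)
  set A₂ : ℝ := (d + 1) ^ 2 * (2 * (1 + volume.real O)) with hA₂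
  set B₁ : ℝ := volume.real O ^ (m + 1) * (C₁ * Λ ^ (3 * (m + 1))) with hB₁
  set B₂ : ℝ := A₂ ^ (m + 1) * (2 ^ m * (2 * (C₂ * Λ ^ (m + 1)))) with hB₂
  have hB₁0 : 0 ≤ B₁ := by positivity
  have hB₂0 : 0 ≤ B₂ := by positivity
  refine ⟨2 ^ m * (1 + C ^ (m + 1) * (2 ^ m * (B₁ + B₂))), by positivity, ?_⟩
  intro 𝒯 Z 𝓕 T N ξ h hτ n hn ζ hζm hζ v hvm hv0 hvi
  set c : Ω → ℤ → ℝ := fun ω => noiseCoeff 𝔤 (T / N) (ξ (n + 1) ω) with hc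
  set γ : Ω → Space d → ℝ := fun ω => noiseField Z g (c ω) with hγ
  have h𝓗 : MeasurableSpace.comap (ξ (n + 1)) (borel (L2 O)) ≤ mΩ :=
    ((h.measurable (n + 1) (by omega) hn).comap_le).trans (𝓕.le _)
  have hind := h.indep (n + 1) (by omega) hn n (Nat.lt_succ_self n)
  have hcm : ∀ k, Measurable[MeasurableSpace.comap (ξ (n + 1)) (borel (L2 O))] fun ω => c ω k :=
    fun k => measurable_noiseCoeff 𝔤 _ _ k
  have eγ : ∀ x ω, γ ω x = ∑ k ∈ Z, g k x * c ω k := fun x ω =>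
    Finset.sum_congr rfl fun k _ => mul_comm _ _
  have eq : ∀ x y ω, diffQuot (γ ω) x y = ∑ k ∈ Z, diffQuot (g k) x y * c ω k := fun x y ω => by
    simp only [diffQuot, eγ, ← Finset.sum_sub_distrib, Finset.sum_div]
    exact Finset.sum_congr rfl fun k _ => by ring
  have hγm : ∀ x, Measurable[MeasurableSpace.comap (ξ (n + 1)) (borel (L2 O))] fun ω => γ ω x :=
    fun x => by
      simp only [eγ]
      exact Finset.measurable_fun_sum _ fun k _ => (hcm k).const_mul _
  have hqm : ∀ x y, Measurable[MeasurableSpace.comap (ξ (n + 1)) (borel (L2 O))] fun ω =>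
      diffQuot (γ ω) x y := fun x y => ((hγm x).sub (hγm y)).div_const _
  have hγp : ∀ x, ∀ q : ℕ, MemLp (fun ω => γ ω x) q P := fun x q => by
    simp only [eγ]
    exact h.memLp_sum_coeff hτ hn Z _ q
  have hqp : ∀ x y, ∀ q : ℕ, MemLp (fun ω => diffQuot (γ ω) x y) q P := fun x y q => by
    simp only [eq]
    exact h.memLp_sum_coeff hτ hn Z _ q
  -- the contribution of the nodal values
  obtain ⟨i₁, l₁⟩ := integral_mul_sum_pow_le h𝓗 (𝓕.le _) hind 𝒯.vertices (m := m)
    (a := fun x _ => 𝒯.nodeWeight x) (ψ := fun x ω => γ ω x ^ 6) (A := volume.real O)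
    (B := C₁ * Λ ^ (3 * (m + 1))) (by positivity) (fun x _ => measurable_const)
    (fun x _ _ => 𝒯.nodeWeight_nonneg x) (fun _ => (sum_nodeWeight hO 𝒯).le)
    (fun x _ => (hγm x).pow_const 6) (fun x _ _ => by positivity)
    (fun x _ => by
      simp only [← pow_mul]
      exact integrable_pow_of_memLp (hγp x _))
    (fun x hx => by
      simp only [← pow_mul, eγ, show 6 * (m + 1) = 2 * (3 * (m + 1)) by ring]
      refine (h₁ 𝓕 T N ξ h hτ n hn Z fun k => g k x).trans ?_
      have := (hcol Z x (vertex_mem_closure 𝒯 hx)).1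
      gcongr) hvm hv0 hvi
  -- the contribution of the difference quotients
  have hpair : ∀ i ∈ vertexPairs 𝒯, i.1 ∈ 𝒯.cells ∧ i.2.1 ∈ closure O ∧ i.2.2 ∈ closure O := by
    intro i hi
    obtain ⟨hs, h3⟩ := Finset.mem_sigma.1 hi
    obtain ⟨h4, h5⟩ := Finset.mem_product.1 h3
    exact ⟨hs, vertex_mem_closure 𝒯 (𝒯.mem_vertices.2 ⟨_, hs, h4⟩),
      vertex_mem_closure 𝒯 (𝒯.mem_vertices.2 ⟨_, hs, h5⟩)⟩
  have hψle : ∀ i : (_ : Finset (Space d)) × Space d × Space d, ∀ ω,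
      (γ ω i.2.1 ^ 2 + diffQuot (γ ω) i.2.1 i.2.2 ^ 2) ^ (m + 1)
        ≤ 2 ^ m * (γ ω i.2.1 ^ (2 * (m + 1)) + diffQuot (γ ω) i.2.1 i.2.2 ^ (2 * (m + 1))) :=
    fun i ω => by
      have := add_pow_le (sq_nonneg (γ ω i.2.1)) (sq_nonneg (diffQuot (γ ω) i.2.1 i.2.2)) (m + 1)
      simpa only [← pow_mul, Nat.add_sub_cancel] using this
  have hψint : ∀ i : (_ : Finset (Space d)) × Space d × Space d, Integrable (fun ω =>
      2 ^ m * (γ ω i.2.1 ^ (2 * (m + 1)) + diffQuot (γ ω) i.2.1 i.2.2 ^ (2 * (m + 1)))) P :=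
    fun i => ((integrable_pow_of_memLp (hγp _ _)).add
      (integrable_pow_of_memLp (hqp _ _ _))).const_mul _
  have hψi : ∀ i : (_ : Finset (Space d)) × Space d × Space d, Integrable (fun ω =>
      (γ ω i.2.1 ^ 2 + diffQuot (γ ω) i.2.1 i.2.2 ^ 2) ^ (m + 1)) P := fun i => by
    refine (hψint i).mono' (Measurable.aestronglyMeasurable ?_) (ae_of_all _ fun ω => ?_)
    · exact ((((hγm _).mono h𝓗 le_rfl).pow_const 2).add
        (((hqm _ _).mono h𝓗 le_rfl).pow_const 2)).pow_const _
    · rw [Real.norm_of_nonneg (by positivity)]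
      exact hψle i ω
  obtain ⟨i₂, l₂⟩ := integral_mul_sum_pow_le h𝓗 (𝓕.le _) hind (vertexPairs 𝒯) (m := m)
    (a := fun i ω => gradWeight O (ζ ω) i.1)
    (ψ := fun i ω => γ ω i.2.1 ^ 2 + diffQuot (γ ω) i.2.1 i.2.2 ^ 2) (A := A₂)
    (B := 2 ^ m * (2 * (C₂ * Λ ^ (m + 1)))) (by positivity)
    (fun i hi => measurable_gradWeight hO 𝒯 (hpair i hi).1 hζm hζ)
    (fun i _ ω => gradWeight_nonneg _ _) (fun ω => sum_gradWeight_le hO 𝒯 (hζ ω))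
    (fun i _ => ((hγm _).pow_const 2).add ((hqm _ _).pow_const 2)) (fun i _ ω => by positivity)
    (fun i _ => hψi i)
    (fun i hi => by
      obtain ⟨-, hx, hy⟩ := hpair i hi
      refine (integral_mono (hψi i) (hψint i) (hψle i)).trans ?_
      rw [integral_const_mul, integral_add (integrable_pow_of_memLp (hγp _ _))
        (integrable_pow_of_memLp (hqp _ _ _))]
      have k1 : ∫ ω, γ ω i.2.1 ^ (2 * (m + 1)) ∂P ≤ C₂ * Λ ^ (m + 1) := by
        simp only [eγ]
        refine (h₂ 𝓕 T N ξ h hτ n hn Z fun k => g k i.2.1).trans ?_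
        have := (hcol Z _ hx).1
        gcongr
      have k2 : ∫ ω, diffQuot (γ ω) i.2.1 i.2.2 ^ (2 * (m + 1)) ∂P ≤ C₂ * Λ ^ (m + 1) := by
        simp only [eq]
        refine (h₂ 𝓕 T N ξ h hτ n hn Z fun k => diffQuot (g k) i.2.1 i.2.2).trans ?_
        have := (hcol Z _ hx).2 _ hy
        gcongr
      gcongr
      linarith) hvm hv0 hvi
  -- the power of the sum
  set S₁ : Ω → ℝ := fun ω => ∑ x ∈ 𝒯.vertices, 𝒯.nodeWeight x * γ ω x ^ 6 with hS₁
  set S₂ : Ω → ℝ := fun ω => ∑ i ∈ vertexPairs 𝒯, gradWeight O (ζ ω) i.1 *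
    (γ ω i.2.1 ^ 2 + diffQuot (γ ω) i.2.1 i.2.2 ^ 2) with hS₂
  have hS₁0 : ∀ ω, 0 ≤ S₁ ω := fun ω =>
    Finset.sum_nonneg fun x _ => mul_nonneg (𝒯.nodeWeight_nonneg x) (by positivity)
  have hS₂0 : ∀ ω, 0 ≤ S₂ ω := fun ω =>
    Finset.sum_nonneg fun i _ => mul_nonneg (gradWeight_nonneg _ i.1) (by positivity)
  have hle : ∀ ω, v ω * noiseSize 𝒯 C (ζ ω) (γ ω) ^ (m + 1)
      ≤ 2 ^ m * (v ω + C ^ (m + 1) * (2 ^ m * (v ω * S₁ ω ^ (m + 1) + v ω * S₂ ω ^ (m + 1)))) := by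
    intro ω
    have k1 := add_pow_le (zero_le_one' ℝ) (mul_nonneg hC (add_nonneg (hS₁0 ω) (hS₂0 ω))) (m + 1)
    have k2 := add_pow_le (hS₁0 ω) (hS₂0 ω) (m + 1)
    simp only [Nat.add_sub_cancel, one_pow, mul_pow] at k1 k2
    have k3 : (1 + C * (S₁ ω + S₂ ω)) ^ (m + 1)
        ≤ 2 ^ m * (1 + C ^ (m + 1) * (2 ^ m * (S₁ ω ^ (m + 1) + S₂ ω ^ (m + 1)))) :=
      k1.trans (by gcongr)
    calc _ ≤ v ω * _ := mul_le_mul_of_nonneg_left k3 (hv0 ω)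
      _ = _ := by ring
  have hR' : Integrable (fun ω =>
      C ^ (m + 1) * (2 ^ m * (v ω * S₁ ω ^ (m + 1) + v ω * S₂ ω ^ (m + 1)))) P :=
    ((i₁.add i₂).const_mul _).const_mul _
  have hR : Integrable (fun ω =>
      2 ^ m * (v ω + C ^ (m + 1) * (2 ^ m * (v ω * S₁ ω ^ (m + 1) + v ω * S₂ ω ^ (m + 1))))) P :=
    (hvi.add hR').const_mul _
  have hint : Integrable (fun ω => v ω * noiseSize 𝒯 C (ζ ω) (γ ω) ^ (m + 1)) P := by
    refine hR.mono' (Measurable.aestronglyMeasurable ?_) (ae_of_all _ fun ω => ?_)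
    · exact (hvm.mono (𝓕.le _) le_rfl).mul ((measurable_noiseSize hO 𝒯 C
        (hζm.mono (𝓕.le _) le_rfl) hζ fun x => (hγm x).mono h𝓗 le_rfl).pow_const _)
    · rw [Real.norm_of_nonneg]
      · exact hle ω
      · have := one_le_noiseSize 𝒯 hC (ζ ω) (γ ω)
        exact mul_nonneg (hv0 ω) (by positivity)
  refine ⟨hint, (integral_mono hint hR hle).trans ?_⟩
  rw [integral_const_mul, integral_add hvi hR', integral_const_mul, integral_const_mul,
    integral_add i₁ i₂]
  calc _ ≤ 2 ^ m * (∫ ω, v ω ∂P + C ^ (m + 1) * (2 ^ m * (B₁ * ∫ ω, v ω ∂P + B₂ * ∫ ω, v ω ∂P))) := by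
        gcongr
    _ = _ := by ring

end NoiseMoments


/-! ### The martingale part of the energy increment -/

section Linearity

variable {d : ℕ} {O : Set (Space d)}

open Triangulation

theorem dirichletForm_sum_right (hO : IsConvexPolyhedralDomain O) (𝒯 : Triangulation O)
    {u : Space d → ℝ} (hu : u ∈ 𝒯.femSpace) {ι : Type*} (I : Finset ι) (c : ι → ℝ)
    (w : ι → Space d → ℝ) (hw : ∀ i ∈ I, w i ∈ 𝒯.femSpace) :
    dirichletForm O u (∑ i ∈ I, c i • w i) = ∑ i ∈ I, c i * dirichletForm O u (w i) := by
  rw [dirichletForm_eq_sum hO 𝒯 hu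
    (𝒯.femSpace.sum_mem fun i hi => 𝒯.femSpace.smul_mem (c i) (hw i hi))]
  have h : ∀ i ∈ I, c i * dirichletForm O u (w i)
      = ∑ s ∈ 𝒯.cells, c i * (volume.real (cell s) * inner ℝ (slope s u) (slope s (w i))) :=
    fun i hi => by rw [dirichletForm_eq_sum hO 𝒯 hu (hw i hi), Finset.mul_sum]
  rw [Finset.sum_congr rfl h]
  rw [Finset.sum_comm]
  refine Finset.sum_congr rfl fun s hs => ?_
  rw [𝒯.slope_sum hs I c w hw, inner_sum, Finset.mul_sum]
  exact Finset.sum_congr rfl fun i _ => by rw [real_inner_smul_right]; ring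

theorem lumped_mul_sum (hO : IsConvexPolyhedralDomain O) (𝒯 : Triangulation O)
    (a : Space d → ℝ) {ι : Type*} (I : Finset ι) (c : ι → ℝ) (w : ι → Space d → ℝ) :
    lumped 𝒯 (fun x => a x * (∑ i ∈ I, c i • w i) x)
      = ∑ i ∈ I, c i * lumped 𝒯 (fun x => a x * w i x) := by
  simp only [lumped_eq_sum hO, Finset.mul_sum, Finset.sum_apply, Pi.smul_apply, smul_eq_mul]
  rw [Finset.sum_comm]
  exact Finset.sum_congr rfl fun i _ => Finset.sum_congr rfl fun v _ => by ring

theorem noisePairing_sum (hO : IsConvexPolyhedralDomain O) (𝒯 : Triangulation O) (F : ℝ → ℝ)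
    {φ : Space d → ℝ} (hφ : φ ∈ 𝒯.femSpace) (r : ℝ) {ι : Type*} (I : Finset ι) (c : ι → ℝ)
    (w : ι → Space d → ℝ) (hw : ∀ i ∈ I, w i ∈ 𝒯.femSpace) :
    noisePairing 𝒯 F φ r (∑ i ∈ I, c i • w i) = ∑ i ∈ I, c i * noisePairing 𝒯 F φ r (w i) := by
  simp only [noisePairing]
  rw [dirichletForm_sum_right hO 𝒯 hφ I c w hw,
    lumped_mul_sum hO 𝒯 (fun x => deriv F (φ x)), lumped_mul_sum hO 𝒯 φ, Finset.sum_div,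
    Finset.mul_sum, Finset.mul_sum, ← Finset.sum_add_distrib, ← Finset.sum_add_distrib]
  exact Finset.sum_congr rfl fun i _ => by ring

theorem correctedSlope_sum (hO : IsConvexPolyhedralDomain O) (𝒯 : Triangulation O) (F : ℝ → ℝ)
    (φ Θ : Space d → ℝ) {ι : Type*} (I : Finset ι) (c : ι → ℝ) (w : ι → Space d → ℝ) :
    correctedSlope 𝒯 F φ Θ (∑ i ∈ I, c i • w i)
      = ∑ i ∈ I, c i * correctedSlope 𝒯 F φ Θ (w i) := by
  simp only [correctedSlope]
  rw [lumped_mul_sum hO 𝒯 (fun x => deriv F (φ x)),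
    lumped_mul_sum hO 𝒯 (fun x => iteratedDeriv 2 F (φ x) * Θ x), Finset.sum_div, Finset.mul_sum,
    Finset.sum_div, Finset.sum_div, ← Finset.sum_sub_distrib, ← Finset.sum_add_distrib]
  exact Finset.sum_congr rfl fun i _ => by ring

theorem discPhi_eq_sum (𝒯 : Triangulation O) (Z : Finset ℤ) (σ : ℝ → ℝ)
    (𝔤 : HilbertBasis ℤ ℝ (L2 O)) (g : ℤ → Space d → ℝ) {τ : ℝ} (hτ : 0 < τ) (ζ : Space d → ℝ)
    (f : L2 O) :
    discPhi 𝒯 Z σ 𝔤 g ζ f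
      = ∑ k ∈ Z, (√τ * noiseCoeff 𝔤 τ f k) • 𝒯.interp fun x => σ (ζ x) * g k x := by
  have := Real.sqrt_pos.2 hτ
  simp only [discPhi, interp, Finset.smul_sum, smul_smul]
  refine Finset.sum_congr rfl fun k _ => Finset.sum_congr rfl fun v _ => ?_
  rw [noiseCoeff]
  congr 1
  field_simp

theorem discPhi_mem (𝒯 : Triangulation O) (Z : Finset ℤ) (σ : ℝ → ℝ)
    (𝔤 : HilbertBasis ℤ ℝ (L2 O)) (g : ℤ → Space d → ℝ) (ζ : Space d → ℝ) (f : L2 O) :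
    discPhi 𝒯 Z σ 𝔤 g ζ f ∈ 𝒯.femSpace :=
  𝒯.femSpace.sum_mem fun _ _ => 𝒯.interp_mem _

/-- For a fixed field and triangulation the size of the noise is bounded in `ζ`. -/
theorem exists_noiseSize_le (hO : IsConvexPolyhedralDomain O) (𝒯 : Triangulation O) {C : ℝ}
    (hC : 0 ≤ C) (γ : Space d → ℝ) : ∃ D, ∀ ζ ∈ 𝒯.femSpace, noiseSize 𝒯 C ζ γ ≤ D := by
  set S := ∑ i ∈ vertexPairs 𝒯, (γ i.2.1 ^ 2 + diffQuot γ i.2.1 i.2.2 ^ 2) with hS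
  have hS0 : 0 ≤ S := Finset.sum_nonneg fun i _ => by positivity
  refine ⟨1 + C * (∑ v ∈ 𝒯.vertices, 𝒯.nodeWeight v * γ v ^ 6
    + (d + 1) ^ 2 * (2 * (1 + volume.real O)) * S), fun ζ hζ => ?_⟩
  rw [noiseSize]
  gcongr
  calc _ ≤ ∑ i ∈ vertexPairs 𝒯, gradWeight O ζ i.1 * S :=
        Finset.sum_le_sum fun i hi => mul_le_mul_of_nonneg_left
          (Finset.single_le_sum (f := fun i : (_ : Finset (Space d)) × Space d × Space d =>
            γ i.2.1 ^ 2 + diffQuot γ i.2.1 i.2.2 ^ 2) (fun i _ => by positivity) hi)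
          (gradWeight_nonneg ζ _)
    _ = (∑ i ∈ vertexPairs 𝒯, gradWeight O ζ i.1) * S := by rw [Finset.sum_mul]
    _ ≤ _ := mul_le_mul_of_nonneg_right (sum_gradWeight_le hO 𝒯 hζ) hS0

/-- For a fixed field `γ` the martingale increment is at most proportional to the energy.  The constant
depends on the triangulation and serves only to ensure integrability. -/
theorem exists_abs_noisePairing_le (hd : d = 2 ∨ d = 3) (hO : IsConvexPolyhedralDomain O)
    {𝒯 : ℝ → Triangulation O} (h𝒯 : QuasiUniform 𝒯) {σ : ℝ → ℝ} (hσ : IsNoiseCoefficient σ)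
    {F : ℝ → ℝ} {ν K : ℝ} (hF : PotentialBounds F ν K) {h : ℝ} (hh : h ∈ Ioc (0 : ℝ) 1)
    (γ : Space d → ℝ) :
    ∃ D, ∀ ζ ∈ (𝒯 h).femSpace, ∀ r,
      |noisePairing (𝒯 h) F ζ r ((𝒯 h).interp fun x => σ (ζ x) * γ x)|
        ≤ D * energy (𝒯 h) ζ r := by
  obtain ⟨C₁, hC₁, h₁⟩ := exists_noiseSize hO h𝒯 hσ
  obtain ⟨C₂, hC₂, h₂⟩ := exists_noisePairing_sq_le hd hO hF
  obtain ⟨D, hD⟩ := exists_noiseSize_le hO (𝒯 h) hC₁ γ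
  refine ⟨√(C₂ * D), fun ζ hζ r => ?_⟩
  have hχ := one_le_noiseSize (𝒯 h) hC₁ ζ γ
  have hχD := hD ζ hζ
  have h3 := h₁ h hh ζ hζ γ 1 one_pos
  simp only [Real.sqrt_one, one_mul] at h3
  have h4 := h₂ (𝒯 h) ζ _ r _ hζ ((𝒯 h).interp_mem _) (by linarith) h3.1 h3.2
  have he := one_le_energy hO (𝒯 h) ζ r
  refine (Real.abs_le_sqrt h4).trans ?_
  rw [← mul_assoc, Real.sqrt_mul (by positivity), Real.sqrt_sq (by linarith)]
  gcongr

end Linearity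

section Martingale

variable {d : ℕ} {O : Set (Space d)} {Ω : Type*}

open Triangulation

theorem measurable_interp {m : MeasurableSpace Ω} (𝒯 : Triangulation O) {a : Ω → Space d → ℝ}
    (ha : ∀ v, Measurable fun ω => a ω v) : Measurable fun ω => 𝒯.interp (a ω) := by
  refine measurable_pi_lambda _ fun x => ?_
  simp only [interp, Finset.sum_apply, Pi.smul_apply, smul_eq_mul]
  exact Finset.measurable_fun_sum _ fun v _ => (ha v).mul_const _

theorem measurable_discEnergy {m : MeasurableSpace Ω} (hO : IsConvexPolyhedralDomain O)
    (𝒯 : Triangulation O) {F : ℝ → ℝ} (hF : Measurable F) {φ : Ω → Space d → ℝ}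
    (hφ : Measurable φ) : Measurable fun ω => discEnergy 𝒯 F (φ ω) :=
  measurable_lumped hO 𝒯 fun v => hF.comp ((measurable_pi_apply v).comp hφ)

theorem measurable_energy {m : MeasurableSpace Ω} (hO : IsConvexPolyhedralDomain O)
    (𝒯 : Triangulation O) {φ : Ω → Space d → ℝ} {r : Ω → ℝ} (hφ : Measurable φ)
    (hmem : ∀ ω, φ ω ∈ 𝒯.femSpace) (hr : Measurable r) :
    Measurable fun ω => energy 𝒯 (φ ω) (r ω) :=
  (((hr.pow_const 2).const_add 1).add
    ((measurable_dirichletForm hO 𝒯 hφ hmem hφ hmem).const_mul _)).add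
    ((measurable_lumped hO 𝒯 fun v => ((measurable_pi_apply v).comp hφ).pow_const 2).const_mul _)

theorem measurable_noisePairing {m : MeasurableSpace Ω} (hO : IsConvexPolyhedralDomain O)
    (𝒯 : Triangulation O) {F : ℝ → ℝ} (hF : Measurable F) {φ Θ : Ω → Space d → ℝ} {r : Ω → ℝ}
    (hφ : Measurable φ) (hmem : ∀ ω, φ ω ∈ 𝒯.femSpace) (hr : Measurable r) (hΘ : Measurable Θ)
    (hΘmem : ∀ ω, Θ ω ∈ 𝒯.femSpace) :
    Measurable fun ω => noisePairing 𝒯 F (φ ω) (r ω) (Θ ω) := by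
  have hΘv : ∀ v, Measurable fun ω => Θ ω v := fun v => (measurable_pi_apply v).comp hΘ
  have hφv : ∀ v, Measurable fun ω => φ ω v := fun v => (measurable_pi_apply v).comp hφ
  exact ((measurable_dirichletForm hO 𝒯 hφ hmem hΘ hΘmem).add (hr.mul
    ((measurable_lumped hO 𝒯 fun v => ((measurable_deriv F).comp (hφv v)).mul (hΘv v)).div
      (measurable_discEnergy hO 𝒯 hF hφ).sqrt))).add
    ((measurable_lumped hO 𝒯 fun v => (hφv v).mul (hΘv v)).const_mul _)

/-- The part of the energy increment which is linear in the noise is orthogonal to everything that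
is known at the beginning of the step. -/
theorem integral_mul_noisePairing_eq_zero {mΩ : MeasurableSpace Ω} {P : Measure Ω}
    [IsProbabilityMeasure P] {𝓕 : Filtration ℝ≥0 mΩ} {T : ℝ} {N : ℕ}
    {𝔤 : HilbertBasis ℤ ℝ (L2 O)} {g : ℤ → Space d → ℝ} {lam : ℤ → ℝ} {Cmom : ℕ → ℝ}
    {ξ : ℕ → Ω → L2 O} (hinc : IsDiscreteIncrement P 𝓕 T N 𝔤 lam Cmom ξ) (hτ : 0 < T / N)
    {n : ℕ} (hn : n < N) (hd : d = 2 ∨ d = 3) (hO : IsConvexPolyhedralDomain O)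
    {𝒯 : ℝ → Triangulation O} (h𝒯 : QuasiUniform 𝒯) {σ : ℝ → ℝ} (hσ : IsNoiseCoefficient σ)
    {F : ℝ → ℝ} (hFm : Measurable F) {ν K : ℝ} (hF : PotentialBounds F ν K) {h : ℝ}
    (hh : h ∈ Ioc (0 : ℝ) 1) (Z : Finset ℤ) {φ : Ω → Space d → ℝ} {r : Ω → ℝ}
    (hφ : Measurable[𝓕 (gridTime T N n)] φ) (hmem : ∀ ω, φ ω ∈ (𝒯 h).femSpace)
    (hr : Measurable[𝓕 (gridTime T N n)] r) {G : Ω → ℝ} (hG : Measurable[𝓕 (gridTime T N n)] G)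
    (hi : Integrable (fun ω => G ω * energy (𝒯 h) (φ ω) (r ω)) P) :
    Integrable (fun ω => G ω * noisePairing (𝒯 h) F (φ ω) (r ω)
        (discPhi (𝒯 h) Z σ 𝔤 g (φ ω) (ξ (n + 1) ω))) P ∧
      ∫ ω, G ω * noisePairing (𝒯 h) F (φ ω) (r ω)
        (discPhi (𝒯 h) Z σ 𝔤 g (φ ω) (ξ (n + 1) ω)) ∂P = 0 := by
  obtain ⟨L, hL⟩ := hσ.lipschitz
  have hind := hinc.indep (n + 1) (by omega) hn n (Nat.lt_succ_self n)
  set w : ℤ → Ω → Space d → ℝ := fun k ω => (𝒯 h).interp fun x => σ (φ ω x) * g k x with hw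
  set μ : ℤ → Ω → ℝ := fun k ω => noisePairing (𝒯 h) F (φ ω) (r ω) (w k ω) with hμ
  have hwm : ∀ k, Measurable[𝓕 (gridTime T N n)] (w k) := fun k =>
    measurable_interp (𝒯 h) fun v =>
      (hL.continuous.measurable.comp ((measurable_pi_apply v).comp hφ)).mul_const _
  have hμm : ∀ k, Measurable[𝓕 (gridTime T N n)] (μ k) := fun k =>
    measurable_noisePairing hO (𝒯 h) hFm hφ hmem hr (hwm k) fun ω => (𝒯 h).interp_mem _
  have e : ∀ ω, G ω * noisePairing (𝒯 h) F (φ ω) (r ω)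
        (discPhi (𝒯 h) Z σ 𝔤 g (φ ω) (ξ (n + 1) ω))
      = ∑ k ∈ Z, √(T / N) * (G ω * μ k ω * noiseCoeff 𝔤 (T / N) (ξ (n + 1) ω) k) := fun ω => by
    rw [discPhi_eq_sum _ _ _ _ _ hτ, noisePairing_sum hO (𝒯 h) F (hmem ω) _ _ _ _
      fun k _ => (𝒯 h).interp_mem _, Finset.mul_sum]
    exact Finset.sum_congr rfl fun k _ => by simp only [hμ, hw]; ring
  have hGμ : ∀ k, Integrable (fun ω => G ω * μ k ω) P := fun k => by
    obtain ⟨D, hD⟩ := exists_abs_noisePairing_le hd hO h𝒯 hσ hF hh (g k)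
    refine (hi.norm.const_mul D).mono' (Measurable.aestronglyMeasurable ?_)
      (ae_of_all _ fun ω => ?_)
    · exact (hG.mul (hμm k)).mono (𝓕.le _) le_rfl
    · have he := one_le_energy hO (𝒯 h) (φ ω) (r ω)
      rw [norm_mul, norm_mul, Real.norm_eq_abs (μ k ω),
        Real.norm_of_nonneg (by linarith : 0 ≤ energy (𝒯 h) (φ ω) (r ω))]
      calc _ ≤ ‖G ω‖ * (D * energy (𝒯 h) (φ ω) (r ω)) :=
            mul_le_mul_of_nonneg_left (hD _ (hmem ω) _) (norm_nonneg _)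
        _ = _ := by ring
  have hI : ∀ k, IndepFun (fun ω => G ω * μ k ω)
      (fun ω => noiseCoeff 𝔤 (T / N) (ξ (n + 1) ω) k) P := fun k =>
    (indepFun_of_measurable hind (measurable_noiseCoeff 𝔤 _ _ k) (hG.mul (hμm k))).symm
  have hk : ∀ k ∈ Z, Integrable (fun ω =>
      √(T / N) * (G ω * μ k ω * noiseCoeff 𝔤 (T / N) (ξ (n + 1) ω) k)) P := fun k _ =>
    ((hI k).integrable_mul (hGμ k) (hinc.integral_coeff hτ hn k).1).const_mul _
  simp only [e]
  refine ⟨integrable_finsetSum Z hk, ?_⟩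
  rw [integral_finsetSum Z hk]
  refine Finset.sum_eq_zero fun k _ => ?_
  rw [integral_const_mul, (hI k).integral_fun_mul_eq_mul_integral (hGμ k).aestronglyMeasurable
    (hinc.integral_coeff hτ hn k).1.aestronglyMeasurable, (hinc.integral_coeff hτ hn k).2]
  ring

end Martingale


/-! ### Adaptedness of the discrete solution -/

section LinearSystem

variable {Ω ι : Type*} {m : MeasurableSpace Ω} [Fintype ι] [DecidableEq ι]

theorem measurable_det {A : Ω → Matrix ι ι ℝ} (hA : ∀ i j, Measurable fun ω => A ω i j) :
    Measurable fun ω => (A ω).det := by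
  simp only [Matrix.det_apply']
  exact Finset.measurable_fun_sum _ fun σ _ =>
    (Finset.measurable_fun_prod _ fun i _ => hA _ _).const_mul _

/-- By Cramer's rule the solution of a regular linear system depends measurably on the data. -/
theorem measurable_of_mulVec_eq {A : Ω → Matrix ι ι ℝ} {b x : Ω → ι → ℝ}
    (hA : ∀ i j, Measurable fun ω => A ω i j) (hb : ∀ i, Measurable fun ω => b ω i)
    (hx : ∀ ω, (A ω).mulVec (x ω) = b ω) (hdet : ∀ ω, (A ω).det ≠ 0) (i : ι) :
    Measurable fun ω => x ω i := by
  have e : ∀ ω, x ω i = ((A ω).updateCol i (b ω)).det / (A ω).det := fun ω => by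
    rw [eq_div_iff (hdet ω), ← Matrix.cramer_apply, Matrix.cramer_eq_adjugate_mulVec, ← hx ω,
      Matrix.mulVec_mulVec, Matrix.adjugate_mul, Matrix.smul_mulVec, Matrix.one_mulVec,
      Pi.smul_apply, smul_eq_mul, mul_comm]
  simp only [e]
  refine (measurable_det fun j k => ?_).div (measurable_det hA)
  simp only [Matrix.updateCol_apply]
  split_ifs
  exacts [hb j, hA j k]

end LinearSystem

section Adapted

variable {d : ℕ} {O : Set (Space d)} {Ω : Type*}

open Triangulation

theorem measurable_correctedSlope {m : MeasurableSpace Ω} (hO : IsConvexPolyhedralDomain O)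
    (𝒯 : Triangulation O) {F : ℝ → ℝ} (hF : Measurable F) {φ Θ : Ω → Space d → ℝ}
    (hφ : Measurable φ) (hΘ : Measurable Θ) (ψ : Space d → ℝ) :
    Measurable fun ω => correctedSlope 𝒯 F (φ ω) (Θ ω) ψ := by
  have hφv : ∀ v, Measurable fun ω => φ ω v := fun v => (measurable_pi_apply v).comp hφ
  have hΘv : ∀ v, Measurable fun ω => Θ ω v := fun v => (measurable_pi_apply v).comp hΘ
  have hF1 : ∀ v, Measurable fun ω => deriv F (φ ω v) := fun v =>
    (measurable_deriv F).comp (hφv v)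
  have hF2 : ∀ v, Measurable fun ω => iteratedDeriv 2 F (φ ω v) := fun v => by
    rw [iteratedDeriv_succ]
    exact (measurable_deriv _).comp (hφv v)
  have hE := (measurable_discEnergy hO 𝒯 hF hφ).sqrt
  have h1 : Measurable fun ω => lumped 𝒯 fun x => deriv F (φ ω x) * ψ x :=
    measurable_lumped hO 𝒯 fun v => (hF1 v).mul_const _
  have h2 : Measurable fun ω => lumped 𝒯 fun x => deriv F (φ ω x) * Θ ω x :=
    measurable_lumped hO 𝒯 fun v => (hF1 v).mul (hΘv v)
  have h3 : Measurable fun ω => lumped 𝒯 fun x => iteratedDeriv 2 F (φ ω x) * Θ ω x * ψ x :=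
    measurable_lumped hO 𝒯 fun v => ((hF2 v).mul (hΘv v)).mul_const _
  exact ((h1.div hE).sub ((h2.mul h1).div ((hE.pow_const 3).const_mul 4))).add
    (h3.div (hE.const_mul 2))

/-- One step of the scheme amounts to a linear system for the nodal values of the increment, whose
matrix is the sum of the lumped mass matrix, a stiffness matrix, and a matrix of rank one.  It is
positive definite, so the step preserves measurability. -/
theorem measurable_of_isStep {m : MeasurableSpace Ω} (hO : IsConvexPolyhedralDomain O)
    (𝒯 : Triangulation O) {F : ℝ → ℝ} (hFm : Measurable F) {ν K : ℝ} (hF : PotentialBounds F ν K)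
    {τ : ℝ} (hτ : 0 < τ) {φ₀ φ₁ Θ : Ω → Space d → ℝ} {r₀ r₁ : Ω → ℝ} (hφ₀ : Measurable φ₀)
    (hr₀ : Measurable r₀) (hΘ : Measurable Θ) (h₀ : ∀ ω, φ₀ ω ∈ 𝒯.femSpace)
    (h₁ : ∀ ω, φ₁ ω ∈ 𝒯.femSpace)
    (hst : ∀ ω, IsStep 𝒯 F τ (Θ ω) (φ₀ ω) (r₀ ω) (φ₁ ω) (r₁ ω)) :
    Measurable φ₁ ∧ Measurable r₁ := by
  classical
  set ℓ : Ω → Space d → ℝ := fun ω v => correctedSlope 𝒯 F (φ₀ ω) (Θ ω) (𝒯.hat v) with hℓ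
  have hℓm : ∀ v, Measurable fun ω => ℓ ω v := fun v =>
    measurable_correctedSlope hO 𝒯 hFm hφ₀ hΘ _
  set D : Ω → Space d → ℝ := fun ω => φ₁ ω - φ₀ ω with hD
  have hDmem : ∀ ω, D ω ∈ 𝒯.femSpace := fun ω => 𝒯.femSpace.sub_mem (h₁ ω) (h₀ ω)
  have hE : ∀ ω, 0 < discEnergy 𝒯 F (φ₀ ω) := fun ω =>
    (hF.volume_le_discEnergy hO 𝒯 (φ₀ ω)).2.2
  have hDsum : ∀ ω, D ω = ∑ v : 𝒯.vertices, D ω v • 𝒯.hat v := fun ω => by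
    rw [Finset.sum_coe_sort 𝒯.vertices fun v => D ω v • 𝒯.hat v]
    exact 𝒯.eq_sum_hat (hDmem ω)
  have hr : ∀ ω, r₁ ω = r₀ ω + 1 / 2 * ∑ v : 𝒯.vertices, D ω v * ℓ ω v := fun ω => by
    have h := (hst ω).auxiliary_eq (hE ω)
    rw [show φ₁ ω - φ₀ ω = ∑ v : 𝒯.vertices, D ω v • 𝒯.hat v from hDsum ω,
      correctedSlope_sum hO] at h
    linarith
  set A : Ω → Matrix 𝒯.vertices 𝒯.vertices ℝ := fun ω v w =>
    (if v = w then 𝒯.nodeWeight v else 0) + τ * dirichletForm O (𝒯.hat v) (𝒯.hat w)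
      + τ / 2 * (ℓ ω v * ℓ ω w) with hA
  set b : Ω → 𝒯.vertices → ℝ := fun ω v =>
    𝒯.nodeWeight v * Θ ω v - τ * dirichletForm O (𝒯.hat v) (φ₀ ω) - τ * r₀ ω * ℓ ω v with hb
  have hAx : ∀ ω, ∀ x : 𝒯.vertices → ℝ, ∀ v, (A ω).mulVec x v
      = 𝒯.nodeWeight v * x v + τ * dirichletForm O (𝒯.hat v) (∑ w, x w • 𝒯.hat w)
        + τ / 2 * (ℓ ω v * ∑ w, x w * ℓ ω w) := fun ω x v => by
    rw [dirichletForm_sum_right hO 𝒯 (𝒯.hat_mem v) Finset.univ x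
      (fun w : 𝒯.vertices => 𝒯.hat w) fun w _ => 𝒯.hat_mem w]
    simp only [Matrix.mulVec, dotProduct, hA, add_mul, Finset.sum_add_distrib, Finset.mul_sum,
      ite_mul, zero_mul, Finset.sum_ite_eq, Finset.mem_univ, if_true]
    congr 1
    · congr 1
      exact Finset.sum_congr rfl fun w _ => by ring
    · exact Finset.sum_congr rfl fun w _ => by ring
  have hlump : ∀ a : Space d → ℝ, ∀ v : 𝒯.vertices,
      lumped 𝒯 (fun x => a x * 𝒯.hat v x) = 𝒯.nodeWeight v * a v := fun a v => by
    rw [lumped_eq_sum hO, Finset.sum_eq_single_of_mem (v : Space d) v.2]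
    · rw [𝒯.hat_apply _ v.2, if_pos rfl, mul_one]
    · intro w hw hne
      rw [𝒯.hat_apply _ hw, if_neg hne, mul_zero, mul_zero]
  have hsys : ∀ ω, (A ω).mulVec (fun v => D ω v) = b ω := fun ω => by
    funext v
    have h := (hst ω).phase_eq (hE ω) (𝒯.hat_mem v)
    rw [hlump (fun x => φ₁ ω x - φ₀ ω x), hlump (Θ ω), hr ω] at h
    rw [hAx, ← hDsum ω]
    have h2 : dirichletForm O (𝒯.hat v) (D ω)
        = dirichletForm O (φ₁ ω) (𝒯.hat v) - dirichletForm O (𝒯.hat v) (φ₀ ω) := by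
      rw [dirichletForm_comm, hD, dirichletForm_sub_left hO 𝒯 (h₁ ω) (h₀ ω) (𝒯.hat_mem v),
        dirichletForm_comm (φ₀ ω)]
    rw [h2]
    have h3 : D ω v = φ₁ ω v - φ₀ ω v := rfl
    have h4 : correctedSlope 𝒯 F (φ₀ ω) (Θ ω) (𝒯.hat v) = ℓ ω v := rfl
    simp only [hb]
    rw [h4] at h
    rw [h3]
    linear_combination h
  have hdet : ∀ ω, (A ω).det ≠ 0 := fun ω hdet => by
    obtain ⟨x, hx0, hx⟩ := Matrix.exists_mulVec_eq_zero_iff.2 hdet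
    refine hx0 (funext fun v => ?_)
    set X : Space d → ℝ := ∑ w, x w • 𝒯.hat w with hX
    have hXm : X ∈ 𝒯.femSpace :=
      𝒯.femSpace.sum_mem fun w _ => 𝒯.femSpace.smul_mem _ (𝒯.hat_mem w)
    have h1 : ∑ v : 𝒯.vertices, x v * (A ω).mulVec x v
        = ∑ v : 𝒯.vertices, 𝒯.nodeWeight v * x v ^ 2 + τ * dirichletForm O X X
          + τ / 2 * (∑ v : 𝒯.vertices, x v * ℓ ω v) ^ 2 := by
      have h2 : dirichletForm O X X = ∑ v : 𝒯.vertices, x v * dirichletForm O (𝒯.hat v) X := by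
        have h3 := dirichletForm_sum_right hO 𝒯 hXm Finset.univ x
          (fun w : 𝒯.vertices => 𝒯.hat w) fun w _ => 𝒯.hat_mem w
        rw [← hX] at h3
        rw [h3]
        exact Finset.sum_congr rfl fun w _ => by rw [dirichletForm_comm]
      simp only [hAx, ← hX]
      rw [h2, sq, Finset.sum_mul, Finset.mul_sum, Finset.mul_sum, ← Finset.sum_add_distrib,
        ← Finset.sum_add_distrib]
      exact Finset.sum_congr rfl fun w _ => by ring
    have h2 : ∑ v : 𝒯.vertices, 𝒯.nodeWeight v * x v ^ 2 ≤ 0 := by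
      have h3 := dirichletForm_nonneg (O := O) X
      simp only [hx, Pi.zero_apply, mul_zero, Finset.sum_const_zero] at h1
      nlinarith [sq_nonneg (∑ v : 𝒯.vertices, x v * ℓ ω v), mul_nonneg hτ.le h3]
    have h4 : 𝒯.nodeWeight v * x v ^ 2 ≤ 0 :=
      (Finset.single_le_sum (f := fun v : 𝒯.vertices => 𝒯.nodeWeight v * x v ^ 2)
        (fun w _ => mul_nonneg (𝒯.nodeWeight_nonneg w) (sq_nonneg _)) (Finset.mem_univ v)).trans h2
    have h5 := 𝒯.nodeWeight_pos hO v.2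
    exact pow_eq_zero_iff (two_ne_zero) |>.1
      (le_antisymm (nonpos_of_mul_nonpos_right h4 h5) (sq_nonneg (x v)))
  have hDm : ∀ v : 𝒯.vertices, Measurable fun ω => D ω v := by
    refine measurable_of_mulVec_eq (fun v w => ?_) (fun v => ?_) hsys hdet
    · exact (((hℓm v).mul (hℓm w)).const_mul _).const_add _
    · exact ((((measurable_pi_apply _).comp hΘ).const_mul _).sub
        ((measurable_dirichletForm hO 𝒯 measurable_const (fun _ => 𝒯.hat_mem v) hφ₀ h₀).const_mul
          _)).sub ((hr₀.const_mul τ).mul (hℓm v))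
  constructor
  · refine measurable_pi_lambda _ fun x => ?_
    have e : ∀ ω, φ₁ ω x = φ₀ ω x + ∑ v : 𝒯.vertices, D ω v * 𝒯.hat v x := fun ω => by
      have h := congrFun (hDsum ω) x
      simp only [Finset.sum_apply, Pi.smul_apply, smul_eq_mul] at h
      rw [← h]
      simp [hD]
    simp only [e]
    exact ((measurable_pi_apply x).comp hφ₀).add
      (Finset.measurable_fun_sum _ fun v _ => (hDm v).mul_const _)
  · rw [show r₁ = fun ω => r₀ ω + 1 / 2 * ∑ v : 𝒯.vertices, D ω v * ℓ ω v from funext hr]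
    exact hr₀.add ((Finset.measurable_fun_sum _ fun v _ => (hDm v).mul (hℓm v)).const_mul _)

theorem gridTime_mono {T : ℝ} (hT : 0 ≤ T) (N : ℕ) {i j : ℕ} (hij : i ≤ j) :
    gridTime T N i ≤ gridTime T N j := by
  refine Real.toNNReal_mono ?_
  gcongr

variable {mΩ : MeasurableSpace Ω} {P : Measure Ω} [IsProbabilityMeasure P]
  {𝓕 : Filtration ℝ≥0 mΩ} {T : ℝ} {N : ℕ} {𝔤 : HilbertBasis ℤ ℝ (L2 O)}
  {g : ℤ → Space d → ℝ} {lam : ℤ → ℝ} {Cmom : ℕ → ℝ} {ξ : ℕ → Ω → L2 O}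

omit [IsProbabilityMeasure P] in
theorem IsDiscreteIncrement.measurable_discPhi (hinc : IsDiscreteIncrement P 𝓕 T N 𝔤 lam Cmom ξ)
    (hT : 0 < T) {n : ℕ} (hn : n < N) (𝒯 : Triangulation O) (Z : Finset ℤ) {σ : ℝ → ℝ}
    (hσ : IsNoiseCoefficient σ) {φ : Ω → Space d → ℝ} (hφ : Measurable[𝓕 (gridTime T N n)] φ) :
    Measurable[𝓕 (gridTime T N (n + 1))] fun ω => discPhi 𝒯 Z σ 𝔤 g (φ ω) (ξ (n + 1) ω) := by
  obtain ⟨L, hL⟩ := hσ.lipschitz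
  have hτ : 0 < T / N := div_pos hT (by exact_mod_cast (by omega : 0 < N))
  simp only [discPhi_eq_noiseCoeff 𝒯 Z σ hτ]
  refine measurable_interp 𝒯 fun v => ?_
  have h1 : Measurable[𝓕 (gridTime T N (n + 1))] fun ω => σ (φ ω v) :=
    (hL.continuous.measurable.comp ((measurable_pi_apply v).comp hφ)).mono
      (𝓕.mono (gridTime_mono hT.le N (Nat.le_succ n))) le_rfl
  refine h1.mul (Measurable.const_mul ?_ _)
  refine Finset.measurable_fun_sum _ fun k _ => Measurable.mul_const ?_ _
  exact (measurable_noiseCoeff 𝔤 _ _ k).mono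
    (hinc.measurable (n + 1) (by omega) hn).comap_le le_rfl

omit [IsProbabilityMeasure P] in
theorem IsDiscreteSolution.measurable_gridTime (hO : IsConvexPolyhedralDomain O)
    {𝒯 : Triangulation O} {Z : Finset ℤ} {F σ : ℝ → ℝ} {φinit : Space d → ℝ}
    {φ : ℕ → Ω → Space d → ℝ} {r : ℕ → Ω → ℝ}
    (hsol : IsDiscreteSolution 𝒯 Z F σ 𝔤 g (T / N) N φinit ξ φ r)
    (hinc : IsDiscreteIncrement P 𝓕 T N 𝔤 lam Cmom ξ) (hT : 0 < T) (hσ : IsNoiseCoefficient σ)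
    (hFm : Measurable F) {ν K : ℝ} (hF : PotentialBounds F ν K) {n : ℕ} (hn : n ≤ N) :
    Measurable[𝓕 (gridTime T N n)] (φ n) ∧ Measurable[𝓕 (gridTime T N n)] (r n) := by
  induction n with
  | zero =>
    rw [show φ 0 = fun _ => φinit from funext hsol.init_phase,
      show r 0 = fun _ => √(discEnergy 𝒯 F φinit) from funext hsol.init_auxiliary]
    exact ⟨measurable_const, measurable_const⟩
  | succ n ih =>
    obtain ⟨h1, h2⟩ := ih (by omega)
    have hmono := 𝓕.mono (gridTime_mono hT.le N (Nat.le_succ n))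
    exact measurable_of_isStep hO 𝒯 hFm hF (div_pos hT (by exact_mod_cast (by omega : 0 < N)))
      (h1.mono hmono le_rfl) (h2.mono hmono le_rfl)
      (hinc.measurable_discPhi hT (by omega) 𝒯 Z hσ h1) (hsol.mem n (by omega))
      (hsol.mem (n + 1) hn) (hsol.step (n + 1) (by omega) hn)

end Adapted


/-! ### Bounds along a single path -/

section Path

variable {d : ℕ} {O : Set (Space d)}

open Triangulation

/-- The energy of the approximate initial data is bounded uniformly in the mesh size. -/
theorem IsInitialApproximation.exists_energy_le (hd : d = 2 ∨ d = 3)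
    (hO : IsConvexPolyhedralDomain O) {F : ℝ → ℝ} {ν K : ℝ} (hF : PotentialBounds F ν K)
    {𝒯 : ℝ → Triangulation O} {φ₀ : Space d → ℝ}
    {proj : ℝ → (Space d → ℝ) → (Space d → ℝ)} (hφ₀ : IsInitialApproximation 𝒯 φ₀ proj) :
    ∃ y, ∀ h ∈ Ioc (0 : ℝ) 1,
      energy (𝒯 h) (proj h φ₀) (√(discEnergy (𝒯 h) F (proj h φ₀))) ≤ y := by
  obtain ⟨C, hC, h6⟩ := exists_lumped_pow_six_le_cube hd hO
  obtain ⟨M, hM⟩ := hφ₀.bounded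
  have hK := hF.one_le
  set L : ℝ := 2 ^ 2 * 4 ^ d * M ^ 2 with hL
  refine ⟨1 + K * (C * (1 + L + M ^ 2)) ^ 3 + 1 / 2 * M ^ 2 + 1 / 8 * L, fun h hh => ?_⟩
  set u := proj h φ₀ with hu
  have hmem : u ∈ (𝒯 h).femSpace := hφ₀.mapsTo h hh _ hφ₀.memH1
  have hi1 : 0 ≤ ∫ x in O, u x ^ 2 := integral_nonneg fun x => sq_nonneg _
  have hi2 : 0 ≤ ∫ x in O, ‖gradient u x‖ ^ 2 := integral_nonneg fun x => sq_nonneg _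
  have h1 : (∫ x in O, u x ^ 2) + ∫ x in O, ‖gradient u x‖ ^ 2 ≤ M ^ 2 := by
    have h2 := hM h hh
    rw [femH1Norm] at h2
    have h3 := pow_le_pow_left₀ (Real.sqrt_nonneg _) h2 2
    rwa [Real.sq_sqrt (by positivity)] at h3
  rw [integral_norm_gradient_sq] at h1 hi2
  have h2 : lumped (𝒯 h) (fun x => u x ^ 2) ≤ L := by
    have h3 := lumped_abs_pow_le hO (𝒯 h) hmem 2
    simp only [sq_abs] at h3
    refine h3.trans ?_
    rw [hL]
    gcongr
    linarith
  have hl2 : 0 ≤ lumped (𝒯 h) (fun x => u x ^ 2) := lumped_nonneg hO (𝒯 h) fun v => sq_nonneg _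
  have h3 : discEnergy (𝒯 h) F u ≤ K * (C * (1 + L + M ^ 2)) ^ 3 := by
    calc discEnergy (𝒯 h) F u ≤ lumped (𝒯 h) (fun x => K * (1 + |u x|) ^ 6) := by
          refine lumped_mono hO (𝒯 h) fun v => (hF.upper _).trans ?_
          have : (1 : ℝ) ≤ 1 + |u v| := by linarith [abs_nonneg (u v)]
          gcongr
          norm_num
      _ = K * lumped (𝒯 h) (fun x => (1 + |u x|) ^ 6) := lumped_const_mul hO (𝒯 h) _ _
      _ ≤ _ := by
          refine mul_le_mul_of_nonneg_left ((h6 (𝒯 h) u hmem).2.trans ?_) (by linarith)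
          gcongr
          linarith
  rw [energy, Real.sq_sqrt (hF.volume_le_discEnergy hO (𝒯 h) u).2.2.le]
  linarith

/-- A majorant of the energy, whose increments are the part of the energy increment which is linear
in the noise and a multiple of the remainder in the energy inequality. -/
def energyMajorant (𝒯 : Triangulation O) (F : ℝ → ℝ) (K τ : ℝ) (φ Θ : ℕ → Space d → ℝ)
    (r χ : ℕ → ℝ) : ℕ → ℝ
  | 0 => energy 𝒯 (φ 0) (r 0)
  | n + 1 => energyMajorant 𝒯 F K τ φ Θ r χ n + noisePairing 𝒯 F (φ n) (r n) (Θ n)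
      + K * (τ * χ n ^ 2 * energy 𝒯 (φ n) (r n))

/-- The energy and the sum of all dissipation terms are controlled by the majorant.  So is the
accumulated consistency error, since the local errors are proportional to the dissipation. -/
theorem exists_path_bounds (hd : d = 2 ∨ d = 3) (hO : IsConvexPolyhedralDomain O)
    {F : ℝ → ℝ} {ν K₀ : ℝ} (hF : PotentialBounds F ν K₀) (hν : 0 < ν) (hν1 : ν ≤ 1) :
    ∃ K ≥ 1, ∀ (𝒯 : Triangulation O) (τ : ℝ) (N : ℕ) (φ Θ : ℕ → Space d → ℝ) (r χ : ℕ → ℝ),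
      0 < τ → τ < 1 → (∀ n ≤ N, φ n ∈ 𝒯.femSpace) → r 0 = √(discEnergy 𝒯 F (φ 0)) →
      (∀ n < N, 1 ≤ χ n ∧ Θ n ∈ 𝒯.femSpace ∧ lumped 𝒯 (fun x => Θ n x ^ 6) ≤ (τ * χ n) ^ 3 ∧
        dirichletForm O (Θ n) (Θ n) ≤ τ * χ n * (1 + dirichletForm O (φ n) (φ n)) ∧
        IsStep 𝒯 F τ (Θ n) (φ n) (r n) (φ (n + 1)) (r (n + 1))) →
      (∀ n ≤ N, energy 𝒯 (φ n) (r n) ≤ energyMajorant 𝒯 F K τ φ Θ r χ n) ∧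
      (∀ n < N, |noisePairing 𝒯 F (φ n) (r n) (Θ n)| ≤ K * (√τ * χ n * energy 𝒯 (φ n) (r n))) ∧
      ∀ S, (∀ n ≤ N, energyMajorant 𝒯 F K τ φ Θ r χ n ≤ S) →
        ∀ n ≤ N, |r n - √(discEnergy 𝒯 F (φ n))| ≤ K * (τ ^ min (ν / 2) (1 / 4) * S ^ 8) := by
  obtain ⟨C₁, hC₁, h₁⟩ := exists_energy_step hd hO hF
  obtain ⟨C₂, hC₂, h₂⟩ := exists_noisePairing_sq_le hd hO hF
  obtain ⟨C₃, hC₃, h₃⟩ := exists_consistency hd hO hF hν hν1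
  refine ⟨C₁ + 1 + C₂ + C₃ * 3 ^ 7, by nlinarith, ?_⟩
  intro 𝒯 τ N φ Θ r χ hτ hτ1 hφ hr0 hstep
  set K := C₁ + 1 + C₂ + C₃ * 3 ^ 7 with hK
  set Y := energyMajorant 𝒯 F K τ φ Θ r χ with hY
  set s : ℕ → ℝ := fun n => dissipation 𝒯 τ (φ (n + 1) - φ n) (Θ n) with hs
  set e : ℕ → ℝ := fun n => τ * χ n ^ 2 with he
  have hs0 : ∀ n, 0 ≤ s n := fun n => dissipation_nonneg hO 𝒯 hτ _ _
  have he0 : ∀ n, 0 ≤ e n := fun n => by simp only [he]; positivity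
  have hE1 : ∀ n, 1 ≤ energy 𝒯 (φ n) (r n) := fun n => one_le_energy hO 𝒯 _ _
  -- the energy inequality, with the additional small quantity `e n` absorbed in the remainder
  have hone : ∀ n < N, energy 𝒯 (φ (n + 1)) (r (n + 1)) + (s n + e n)
      ≤ energy 𝒯 (φ n) (r n) + noisePairing 𝒯 F (φ n) (r n) (Θ n)
        + K * (τ * χ n ^ 2 * energy 𝒯 (φ n) (r n)) := fun n hn => by
    obtain ⟨hχ, hΘ, h6, hdir, hst⟩ := hstep n hn
    have h := h₁ 𝒯 τ (χ n) (φ n) (φ (n + 1)) (Θ n) (r n) (r (n + 1)) hτ hτ1 hχ (hφ n hn.le)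
      (hφ (n + 1) hn) hΘ h6 hdir hst
    have h4 : e n ≤ τ * χ n ^ 2 * energy 𝒯 (φ n) (r n) := le_mul_of_one_le_right (he0 n) (hE1 n)
    have h5 : 0 ≤ (C₂ + C₃ * 3 ^ 7) * (τ * χ n ^ 2 * energy 𝒯 (φ n) (r n)) :=
      mul_nonneg (by linarith) ((he0 n).trans h4)
    simp only [hs, hK]
    linear_combination h + h4 + h5
  have hsum : ∀ n ≤ N, energy 𝒯 (φ n) (r n) + ∑ j ∈ Finset.range n, (s j + e j) ≤ Y n := by
    intro n
    induction n with
    | zero => intro _; simp [hY, energyMajorant]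
    | succ n ih =>
      intro hn
      have h4 := ih (by omega)
      have h5 := hone n hn
      rw [Finset.sum_range_succ]
      have h6 : Y (n + 1) = Y n + noisePairing 𝒯 F (φ n) (r n) (Θ n)
        + K * (τ * χ n ^ 2 * energy 𝒯 (φ n) (r n)) := rfl
      rw [h6]
      linarith
  have hsum0 : ∀ n, 0 ≤ ∑ j ∈ Finset.range n, (s j + e j) := fun n =>
    Finset.sum_nonneg fun j _ => add_nonneg (hs0 j) (he0 j)
  refine ⟨fun n hn => by linarith [hsum n hn, hsum0 n], fun n hn => ?_, fun S hS n hn => ?_⟩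
  · obtain ⟨hχ, hΘ, h6, hdir, hst⟩ := hstep n hn
    have h := Real.abs_le_sqrt (h₂ 𝒯 (φ n) (Θ n) (r n) (τ * χ n) (hφ n hn.le) hΘ
      (by positivity) h6 hdir)
    refine h.trans (Real.sqrt_le_iff.2 ⟨?_, ?_⟩)
    · have := hE1 n
      positivity
    · have h4 : C₂ ≤ K ^ 2 := by nlinarith
      have h5 : χ n ≤ χ n ^ 2 := le_self_pow₀ hχ (by norm_num)
      calc C₂ * (τ * χ n * energy 𝒯 (φ n) (r n) ^ 2)
          ≤ K ^ 2 * (τ * χ n ^ 2 * energy 𝒯 (φ n) (r n) ^ 2) := by gcongr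
        _ = K ^ 2 * (√τ ^ 2 * χ n ^ 2 * energy 𝒯 (φ n) (r n) ^ 2) := by rw [Real.sq_sqrt hτ.le]
        _ = _ := by ring
  · set κ := min (ν / 2) (1 / 4) with hκ
    set a := τ ^ (1 / 4 : ℝ) with ha
    have ha0 : 0 < a := Real.rpow_pos_of_pos hτ _
    have ha1 : a ≤ 1 := Real.rpow_le_one hτ.le hτ1.le (by norm_num)
    have ha4 : a ^ 4 = τ := by
      rw [ha, ← Real.rpow_natCast, ← Real.rpow_mul hτ.le]
      norm_num
    have haκ : a ≤ τ ^ κ :=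
      Real.rpow_le_rpow_of_exponent_ge hτ hτ1.le (min_le_right _ _)
    have haν : (a ^ 2) ^ ν ≤ τ ^ κ := by
      have h4 : (a ^ 2) ^ ν = τ ^ (ν / 2) := by
        rw [ha, ← Real.rpow_natCast, ← Real.rpow_mul hτ.le, ← Real.rpow_mul hτ.le]
        congr 1
        push_cast
        ring
      rw [h4]
      exact Real.rpow_le_rpow_of_exponent_ge hτ hτ1.le (min_le_left _ _)
    have hϱ : 0 ≤ τ ^ κ := (Real.rpow_pos_of_pos hτ _).le
    have hS0 : 0 ≤ S := by linarith [hsum 0 (by omega), hsum0 0, hE1 0, hS 0 (by omega)]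
    have hloc : ∀ j < N, |r (j + 1) - r j
        - (√(discEnergy 𝒯 F (φ (j + 1))) - √(discEnergy 𝒯 F (φ j)))|
        ≤ C₃ * (τ ^ κ * (3 * S) ^ 7) * (s j + e j) := fun j hj => by
      obtain ⟨hχ, hΘ, h6, hdir, hst⟩ := hstep j hj
      have h4 := h₃ 𝒯 a (τ ^ κ) (χ j)
        (energy 𝒯 (φ j) (r j) + energy 𝒯 (φ (j + 1)) (r (j + 1)) + (s j + e j)) (s j) (e j)
        (φ j) (φ (j + 1)) (Θ j) (r j) (r (j + 1)) ha0 ha1 haκ haν hχ (hφ j hj.le)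
        (hφ (j + 1) hj) (by rwa [ha4]) (by rw [ha4]) (by rw [ha4]) rfl (by rwa [ha4])
      refine h4.trans (le_of_le_of_eq (b := C₃ * (τ ^ κ * (3 * S) ^ 7 * (s j + e j))) ?_ (by ring))
      have h5 : energy 𝒯 (φ j) (r j) + energy 𝒯 (φ (j + 1)) (r (j + 1)) + (s j + e j)
          ≤ 3 * S := by
        have h6 := hsum j hj.le
        have h7 := hsum (j + 1) hj
        rw [Finset.sum_range_succ] at h7
        linarith [hsum0 j, hS j hj.le, hS (j + 1) hj]
      have h6 := add_nonneg (hs0 j) (he0 j)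
      have h7 : 0 ≤ energy 𝒯 (φ j) (r j) + energy 𝒯 (φ (j + 1)) (r (j + 1)) + (s j + e j) := by
        linarith [hE1 j, hE1 (j + 1)]
      gcongr
    have hacc : ∀ n ≤ N, |r n - √(discEnergy 𝒯 F (φ n))|
        ≤ C₃ * (τ ^ κ * (3 * S) ^ 7) * ∑ j ∈ Finset.range n, (s j + e j) := by
      intro n
      induction n with
      | zero => intro _; simp [hr0]
      | succ n ih =>
        intro hn
        have h4 := ih (by omega)
        have h5 := hloc n hn
        rw [Finset.sum_range_succ, mul_add]
        have h6 := abs_add_le (r n - √(discEnergy 𝒯 F (φ n))) (r (n + 1) - r n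
          - (√(discEnergy 𝒯 F (φ (n + 1))) - √(discEnergy 𝒯 F (φ n))))
        rw [show r n - √(discEnergy 𝒯 F (φ n)) + (r (n + 1) - r n
          - (√(discEnergy 𝒯 F (φ (n + 1))) - √(discEnergy 𝒯 F (φ n))))
          = r (n + 1) - √(discEnergy 𝒯 F (φ (n + 1))) by ring] at h6
        linarith
    have h4 : ∑ j ∈ Finset.range n, (s j + e j) ≤ S := by
      linarith [hsum n hn, hE1 n, hS n hn]
    calc _ ≤ C₃ * (τ ^ κ * (3 * S) ^ 7) * S := (hacc n hn).trans (by gcongr)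
      _ = C₃ * 3 ^ 7 * (τ ^ κ * S ^ 8) := by ring
      _ ≤ K * (τ ^ κ * S ^ 8) := by
        gcongr
        linarith

end Path


/-! ### Moments of the error along the path -/

section Moments

variable {d : ℕ} {O : Set (Space d)}

open Triangulation

/-- The error of the scalar auxiliary variable is bounded pathwise by a power of the step size
times the eighth power of a random variable with moments bounded uniformly in `h` and `N`. -/
theorem exists_error_majorant (hd : d = 2 ∨ d = 3) (hO : IsConvexPolyhedralDomain O)
    {T : ℝ} (hT : 0 < T) {𝒯 : ℝ → Triangulation O} (h𝒯 : QuasiUniform 𝒯) {F : ℝ → ℝ} {ν : ℝ}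
    (hF : IsPotential F ν) {φ₀ : Space d → ℝ} {proj : ℝ → (Space d → ℝ) → (Space d → ℝ)}
    (hφ₀ : IsInitialApproximation 𝒯 φ₀ proj) {σ : ℝ → ℝ} (hσ : IsNoiseCoefficient σ)
    {𝔤 : HilbertBasis ℤ ℝ (L2 O)} {g : ℤ → Space d → ℝ} {lam : ℤ → ℝ} (hg : IsColored 𝔤 g lam)
    (Z : ℝ → Finset ℤ) {Ω : Type*} {mΩ : MeasurableSpace Ω} {P : Measure Ω}
    [IsProbabilityMeasure P] {𝓕 : Filtration ℝ≥0 mΩ} {Cmom : ℕ → ℝ} {ξ : ℕ → ℕ → Ω → L2 O}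
    (hξ : ∀ N : ℕ, 0 < N → T / N < 1 → IsDiscreteIncrement P 𝓕 T N 𝔤 lam Cmom (ξ N))
    {φ : ℝ → ℕ → ℕ → Ω → Space d → ℝ} {r : ℝ → ℕ → ℕ → Ω → ℝ}
    (hsol : ∀ h ∈ Ioc (0 : ℝ) 1, ∀ N : ℕ, 0 < N → T / N < 1 →
      IsDiscreteSolution (𝒯 h) (Z h) F σ 𝔤 g (T / N) N (proj h φ₀) (ξ N) (φ h N) (r h N))
    (q : ℕ) :
    ∃ C > 0, ∃ K ≥ 1, ∀ h ∈ Ioc (0 : ℝ) 1, ∀ N : ℕ, 0 < N → T / N < 1 →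
      ∃ S : Ω → ℝ, (∀ ω, 1 ≤ S ω) ∧ Integrable (fun ω => S ω ^ (2 * (q + 2))) P ∧
        ∫ ω, S ω ^ (2 * (q + 2)) ∂P ≤ C ∧
        ∀ ω, ∀ n ≤ N, |r h N n ω - √(discEnergy (𝒯 h) F (φ h N n ω))|
          ≤ K * ((T / N) ^ min (ν / 2) (1 / 4) * S ω ^ 8) := by
  have hFm : Measurable F := hF.contDiff.continuous.measurable
  obtain ⟨K₀, hF₀⟩ := hF.exists_bounds
  obtain ⟨K, hK, hpath⟩ := exists_path_bounds hd hO hF₀ hF.exponent_pos hF.exponent_le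
  obtain ⟨Cσ, hCσ, hnoise⟩ := exists_noiseSize hO h𝒯 hσ
  -- moments of order `4 (q + 2) = 4 q + 7 + 1` of the noise size enter the bound for the maximum
  obtain ⟨B, hB, hmom⟩ := exists_integral_noiseSize_pow_le hO P hg Cmom hCσ (4 * q + 7)
  obtain ⟨y, hy⟩ := hφ₀.exists_energy_le hd hO hF₀
  obtain ⟨C, hC, hmax⟩ := exists_integral_runningMax_pow_le (P := P) K B T hK hB q
  refine ⟨C * max y 1 ^ (2 * (q + 2)), by positivity, K, hK, fun h hh N hN hτ1 => ?_⟩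
  have hτ : 0 < T / N := div_pos hT (by exact_mod_cast hN)
  have hs := hsol h hh N hN hτ1
  have hinc := hξ N hN hτ1
  set Θ : ℕ → Ω → Space d → ℝ := fun n ω =>
    discPhi (𝒯 h) (Z h) σ 𝔤 g (φ h N n ω) (ξ N (n + 1) ω) with hΘ
  set γ : ℕ → Ω → Space d → ℝ := fun n ω =>
    noiseField (Z h) g (noiseCoeff 𝔤 (T / N) (ξ N (n + 1) ω)) with hγ
  set χ : ℕ → Ω → ℝ := fun n ω => noiseSize (𝒯 h) Cσ (φ h N n ω) (γ n ω) with hχ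
  set M : ℕ → Ω → ℝ := fun n ω =>
    noisePairing (𝒯 h) F (φ h N n ω) (r h N n ω) (Θ n ω) with hM
  set H : ℕ → Ω → ℝ := fun n ω => energy (𝒯 h) (φ h N n ω) (r h N n ω) with hH
  set Y : ℕ → Ω → ℝ := fun n ω => energyMajorant (𝒯 h) F K (T / N) (fun n => φ h N n ω)
    (fun n => Θ n ω) (fun n => r h N n ω) (fun n => χ n ω) n with hY
  have hχ1 : ∀ n ω, 1 ≤ χ n ω := fun n ω => one_le_noiseSize _ hCσ _ _
  have hH1 : ∀ n ω, 1 ≤ H n ω := fun n ω => one_le_energy hO _ _ _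
  -- the deterministic estimates, path by path
  have hp := fun ω => hpath (𝒯 h) (T / N) N (fun n => φ h N n ω) (fun n => Θ n ω)
    (fun n => r h N n ω) (fun n => χ n ω) hτ hτ1 (fun n hn => hs.mem n hn ω)
    (by rw [hs.init_auxiliary, hs.init_phase]) (fun n hn => by
      have h1 := hnoise h hh (φ h N n ω) (hs.mem n hn.le ω) (γ n ω) (T / N) hτ
      have h2 : Θ n ω = (𝒯 h).interp fun x => σ (φ h N n ω x) * (√(T / N) * γ n ω x) :=
        discPhi_eq_noiseCoeff (𝒯 h) (Z h) σ hτ _ _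
      rw [← h2] at h1
      exact ⟨hχ1 n ω, discPhi_mem _ _ _ _ _ _ _, h1.1, h1.2,
        hs.step (n + 1) (by omega) hn ω⟩)
  have hmono : ∀ i j, i ≤ j → j ≤ N → 𝓕 (gridTime T N i) ≤ 𝓕 (gridTime T N j) :=
    fun i j hij _ => 𝓕.mono (gridTime_mono hT.le N hij)
  have hsucc : ∀ n < N, 𝓕 (gridTime T N n) ≤ 𝓕 (gridTime T N (n + 1)) :=
    fun n hn => hmono n (n + 1) (Nat.le_succ n) hn
  have had := fun n (hn : n ≤ N) => hs.measurable_gridTime hO hinc hT hσ hFm hF₀ hn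
  have hHm : ∀ n ≤ N, Measurable[𝓕 (gridTime T N n)] (H n) := fun n hn =>
    measurable_energy hO (𝒯 h) (had n hn).1 (hs.mem n hn) (had n hn).2
  have hMm : ∀ n < N, Measurable[𝓕 (gridTime T N (n + 1))] (M n) := fun n hn =>
    measurable_noisePairing hO (𝒯 h) hFm ((had n hn.le).1.mono (hsucc n hn) le_rfl)
      (hs.mem n hn.le) ((had n hn.le).2.mono (hsucc n hn) le_rfl)
      (hinc.measurable_discPhi hT hn (𝒯 h) (Z h) hσ (had n hn.le).1)
      fun ω => discPhi_mem _ _ _ _ _ _ _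
  have hχm : ∀ n < N, Measurable[𝓕 (gridTime T N (n + 1))] (χ n) := fun n hn =>
    measurable_noiseSize hO (𝒯 h) Cσ ((had n hn.le).1.mono (hsucc n hn) le_rfl)
      (hs.mem n hn.le) fun v => Finset.measurable_fun_sum _ fun k _ =>
        ((measurable_noiseCoeff 𝔤 _ _ k).mono
          (hinc.measurable (n + 1) (by omega) hn).comap_le le_rfl).mul_const _
  have hYm : ∀ n ≤ N, Measurable[𝓕 (gridTime T N n)] (Y n) := by
    intro n
    induction n with
    | zero => exact hHm 0
    | succ n ih =>
      intro hn
      exact (((ih (by omega)).mono (hsucc n hn) le_rfl).add (hMm n hn)).add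
        ((((hχm n hn).pow_const 2).const_mul _).mul ((hHm n (by omega)).mono (hsucc n hn) le_rfl)
          |>.const_mul K)
  have hHY : ∀ n ≤ N, ∀ ω, H n ω ≤ Y n ω := fun n hn ω => (hp ω).1 n hn
  have hY0 : ∀ ω, Y 0 ω
      = energy (𝒯 h) (proj h φ₀) (√(discEnergy (𝒯 h) F (proj h φ₀))) := fun ω => by
    simp only [hY, energyMajorant, hs.init_phase, hs.init_auxiliary]
  -- the remainder `K τ χ² H` and the martingale increment are of the size of the energy `H` times powers
  -- of `χ`, and the energy is dominated by the process `Y`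
  have hres := hmax N (T / N) _ Y M (fun n ω => K * (T / N * χ n ω ^ 2 * H n ω)) χ
    (fun n => 𝓕 (gridTime T N n)) hτ hτ1.le
    (le_of_eq (mul_div_cancel₀ T (by exact_mod_cast hN.ne'))) (fun n _ => 𝓕.le _) hmono hYm
    (fun n hn ω => (hH1 n ω).trans (hHY n hn ω)) hY0 (fun n _ ω => rfl)
    (fun n hn ω => ((hp ω).2.1 n hn).trans (by
      have h1 := hχ1 n ω
      have h2 := hHY n hn.le ω
      have h3 := hH1 n ω
      change K * (√(T / N) * χ n ω * H n ω) ≤ _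
      gcongr))
    (fun n _ ω => by
      have h1 := hH1 n ω
      positivity)
    (fun n hn ω => by
      have h1 := hHY n hn.le ω
      gcongr)
    (fun n _ ω => hχ1 n ω)
    (fun n hn G hG hGY => by
      refine integral_mul_noisePairing_eq_zero hinc hτ hn hd hO h𝒯 hσ hFm hF₀ hh (Z h)
        (had n hn.le).1 (hs.mem n hn.le) (had n hn.le).2 hG (hGY.mono ?_ (ae_of_all _ fun ω => ?_))
      · exact ((hG.mul (hHm n hn.le)).mono (𝓕.le _) le_rfl).aestronglyMeasurable
      · have h1 := hHY n hn.le ω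
        have h2 := hH1 n ω
        change ‖G ω * H n ω‖ ≤ _
        rw [norm_mul, norm_mul, Real.norm_of_nonneg (by linarith : 0 ≤ H n ω),
          Real.norm_of_nonneg (by linarith : 0 ≤ Y n ω)]
        gcongr)
    (fun n hn v hv hv0 hvi =>
      hmom (𝒯 h) (Z h) 𝓕 T N (ξ N) hinc hτ n hn (φ h N n) (had n hn.le).1 (hs.mem n hn.le) v hv
        hv0 hvi)
  refine ⟨fun ω => runningMax Y N ω, fun ω => ?_, hres.1, hres.2.trans ?_, fun ω n hn => ?_⟩
  · exact (hH1 0 ω).trans ((hHY 0 (by omega) ω).trans (le_runningMax Y (by omega) ω))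
  · have h1 := one_le_energy hO (𝒯 h) (proj h φ₀) (√(discEnergy (𝒯 h) F (proj h φ₀)))
    have h2 := (hy h hh).trans (le_max_left y 1)
    gcongr
  · exact (hp ω).2.2 _ (fun n hn => le_runningMax Y hn ω) n hn

end Moments

end SAV
end

theorem lemma6p4 {d : ℕ} (hd : d = 2 ∨ d = 3)
    (O : Set (SAV.Space d)) (hO : SAV.IsConvexPolyhedralDomain O)
    (T : ℝ) (hT : 0 < T)
    (𝒯 : ℝ → SAV.Triangulation O) (h𝒯 : SAV.QuasiUniform 𝒯)
    (F : ℝ → ℝ) (ν : ℝ) (hF : SAV.IsPotential F ν)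
    (φ₀ : SAV.Space d → ℝ) (proj : ℝ → (SAV.Space d → ℝ) → (SAV.Space d → ℝ))
    (hφ₀ : SAV.IsInitialApproximation 𝒯 φ₀ proj)
    (σ : ℝ → ℝ) (hσ : SAV.IsNoiseCoefficient σ)
    (𝔤 : HilbertBasis ℤ ℝ (SAV.L2 O)) (g : ℤ → SAV.Space d → ℝ) (lam : ℤ → ℝ)
    (hg : SAV.IsColored 𝔤 g lam)
    (Z : ℝ → Finset ℤ) (hZ : SAV.IsExhausting Z)
    {Ω : Type*} {mΩ : MeasurableSpace Ω} (P : Measure Ω) [IsProbabilityMeasure P]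
    (𝓕 : Filtration ℝ≥0 mΩ)
    (Cmom : ℕ → ℝ) (ξ : ℕ → ℕ → Ω → SAV.L2 O)
    (hξ : ∀ N : ℕ, 0 < N → T / N < 1 →
      SAV.IsDiscreteIncrement P 𝓕 T N 𝔤 lam Cmom (ξ N))
    (φ : ℝ → ℕ → ℕ → Ω → SAV.Space d → ℝ) (r : ℝ → ℕ → ℕ → Ω → ℝ)
    (hsol : ∀ h ∈ Ioc (0 : ℝ) 1, ∀ N : ℕ, 0 < N → T / N < 1 →
      SAV.IsDiscreteSolution (𝒯 h) (Z h) F σ 𝔤 g (T / N) N (proj h φ₀) (ξ N) (φ h N) (r h N))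
    (p : ℝ) (hp : 1 ≤ p) :
    ∃ C > 0, ∀ h ∈ Ioc (0 : ℝ) 1, ∀ N : ℕ, 0 < N → T / N < 1 →
      ∀ δ : ℝ, 0 < δ → δ < 1 / 2 →
        Integrable (fun ω => ⨆ m : Fin (N + 1),
          |r h N m ω - √(SAV.discEnergy (𝒯 h) F (φ h N m ω))| ^ p) P ∧
        ∫ ω, (⨆ m : Fin (N + 1),
          |r h N m ω - √(SAV.discEnergy (𝒯 h) F (φ h N m ω))| ^ p) ∂P
          ≤ C * (T / N) ^ (p * min (ν / 2) (1 / 4 - δ / 2)) := by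
  -- then `(S⁸)^p ≤ S^(2 (q + 2))`, a moment of `S` that is under control
  obtain ⟨q, hq⟩ := exists_nat_ge (4 * p)
  obtain ⟨C, hC, K, hK, hmaj⟩ :=
    SAV.exists_error_majorant hd hO hT h𝒯 hF hφ₀ hσ hg Z hξ hsol q
  refine ⟨K ^ p * C, by positivity, fun h hh N hN hτ1 δ hδ _ => ?_⟩
  obtain ⟨S, hS1, hSi, hSC, hS⟩ := hmaj h hh N hN hτ1
  have hp0 : 0 ≤ p := by linarith
  have hτ : 0 < T / N := div_pos hT (by exact_mod_cast hN)
  have hs := hsol h hh N hN hτ1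
  set κ := min (ν / 2) (1 / 4 : ℝ) with hκ
  set ρ := (T / N) ^ (p * min (ν / 2) (1 / 4 - δ / 2)) with hρ
  have hρ0 : 0 < ρ := Real.rpow_pos_of_pos hτ _
  -- as `τ < 1`, the smaller exponent with `δ` gives the larger bound
  have hκρ : ((T / N) ^ κ) ^ p ≤ ρ := by
    rw [← Real.rpow_mul hτ.le, mul_comm κ p]
    refine Real.rpow_le_rpow_of_exponent_ge hτ hτ1.le (mul_le_mul_of_nonneg_left ?_ hp0)
    exact min_le_min_left _ (by linarith)
  have hle : ∀ ω, ∀ m : Fin (N + 1),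
      |r h N m ω - √(SAV.discEnergy (𝒯 h) F (φ h N m ω))| ^ p
        ≤ K ^ p * ρ * S ω ^ (2 * (q + 2)) := fun ω m => by
    have hS0 : 0 ≤ S ω := by linarith [hS1 ω]
    have hτκ : 0 ≤ (T / N) ^ κ := (Real.rpow_pos_of_pos hτ κ).le
    have h1 : (S ω ^ 8) ^ p ≤ S ω ^ (2 * (q + 2)) := by
      rw [← Real.rpow_natCast, ← Real.rpow_natCast, ← Real.rpow_mul hS0]
      refine Real.rpow_le_rpow_of_exponent_le (hS1 ω) ?_
      push_cast
      linarith
    calc _ ≤ (K * ((T / N) ^ κ * S ω ^ 8)) ^ p :=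
          Real.rpow_le_rpow (abs_nonneg _) (hS ω m (Nat.lt_succ_iff.1 m.2)) hp0
      _ = K ^ p * (((T / N) ^ κ) ^ p * (S ω ^ 8) ^ p) := by
          rw [Real.mul_rpow (by linarith) (by positivity), Real.mul_rpow hτκ (by positivity)]
      _ ≤ K ^ p * (ρ * S ω ^ (2 * (q + 2))) := by gcongr
      _ = _ := by ring
  have hmeas : Measurable fun ω => ⨆ m : Fin (N + 1),
      |r h N m ω - √(SAV.discEnergy (𝒯 h) F (φ h N m ω))| ^ p :=
    Measurable.iSup fun m => by
      have hm : (m : ℕ) ≤ N := Nat.lt_succ_iff.1 m.2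
      have h1 := (SAV.measurable_discEnergy hO (𝒯 h) hF.contDiff.continuous.measurable
        (hs.measurable_phase m hm)).sqrt
      exact ((hs.measurable_auxiliary m hm).sub h1).abs.pow_const p
  have hdom : Integrable (fun ω => K ^ p * ρ * S ω ^ (2 * (q + 2))) P := hSi.const_mul _
  have hint : Integrable (fun ω => ⨆ m : Fin (N + 1),
      |r h N m ω - √(SAV.discEnergy (𝒯 h) F (φ h N m ω))| ^ p) P := by
    refine hdom.mono' hmeas.aestronglyMeasurable (ae_of_all _ fun ω => ?_)
    rw [Real.norm_of_nonneg (Real.iSup_nonneg fun m => Real.rpow_nonneg (abs_nonneg _) p)]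
    exact ciSup_le (hle ω)
  refine ⟨hint, (integral_mono hint hdom fun ω => ciSup_le (hle ω)).trans ?_⟩
  rw [integral_const_mul]
  calc K ^ p * ρ * ∫ ω, S ω ^ (2 * (q + 2)) ∂P ≤ K ^ p * ρ * C := by gcongr
    _ = K ^ p * C * ρ := by ring
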